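/- **Setting.** Let $G$ be a compact, simple, connected, simply connected Lie group, $\mathfrak t$ the Lie algebra of a maximal torus $T$, $W$ the Weyl group, $\Lambda\subset\mathfrak t$ the coroot lattice, so that $T=\mathfrak t/\Lambda$, and $\langle\cdot,\cdot\rangle$ the $W$-invariant inner product on $\mathfrak t$ for which the longest roots have squared length $2$. (All that enters is the root system of $G$, an arbitrary reduced irreducible crystallographic root system.) Fix an integer $k\ge 1$, a real number $s$, put $t=k+is$, $\langle\cdot,\cdot\rangle_k=k\langle\cdot,\cdot\rangle$, and choose $r\in\mathbb C$ with $$e^{-4kr}=-\frac{k-is}{k+is}.$$ For $A=(\theta_1,\theta_2)$ and $A'=(\theta_1',\theta_2')$ in $\mathfrak t\oplus\mathfrak t$ put $\omega(A,A')=2\pi(\langle\theta_1,\theta_2'\rangle_k-\langle\theta_1',\theta_2\rangle_k)$. Let $\mathcal H^{(k)}$ be the space of smooth sections of the level $k$ Chern–Simons line bundle on $(T\times T)/W$, that is, of smooth $\psi:\mathfrak t\oplus\mathfrak t\to\mathbb C$ with $$\psi(A+\lambda)=(-1)^{\langle\lambda_1,\lambda_2\rangle_k}e^{-\frac i2\omega(A,\lambda)}\psi(A)\quad(\lambda=(\lambda_1,\lambda_2)\in\Lambda\times\Lambda),\qquad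 \psi(wA)=\psi(A)\quad(w\in W),$$ with the $L^2$ inner product over $T\times T$, and let $\nabla_X\psi=d\psi(X)-\frac i2\omega(A,X)\psi$ be the pre-quantum connection. Let $b_1,\dots,b_n$ be a basis of $\mathfrak t$ and $(C^{pq})$ the inverse of the matrix $(\langle b_p,b_q\rangle)$. For $\sigma$ in the upper half plane $\mathbb H$ use the complex coordinates $z_j=u_j+\sigma v_j$ on $\mathfrak t\oplus\mathfrak t$, where $\theta_1=\sum_j u_jb_j$, $\theta_2=\sum_j v_jb_j$, and put $$\Delta_\sigma=\frac{i(\sigma-\bar\sigma)}{2\pi}\sum_{p,q}C^{pq}(\nabla_{z_p}\nabla_{\bar z_q}+\nabla_{\bar z_p}\nabla_{z_q}),\quad \Delta_G=\frac i\pi\sum_{p,q}C^{pq}\nabla_{z_p}\nabla_{z_q},\quad \Delta_{\bar G}=-\frac i\pi\sum_{p,q}C^{pq}\nabla_{\bar z_p}\nabla_{\bar z_q}.$$ The Hitchin–Witten connection on the trivial bundle $\mathbb H\times\mathcal H^{(k)}\to\mathbb H$ is $$\boldsymbol\nabla_{\partial_\sigma}=\partial_\sigma+\frac1{2t}\Delta_G,\qquad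 \boldsymbol\nabla_{\partial_{\bar\sigma}}=\partial_{\bar\sigma}-\frac1{2\bar t}\Delta_{\bar G},$$ and $\mathcal P_{\sigma_0,\sigma_1}$ denotes its parallel transport from the fibre over $\sigma_1$ to the fibre over $\sigma_0$: $\mathcal P_{\sigma_0,\sigma_1}\psi=\Psi(\sigma_0)$ for the smooth parallel section $\Psi$ with $\Psi(\sigma_1)=\psi$. For $\phi=\begin{pmatrix}a&b\\c&d\end{pmatrix}\in\Gamma=SL(2,\mathbb Z)$ let $(\rho_k(\phi)\psi)(\theta_1,\theta_2)=\psi(a\theta_1+c\theta_2,\,b\theta_1+d\theta_2)$ be the pre-quantum representation on $\mathcal H^{(k)}$, let $\phi_*\sigma=\dfrac{c+d\sigma}{a+b\sigma}$, and let $\eta_{t,\sigma}(\phi)=\mathcal P_{\sigma,\phi_*\sigma}\circ\rho_k(\phi)$. For $x\in\mathbb C$, the operator $e^{x\Delta_\sigma}$ on $\mathcal H^{(k)}$ is given by the functional calculus: $\chi=e^{x\Delta_\sigma}\psi$ means that $\langle\chi,v\rangle=e^{x\mu}\langle\psi,v\rangle$ for every $v\in\mathcal H^{(k)}$ with $\Delta_\sigma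 v=\mu v$, $\mu\in\mathbb R$. **Proposition.** For every $\sigma\in\mathbb H$ the operators $e^{r\Delta_\sigma}$ and $e^{-r\Delta_\sigma}$ are well defined on all of $\mathcal H^{(k)}$ (in particular densely defined) and are inverse linear bijections of $\mathcal H^{(k)}$; the operators $\eta_{t,\sigma}(\phi)$ are well defined and form a representation of $\Gamma$ on $\mathcal H^{(k)}$; and $e^{r\Delta_\sigma}$ conjugates $\rho_k$ to $\eta_{t,\sigma}$: for all $\phi\in\Gamma$, $$\eta_{t,\sigma}(\phi)=e^{-r\Delta_\sigma}\circ\rho_k(\phi)\circ e^{r\Delta_\sigma}.$$ -/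

import Mathlib

open scoped InnerProductSpace ContDiff ComplexConjugate MatrixGroups
open MeasureTheory

noncomputable section

namespace ComplexCS

/-! ### Lie-theoretic data

The Cartan data of a compact, simple, connected, simply connected Lie group `G` is encoded by the
reduced irreducible crystallographic root system `P` of `G`: the real vector space `V` plays the
role of the Lie algebra of a maximal torus (it contains the coroots), `M` is its dual (it contains
the roots), the inner product of `V` is the basic one (see `IsBasicInner`), and the maximal torus is
the quotient of `V` by the coroot lattice `P.corootSpan ℤ`. -/

section Lie

variable {ι M V : Type*} [AddCommGroup M] [Module ℝ M]
  [NormedAddCommGroup V] [InnerProductSpace ℝ V]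

/-- The inner product of `V` is the basic inner product: it is invariant under the reflections
generating the Weyl group, and it is normalized so that the longest roots `α` have squared length
`2`. Since the coroot is `h_α = 2 α / ⟨α, α⟩` after identifying `V` with its dual, we have
`⟨h_α, h_α⟩ = 4 / ⟨α, α⟩`, and the normalization says that the shortest coroots have squared
length `2`. -/
structure IsBasicInner (P : RootPairing ι ℝ M V) : Prop where
  invariant : ∀ (i : ι) (x y : V), ⟪P.coreflection i x, P.coreflection i y⟫_ℝ = ⟪x, y⟫_ℝ
  normalized : IsLeast (Set.range fun i : ι => ⟪P.coroot i, P.coroot i⟫_ℝ) 2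

/-- The Weyl group, acting on `V`. -/
def weylGroup (P : RootPairing ι ℝ M V) : Subgroup (V ≃ₗ[ℝ] V) :=
  Subgroup.closure (Set.range P.coreflection)

/-- The pairing of a coroot with the form: `2 ⟨h_i, x⟩ = ⟨h_i, h_i⟩ α_i(x)`. -/
lemma IsBasicInner.two_mul_inner {P : RootPairing ι ℝ M V} (hP : IsBasicInner P) (i : ι) (x : V) :
    2 * ⟪P.coroot i, x⟫_ℝ = ⟪P.coroot i, P.coroot i⟫_ℝ * P.root' i x := by
  have h := hP.invariant i (P.coroot i) x
  rw [P.coreflection_apply_self, P.coreflection_apply, inner_neg_left, inner_sub_right,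
    inner_smul_right] at h
  linarith

lemma IsBasicInner.exists_even {P : RootPairing ι ℝ M V} [Finite ι] [P.IsCrystallographic]
    [P.IsIrreducible] (hP : IsBasicInner P) (i : ι) :
    ∃ m : ℤ, ⟪P.coroot i, P.coroot i⟫_ℝ = 2 * m := by
  obtain ⟨⟨j, hj⟩, hle⟩ := hP.normalized
  simp only at hj
  let B : P.flip.InvariantForm :=
    { form := innerₗ V
      symm := ⟨fun x y => by simp [real_inner_comm]⟩
      ne_zero := fun i => by simpa using P.flip.ne_zero i
      isOrthogonal_reflection := fun i x y => hP.invariant i x y }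
  obtain ⟨l, hl, hne⟩ := P.flip.exists_form_eq_form_and_form_ne_zero B i j
  simp only [B, RootPairing.flip_root, innerₗ_apply_apply] at hl hne
  obtain ⟨a, ha⟩ := P.exists_value (S := ℤ) l i
  obtain ⟨b, hb⟩ := P.exists_value (S := ℤ) i l
  have h1 := hP.two_mul_inner l (P.coroot i)
  have h2 := hP.two_mul_inner i (P.coroot l)
  rw [RootPairing.root'_coroot_eq_pairing, ← ha] at h1
  rw [RootPairing.root'_coroot_eq_pairing, ← hb] at h2
  have hcs := real_inner_mul_inner_self_le (P.coroot i) (P.coroot l)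
  have hge : 2 ≤ ⟪P.coroot i, P.coroot i⟫_ℝ := hle ⟨i, rfl⟩
  rw [hl, hj] at h1 hcs
  rw [real_inner_comm] at h1
  set q := ⟪P.coroot i, P.coroot i⟫_ℝ with hq
  set c := ⟪P.coroot i, P.coroot l⟫_ℝ with hc
  simp only [eq_intCast] at h1 h2
  have hca : c = a := by linarith
  have hqb : 2 * (a : ℝ) = q * b := by rw [← hca]; exact h2
  have ha0 : a ≠ 0 := by
    rintro rfl
    exact hne (by simpa using hca)
  have hb0 : b ≠ 0 := by
    rintro rfl
    simp at hqb
    exact ha0 hqb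
  have hmul : ((a * b : ℤ) : ℝ) ≤ 4 := by
    push_cast
    rw [hca] at hcs
    have hbq : (a : ℝ) = q * b / 2 := by linarith
    have : (a : ℝ) * a = q * (a * b) / 2 := by nth_rewrite 2 [hbq]; ring
    rw [this] at hcs
    nlinarith
  have hmul' : a * b ≤ 4 := by exact_mod_cast hmul
  have hpos : 0 < a * b := by
    have : 0 < (a : ℝ) * b := by
      have hb2 : 0 < (b : ℝ) * b := mul_self_pos.mpr (by exact_mod_cast hb0)
      have : 2 * ((a : ℝ) * b) = q * (b * b) := by rw [← mul_assoc, hqb]; ring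
      nlinarith
    exact_mod_cast this
  have hba : b * b ≤ a * b := by
    have : (b : ℝ) * b ≤ a * b := by
      have hb2 : 0 ≤ (b : ℝ) * b := mul_self_nonneg _
      have : 2 * ((a : ℝ) * b) = q * (b * b) := by rw [← mul_assoc, hqb]; ring
      nlinarith
    exact_mod_cast this
  have hb2 : b ≤ 2 := by nlinarith
  have hb2' : -2 ≤ b := by nlinarith
  have hdvd : b ∣ a := by
    have : b = -2 ∨ b = -1 ∨ b = 1 ∨ b = 2 := by omega
    rcases this with rfl | rfl | rfl | rfl
    · exact ⟨1, by omega⟩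
    · exact ⟨-a, by ring⟩
    · exact ⟨a, by ring⟩
    · exact ⟨1, by omega⟩
  obtain ⟨m, rfl⟩ := hdvd
  refine ⟨m, ?_⟩
  have hb0' : (b : ℝ) ≠ 0 := by exact_mod_cast hb0
  apply mul_right_cancel₀ hb0'
  rw [← hqb]
  push_cast
  ring

/-- The coroot lattice is integral. -/
lemma IsBasicInner.exists_int {P : RootPairing ι ℝ M V} [Finite ι] [P.IsCrystallographic]
    [P.IsIrreducible] (hP : IsBasicInner P) {x y : V} (hx : x ∈ P.corootSpan ℤ)
    (hy : y ∈ P.corootSpan ℤ) : ∃ m : ℤ, ⟪x, y⟫_ℝ = m := by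
  induction hx using Submodule.span_induction with
  | zero => exact ⟨0, by simp⟩
  | add u v _ _ hu hv =>
    obtain ⟨m, hm⟩ := hu
    obtain ⟨l, hl⟩ := hv
    exact ⟨m + l, by rw [inner_add_left, hm, hl]; push_cast; ring⟩
  | smul a u _ hu =>
    obtain ⟨m, hm⟩ := hu
    refine ⟨a * m, ?_⟩
    rw [← Int.cast_smul_eq_zsmul ℝ a u, inner_smul_left, hm]
    simp
  | mem u hu =>
    obtain ⟨i, rfl⟩ := hu
    induction hy using Submodule.span_induction with
    | zero => exact ⟨0, by simp⟩
    | add u v _ _ hu hv =>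
      obtain ⟨m, hm⟩ := hu
      obtain ⟨l, hl⟩ := hv
      exact ⟨m + l, by rw [inner_add_right, hm, hl]; push_cast; ring⟩
    | smul a u _ hu =>
      obtain ⟨m, hm⟩ := hu
      refine ⟨a * m, ?_⟩
      rw [← Int.cast_smul_eq_zsmul ℝ a u, inner_smul_right, hm]
      simp
    | mem u hu =>
      obtain ⟨j, rfl⟩ := hu
      obtain ⟨m, hm⟩ := hP.exists_even i
      obtain ⟨a, ha⟩ := P.exists_value (S := ℤ) i j
      have h := hP.two_mul_inner i (P.coroot j)
      rw [RootPairing.root'_coroot_eq_pairing, ← ha, hm] at h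
      refine ⟨m * a, ?_⟩
      push_cast
      simp only [eq_intCast] at h
      linarith

/-- The coroot lattice is even. -/
lemma IsBasicInner.exists_even_self {P : RootPairing ι ℝ M V} [Finite ι] [P.IsCrystallographic]
    [P.IsIrreducible] (hP : IsBasicInner P) {x : V} (hx : x ∈ P.corootSpan ℤ) :
    ∃ m : ℤ, ⟪x, x⟫_ℝ = 2 * m := by
  induction hx using Submodule.span_induction with
  | zero => exact ⟨0, by simp⟩
  | add u v hu' hv' hu hv =>
    obtain ⟨m, hm⟩ := hu
    obtain ⟨l, hl⟩ := hv
    obtain ⟨c, hc⟩ := hP.exists_int hu' hv'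
    refine ⟨m + c + l, ?_⟩
    rw [real_inner_add_add_self, hm, hl, hc]
    push_cast
    ring
  | smul a u _ hu =>
    obtain ⟨m, hm⟩ := hu
    refine ⟨a * a * m, ?_⟩
    rw [← Int.cast_smul_eq_zsmul ℝ a u, inner_smul_left, inner_smul_right, hm]
    simp
    ring
  | mem u hu =>
    obtain ⟨i, rfl⟩ := hu
    exact hP.exists_even i

end Lie

/-! ### The pre-quantum line bundle and its sections -/

/-! ### The row action of `SL(2, ℤ)` -/

/-- The right action `(θ₁, θ₂) ↦ (θ₁, θ₂) φ` (row vector times matrix) of `SL(2, ℤ)` on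
`V ⊕ V`. -/
def rowAction {V : Type*} [AddCommGroup V] (φ : SL(2, ℤ)) (A : V × V) : V × V :=
  (φ 0 0 • A.1 + φ 1 0 • A.2, φ 0 1 • A.1 + φ 1 1 • A.2)

lemma rowAction_one {V : Type*} [AddCommGroup V] (A : V × V) : rowAction 1 A = A := by
  simp [rowAction]

lemma rowAction_mul {V : Type*} [AddCommGroup V] (φ χ : SL(2, ℤ)) (A : V × V) :
    rowAction (φ * χ) A = rowAction χ (rowAction φ A) := by
  simp only [rowAction, Matrix.SpecialLinearGroup.coe_mul, Matrix.mul_apply, Fin.sum_univ_two,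
    Prod.mk.injEq]
  constructor <;> module

section Bundle

variable {V : Type*} [NormedAddCommGroup V] [InnerProductSpace ℝ V]

/-- The level `k` symplectic form
`ω(A, X) = 2π (⟨A₁, X₂⟩_k - ⟨X₁, A₂⟩_k)` on `V ⊕ V`, with `⟨x, y⟩_k = k ⟨x, y⟩`. -/
def omega (k : ℕ) (A X : V × V) : ℝ :=
  2 * Real.pi * (k * ⟪A.1, X.2⟫_ℝ - k * ⟪X.1, A.2⟫_ℝ)

/-- The multiplier `e_l(A) = (-1)^{⟨l₁, l₂⟩_k} exp(-(i/2) ω(A, l))` of the level `k` line bundle.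
The pairing `⟨l₁, l₂⟩_k` is an integer for lattice vectors, and the sign is written as an
exponential. -/
def multiplier (k : ℕ) (l A : V × V) : ℂ :=
  Complex.exp (Real.pi * Complex.I * ((k * ⟪l.1, l.2⟫_ℝ : ℝ) : ℂ)) *
    Complex.exp (-(Complex.I / 2) * (omega k A l : ℂ))

/-- The space `H^(k)` of smooth sections over `(T × T) / W` of the level `k` Chern-Simons line
bundle: smooth functions on `V ⊕ V` which are quasi-periodic with respect to the coroot lattice in
each factor, with the given multipliers, and invariant under the diagonal Weyl group action. -/
def sections {ι M : Type*} [AddCommGroup M] [Module ℝ M] (P : RootPairing ι ℝ M V) (k : ℕ) :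
    Submodule ℂ (V × V → ℂ) where
  carrier := {ψ | ContDiff ℝ ∞ ψ ∧
    (∀ l₁ ∈ P.corootSpan ℤ, ∀ l₂ ∈ P.corootSpan ℤ, ∀ A : V × V,
      ψ (A + (l₁, l₂)) = multiplier k (l₁, l₂) A * ψ A) ∧
    ∀ w ∈ weylGroup P, ∀ A : V × V, ψ (w A.1, w A.2) = ψ A}
  add_mem' := by
    rintro ψ χ ⟨h1, h2, h3⟩ ⟨h1', h2', h3'⟩
    refine ⟨h1.add h1', fun l₁ hl₁ l₂ hl₂ A => ?_, fun w hw A => ?_⟩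
    · simp only [Pi.add_apply, h2 l₁ hl₁ l₂ hl₂ A, h2' l₁ hl₁ l₂ hl₂ A, mul_add]
    · simp only [Pi.add_apply, h3 w hw A, h3' w hw A]
  zero_mem' := ⟨contDiff_const, fun _ _ _ _ _ => by simp, fun _ _ _ => rfl⟩
  smul_mem' := by
    rintro c ψ ⟨h1, h2, h3⟩
    refine ⟨contDiff_const.smul h1, fun l₁ hl₁ l₂ hl₂ A => ?_, fun w hw A => ?_⟩
    · simp only [Pi.smul_apply, smul_eq_mul, h2 l₁ hl₁ l₂ hl₂ A]
      ring
    · simp only [Pi.smul_apply, h3 w hw A]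

/-- The `L²` inner product of sections, `∫_{T × T} ψ conj(χ)`, computed on the product of two copies
of a fundamental domain `F` of the coroot lattice. It is normalized by the Lebesgue measure of the
given inner product; the positive constant by which other normalizations differ is irrelevant
below. -/
def sectionInner [MeasurableSpace V] [BorelSpace V] [FiniteDimensional ℝ V] (F : Set V)
    (ψ χ : V × V → ℂ) : ℂ :=
  ∫ A in F ×ˢ F, ψ A * conj (χ A)

/-! ### The mapping class group -/

lemma omega_rowAction (k : ℕ) (φ : SL(2, ℤ)) (A X : V × V) :
    omega k (rowAction φ A) (rowAction φ X) = omega k A X := by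
  have hdet : (φ 0 0 : ℝ) * φ 1 1 - φ 0 1 * φ 1 0 = 1 := by
    have := φ.det_coe
    rw [Matrix.det_fin_two] at this
    exact_mod_cast this
  simp only [omega, rowAction, ← Int.cast_smul_eq_zsmul ℝ, inner_add_left, inner_add_right,
    inner_smul_left, inner_smul_right, RCLike.conj_to_real]
  rw [real_inner_comm A.1 X.1, real_inner_comm A.2 X.2, real_inner_comm A.2 X.1,
    real_inner_comm A.1 X.2]
  linear_combination (2 * Real.pi * (k * ⟪A.1, X.2⟫_ℝ - k * ⟪A.2, X.1⟫_ℝ)) * hdet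

lemma multiplier_rowAction {ι M : Type*} [AddCommGroup M] [Module ℝ M]
    {P : RootPairing ι ℝ M V} [Finite ι] [P.IsCrystallographic] [P.IsIrreducible]
    (hP : IsBasicInner P) (k : ℕ) (φ : SL(2, ℤ)) {l : V × V} (h1 : l.1 ∈ P.corootSpan ℤ)
    (h2 : l.2 ∈ P.corootSpan ℤ) (A : V × V) :
    multiplier k (rowAction φ l) (rowAction φ A) = multiplier k l A := by
  have hdet : (φ 0 0 : ℝ) * φ 1 1 - φ 0 1 * φ 1 0 = 1 := by
    have := φ.det_coe
    rw [Matrix.det_fin_two] at this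
    exact_mod_cast this
  obtain ⟨a, ha⟩ := hP.exists_even_self h1
  obtain ⟨b, hb⟩ := hP.exists_even_self h2
  obtain ⟨c, hc⟩ := hP.exists_int h1 h2
  unfold multiplier
  rw [omega_rowAction]
  congr 1
  rw [Complex.exp_eq_exp_iff_exists_int]
  refine ⟨k * (φ 0 0 * φ 0 1 * a + φ 1 0 * φ 1 1 * b + φ 0 1 * φ 1 0 * c), ?_⟩
  have key : (k * ⟪(rowAction φ l).1, (rowAction φ l).2⟫_ℝ : ℝ) = k * ⟪l.1, l.2⟫_ℝ +
      2 * (k * (φ 0 0 * φ 0 1 * a + φ 1 0 * φ 1 1 * b + φ 0 1 * φ 1 0 * c)) := by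
    simp only [rowAction, ← Int.cast_smul_eq_zsmul ℝ, inner_add_left, inner_add_right,
      inner_smul_left, inner_smul_right, RCLike.conj_to_real]
    rw [real_inner_comm l.1 l.2, ha, hb, hc]
    linear_combination (k * c : ℝ) * hdet
  rw [key]
  push_cast
  ring

/-- The pre-quantum representation `ρ_k` of `SL(2, ℤ)` on `H^(k)`, `(ρ_k(φ) ψ)(θ) = ψ(θ φ)`. -/
def preQuantum {ι M : Type*} [AddCommGroup M] [Module ℝ M]
    (P : RootPairing ι ℝ M V) [Finite ι] [P.IsCrystallographic] [P.IsIrreducible]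
    (hP : IsBasicInner P) [FiniteDimensional ℝ V] (k : ℕ) :
    Representation ℂ SL(2, ℤ) (sections P k) where
  toFun φ :=
    { toFun := fun ψ => ⟨fun A => ψ.1 (rowAction φ A), by
        obtain ⟨ψ, h1, h2, h3⟩ := ψ
        refine ⟨?_, fun l₁ hl₁ l₂ hl₂ A => ?_, fun w hw A => ?_⟩
        · apply h1.comp
          unfold rowAction
          simp only [← Int.cast_smul_eq_zsmul ℝ]
          fun_prop
        · have hadd : rowAction φ (A + (l₁, l₂)) = rowAction φ A + rowAction φ (l₁, l₂) := by
            simp only [rowAction, Prod.fst_add, Prod.snd_add, Prod.mk_add_mk, Prod.mk.injEq]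
            constructor <;> module
          rw [← multiplier_rowAction hP k φ (l := (l₁, l₂)) hl₁ hl₂ A]
          simp only [hadd]
          exact h2 _ (Submodule.add_mem _ (Submodule.smul_mem _ _ hl₁)
            (Submodule.smul_mem _ _ hl₂)) _ (Submodule.add_mem _ (Submodule.smul_mem _ _ hl₁)
            (Submodule.smul_mem _ _ hl₂)) _
        · have hw' : rowAction φ (w A.1, w A.2) = (w (rowAction φ A).1, w (rowAction φ A).2) := by
            simp [rowAction]
          simp only [hw']
          exact h3 w hw _⟩
      map_add' := fun _ _ => rfl
      map_smul' := fun _ _ => rfl }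
  map_one' := by
    ext ψ A
    simp [rowAction_one]
  map_mul' φ χ := by
    ext ψ A
    simp [rowAction_mul]

/-- `(ρ_k(S) ψ)(θ₁, θ₂) = ψ(θ₂, -θ₁)`, where `S` is the matrix with rows `(0, -1)`, `(1, 0)`. -/
lemma preQuantum_S {ι M : Type*} [AddCommGroup M] [Module ℝ M]
    (P : RootPairing ι ℝ M V) [Finite ι] [P.IsCrystallographic] [P.IsIrreducible]
    (hP : IsBasicInner P) [FiniteDimensional ℝ V] (k : ℕ) (ψ : sections P k) (θ₁ θ₂ : V) :
    (preQuantum P hP k ModularGroup.S ψ).1 (θ₁, θ₂) = ψ.1 (θ₂, -θ₁) := by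
  simp [preQuantum, rowAction, ModularGroup.S]

/-- `(ρ_k(T) ψ)(θ₁, θ₂) = ψ(θ₁, θ₁ + θ₂)`, where `T` is the matrix with rows `(1, 1)`, `(0, 1)`. -/
lemma preQuantum_T {ι M : Type*} [AddCommGroup M] [Module ℝ M]
    (P : RootPairing ι ℝ M V) [Finite ι] [P.IsCrystallographic] [P.IsIrreducible]
    (hP : IsBasicInner P) [FiniteDimensional ℝ V] (k : ℕ) (ψ : sections P k) (θ₁ θ₂ : V) :
    (preQuantum P hP k ModularGroup.T ψ).1 (θ₁, θ₂) = ψ.1 (θ₁, θ₁ + θ₂) := by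
  simp [preQuantum, rowAction, ModularGroup.T]

/-- Exchange of the two basis vectors: the matrix with rows `(a, b)`, `(c, d)` is sent to the one
with rows `(d, c)`, `(b, a)`. -/
def swapConj (φ : SL(2, ℤ)) : SL(2, ℤ) :=
  ⟨!![φ 1 1, φ 1 0; φ 0 1, φ 0 0], by
    have := φ.det_coe
    rw [Matrix.det_fin_two] at this
    rw [Matrix.det_fin_two_of]
    linarith⟩

/-- The action `σ ↦ φ_* σ = (c + d σ) / (a + b σ)` of the mapping class group on the upper half
plane, for `φ` with rows `(a, b)`, `(c, d)`. -/
def pushforward (φ : SL(2, ℤ)) (σ : UpperHalfPlane) : UpperHalfPlane :=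
  swapConj φ • σ

lemma coe_pushforward (φ : SL(2, ℤ)) (σ : UpperHalfPlane) :
    (pushforward φ σ : ℂ) = (φ 1 0 + φ 1 1 * σ) / (φ 0 0 + φ 0 1 * σ) := by
  rw [pushforward, UpperHalfPlane.coe_specialLinearGroup_apply]
  simp [swapConj, add_comm]

lemma pushforward_one (σ : UpperHalfPlane) : pushforward 1 σ = σ := by
  ext
  simp [coe_pushforward]

lemma pushforward_mul (φ χ : SL(2, ℤ)) (σ : UpperHalfPlane) :
    pushforward (φ * χ) σ = pushforward φ (pushforward χ σ) := by
  have : swapConj (φ * χ) = swapConj φ * swapConj χ := by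
    ext i j
    rw [Matrix.SpecialLinearGroup.coe_mul]
    fin_cases i <;> fin_cases j <;>
      simp [swapConj, Matrix.mul_apply, Fin.sum_univ_two, add_comm]
  rw [pushforward, this, mul_smul, pushforward, pushforward]

/-- `S_* σ = -1 / σ`. -/
lemma coe_pushforward_S (σ : UpperHalfPlane) :
    (pushforward ModularGroup.S σ : ℂ) = -1 / σ := by
  rw [coe_pushforward]
  simp [ModularGroup.S, neg_div, div_neg]

/-- `T_* σ = σ / (1 + σ)`. -/
lemma coe_pushforward_T (σ : UpperHalfPlane) :
    (pushforward ModularGroup.T σ : ℂ) = σ / (1 + σ) := by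
  rw [coe_pushforward]
  simp [ModularGroup.T]

/-! ### The pre-quantum connection, the Laplacian and the Hitchin-Witten connection -/

/-- The pre-quantum connection `∇_X ψ = dψ(X) - (i/2) ω(A, X) ψ` in the direction of the constant
vector field `X` on `V ⊕ V`; its curvature is `-i ω`. -/
def covDeriv (k : ℕ) (X : V × V) (ψ : V × V → ℂ) : V × V → ℂ :=
  fun A => fderiv ℝ ψ A X - Complex.I / 2 * (omega k A X : ℂ) * ψ A

variable {n : ℕ}

/-- `∇_{z_j}`, for the coordinates `θ₁ = ∑ u_j b_j`, `θ₂ = ∑ v_j b_j`, `z_j = u_j + σ v_j`; thus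
`∂/∂z_j = (∂/∂v_j - conj σ ∂/∂u_j) / (σ - conj σ)`. -/
def covZ (k : ℕ) (b : Module.Basis (Fin n) ℝ V) (σ : UpperHalfPlane) (j : Fin n)
    (ψ : V × V → ℂ) : V × V → ℂ :=
  ((σ : ℂ) - conj (σ : ℂ))⁻¹ •
    (covDeriv k (0, b j) ψ - conj (σ : ℂ) • covDeriv k (b j, 0) ψ)

/-- The covariant derivative along `∂/∂(conj z_j) = (∂/∂v_j - σ ∂/∂u_j) / (conj σ - σ)`. -/
def covZbar (k : ℕ) (b : Module.Basis (Fin n) ℝ V) (σ : UpperHalfPlane) (j : Fin n)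
    (ψ : V × V → ℂ) : V × V → ℂ :=
  (conj (σ : ℂ) - (σ : ℂ))⁻¹ •
    (covDeriv k (0, b j) ψ - (σ : ℂ) • covDeriv k (b j, 0) ψ)

/-- The inverse of the Gram matrix `⟨b_p, b_q⟩` of the basis. -/
def gramInv (b : Module.Basis (Fin n) ℝ V) : Matrix (Fin n) (Fin n) ℝ :=
  (Matrix.of fun p q => ⟪b p, b q⟫_ℝ)⁻¹

/-- The Laplace operator `Δ_σ`. -/
def laplacian (k : ℕ) (b : Module.Basis (Fin n) ℝ V) (σ : UpperHalfPlane) (ψ : V × V → ℂ) :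
    V × V → ℂ :=
  (Complex.I / (2 * Real.pi) * ((σ : ℂ) - conj (σ : ℂ))) • ∑ p, ∑ q, (gramInv b p q : ℂ) •
    (covZ k b σ p (covZbar k b σ q ψ) + covZbar k b σ p (covZ k b σ q ψ))

/-- The operator `Δ_G = (i/π) ∑ C^{pq} ∇_{z_p} ∇_{z_q}`. -/
def laplacianG (k : ℕ) (b : Module.Basis (Fin n) ℝ V) (σ : UpperHalfPlane) (ψ : V × V → ℂ) :
    V × V → ℂ :=
  (Complex.I / Real.pi) • ∑ p, ∑ q, (gramInv b p q : ℂ) • covZ k b σ p (covZ k b σ q ψ)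

/-- The operator obtained from `Δ_G` by conjugation: `-(i/π) ∑ C^{pq}` times the product of the
covariant derivatives along the conjugates of `z_p` and `z_q`. -/
def laplacianGbar (k : ℕ) (b : Module.Basis (Fin n) ℝ V) (σ : UpperHalfPlane) (ψ : V × V → ℂ) :
    V × V → ℂ :=
  (-(Complex.I / Real.pi)) • ∑ p, ∑ q, (gramInv b p q : ℂ) • covZbar k b σ p (covZbar k b σ q ψ)

/-- The derivative at `σ` of a family `Ψ` of functions over the upper half plane, in the real
direction `ξ ∈ ℂ`, evaluated at the point `A`. -/
def dirDeriv (Ψ : UpperHalfPlane → V × V → ℂ) (σ : UpperHalfPlane) (ξ : ℂ) (A : V × V) : ℂ :=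
  fderiv ℝ (fun τ : ℂ => Ψ (UpperHalfPlane.ofComplex τ) A) (σ : ℂ) ξ

/-- `∂Ψ/∂σ`. -/
def dSigma (Ψ : UpperHalfPlane → V × V → ℂ) (σ : UpperHalfPlane) (A : V × V) : ℂ :=
  (dirDeriv Ψ σ 1 A - Complex.I * dirDeriv Ψ σ Complex.I A) / 2

/-- `∂Ψ/∂(conj σ)`. -/
def dSigmaBar (Ψ : UpperHalfPlane → V × V → ℂ) (σ : UpperHalfPlane) (A : V × V) : ℂ :=
  (dirDeriv Ψ σ 1 A + Complex.I * dirDeriv Ψ σ Complex.I A) / 2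

variable {ι M : Type*} [AddCommGroup M] [Module ℝ M]

/-- `Ψ` is a smooth section of the trivial bundle with fibre `H^(k)` over the upper half plane which
is parallel for the Hitchin-Witten connection
`∇_σ = ∂_σ + (1/2t) Δ_G`, `∇_{conj σ} = ∂_{conj σ} - (1/(2 conj t)) Δ_{conj G}`. -/
structure IsParallel (P : RootPairing ι ℝ M V) (k : ℕ) (b : Module.Basis (Fin n) ℝ V) (t : ℂ)
    (Ψ : UpperHalfPlane → sections P k) : Prop where
  smooth : ContDiffOn ℝ ∞
    (fun p : ℂ × (V × V) => (Ψ (UpperHalfPlane.ofComplex p.1)).1 p.2)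
    ({τ : ℂ | 0 < τ.im} ×ˢ Set.univ)
  holo : ∀ (σ : UpperHalfPlane) (A : V × V),
    dSigma (fun τ => (Ψ τ).1) σ A + 1 / (2 * t) * laplacianG k b σ (Ψ σ).1 A = 0
  antiholo : ∀ (σ : UpperHalfPlane) (A : V × V),
    dSigmaBar (fun τ => (Ψ τ).1) σ A - 1 / (2 * conj t) * laplacianGbar k b σ (Ψ σ).1 A = 0

/-- `χ = 𝒫_{σ₀, σ₁} ψ`: the Hitchin-Witten parallel transport from the fibre over `σ₁` to the fibre
over `σ₀` takes `ψ` to `χ`. -/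
def IsParallelTransport (P : RootPairing ι ℝ M V) (k : ℕ) (b : Module.Basis (Fin n) ℝ V) (t : ℂ)
    (σ₀ σ₁ : UpperHalfPlane) (ψ χ : sections P k) : Prop :=
  ∃ Ψ : UpperHalfPlane → sections P k, IsParallel P k b t Ψ ∧ Ψ σ₁ = ψ ∧ Ψ σ₀ = χ

/-- `χ = η_{t, σ}(φ) ψ`, where `η_{t, σ}(φ) = 𝒫_{σ, φ_* σ} ∘ ρ_k(φ)`. -/
def IsQuantum (P : RootPairing ι ℝ M V) [Finite ι] [P.IsCrystallographic] [P.IsIrreducible]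
    (hP : IsBasicInner P) [FiniteDimensional ℝ V] (k : ℕ) (b : Module.Basis (Fin n) ℝ V) (t : ℂ)
    (σ : UpperHalfPlane) (φ : SL(2, ℤ)) (ψ χ : sections P k) : Prop :=
  IsParallelTransport P k b t σ (pushforward φ σ) (preQuantum P hP k φ ψ) χ

/-- `χ = e^{c Δ_σ} ψ`, in the sense of the functional calculus of the Laplace operator, which has
discrete spectrum: for every eigensection `v`, with eigenvalue `μ`, the coefficient of `χ` along `v`
is `e^{c μ}` times that of `ψ`. The domain of `e^{c Δ_σ}` in `H^(k)` consists of those `ψ` for which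
such a `χ` in `H^(k)` exists. -/
def IsExpLaplacian [MeasurableSpace V] [BorelSpace V] [FiniteDimensional ℝ V]
    (P : RootPairing ι ℝ M V) (k : ℕ) (b : Module.Basis (Fin n) ℝ V) (F : Set V)
    (σ : UpperHalfPlane) (c : ℂ) (ψ χ : sections P k) : Prop :=
  ∀ (μ : ℝ) (v : sections P k), laplacian k b σ v.1 = (μ : ℂ) • v.1 →
    sectionInner F χ.1 v.1 = Complex.exp (c * μ) * sectionInner F ψ.1 v.1

end Bundle

end ComplexCS

end

open scoped InnerProductSpace ContDiff ComplexConjugate MatrixGroups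
open MeasureTheory

noncomputable section

namespace ComplexCS

/-! Since `k - is` and `k + is` are conjugate, `e^{-4kr}` has modulus one and `r` is purely
imaginary. So `e^{rΔ_σ}` is unitary: it is the Schrödinger flow `e^{i(θ/k)Δ_σ}` with `θ = k Im r`.
The heart of the matter is that `σ ↦ e^{-rΔ_σ} ψ` is parallel for the Hitchin-Witten connection.
Indeed `[∂_σ, Δ_σ] = Δ_G` and `[Δ_σ, Δ_G] = 4k Δ_G` (`dolbeault_mul_lapOp`, `lapOp_mul_hitchinOp`),
so a section constant in `σ` is carried by the flow to a solution of `∂_σ f = c Δ_G f` with `c =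
(e^{4iθ} - 1)/(4k)` (`dolbeault_flow`, `dolbeault_lapEvol`). For `θ = -k Im r` the choice of `r`
gives `c = -1/(2t)`, because `t + conj t = 2k` (`isParallel_expSec`). The conjugate equation is
treated at the same time through a sign `ε`. Parallel transport from `σ₁` to `σ₀` is therefore
`e^{-rΔ_{σ₀}} e^{rΔ_{σ₁}}`, and since `ρ_k(φ)` carries `Δ_σ` to `Δ_{φ_*σ}` (`lapPt_rho`), `η(φ) =
e^{-rΔ_σ} ρ_k(φ) e^{rΔ_σ}`.

Existence of the flow on smooth sections. The covariant derivatives generate a Heisenberg algebra,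
and `Lu`, `Lv`, `Luv` span a copy of `sl₂` in which `Δ_σ` is elliptic. A rotation is a product of
three shears, that is, of flows of `Lu`, `Lv`, `Lu` (`exists_triple_flow`, `exists_lap_flow`). The
flow of `Lv` is explicit: along a lattice vector `d` a section has a Fourier series on whose modes
`∇_d²` is multiplication by a real function (`exists_lineFlow`), and `∑ e_i ⊗ e_i` is a combination
of squares of lattice vectors, whose flows commute (`isFlowable_symm`). Everything is done for
families depending smoothly on parameters, so that the flows can be differentiated in `σ`.

Uniqueness. Real quadratic Hamiltonians are symmetric, so the `L²` norm is conserved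
(`eq_zero_of_schrodinger`). This yields uniqueness of the flows, the zero-curvature argument
`flow_param_deriv`, the symmetries of the flow, and uniqueness of parallel sections, since in each
real direction the Hitchin-Witten connection is a Schrödinger equation with real coefficients
(`eq_zero_of_hitchinWitten`).

The functional calculus sees only coefficients along eigensections, so these must be total. Ladder
operators show that polynomials times a Gaussian are spanned by eigenfunctions on `V × V`
(`polyGauss_le_eigenGauss`). Their periodizations are eigensections, and a section orthogonal to all
of them is, after unfolding, orthogonal to every polynomial times the Gaussian, hence zero
(`eq_zero_of_pair_eigen`). Averaging over the Weyl group gives the invariant version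
(`eq_zero_of_pair_eigensection`). -/

/-! ### Covariant derivatives of families of functions on `V × V` -/

section Families

variable {V : Type*} [NormedAddCommGroup V] [InnerProductSpace ℝ V]

/-- The symplectic form as a continuous linear functional of its first argument. -/
def omegaL (k : ℕ) (X : V × V) : V × V →L[ℝ] ℝ :=
  (2 * Real.pi * k) • ((innerSL ℝ X.2).comp (ContinuousLinearMap.fst ℝ V V) -
    (innerSL ℝ X.1).comp (ContinuousLinearMap.snd ℝ V V))

lemma omegaL_apply (k : ℕ) (X A : V × V) : omegaL k X A = omega k A X := by
  simp only [omegaL, omega, smul_apply, sub_apply,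
    ContinuousLinearMap.coe_comp, Function.comp_apply, ContinuousLinearMap.coe_fst',
    ContinuousLinearMap.coe_snd', innerSL_apply_apply, smul_eq_mul, real_inner_comm]
  ring

lemma omega_swap (k : ℕ) (A X : V × V) : omega k A X = -omega k X A := by
  simp only [omega]
  ring

lemma omega_add_left (k : ℕ) (A B X : V × V) : omega k (A + B) X = omega k A X + omega k B X := by
  simp only [← omegaL_apply, map_add]

lemma omega_smul_left (k : ℕ) (c : ℝ) (A X : V × V) : omega k (c • A) X = c * omega k A X := by
  simp only [← omegaL_apply, map_smul, smul_eq_mul]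

lemma omega_add_right (k : ℕ) (A X Y : V × V) : omega k A (X + Y) = omega k A X + omega k A Y := by
  rw [omega_swap, omega_add_left, omega_swap k A X, omega_swap k A Y]
  ring

lemma omega_smul_right (k : ℕ) (c : ℝ) (A X : V × V) : omega k A (c • X) = c * omega k A X := by
  rw [omega_swap, omega_smul_left, omega_swap k A X]
  ring

variable {E : Type*} [NormedAddCommGroup E] [NormedSpace ℝ E]

lemma hasFDerivAt_omega (k : ℕ) (X : V × V) (x : E × (V × V)) :
    HasFDerivAt (fun y : E × (V × V) => (omega k y.2 X : ℂ))
      (Complex.ofRealCLM.comp ((omegaL k X).comp (ContinuousLinearMap.snd ℝ E (V × V)))) x := by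
  have := (Complex.ofRealCLM.comp
    ((omegaL k X).comp (ContinuousLinearMap.snd ℝ E (V × V)))).hasFDerivAt (x := x)
  refine this.congr_of_eventuallyEq (.of_forall fun y => ?_)
  simp [omegaL_apply]

lemma contDiff_omega (k : ℕ) (X : V × V) :
    ContDiff ℝ ∞ (fun y : E × (V × V) => (omega k y.2 X : ℂ)) := by
  simp only [← omegaL_apply]
  exact (Complex.ofRealCLM.comp
    ((omegaL k X).comp (ContinuousLinearMap.snd ℝ E (V × V)))).contDiff

/-- The covariant derivative of a family of functions on `V × V` parametrized by `E`, in the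
direction of a constant vector field on `E × (V × V)`. -/
def nabF (k : ℕ) (ξ : E × (V × V)) (f : E × (V × V) → ℂ) : E × (V × V) → ℂ :=
  fun x => fderiv ℝ f x ξ - Complex.I / 2 * (omega k x.2 ξ.2 : ℂ) * f x

lemma contDiff_nabF (k : ℕ) (ξ : E × (V × V)) {f : E × (V × V) → ℂ} (hf : ContDiff ℝ ∞ f) :
    ContDiff ℝ ∞ (nabF k ξ f) := by
  have h1 : ContDiff ℝ ∞ (fun x => fderiv ℝ f x ξ) :=
    (hf.fderiv_right (m := ∞) (by simp)).clm_apply contDiff_const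
  exact h1.sub ((contDiff_const.mul (contDiff_omega k ξ.2)).mul hf)

lemma nabF_nabF_apply (k : ℕ) (ξ ζ : E × (V × V)) {f : E × (V × V) → ℂ} (hf : ContDiff ℝ ∞ f)
    (x : E × (V × V)) :
    nabF k ξ (nabF k ζ f) x = fderiv ℝ (fderiv ℝ f) x ξ ζ
      - Complex.I / 2 * (omega k ξ.2 ζ.2 * f x + omega k x.2 ζ.2 * fderiv ℝ f x ξ)
      - Complex.I / 2 * omega k x.2 ξ.2 *
        (fderiv ℝ f x ζ - Complex.I / 2 * omega k x.2 ζ.2 * f x) := by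
  have hd : DifferentiableAt ℝ f x := (hf.differentiable (by simp)).differentiableAt
  have hdd : DifferentiableAt ℝ (fderiv ℝ f) x :=
    ((hf.fderiv_right (m := ∞) (by simp)).differentiable (by simp)).differentiableAt
  have h1 : HasFDerivAt (fun y => fderiv ℝ f y ζ) ((fderiv ℝ (fderiv ℝ f) x).flip ζ) x := by
    have := hdd.hasFDerivAt.clm_apply (hasFDerivAt_const ζ x)
    simpa using this
  have h2 := ((hasFDerivAt_omega (E := E) k ζ.2 x).const_mul (Complex.I / 2)).mul hd.hasFDerivAt
  have h3 := (h1.sub h2).fderiv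
  have h4 : fderiv ℝ (nabF k ζ f) x = _ := h3
  rw [nabF, h4]
  simp only [nabF, sub_apply, ContinuousLinearMap.flip_apply,
    add_apply, smul_apply, ContinuousLinearMap.coe_comp,
    Function.comp_apply, Complex.ofRealCLM_apply, omegaL_apply, smul_eq_mul,
    ContinuousLinearMap.coe_snd']
  ring

/-- Second derivatives are symmetric and cancel; the derivative of the connection form leaves the
curvature `-iω`. -/
lemma nabF_comm (k : ℕ) (ξ ζ : E × (V × V)) {f : E × (V × V) → ℂ} (hf : ContDiff ℝ ∞ f)
    (x : E × (V × V)) :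
    nabF k ξ (nabF k ζ f) x = nabF k ζ (nabF k ξ f) x
      - Complex.I * omega k ξ.2 ζ.2 * f x := by
  have hs : fderiv ℝ (fderiv ℝ f) x ξ ζ = fderiv ℝ (fderiv ℝ f) x ζ ξ :=
    (hf.contDiffAt (x := x)).isSymmSndFDerivAt
      (by simpa using WithTop.coe_le_coe.2 (le_top : (2 : ℕ∞) ≤ ⊤)) ξ ζ
  rw [nabF_nabF_apply k ξ ζ hf, nabF_nabF_apply k ζ ξ hf, hs, omega_swap k ζ.2 ξ.2]
  push_cast
  ring

lemma nabF_add (k : ℕ) (ξ : E × (V × V)) {f g : E × (V × V) → ℂ} (hf : ContDiff ℝ ∞ f)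
    (hg : ContDiff ℝ ∞ g) : nabF k ξ (f + g) = nabF k ξ f + nabF k ξ g := by
  ext x
  have h1 : DifferentiableAt ℝ f x := (hf.differentiable (by simp)).differentiableAt
  have h2 : DifferentiableAt ℝ g x := (hg.differentiable (by simp)).differentiableAt
  simp only [nabF, fderiv_add h1 h2, add_apply, Pi.add_apply]
  ring

lemma nabF_smul (k : ℕ) (ξ : E × (V × V)) (c : ℂ) {f : E × (V × V) → ℂ} (hf : ContDiff ℝ ∞ f) :
    nabF k ξ (c • f) = c • nabF k ξ f := by
  ext x
  have h1 : DifferentiableAt ℝ f x := (hf.differentiable (by simp)).differentiableAt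
  simp only [nabF, fderiv_const_smul h1, smul_apply, Pi.smul_apply, smul_eq_mul]
  ring

lemma nabF_dir_add (k : ℕ) (ξ ζ : E × (V × V)) (f : E × (V × V) → ℂ) :
    nabF k (ξ + ζ) f = nabF k ξ f + nabF k ζ f := by
  ext x
  simp only [nabF, map_add, Prod.snd_add, omega_add_right, Pi.add_apply]
  push_cast
  ring

lemma nabF_dir_smul (k : ℕ) (c : ℝ) (ξ : E × (V × V)) (f : E × (V × V) → ℂ) :
    nabF k (c • ξ) f = (c : ℂ) • nabF k ξ f := by
  ext x
  simp only [nabF, map_smul, Prod.smul_snd, omega_smul_right, Pi.smul_apply, Complex.real_smul,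
    smul_eq_mul]
  push_cast
  ring

lemma fderiv_eq_nabF (k : ℕ) (ξ : E × (V × V)) (f : E × (V × V) → ℂ) (x : E × (V × V)) :
    fderiv ℝ f x ξ = nabF k ξ f x + Complex.I / 2 * (omega k x.2 ξ.2 : ℂ) * f x := by
  simp [nabF]

lemma hasFDerivAt_multiplier (k : ℕ) (l : V × V) (x : E × (V × V)) :
    HasFDerivAt (fun y : E × (V × V) => multiplier k l y.2)
      (multiplier k l x.2 • ((-(Complex.I / 2)) • (Complex.ofRealCLM.comp ((omegaL k l).comp
        (ContinuousLinearMap.snd ℝ E (V × V)))))) x := by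
  unfold multiplier
  have := (((hasFDerivAt_omega (E := E) k l x).const_mul (-(Complex.I / 2))).cexp).const_mul
    (Complex.exp (Real.pi * Complex.I * ((k * ⟪l.1, l.2⟫_ℝ : ℝ) : ℂ)))
  refine this.congr_fderiv ?_
  rw [smul_smul]

/-- Covariant derivatives commute with the magnetic translations defining the line bundle. -/
lemma nabF_quasiperiodic (k : ℕ) (ξ : E × (V × V)) {f : E × (V × V) → ℂ} (hf : ContDiff ℝ ∞ f)
    {l : V × V} (hl : ∀ p A, f (p, A + l) = multiplier k l A * f (p, A)) (p : E) (A : V × V) :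
    nabF k ξ f (p, A + l) = multiplier k l A * nabF k ξ f (p, A) := by
  have h1 : HasFDerivAt f (fderiv ℝ f (p, A)) (p, A) :=
    (hf.differentiable (by simp)).differentiableAt.hasFDerivAt
  have h2 := (hasFDerivAt_multiplier (E := E) k l (p, A)).mul h1
  have h3 : (fun y : E × (V × V) => f (y + (0, l))) =
      fun y => multiplier k l y.2 * f y := by
    ext ⟨q, B⟩
    simp [hl]
  have h4 : fderiv ℝ f ((p, A) + (0, l)) = _ :=
    (fderiv_comp_add_right (f := f) (x := (p, A)) ((0 : E), l)).symm.trans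
      ((congrArg (fun g => fderiv ℝ g (p, A)) h3).trans h2.fderiv)
  have h5 : ((p, A) : E × (V × V)) + (0, l) = (p, A + l) := by simp
  rw [h5] at h4
  -- The derivative of the multiplier contributes `-(i/2) ω(ξ, l)` and the shifted connection form
  -- `-(i/2) ω(l, ξ)`; they cancel by antisymmetry.
  simp only [nabF, h4, hl, omega_add_left]
  simp only [add_apply, smul_apply, ContinuousLinearMap.coe_comp,
    Function.comp_apply, Complex.ofRealCLM_apply, omegaL_apply, smul_eq_mul,
    ContinuousLinearMap.coe_snd']
  rw [omega_swap k l ξ.2]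
  push_cast
  ring

/-- The submodule of smooth families, parametrized by `E`, of sections of the level `k` line bundle
over the quotient of `V × V` by `Λ × Λ`. -/
def famSubmodule (E : Type*) [NormedAddCommGroup E] [NormedSpace ℝ E] (k : ℕ) (Λ : Submodule ℤ V) :
    Submodule ℂ (E × (V × V) → ℂ) where
  carrier := {f | ContDiff ℝ ∞ f ∧ ∀ l₁ ∈ Λ, ∀ l₂ ∈ Λ, ∀ p A,
    f (p, A + (l₁, l₂)) = multiplier k (l₁, l₂) A * f (p, A)}
  add_mem' := by
    rintro f g ⟨h1, h2⟩ ⟨h1', h2'⟩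
    refine ⟨h1.add h1', fun l₁ hl₁ l₂ hl₂ p A => ?_⟩
    simp only [Pi.add_apply, h2 l₁ hl₁ l₂ hl₂ p A, h2' l₁ hl₁ l₂ hl₂ p A, mul_add]
  zero_mem' := ⟨contDiff_const, fun _ _ _ _ _ => by simp⟩
  smul_mem' := by
    rintro c f ⟨h1, h2⟩
    refine ⟨contDiff_const.smul h1, fun l₁ hl₁ l₂ hl₂ p A => ?_⟩
    simp only [Pi.smul_apply, smul_eq_mul, h2 l₁ hl₁ l₂ hl₂ p A]
    ring

/-- Smooth families, parametrized by `E`, of sections of the level `k` line bundle over the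
quotient of `V × V` by `Λ × Λ`. -/
def Fam (E : Type*) [NormedAddCommGroup E] [NormedSpace ℝ E] (k : ℕ) (Λ : Submodule ℤ V) :
    Type _ :=
  famSubmodule E k Λ

variable {k : ℕ} {Λ : Submodule ℤ V}

instance : AddCommGroup (Fam E k Λ) := inferInstanceAs (AddCommGroup (famSubmodule E k Λ))

instance : Module ℂ (Fam E k Λ) := inferInstanceAs (Module ℂ (famSubmodule E k Λ))

namespace Fam

lemma contDiff (f : Fam E k Λ) : ContDiff ℝ ∞ f.1 := f.2.1

lemma differentiableAt (f : Fam E k Λ) (x : E × (V × V)) : DifferentiableAt ℝ f.1 x :=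
  (f.contDiff.differentiable (by simp)).differentiableAt

lemma apply_add (f : Fam E k Λ) {l₁ l₂ : V} (h₁ : l₁ ∈ Λ) (h₂ : l₂ ∈ Λ) (p : E) (A : V × V) :
    f.1 (p, A + (l₁, l₂)) = multiplier k (l₁, l₂) A * f.1 (p, A) := f.2.2 l₁ h₁ l₂ h₂ p A

@[ext]
lemma ext {f g : Fam E k Λ} (h : ∀ x, f.1 x = g.1 x) : f = g := Subtype.ext (funext h)

@[simp]
lemma zero_val (x : E × (V × V)) : (0 : Fam E k Λ).1 x = 0 := rfl

@[simp]
lemma add_val (f g : Fam E k Λ) (x : E × (V × V)) : (f + g).1 x = f.1 x + g.1 x := rfl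

@[simp]
lemma sub_val (f g : Fam E k Λ) (x : E × (V × V)) : (f - g).1 x = f.1 x - g.1 x := rfl

@[simp]
lemma neg_val (f : Fam E k Λ) (x : E × (V × V)) : (-f).1 x = -f.1 x := rfl

@[simp]
lemma smul_val (c : ℂ) (f : Fam E k Λ) (x : E × (V × V)) : (c • f).1 x = c * f.1 x := rfl

/-- Evaluation at a point. -/
def evalL (x : E × (V × V)) : Fam E k Λ →ₗ[ℂ] ℂ where
  toFun f := f.1 x
  map_add' _ _ := rfl
  map_smul' _ _ := rfl

@[simp]
lemma sum_val {κ : Type*} (s : Finset κ) (f : κ → Fam E k Λ) (x : E × (V × V)) :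
    (∑ i ∈ s, f i).1 x = ∑ i ∈ s, (f i).1 x := map_sum (evalL x) f s

end Fam

/-- The covariant derivative as an operator on families of sections. -/
def nab (ξ : E × (V × V)) : Module.End ℂ (Fam E k Λ) where
  toFun f := ⟨nabF k ξ f.1, contDiff_nabF k ξ f.contDiff, fun _ hl₁ _ hl₂ p A =>
    nabF_quasiperiodic k ξ f.contDiff (fun q B => f.apply_add hl₁ hl₂ q B) p A⟩
  map_add' f g := Subtype.ext (nabF_add k ξ f.contDiff g.contDiff :)
  map_smul' c f := Subtype.ext (nabF_smul k ξ c f.contDiff)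

lemma nab_coe (ξ : E × (V × V)) (f : Fam E k Λ) : (nab ξ f).1 = nabF k ξ f.1 := rfl

lemma nab_add (ξ ζ : E × (V × V)) : (nab (ξ + ζ) : Module.End ℂ (Fam E k Λ)) = nab ξ + nab ζ :=
  LinearMap.ext fun f => Subtype.ext (nabF_dir_add k ξ ζ f.1)

lemma nab_smul (c : ℝ) (ξ : E × (V × V)) :
    (nab (c • ξ) : Module.End ℂ (Fam E k Λ)) = (c : ℂ) • nab ξ :=
  LinearMap.ext fun f => Subtype.ext (nabF_dir_smul k c ξ f.1)

lemma nab_mul_nab (ξ ζ : E × (V × V)) : (nab ξ * nab ζ : Module.End ℂ (Fam E k Λ)) =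
    nab ζ * nab ξ - (Complex.I * omega k ξ.2 ζ.2) • 1 := by
  ext f x
  exact nabF_comm k ξ ζ f.contDiff x

/-- The connection is trivial in the parameter directions. -/
lemma nab_param_apply (x : E) (f : Fam E k Λ) (q : E × (V × V)) :
    (nab (x, 0) f).1 q = fderiv ℝ f.1 q (x, 0) := by
  simp [nab_coe, nabF, omega]

/-! ### Coefficients depending on the parameters -/

/-- The subalgebra of smooth functions on the parameter space. -/
def smoothSubalgebra (E : Type*) [NormedAddCommGroup E] [NormedSpace ℝ E] :
    Subalgebra ℂ (E → ℂ) where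
  carrier := {m | ContDiff ℝ ∞ m}
  mul_mem' h1 h2 := ContDiff.mul (Set.mem_ofPred.1 h1) (Set.mem_ofPred.1 h2)
  add_mem' h1 h2 := ContDiff.add (Set.mem_ofPred.1 h1) (Set.mem_ofPred.1 h2)
  algebraMap_mem' c := (contDiff_const : ContDiff ℝ ∞ fun _ : E => c)

/-- The algebra of smooth functions on the parameter space. -/
def SmoothFns (E : Type*) [NormedAddCommGroup E] [NormedSpace ℝ E] : Type _ :=
  smoothSubalgebra E

instance : CommRing (SmoothFns E) := inferInstanceAs (CommRing (smoothSubalgebra E))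

instance : Algebra ℂ (SmoothFns E) := inferInstanceAs (Algebra ℂ (smoothSubalgebra E))

namespace SmoothFns

@[ext]
lemma ext {m m' : SmoothFns E} (h : ∀ p, m.1 p = m'.1 p) : m = m' := Subtype.ext (funext h)

@[simp] lemma zero_val (p : E) : (0 : SmoothFns E).1 p = 0 := rfl

@[simp] lemma one_val (p : E) : (1 : SmoothFns E).1 p = 1 := rfl

@[simp] lemma add_val (m m' : SmoothFns E) (p : E) : (m + m').1 p = m.1 p + m'.1 p := rfl

@[simp] lemma sub_val (m m' : SmoothFns E) (p : E) : (m - m').1 p = m.1 p - m'.1 p := rfl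

@[simp] lemma neg_val (m : SmoothFns E) (p : E) : (-m).1 p = -m.1 p := rfl

@[simp] lemma mul_val (m m' : SmoothFns E) (p : E) : (m * m').1 p = m.1 p * m'.1 p := rfl

@[simp] lemma smul_val (c : ℂ) (m : SmoothFns E) (p : E) : (c • m).1 p = c * m.1 p := rfl

@[simp] lemma algebraMap_val (c : ℂ) (p : E) : (algebraMap ℂ (SmoothFns E) c).1 p = c := rfl

end SmoothFns

lemma SmoothFns.contDiff (m : SmoothFns E) : ContDiff ℝ ∞ m.1 := m.2

lemma SmoothFns.differentiableAt (m : SmoothFns E) (p : E) : DifferentiableAt ℝ m.1 p :=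
  (m.contDiff.differentiable (by simp)).differentiableAt

/-- Multiplication of families of sections by a function of the parameters. -/
def mulLin (m : SmoothFns E) : Module.End ℂ (Fam E k Λ) where
  toFun f := ⟨fun x => m.1 x.1 * f.1 x, (m.contDiff.comp contDiff_fst).mul f.contDiff,
    fun l₁ hl₁ l₂ hl₂ p A => by
      simp only [f.apply_add hl₁ hl₂ p A]
      ring⟩
  map_add' f g := Fam.ext fun x => mul_add _ _ _
  map_smul' c f := Fam.ext fun x => mul_left_comm _ _ _

/-- Multiplication of families of sections by functions of the parameters. -/
def mulOp : SmoothFns E →ₐ[ℂ] Module.End ℂ (Fam E k Λ) where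
  toFun := mulLin
  map_one' := LinearMap.ext fun _ => Fam.ext fun _ => one_mul _
  map_mul' _ _ := LinearMap.ext fun _ => Fam.ext fun _ => mul_assoc _ _ _
  map_zero' := LinearMap.ext fun _ => Fam.ext fun _ => zero_mul _
  map_add' _ _ := LinearMap.ext fun _ => Fam.ext fun _ => add_mul _ _ _
  commutes' _ := LinearMap.ext fun _ => Fam.ext fun _ => rfl

lemma mulOp_apply (m : SmoothFns E) (f : Fam E k Λ) (x : E × (V × V)) :
    (mulOp m f).1 x = m.1 x.1 * f.1 x := rfl

/-- The derivative of a function of the parameters in a constant direction. -/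
def paramDeriv (x : E) (m : SmoothFns E) : SmoothFns E :=
  ⟨fun p => fderiv ℝ m.1 p x, (m.contDiff.fderiv_right (m := ∞) (by simp)).clm_apply
    contDiff_const⟩

lemma nab_mul_mulOp (ξ : E × (V × V)) (m : SmoothFns E) :
    (nab ξ * mulOp m : Module.End ℂ (Fam E k Λ)) =
      mulOp m * nab ξ + mulOp (paramDeriv ξ.1 m) := by
  ext f x
  have h1 : HasFDerivAt (fun y : E × (V × V) => m.1 y.1)
      ((fderiv ℝ m.1 x.1).comp (ContinuousLinearMap.fst ℝ E (V × V))) x :=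
    HasFDerivAt.comp x (m.differentiableAt x.1).hasFDerivAt hasFDerivAt_fst
  have h2 := (h1.mul (f.differentiableAt x).hasFDerivAt).fderiv
  have h3 : fderiv ℝ (mulOp m f).1 x = _ := h2
  simp only [Module.End.mul_apply, nab_coe, LinearMap.add_apply, Fam.add_val, mulOp_apply, nabF,
    h3]
  simp only [paramDeriv, add_apply, smul_apply,
    ContinuousLinearMap.coe_comp, Function.comp_apply, smul_eq_mul, ContinuousLinearMap.coe_fst']
  ring

lemma nab_zero_commute_mulOp (X : V × V) (m : SmoothFns E) :
    (nab (0, X) * mulOp m : Module.End ℂ (Fam E k Λ)) = mulOp m * nab (0, X) := by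
  rw [nab_mul_mulOp]
  have : paramDeriv (0 : E) m = 0 := by
    ext p
    simp [paramDeriv]
  simp [this]

/-! ### Smoothness of sums of series -/

/-- Bootstrap on the order of differentiability: a partial derivative of `Φ j` is another member of
the family plus a smooth multiple of `Φ j`. -/
lemma contDiff_of_nabF_closed [FiniteDimensional ℝ E] [FiniteDimensional ℝ V] {J : Type*}
    (Φ : J → E × (V × V) → ℂ) (D : E × (V × V) → J → J)
    (hd : ∀ j, Differentiable ℝ (Φ j)) (hD : ∀ ξ j, nabF k ξ (Φ j) = Φ (D ξ j)) (j : J) :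
    ContDiff ℝ ∞ (Φ j) := by
  rw [contDiff_infty]
  intro n
  induction n generalizing j with
  | zero => exact contDiff_zero.2 (hd j).continuous
  | succ n ih =>
    rw [Nat.cast_succ, contDiff_succ_iff_fderiv_apply]
    refine ⟨hd j, fun h => by simp at h, fun ξ => ?_⟩
    have : (fun x => fderiv ℝ (Φ j) x ξ) = fun x => Φ (D ξ j) x +
        Complex.I / 2 * (omega k x.2 ξ.2 : ℂ) * Φ j x := by
      ext x
      rw [fderiv_eq_nabF k, hD]
    rw [this]
    exact (ih _).add ((contDiff_const.mul ((contDiff_omega k ξ.2).of_le (by exact_mod_cast le_top))).mul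
      (ih j))

lemma hasFDerivAt_tsum_ball {X κ : Type*} [NormedAddCommGroup X] [NormedSpace ℝ X]
    (f : κ → X → ℂ) (hd : ∀ m, Differentiable ℝ (f m)) {u : κ → ℝ} (hu : Summable u) {R : ℝ}
    (hb : ∀ m y, y ∈ Metric.ball (0 : X) R → ‖fderiv ℝ (f m) y‖ ≤ u m)
    (x : X) (hx : x ∈ Metric.ball (0 : X) R) (hs : Summable fun m => f m x) :
    HasFDerivAt (fun y => ∑' m, f m y) (∑' m, fderiv ℝ (f m) x) x ∧
      Summable fun m => fderiv ℝ (f m) x := by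
  have h1 : IsPreconnected (Metric.ball (0 : X) R) := (convex_ball _ _).isPreconnected
  have h2 : IsOpen (Metric.ball (0 : X) R) := Metric.isOpen_ball
  have h3 : ∀ m y, y ∈ Metric.ball (0 : X) R → HasFDerivAt (f m) (fderiv ℝ (f m) y) y :=
    fun m y _ => (hd m y).hasFDerivAt
  exact ⟨hasFDerivAt_tsum_of_isPreconnected hu h2 h1 h3 hb hx hs hx,
    .of_norm_bounded hu fun m => hb m x hx⟩

/-- Termwise covariant differentiation of a series whose terms belong to families stable under
covariant differentiation and satisfying locally uniform bounds. -/
lemma tsum_nabF_closed [FiniteDimensional ℝ E] [FiniteDimensional ℝ V] {J κ : Type*}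
    (Φ : J → κ → E × (V × V) → ℂ) (D : E × (V × V) → J → J)
    (hd : ∀ j m, Differentiable ℝ (Φ j m))
    (hD : ∀ ξ j m, nabF k ξ (Φ j m) = Φ (D ξ j) m)
    (hb : ∀ j (R : ℝ), ∃ u : κ → ℝ, Summable u ∧ ∀ m x, ‖x‖ < R → ‖Φ j m x‖ ≤ u m) (j : J) :
    ContDiff ℝ ∞ (fun x => ∑' m, Φ j m x) ∧
      ∀ ξ, nabF k ξ (fun x => ∑' m, Φ j m x) = fun x => ∑' m, Φ (D ξ j) m x := by
  have hsum : ∀ j x, Summable fun m => Φ j m x := fun j x => by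
    obtain ⟨u, hu, hle⟩ := hb j (‖x‖ + 1)
    exact .of_norm_bounded hu fun m => hle m x (by linarith)
  have key : ∀ j x, HasFDerivAt (fun x => ∑' m, Φ j m x) (∑' m, fderiv ℝ (Φ j m) x) x ∧
      Summable fun m => fderiv ℝ (Φ j m) x := by
    intro j x
    -- In finite dimension a bound on the derivatives in the basis directions bounds the operator
    -- norm. By `hD` such a derivative is again a term of the system plus the connection form times
    -- a term, and `hb` applies to both.
    set v := Module.finBasis ℝ (E × (V × V))
    obtain ⟨C, hC, hop⟩ := v.exists_opNorm_le (F := ℂ)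
    obtain ⟨u, hu, hle⟩ := hb j (‖x‖ + 1)
    choose w hw hwle using fun i => hb (D (v i) j) (‖x‖ + 1)
    set c : ℝ := ∑ i, ‖omegaL k (v i).2‖ * (‖x‖ + 1) with hc
    have hc0 : 0 ≤ c := Finset.sum_nonneg fun i _ => by positivity
    set U : κ → ℝ := fun m => C * (∑ i, |w i m| + c * |u m|) with hU
    have hUs : Summable U := by
      refine Summable.mul_left _ (Summable.add ?_ ?_)
      · exact summable_sum fun i _ => (hw i).abs
      · exact hu.abs.mul_left _
    have hbound : ∀ m y, y ∈ Metric.ball (0 : E × (V × V)) (‖x‖ + 1) →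
        ‖fderiv ℝ (Φ j m) y‖ ≤ U m := by
      intro m y hy
      rw [mem_ball_zero_iff] at hy
      refine hop (by positivity) fun i => ?_
      rw [fderiv_eq_nabF k, hD]
      refine (norm_add_le _ _).trans (add_le_add ?_ ?_)
      · exact ((hwle i m y hy).trans (le_abs_self _)).trans
          (Finset.single_le_sum (f := fun i => |w i m|) (fun i _ => abs_nonneg _)
            (Finset.mem_univ i))
      · rw [norm_mul, norm_mul]
        refine mul_le_mul ?_ ((hle m y hy).trans (le_abs_self _)) (norm_nonneg _) hc0
        have h1 : ‖(omega k y.2 (v i).2 : ℂ)‖ ≤ ‖omegaL k (v i).2‖ * (‖x‖ + 1) := by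
          rw [← omegaL_apply, Complex.norm_real]
          refine ((omegaL k (v i).2).le_opNorm _).trans ?_
          gcongr
          exact (norm_snd_le y).trans hy.le
        have h2 : ‖Complex.I / 2‖ ≤ 1 := by
          rw [norm_div, Complex.norm_I]
          norm_num
        have h3 : ‖omegaL k (v i).2‖ * (‖x‖ + 1) ≤ c :=
          Finset.single_le_sum (f := fun i => ‖omegaL k (v i).2‖ * (‖x‖ + 1))
            (fun i _ => by positivity) (Finset.mem_univ i)
        calc _ ≤ 1 * c := mul_le_mul h2 (h1.trans h3) (norm_nonneg _) zero_le_one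
          _ = c := one_mul c
    have hx : x ∈ Metric.ball (0 : E × (V × V)) (‖x‖ + 1) := by simp
    clear_value U
    exact hasFDerivAt_tsum_ball (Φ j) (hd j) hUs hbound x hx (hsum j x)
  have hnab : ∀ ξ j, nabF k ξ (fun x => ∑' m, Φ j m x) = fun x => ∑' m, Φ (D ξ j) m x := by
    intro ξ j
    ext x
    obtain ⟨h1, h2⟩ := key j x
    have h3 : (∑' m, fderiv ℝ (Φ j m) x) ξ = ∑' m, fderiv ℝ (Φ j m) x ξ :=
      (ContinuousLinearMap.apply ℝ ℂ ξ).map_tsum h2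
    rw [nabF, h1.fderiv, h3, ← tsum_mul_left, ← Summable.tsum_sub]
    · refine tsum_congr fun m => ?_
      rw [← hD]
      rfl
    · exact h2.map (ContinuousLinearMap.apply ℝ ℂ ξ) (ContinuousLinearMap.apply ℝ ℂ ξ).continuous
    · exact (hsum j x).mul_left _
  exact ⟨contDiff_of_nabF_closed (k := k) (fun j x => ∑' m, Φ j m x) D
    (fun j x => (key j x).1.differentiableAt) hnab j, fun ξ => hnab ξ j⟩

end Families

/-! ### Quadratic expressions in a Heisenberg algebra -/

section Heisenberg

variable {R ι : Type*} [Ring R] [Algebra ℂ R] [Fintype ι] [DecidableEq ι] {U W : ι → R} {c : ℂ}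

/-- Different indices commute, and for a single canonical pair, moving `W²` past `U²` costs `-2c (UW
+ WU)`. With `heisenberg_mixed_sq` this makes the three quadratic sums a copy of `sl₂`. -/
lemma heisenberg_sq_sq (hUW : ∀ i j, U i * W j = W j * U i + (if i = j then c else 0) • (1 : R)) :
    (∑ i, W i * W i) * (∑ i, U i * U i) = (∑ i, U i * U i) * (∑ i, W i * W i)
      + (-2 * c) • ∑ i, (U i * W i + W i * U i) := by
  have key : ∀ i j, W i * W i * (U j * U j) = U j * U j * (W i * W i) +
      if j = i then (-2 * c) • (U j * W j + W j * U j) else 0 := by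
    intro i j
    by_cases h : j = i
    · subst h
      have h1 := hUW j j
      simp only [if_true] at h1 ⊢
      have h2 : W j * U j = U j * W j - c • 1 := by rw [h1]; abel
      have h3 : W j * W j * (U j * U j) = W j * (W j * U j) * U j := by noncomm_ring
      have h4 : W j * (U j * W j - c • 1) * U j = (W j * U j) * (W j * U j) - c • (W j * U j) := by
        simp only [mul_sub, sub_mul, mul_smul_comm, smul_mul_assoc, mul_one]
        noncomm_ring
      have h5 : U j * W j * (U j * W j) = U j * (W j * U j) * W j := by noncomm_ring
      have h6 : U j * (U j * W j - c • 1) * W j = U j * U j * (W j * W j) - c • (U j * W j) := by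
        simp only [mul_sub, sub_mul, mul_smul_comm, smul_mul_assoc, mul_one]
        noncomm_ring
      rw [h3, h2, h4, h2]
      simp only [mul_sub, sub_mul, mul_smul_comm, smul_mul_assoc, mul_one, one_mul, h5]
      rw [h2, h6]
      module
    · have h1 := hUW j i
      simp only [h, if_false, zero_smul, add_zero] at h1 ⊢
      rw [mul_assoc, ← mul_assoc (W i) (U j), ← h1, mul_assoc (U j), ← h1, ← mul_assoc, ← mul_assoc,
        ← h1, mul_assoc, mul_assoc, mul_assoc, ← mul_assoc (W i) (U j), ← h1]
      simp only [mul_assoc]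
  rw [Finset.sum_mul_sum, Finset.sum_mul_sum, Finset.sum_comm (γ := ι) (f := fun i j =>
    U i * U i * (W j * W j))]
  simp only [key]
  simp only [Finset.smul_sum, ← Finset.sum_add_distrib]
  refine Finset.sum_congr rfl fun i _ => ?_
  simp [Finset.sum_add_distrib]

/-- With `Q = ∑ W_j²` one has `[U_i, Q] = 2c W_i` and `[W_i, Q] = 0`, so each summand on the left
contributes `4c W_i²`. -/
lemma heisenberg_mixed_sq (hWW : ∀ i j, W i * W j = W j * W i)
    (hUW : ∀ i j, U i * W j = W j * U i + (if i = j then c else 0) • (1 : R)) :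
    (∑ i, (U i * W i + W i * U i)) * (∑ i, W i * W i) =
      (∑ i, W i * W i) * (∑ i, (U i * W i + W i * U i)) + (4 * c) • ∑ i, W i * W i := by
  have hU : ∀ i, U i * (∑ j, W j * W j) = (∑ j, W j * W j) * U i + (2 * c) • W i := by
    intro i
    have : ∀ j, U i * (W j * W j) = W j * W j * U i + if i = j then (2 * c) • W i else 0 := by
      intro j
      have h1 := hUW i j
      by_cases h : i = j
      · subst h
        simp only [if_true] at h1 ⊢
        rw [← mul_assoc, h1, add_mul, mul_assoc, h1]
        simp only [mul_add, smul_mul_assoc, one_mul, mul_smul_comm, mul_one, mul_assoc]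
        module
      · simp only [h, if_false, zero_smul, add_zero] at h1 ⊢
        rw [← mul_assoc, h1, mul_assoc, h1, mul_assoc]
    simp only [Finset.mul_sum, Finset.sum_mul, this, Finset.sum_add_distrib, Finset.sum_ite_eq,
      Finset.mem_univ, if_true]
  have hW : ∀ i, W i * (∑ j, W j * W j) = (∑ j, W j * W j) * W i := by
    intro i
    simp only [Finset.mul_sum, Finset.sum_mul]
    refine Finset.sum_congr rfl fun j _ => ?_
    rw [← mul_assoc, hWW i j, mul_assoc, hWW i j, mul_assoc]
  set Q := ∑ j, W j * W j with hQ
  rw [Finset.sum_mul, Finset.mul_sum]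
  have : ∀ i, (U i * W i + W i * U i) * Q = Q * (U i * W i + W i * U i) + (4 * c) • (W i * W i) := by
    intro i
    rw [add_mul, mul_assoc, hW, ← mul_assoc, hU, mul_assoc (W i), hU, mul_add, ← mul_assoc, hW]
    simp only [add_mul, mul_add, smul_mul_assoc, mul_smul_comm, mul_assoc]
    module
  clear_value Q
  rw [hQ] at this ⊢
  rw [Finset.smul_sum, ← Finset.sum_add_distrib]
  exact Finset.sum_congr rfl fun i _ => this i

end Heisenberg

/-! ### Independence of the basis -/

section Basis

variable {V : Type*} [NormedAddCommGroup V] [InnerProductSpace ℝ V] {n : ℕ}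

/-- If `N` is the matrix of `b` in the basis `e`, the Gram matrix is `Nᵀ N`, hence `N C Nᵀ = 1`.
This frees the Laplace operators from the chosen basis. -/
lemma sum_gramInv_smul {R : Type*} [AddCommGroup R] [Module ℝ R]
    (b : Module.Basis (Fin n) ℝ V) (e : OrthonormalBasis (Fin n) ℝ V)
    (B : V →ₗ[ℝ] V →ₗ[ℝ] R) :
    ∑ p, ∑ q, gramInv b p q • B (b p) (b q) = ∑ i, B (e i) (e i) := by
  set N : Matrix (Fin n) (Fin n) ℝ := e.toBasis.toMatrix b with hN
  have hNe : ∀ i p, N i p = ⟪e i, b p⟫_ℝ := by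
    intro i p
    rw [hN, Module.Basis.toMatrix_apply, OrthonormalBasis.coe_toBasis_repr_apply,
      OrthonormalBasis.repr_apply_apply]
  have hb : ∀ p, b p = ∑ i, N i p • e i := by
    intro p
    simp only [hNe]
    exact (e.sum_repr' (b p)).symm
  have hgram : (Matrix.of fun p q => ⟪b p, b q⟫_ℝ) = N.transpose * N := by
    ext p q
    rw [Matrix.of_apply, Matrix.mul_apply, ← e.sum_inner_mul_inner (b p) (b q)]
    refine Finset.sum_congr rfl fun i _ => ?_
    rw [Matrix.transpose_apply, hNe, hNe, real_inner_comm]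
  have hu : IsUnit N := by
    have := e.toBasis.invertibleToMatrix b
    exact isUnit_of_invertible N
  have hdet : IsUnit N.det := (Matrix.isUnit_iff_isUnit_det N).1 hu
  have hone : N * gramInv b * N.transpose = 1 := by
    have hT : IsUnit N.transpose.det := by rwa [Matrix.det_transpose]
    rw [gramInv, hgram, Matrix.mul_inv_rev, ← mul_assoc, Matrix.mul_nonsing_inv _ hdet, one_mul,
      Matrix.nonsing_inv_mul _ hT]
  have hexp : ∀ p q, gramInv b p q • B (b p) (b q) =
      ∑ i, ∑ j, (N i p * gramInv b p q * N j q) • B (e i) (e j) := by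
    intro p q
    rw [hb p, hb q]
    simp only [map_sum, map_smul, LinearMap.sum_apply, LinearMap.smul_apply, Finset.smul_sum,
      smul_smul]
    rw [Finset.sum_comm]
    refine Finset.sum_congr rfl fun i _ => Finset.sum_congr rfl fun j _ => ?_
    congr 1
    ring
  simp only [hexp]
  have hij : ∀ i j, ∑ p, ∑ q, (N i p * gramInv b p q * N j q) = if i = j then (1 : ℝ) else 0 := by
    intro i j
    have := congrFun (congrFun hone i) j
    rw [Matrix.one_apply, Matrix.mul_apply] at this
    rw [← this, Finset.sum_comm]
    refine Finset.sum_congr rfl fun q _ => ?_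
    rw [Matrix.mul_apply, Finset.sum_mul]
    rfl
  calc _ = ∑ i, ∑ j, (∑ p, ∑ q, (N i p * gramInv b p q * N j q)) • B (e i) (e j) := by
        simp only [Finset.sum_smul]
        calc _ = ∑ p, ∑ i, ∑ q, ∑ j, (N i p * gramInv b p q * N j q) • B (e i) (e j) :=
              Finset.sum_congr rfl fun p _ => Finset.sum_comm
          _ = ∑ i, ∑ p, ∑ q, ∑ j, (N i p * gramInv b p q * N j q) • B (e i) (e j) :=
              Finset.sum_comm
          _ = ∑ i, ∑ p, ∑ j, ∑ q, (N i p * gramInv b p q * N j q) • B (e i) (e j) :=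
              Finset.sum_congr rfl fun i _ => Finset.sum_congr rfl fun p _ => Finset.sum_comm
          _ = _ := Finset.sum_congr rfl fun i _ => Finset.sum_comm
    _ = _ := by simp [hij]

/-- Serves to show that the quadratic operators are invariant under isometries, which carry one
orthonormal basis to another. -/
lemma sum_orthonormal_eq {R : Type*} [AddCommGroup R] [Module ℝ R]
    (e e' : OrthonormalBasis (Fin n) ℝ V) (B : V →ₗ[ℝ] V →ₗ[ℝ] R) :
    ∑ i, B (e' i) (e' i) = ∑ i, B (e i) (e i) := by
  rw [← sum_gramInv_smul e'.toBasis e B]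
  have : gramInv e'.toBasis = 1 := by
    rw [gramInv]
    have : (Matrix.of fun p q => ⟪e'.toBasis p, e'.toBasis q⟫_ℝ) = 1 := by
      ext p q
      simp [Matrix.one_apply, orthonormal_iff_ite.1 e'.orthonormal]
    rw [this, inv_one]
  simp [this, Matrix.one_apply]

end Basis

/-! ### Quadratic Hamiltonians -/

section Hamiltonians

variable {V : Type*} [NormedAddCommGroup V] [InnerProductSpace ℝ V]
  {E : Type*} [NormedAddCommGroup E] [NormedSpace ℝ E] {k n : ℕ} {Λ : Submodule ℤ V}

/-- The covariant derivative in a direction of the first factor. -/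
def opU (x : V) : Module.End ℂ (Fam E k Λ) := nab (0, (x, 0))

/-- The covariant derivative in a direction of the second factor. -/
def opV (x : V) : Module.End ℂ (Fam E k Λ) := nab (0, (0, x))

/-- `opU` as a real linear map. -/
def opUL : V →ₗ[ℝ] Module.End ℂ (Fam E k Λ) where
  toFun := opU
  map_add' x y := by
    rw [opU, opU, opU, ← nab_add]
    simp
  map_smul' c x := by
    have : ((0 : E), (c • x, (0 : V))) = c • ((0 : E), (x, (0 : V))) := by simp
    rw [opU, this, nab_smul]
    rfl

/-- `opV` as a real linear map. -/
def opVL : V →ₗ[ℝ] Module.End ℂ (Fam E k Λ) where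
  toFun := opV
  map_add' x y := by
    rw [opV, opV, opV, ← nab_add]
    simp
  map_smul' c x := by
    have : ((0 : E), ((0 : V), c • x)) = c • ((0 : E), ((0 : V), x)) := by simp
    rw [opV, this, nab_smul]
    rfl

/-- The structure constant `-2πik` of the Heisenberg algebra. -/
def kap (k : ℕ) : ℂ := -(Complex.I * (2 * Real.pi * k))

lemma opU_mul_opU (x y : V) : (opU x * opU y : Module.End ℂ (Fam E k Λ)) = opU y * opU x := by
  rw [opU, opU, nab_mul_nab]
  simp [omega]

lemma opV_mul_opV (x y : V) : (opV x * opV y : Module.End ℂ (Fam E k Λ)) = opV y * opV x := by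
  rw [opV, opV, nab_mul_nab]
  simp [omega]

lemma opU_mul_opV (x y : V) : (opU x * opV y : Module.End ℂ (Fam E k Λ)) =
    opV y * opU x + (kap k * ⟪x, y⟫_ℝ) • 1 := by
  rw [opU, opV, nab_mul_nab]
  simp only [omega, inner_zero_left, mul_zero, sub_zero, kap]
  rw [sub_eq_add_neg, ← neg_smul]
  congr 2
  push_cast
  ring

variable (e : OrthonormalBasis (Fin n) ℝ V)

lemma opU_mul_opV_basis (i j : Fin n) : (opU (e i) * opV (e j) : Module.End ℂ (Fam E k Λ)) =
    opV (e j) * opU (e i) + (if i = j then kap k else 0) • 1 := by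
  rw [opU_mul_opV, orthonormal_iff_ite.1 e.orthonormal]
  by_cases h : i = j <;> simp [h]

/-- The operator `∑ ∇_{u_i}²`. -/
def Lu : Module.End ℂ (Fam E k Λ) := ∑ i, opU (e i) * opU (e i)

/-- The operator `∑ ∇_{v_i}²`. -/
def Lv : Module.End ℂ (Fam E k Λ) := ∑ i, opV (e i) * opV (e i)

/-- The operator `∑ (∇_{u_i} ∇_{v_i} + ∇_{v_i} ∇_{u_i})`. -/
def Luv : Module.End ℂ (Fam E k Λ) := ∑ i, (opU (e i) * opV (e i) + opV (e i) * opU (e i))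

lemma Lv_mul_Lu : (Lv e * Lu e : Module.End ℂ (Fam E k Λ)) =
    Lu e * Lv e + (-2 * kap k) • Luv e :=
  heisenberg_sq_sq (opU_mul_opV_basis e)

lemma Luv_mul_Lv : (Luv e * Lv e : Module.End ℂ (Fam E k Λ)) =
    Lv e * Luv e + (4 * kap k) • Lv e :=
  heisenberg_mixed_sq (fun _ _ => opV_mul_opV _ _) (opU_mul_opV_basis e)

/-- Exchanging the roles of the two factors in `Luv_mul_Lv` replaces `kap k` by its negative. -/
lemma Luv_mul_Lu : (Luv e * Lu e : Module.End ℂ (Fam E k Λ)) =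
    Lu e * Luv e + (-4 * kap k) • Lu e := by
  have := heisenberg_mixed_sq (R := Module.End ℂ (Fam E k Λ)) (U := fun i => opV (e i))
    (W := fun i => opU (e i)) (c := -kap k)
    (fun _ _ => opU_mul_opU _ _) (fun i j => by
      rw [opU_mul_opV_basis e j i]
      by_cases h : i = j
      · simp [h]
      · simp [h, Ne.symm h])
  have h2 : ∑ i, (opV (e i) * opU (e i) + opU (e i) * opV (e i)) =
      (Luv e : Module.End ℂ (Fam E k Λ)) := Finset.sum_congr rfl fun i _ => add_comm _ _
  rw [h2] at this
  rw [Lu, this]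
  congr 2
  ring

/-- The quadratic Hamiltonian with coefficients depending on the parameters. -/
def ham (A B C : SmoothFns E) : Module.End ℂ (Fam E k Λ) :=
  mulOp A * Lv e + mulOp B * Luv e + mulOp C * Lu e

lemma ham_apply (A B C : SmoothFns E) (f : Fam E k Λ) (x : E × (V × V)) :
    (ham e A B C f).1 x =
      A.1 x.1 * (Lv e f).1 x + B.1 x.1 * (Luv e f).1 x + C.1 x.1 * (Lu e f).1 x := rfl

lemma opU_mul_mulOp (x : V) (m : SmoothFns E) :
    (opU x * mulOp m : Module.End ℂ (Fam E k Λ)) = mulOp m * opU x :=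
  nab_zero_commute_mulOp _ m

lemma opV_mul_mulOp (x : V) (m : SmoothFns E) :
    (opV x * mulOp m : Module.End ℂ (Fam E k Λ)) = mulOp m * opV x :=
  nab_zero_commute_mulOp _ m

lemma mulOp_commute_Lu (m : SmoothFns E) : Commute (mulOp m) (Lu e : Module.End ℂ (Fam E k Λ)) :=
  Commute.sum_right _ _ _ fun _ _ =>
    Commute.mul_right (opU_mul_mulOp _ m).symm (opU_mul_mulOp _ m).symm

lemma mulOp_commute_Lv (m : SmoothFns E) : Commute (mulOp m) (Lv e : Module.End ℂ (Fam E k Λ)) :=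
  Commute.sum_right _ _ _ fun _ _ =>
    Commute.mul_right (opV_mul_mulOp _ m).symm (opV_mul_mulOp _ m).symm

lemma mulOp_commute_Luv (m : SmoothFns E) :
    Commute (mulOp m) (Luv e : Module.End ℂ (Fam E k Λ)) :=
  Commute.sum_right _ _ _ fun _ _ => Commute.add_right
    (Commute.mul_right (opU_mul_mulOp _ m).symm (opV_mul_mulOp _ m).symm)
    (Commute.mul_right (opV_mul_mulOp _ m).symm (opU_mul_mulOp _ m).symm)

lemma nab_param_commute_nab (x : E) (X : V × V) :
    Commute (nab (x, 0)) (nab (0, X) : Module.End ℂ (Fam E k Λ)) := by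
  rw [Commute, SemiconjBy, nab_mul_nab]
  simp [omega]

lemma nab_param_commute_Lu (x : E) :
    Commute (nab (x, 0)) (Lu e : Module.End ℂ (Fam E k Λ)) :=
  Commute.sum_right _ _ _ fun _ _ =>
    Commute.mul_right (nab_param_commute_nab x _) (nab_param_commute_nab x _)

lemma nab_param_commute_Lv (x : E) :
    Commute (nab (x, 0)) (Lv e : Module.End ℂ (Fam E k Λ)) :=
  Commute.sum_right _ _ _ fun _ _ =>
    Commute.mul_right (nab_param_commute_nab x _) (nab_param_commute_nab x _)

lemma nab_param_commute_Luv (x : E) :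
    Commute (nab (x, 0)) (Luv e : Module.End ℂ (Fam E k Λ)) :=
  Commute.sum_right _ _ _ fun _ _ => Commute.add_right
    (Commute.mul_right (nab_param_commute_nab x _) (nab_param_commute_nab x _))
    (Commute.mul_right (nab_param_commute_nab x _) (nab_param_commute_nab x _))

/-- The operators `Lu`, `Lv`, `Luv` do not involve the parameters, so only the coefficients are
differentiated. -/
lemma nab_param_mul_ham (x : E) (A B C : SmoothFns E) :
    (nab (x, 0) * ham e A B C : Module.End ℂ (Fam E k Λ)) = ham e A B C * nab (x, 0) +
      ham e (paramDeriv x A) (paramDeriv x B) (paramDeriv x C) := by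
  simp only [ham, mul_add, add_mul, ← mul_assoc, nab_mul_mulOp]
  simp only [mul_assoc, (nab_param_commute_Lu e x).eq, (nab_param_commute_Lv e x).eq,
    (nab_param_commute_Luv e x).eq]
  abel

lemma ham_add (A B C A' B' C' : SmoothFns E) :
    (ham e A B C + ham e A' B' C' : Module.End ℂ (Fam E k Λ)) =
      ham e (A + A') (B + B') (C + C') := by
  simp only [ham, map_add, add_mul]
  abel

lemma mulOp_mul_ham (m A B C : SmoothFns E) :
    (mulOp m * ham e A B C : Module.End ℂ (Fam E k Λ)) = ham e (m * A) (m * B) (m * C) := by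
  simp only [ham, map_mul, mul_add, mul_assoc]

lemma smul_ham (c : ℂ) (A B C : SmoothFns E) :
    (c • ham e A B C : Module.End ℂ (Fam E k Λ)) = ham e (c • A) (c • B) (c • C) := by
  simp only [ham, map_smul, smul_add, smul_mul_assoc]

lemma mulOp_comm (m m' : SmoothFns E) :
    (mulOp m * mulOp m' : Module.End ℂ (Fam E k Λ)) = mulOp m' * mulOp m := by
  rw [← map_mul, mul_comm, map_mul]

/-- The coefficients depend on the parameters alone and pass through all derivatives along `V × V`;
the commutator is then the bracket of `sl₂`, coefficient by coefficient. -/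
lemma ham_mul_ham (A B C A' B' C' : SmoothFns E) :
    (ham e A B C * ham e A' B' C' : Module.End ℂ (Fam E k Λ)) =
      ham e A' B' C' * ham e A B C +
      ham e ((4 * kap k) • (B * A' - A * B')) ((2 * kap k) • (C * A' - A * C'))
        ((4 * kap k) • (C * B' - B * C')) := by
  have hsw : ∀ (m m' : SmoothFns E) (L L' : Module.End ℂ (Fam E k Λ)), Commute (mulOp m') L →
      mulOp m * L * (mulOp m' * L') = mulOp (m * m') * (L * L') := by
    intro m m' L L' h
    rw [map_mul, mul_assoc, ← mul_assoc L, ← h.eq]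
    simp only [mul_assoc]
  have hv := mulOp_commute_Lv (k := k) (Λ := Λ) (E := E) e
  have hu := mulOp_commute_Lu (k := k) (Λ := Λ) (E := E) e
  have huv := mulOp_commute_Luv (k := k) (Λ := Λ) (E := E) e
  simp only [ham, mul_add, add_mul, hsw _ _ _ _ (hv _), hsw _ _ _ _ (hu _), hsw _ _ _ _ (huv _)]
  have r1 : (Lu e * Lv e : Module.End ℂ (Fam E k Λ)) = Lv e * Lu e + (2 * kap k) • Luv e := by
    rw [Lv_mul_Lu]; module
  have r3 : (Lu e * Luv e : Module.End ℂ (Fam E k Λ)) = Luv e * Lu e + (4 * kap k) • Lu e := by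
    rw [Luv_mul_Lu]; module
  have r4 := Luv_mul_Lv (k := k) (Λ := Λ) (E := E) e
  rw [r1, r3, r4]
  simp only [map_smul, map_sub, smul_mul_assoc, sub_mul, smul_sub, mul_add, mul_smul_comm]
  rw [mul_comm A' A, mul_comm B' B, mul_comm C' C, mul_comm A' B, mul_comm A' C, mul_comm B' A,
    mul_comm B' C, mul_comm C' A, mul_comm C' B]
  module

end Hamiltonians

/-! ### The Laplace operators in an orthonormal frame -/

section Laplacians

variable {V : Type*} [NormedAddCommGroup V] [InnerProductSpace ℝ V]
  {E : Type*} [NormedAddCommGroup E] [NormedSpace ℝ E] {k n : ℕ} {Λ : Submodule ℤ V}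

/-- Links the operators of the statement, which act on functions on `V × V`, to the algebra of
operators on families. -/
lemma covDeriv_slice (X : V × V) (f : Fam E k Λ) (p : E) :
    covDeriv k X (fun A => f.1 (p, A)) = fun A => (nab (0, X) f).1 (p, A) := by
  ext A
  have h1 : HasFDerivAt (fun B : V × V => (p, B)) (ContinuousLinearMap.inr ℝ E (V × V)) A := by
    simpa using hasFDerivAt_prodMk_right p A
  have h2 := ((f.differentiableAt (p, A)).hasFDerivAt.comp A h1).fderiv
  have h3 : fderiv ℝ (fun A => f.1 (p, A)) A = _ := h2
  rw [covDeriv, nab_coe, nabF, h3]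
  simp

/-- The operator `∇_v - a ∇_u`. -/
def opC (a : ℂ) (x : V) : Module.End ℂ (Fam E k Λ) := opV x - a • opU x

/-- Products of the operators `opC`, as a bilinear map. -/
def opCC (a a' : ℂ) : V →ₗ[ℝ] V →ₗ[ℝ] Module.End ℂ (Fam E k Λ) :=
  LinearMap.mk₂ ℝ (fun x y => (opVL x - a • opUL x) * (opVL y - a' • opUL y))
    (fun x x' y => by
      simp only [map_add, smul_add, add_mul, mul_sub, sub_mul]
      abel)
    (fun c x y => by
      simp only [map_smul, smul_comm a c, ← smul_sub, smul_mul_assoc])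
    (fun x y y' => by
      simp only [map_add, smul_add, mul_add, mul_sub, sub_mul]
      abel)
    (fun c x y => by
      simp only [map_smul, smul_comm a' c, ← smul_sub, mul_smul_comm])

variable (b : Module.Basis (Fin n) ℝ V) (e : OrthonormalBasis (Fin n) ℝ V)

lemma sum_gramInv_opC (a a' : ℂ) :
    ∑ p, ∑ q, (gramInv b p q : ℂ) • (opC a (b p) * opC a' (b q)) =
      ∑ i, (opC a (e i) * opC a' (e i) : Module.End ℂ (Fam E k Λ)) :=
  sum_gramInv_smul b e (opCC a a')

lemma sum_opC_mul_opC (a : ℂ) : ∑ i, (opC a (e i) * opC a (e i) : Module.End ℂ (Fam E k Λ)) =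
    Lv e - a • Luv e + a ^ 2 • Lu e := by
  simp only [Lv, Luv, Lu, Finset.smul_sum, ← Finset.sum_sub_distrib, ← Finset.sum_add_distrib]
  refine Finset.sum_congr rfl fun i _ => ?_
  simp only [opC, mul_sub, sub_mul, mul_smul_comm, smul_mul_assoc]
  module

lemma sum_opC_mul_opC_add (a a' : ℂ) :
    ∑ i, (opC a (e i) * opC a' (e i) + opC a' (e i) * opC a (e i) : Module.End ℂ (Fam E k Λ)) =
    (2 : ℂ) • Lv e - (a + a') • Luv e + (2 * a * a') • Lu e := by
  simp only [Lv, Luv, Lu, Finset.smul_sum, ← Finset.sum_sub_distrib, ← Finset.sum_add_distrib]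
  refine Finset.sum_congr rfl fun i _ => ?_
  simp only [opC, mul_sub, sub_mul, mul_smul_comm, smul_mul_assoc]
  module

lemma covZ_slice (σ : UpperHalfPlane) (j : Fin n) (f : Fam E k Λ) (p : E) :
    covZ k b σ j (fun A => f.1 (p, A)) = fun A =>
      ((((σ : ℂ) - conj (σ : ℂ))⁻¹ • opC (conj (σ : ℂ)) (b j)) f).1 (p, A) := by
  rw [covZ, covDeriv_slice, covDeriv_slice]
  rfl

lemma covZbar_slice (σ : UpperHalfPlane) (j : Fin n) (f : Fam E k Λ) (p : E) :
    covZbar k b σ j (fun A => f.1 (p, A)) = fun A =>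
      (((conj (σ : ℂ) - (σ : ℂ))⁻¹ • opC (σ : ℂ) (b j)) f).1 (p, A) := by
  rw [covZbar, covDeriv_slice, covDeriv_slice]
  rfl

/-- Up to the factor `(σ - conj σ)⁻¹`, `∇_z` is `opC (conj σ)`; the contraction with the inverse
Gram matrix becomes a sum over `e`. -/
lemma laplacianG_slice (σ : UpperHalfPlane) (f : Fam E k Λ) (p : E) :
    laplacianG k b σ (fun A => f.1 (p, A)) = fun A =>
      Complex.I / Real.pi * ((σ : ℂ) - conj (σ : ℂ))⁻¹ ^ 2 *
        ((Lv e f).1 (p, A) - conj (σ : ℂ) * (Luv e f).1 (p, A) +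
          conj (σ : ℂ) ^ 2 * (Lu e f).1 (p, A)) := by
  ext A
  have h1 := congrArg (fun T : Module.End ℂ (Fam E k Λ) => (T f).1 (p, A))
    ((sum_gramInv_opC b e _ _).trans (sum_opC_mul_opC e (conj (σ : ℂ))))
  simp only [LinearMap.add_apply, LinearMap.sub_apply, LinearMap.smul_apply, Fam.add_val,
    Fam.sub_val, Fam.smul_val] at h1
  rw [← h1]
  simp only [laplacianG, covZ_slice]
  simp only [Pi.smul_apply, Finset.sum_apply, LinearMap.smul_apply,
    LinearMap.sum_apply, Fam.smul_val, Fam.sum_val, smul_eq_mul, Module.End.mul_apply, map_smul,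
    Finset.mul_sum]
  refine Finset.sum_congr rfl fun i _ => Finset.sum_congr rfl fun j _ => ?_
  ring

lemma laplacianGbar_slice (σ : UpperHalfPlane) (f : Fam E k Λ) (p : E) :
    laplacianGbar k b σ (fun A => f.1 (p, A)) = fun A =>
      -(Complex.I / Real.pi * ((σ : ℂ) - conj (σ : ℂ))⁻¹ ^ 2) *
        ((Lv e f).1 (p, A) - (σ : ℂ) * (Luv e f).1 (p, A) +
          (σ : ℂ) ^ 2 * (Lu e f).1 (p, A)) := by
  ext A
  have h1 := congrArg (fun T : Module.End ℂ (Fam E k Λ) => (T f).1 (p, A))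
    ((sum_gramInv_opC b e _ _).trans (sum_opC_mul_opC e (σ : ℂ)))
  simp only [LinearMap.add_apply, LinearMap.sub_apply, LinearMap.smul_apply, Fam.add_val,
    Fam.sub_val, Fam.smul_val] at h1
  rw [← h1]
  have hneg : (conj (σ : ℂ) - (σ : ℂ))⁻¹ = -((σ : ℂ) - conj (σ : ℂ))⁻¹ := by
    rw [← inv_neg, neg_sub]
  simp only [laplacianGbar, covZbar_slice]
  simp only [Pi.smul_apply, Finset.sum_apply, LinearMap.smul_apply,
    LinearMap.sum_apply, Fam.smul_val, Fam.sum_val, smul_eq_mul, Module.End.mul_apply, map_smul,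
    Finset.mul_sum, hneg]
  refine Finset.sum_congr rfl fun i _ => Finset.sum_congr rfl fun j _ => ?_
  ring

lemma sub_conj_coe (σ : UpperHalfPlane) :
    (σ : ℂ) - conj (σ : ℂ) = 2 * Complex.I * (σ.im : ℂ) := by
  rw [Complex.sub_conj]
  push_cast
  simp
  ring

/-- The coefficients are the sum `2 Re σ` and the product `|σ|²` of `σ` and `conj σ`. Symmetrizing
the two orders of `∇_z` and its conjugate leaves no zeroth order term. -/
lemma laplacian_slice (σ : UpperHalfPlane) (f : Fam E k Λ) (p : E) :
    laplacian k b σ (fun A => f.1 (p, A)) = fun A =>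
      -(1 / (2 * Real.pi * σ.im) : ℂ) * ((Lv e f).1 (p, A) - (σ.re : ℂ) * (Luv e f).1 (p, A) +
        ((σ.re : ℂ) ^ 2 + (σ.im : ℂ) ^ 2) * (Lu e f).1 (p, A)) := by
  ext A
  have h1 := sum_opC_mul_opC_add (k := k) (Λ := Λ) (E := E) e (conj (σ : ℂ)) (σ : ℂ)
  rw [Finset.sum_add_distrib, ← sum_gramInv_opC b e, ← sum_gramInv_opC b e,
    ← Finset.sum_add_distrib] at h1
  simp only [← Finset.sum_add_distrib, ← smul_add] at h1
  have hs : conj (σ : ℂ) + σ = 2 * (σ.re : ℂ) := by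
    rw [add_comm, Complex.add_conj]
    simp
  have hp : 2 * conj (σ : ℂ) * σ = 2 * ((σ.re : ℂ) ^ 2 + (σ.im : ℂ) ^ 2) := by
    rw [mul_assoc, mul_comm (conj (σ : ℂ)), Complex.mul_conj, Complex.normSq_apply]
    simp
    ring
  have h2 : (2 : ℂ) • Lv e - (conj (σ : ℂ) + σ) • Luv e + (2 * conj (σ : ℂ) * σ) • Lu e =
      (2 : ℂ) • (Lv e - (σ.re : ℂ) • Luv e + ((σ.re : ℂ) ^ 2 + (σ.im : ℂ) ^ 2) • Lu e :
        Module.End ℂ (Fam E k Λ)) := by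
    rw [hs, hp]
    module
  rw [h2] at h1
  have hneg : (conj (σ : ℂ) - (σ : ℂ))⁻¹ = -((σ : ℂ) - conj (σ : ℂ))⁻¹ := by
    rw [← inv_neg, neg_sub]
  have hy : (σ.im : ℂ) ≠ 0 := by exact_mod_cast σ.im_ne_zero
  have hpi : (Real.pi : ℂ) ≠ 0 := by exact_mod_cast Real.pi_ne_zero
  have hc : -(1 / (2 * Real.pi * σ.im) : ℂ) = (Complex.I / (2 * Real.pi) *
      ((σ : ℂ) - conj (σ : ℂ))) * (-(((σ : ℂ) - conj (σ : ℂ))⁻¹ ^ 2)) * 2 := by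
    rw [sub_conj_coe]
    field_simp
  replace h1 := congrArg (fun T : Module.End ℂ (Fam E k Λ) => (T f).1 (p, A)) h1
  simp only [LinearMap.add_apply, LinearMap.sub_apply, LinearMap.smul_apply, Fam.add_val,
    Fam.sub_val, Fam.smul_val] at h1
  rw [hc, mul_assoc _ (2 : ℂ), ← h1]
  simp only [laplacian, covZ_slice, covZbar_slice]
  simp only [Pi.smul_apply, Finset.sum_apply,
    LinearMap.smul_apply, Pi.add_apply, LinearMap.add_apply, Fam.add_val,
    LinearMap.sum_apply, Fam.smul_val, Fam.sum_val, smul_eq_mul, Module.End.mul_apply, map_smul,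
    Finset.mul_sum, hneg]
  refine Finset.sum_congr rfl fun i _ => Finset.sum_congr rfl fun j _ => ?_
  ring

end Laplacians

/-! ### Integrals of periodic functions -/

section Periodic

open scoped Pointwise

variable {V : Type*} [NormedAddCommGroup V] [InnerProductSpace ℝ V] [FiniteDimensional ℝ V]
  [MeasurableSpace V] [BorelSpace V]

instance : Measure.IsAddHaarMeasure (volume : Measure (V × V)) :=
  inferInstanceAs (Measure.IsAddHaarMeasure ((volume : Measure V).prod (volume : Measure V)))

instance vaddInvariantMeasure_submodule {Z : Type*} [AddCommGroup Z] [MeasurableSpace Z]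
    (L : Submodule ℤ Z) (μ : Measure Z) [MeasurableAdd Z] [μ.IsAddLeftInvariant] :
    VAddInvariantMeasure L Z μ :=
  ⟨fun c s _ => measure_preimage_add μ (c : Z) s⟩

variable {Λ : Submodule ℤ V}

omit [InnerProductSpace ℝ V] [FiniteDimensional ℝ V] [MeasurableSpace V] [BorelSpace V] in
lemma countable_prod_submodule [Countable Λ] : Countable (Λ.prod Λ) := by
  have : Function.Injective (fun x : Λ.prod Λ =>
      ((⟨x.1.1, x.2.1⟩, ⟨x.1.2, x.2.2⟩) : Λ × Λ)) := by
    intro x y h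
    simp only [Prod.mk.injEq, Subtype.mk.injEq] at h
    exact Subtype.ext (Prod.ext h.1 h.2)
  exact this.countable

lemma isAddFundamentalDomain_prod {F : Set V}
    (hF : IsAddFundamentalDomain Λ F (volume : Measure V)) :
    IsAddFundamentalDomain (Λ.prod Λ) (F ×ˢ F) (volume : Measure (V × V)) where
  nullMeasurableSet := hF.nullMeasurableSet.prod hF.nullMeasurableSet
  ae_covers := by
    have h1 : ∀ᵐ z : V × V, ∃ g : Λ, g +ᵥ z.1 ∈ F :=
      Measure.quasiMeasurePreserving_fst.ae hF.ae_covers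
    have h2 : ∀ᵐ z : V × V, ∃ g : Λ, g +ᵥ z.2 ∈ F :=
      Measure.quasiMeasurePreserving_snd.ae hF.ae_covers
    filter_upwards [h1, h2] with z hz1 hz2
    obtain ⟨g1, hg1⟩ := hz1
    obtain ⟨g2, hg2⟩ := hz2
    exact ⟨⟨(g1, g2), g1.2, g2.2⟩, hg1, hg2⟩
  aedisjoint := by
    intro g g' hne
    have hsub : ∀ g : Λ.prod Λ, g +ᵥ (F ×ˢ F) ⊆
        ((⟨g.1.1, g.2.1⟩ : Λ) +ᵥ F) ×ˢ ((⟨g.1.2, g.2.2⟩ : Λ) +ᵥ F) := by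
      rintro g _ ⟨z, ⟨hz1, hz2⟩, rfl⟩
      exact ⟨⟨z.1, hz1, rfl⟩, ⟨z.2, hz2, rfl⟩⟩
    refine AEDisjoint.mono ?_ (hsub g) (hsub g')
    rw [AEDisjoint, Set.prod_inter_prod, Measure.volume_eq_prod, Measure.prod_prod]
    -- Distinct lattice elements differ in some coordinate, and in that coordinate the intersection
    -- of the translates is null.
    by_cases h : g.1.1 = g'.1.1
    · have h2 : (⟨g.1.2, g.2.2⟩ : Λ) ≠ ⟨g'.1.2, g'.2.2⟩ := fun h' =>
        hne (Subtype.ext (Prod.ext h (congrArg Subtype.val h')))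
      rw [show volume _ = 0 from hF.aedisjoint h2, mul_zero]
    · have h2 : (⟨g.1.1, g.2.1⟩ : Λ) ≠ ⟨g'.1.1, g'.2.1⟩ := fun h' =>
        h (congrArg Subtype.val h')
      rw [show volume _ = 0 from hF.aedisjoint h2, zero_mul]

variable {D : Set (V × V)}

/-- Invariance under the lattice `Λ × Λ`. -/
def IsPeriodic (Λ : Submodule ℤ V) (h : V × V → ℂ) : Prop :=
  ∀ l₁ ∈ Λ, ∀ l₂ ∈ Λ, ∀ A, h (A + (l₁, l₂)) = h A

lemma setIntegral_eq_of_isPeriodic [Countable Λ] {D' : Set (V × V)}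
    (hD : IsAddFundamentalDomain (Λ.prod Λ) D (volume : Measure (V × V)))
    (hD' : IsAddFundamentalDomain (Λ.prod Λ) D' (volume : Measure (V × V))) {h : V × V → ℂ}
    (hp : IsPeriodic Λ h) : ∫ A in D, h A = ∫ A in D', h A := by
  have := countable_prod_submodule (Λ := Λ)
  refine hD.setIntegral_eq hD' fun g x => ?_
  have : g +ᵥ x = x + (g.1.1, g.1.2) := add_comm _ _
  rw [this, hp _ g.2.1 _ g.2.2]

/-- The translate of a fundamental domain is again one, and periodic functions have the same
integral over both. -/
lemma setIntegral_comp_add_right [Countable Λ]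
    (hD : IsAddFundamentalDomain (Λ.prod Λ) D (volume : Measure (V × V))) {h : V × V → ℂ}
    (hp : IsPeriodic Λ h) (X : V × V) : ∫ A in D, h (A + X) = ∫ A in D, h A := by
  have h1 := (measurePreserving_add_right (volume : Measure (V × V)) X).setIntegral_image_emb
    (measurableEmbedding_addRight X) h D
  rw [← h1]
  refine setIntegral_eq_of_isPeriodic ?_ hD hp
  have h2 := hD.vadd_of_comm X
  have h3 : X +ᵥ D = (fun A => A + X) '' D := by
    change (fun A => X +ᵥ A) '' D = _
    exact Set.image_congr fun A _ => add_comm X A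
  rwa [h3] at h2

lemma integrableOn_of_bounded (hb : Bornology.IsBounded D) {h : V × V → ℂ} (hc : Continuous h) :
    IntegrableOn h D :=
  (hc.continuousOn.integrableOn_compact hb.isCompact_closure).mono_set subset_closure

lemma hasDerivAt_setIntegral (hm : NullMeasurableSet D) (hb : Bornology.IsBounded D)
    {H : ℝ × (V × V) → ℂ} (hH : ContDiff ℝ ∞ H) (s : ℝ) :
    HasDerivAt (fun s => ∫ A in D, H (s, A)) (∫ A in D, fderiv ℝ H (s, A) (1, 0)) s := by
  have hK : IsCompact (Metric.closedBall s 1 ×ˢ closure D) :=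
    (isCompact_closedBall s 1).prod hb.isCompact_closure
  have hdc : Continuous fun x : ℝ × (V × V) => fderiv ℝ H x (1, 0) :=
    (hH.continuous_fderiv (by simp)).clm_apply continuous_const
  obtain ⟨C, hC⟩ := hK.exists_bound_of_continuousOn hdc.continuousOn
  have hfin : volume D < ⊤ := hb.measure_lt_top
  have : IsFiniteMeasure (volume.restrict D) := ⟨by simpa using hfin⟩
  refine (hasDerivAt_integral_of_dominated_loc_of_deriv_le (F' := fun s A => fderiv ℝ H (s, A) (1, 0))
    (bound := fun _ => C) (Metric.closedBall_mem_nhds s one_pos) (.of_forall fun s' => ?_) ?_ ?_ ?_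
    (integrable_const C) ?_).2
  · exact (hH.continuous.comp (Continuous.prodMk_right s')).aestronglyMeasurable
  · exact integrableOn_of_bounded hb (hH.continuous.comp (Continuous.prodMk_right s))
  · exact (hdc.comp (Continuous.prodMk_right s)).aestronglyMeasurable
  · refine (ae_restrict_iff'₀ hm).2 <| .of_forall fun A hA s' hs' =>
       hC (s', A) ⟨hs', subset_closure hA⟩
  · refine .of_forall fun A s' _ => ?_
    have h1 : HasDerivAt (fun t : ℝ => ((t, A) : ℝ × (V × V))) (1, 0) s' :=
      (hasDerivAt_id s').prodMk (hasDerivAt_const s' A)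
    exact ((hH.differentiable (by simp) (s', A)).hasFDerivAt).comp_hasDerivAt s' h1

/-- The integral of `h(A + sX)` over `D` does not depend on `s`; differentiate at `s = 0`. This
replaces Stokes' theorem on the torus. -/
lemma setIntegral_fderiv_eq_zero [Countable Λ]
    (hD : IsAddFundamentalDomain (Λ.prod Λ) D (volume : Measure (V × V)))
    (hb : Bornology.IsBounded D) {h : V × V → ℂ} (hp : IsPeriodic Λ h) (hh : ContDiff ℝ ∞ h)
    (X : V × V) : ∫ A in D, fderiv ℝ h A X = 0 := by
  set H : ℝ × (V × V) → ℂ := fun x => h (x.2 + x.1 • X) with hH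
  have hHs : ContDiff ℝ ∞ H := hh.comp (contDiff_snd.add (contDiff_fst.smul contDiff_const))
  have h1 := hasDerivAt_setIntegral hD.nullMeasurableSet hb hHs 0
  have h2 : (fun s => ∫ A in D, H (s, A)) = fun _ => ∫ A in D, h A :=
    funext fun s => setIntegral_comp_add_right hD hp (s • X)
  rw [h2] at h1
  have h3 := h1.unique (hasDerivAt_const (0 : ℝ) (∫ A in D, h A))
  rw [← h3]
  refine integral_congr_ae (.of_forall fun A => ?_)
  have h4 : HasFDerivAt (fun x : ℝ × (V × V) => x.2 + x.1 • X)
      (ContinuousLinearMap.snd ℝ ℝ (V × V) +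
        (ContinuousLinearMap.fst ℝ ℝ (V × V)).smulRight X) ((0 : ℝ), A) :=
    hasFDerivAt_snd.add (hasFDerivAt_fst.smul_const X)
  have h5 : HasFDerivAt h (fderiv ℝ h A) (((0 : ℝ), A).2 + ((0 : ℝ), A).1 • X) := by
    simpa using (hh.differentiable (by simp) A).hasFDerivAt
  have h6 := (h5.comp ((0 : ℝ), A) h4).fderiv
  have h7 : fderiv ℝ H (0, A) = _ := h6
  simp only [h7]
  simp

/-- Periodicity of `‖h‖` suffices: the set where `h ≠ 0` is then invariant and null inside `D`,
hence null, and continuity concludes. -/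
lemma eq_zero_of_setIntegral_eq_zero [Countable Λ]
    (hD : IsAddFundamentalDomain (Λ.prod Λ) D (volume : Measure (V × V)))
    (hb : Bornology.IsBounded D) {h : V × V → ℂ} (hc : Continuous h)
    (hn : ∀ l₁ ∈ Λ, ∀ l₂ ∈ Λ, ∀ A, ‖h (A + (l₁, l₂))‖ = ‖h A‖)
    (h0 : ∫ A in D, h A * conj (h A) = 0) : h = 0 := by
  have := countable_prod_submodule (Λ := Λ)
  have h1 : ∫ A in D, ‖h A‖ ^ 2 = 0 := by
    have : ∫ A in D, h A * conj (h A) = ((∫ A in D, ‖h A‖ ^ 2 : ℝ) : ℂ) := by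
      rw [← integral_complex_ofReal]
      refine integral_congr_ae (.of_forall fun A => ?_)
      simp [Complex.mul_conj']
    rw [this] at h0
    exact_mod_cast h0
  have hint : IntegrableOn (fun A => ‖h A‖ ^ 2) D :=
    ((hc.norm.pow 2).continuousOn.integrableOn_compact hb.isCompact_closure).mono_set
      subset_closure
  rw [setIntegral_eq_zero_iff_of_nonneg_ae (.of_forall fun A => by positivity) hint] at h1
  have hz : volume ({A | h A ≠ 0} ∩ D) = 0 := by
    rw [Filter.EventuallyEq, ae_iff, Measure.restrict_apply₀'
      hD.nullMeasurableSet] at h1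
    simpa using h1
  have hz' : volume {A | h A ≠ 0} = 0 := by
    refine hD.measure_zero_of_invariant _ (fun g => ?_) hz
    ext A
    rw [Set.mem_vadd_set_iff_neg_vadd_mem]
    have h2 : A = (-g +ᵥ A) + (g.1.1, g.1.2) := by
      have : -g +ᵥ A = -g.1 + A := rfl
      rw [this]
      simp
    have h3 := hn _ g.2.1 _ g.2.2 (-g +ᵥ A)
    rw [← h2] at h3
    simp only [Set.mem_ofPred_eq]
    rw [← norm_ne_zero_iff (a := h A), h3, norm_ne_zero_iff]
  have hae : h =ᵐ[volume] 0 := by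
    rw [Filter.EventuallyEq, ae_iff]
    simpa using hz'
  exact Continuous.ae_eq_iff_eq volume hc continuous_zero |>.1 hae

end Periodic

/-! ### Energy identities -/

section Energy

variable {V : Type*} [NormedAddCommGroup V] [InnerProductSpace ℝ V] [FiniteDimensional ℝ V]
  [MeasurableSpace V] [BorelSpace V]
  {E : Type*} [NormedAddCommGroup E] [NormedSpace ℝ E]
  {E' : Type*} [NormedAddCommGroup E'] [NormedSpace ℝ E'] {k n : ℕ} {Λ : Submodule ℤ V}

/-- `D` is a bounded fundamental domain of `Λ × Λ`. -/
structure IsCell (Λ : Submodule ℤ V) (D : Set (V × V)) : Prop where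
  fundamental : IsAddFundamentalDomain (Λ.prod Λ) D (volume : Measure (V × V))
  bounded : Bornology.IsBounded D

omit [FiniteDimensional ℝ V] [MeasurableSpace V] [BorelSpace V] in
lemma multiplier_mul_conj (l A : V × V) : multiplier k l A * conj (multiplier k l A) = 1 := by
  have : ‖multiplier k l A‖ = 1 := by
    rw [multiplier, norm_mul, Complex.norm_exp, Complex.norm_exp]
    simp
  rw [Complex.mul_conj', this]
  simp

omit [FiniteDimensional ℝ V] [MeasurableSpace V] [BorelSpace V] in
lemma norm_multiplier (l A : V × V) : ‖multiplier k l A‖ = 1 := by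
  rw [multiplier, norm_mul, Complex.norm_exp, Complex.norm_exp]
  simp

-- Both factors pick up the same unimodular multiplier, which cancels against its conjugate.
omit [FiniteDimensional ℝ V] [MeasurableSpace V] [BorelSpace V] in
lemma isPeriodic_mul_conj (f : Fam E k Λ) (p : E) (g : Fam E' k Λ) (q : E') :
    IsPeriodic Λ fun A => f.1 (p, A) * conj (g.1 (q, A)) := by
  intro l₁ h₁ l₂ h₂ A
  simp only [f.apply_add h₁ h₂, g.apply_add h₁ h₂, map_mul]
  linear_combination (f.1 (p, A) * conj (g.1 (q, A))) * multiplier_mul_conj (k := k) (l₁, l₂) A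

omit [FiniteDimensional ℝ V] [MeasurableSpace V] [BorelSpace V] in
lemma Fam.contDiff_slice (f : Fam E k Λ) (p : E) : ContDiff ℝ ∞ fun A => f.1 (p, A) :=
  f.contDiff.comp (contDiff_const.prodMk contDiff_id)

omit [FiniteDimensional ℝ V] [MeasurableSpace V] [BorelSpace V] in
lemma contDiff_conj {X : Type*} [NormedAddCommGroup X] [NormedSpace ℝ X] {f : X → ℂ}
    (hf : ContDiff ℝ ∞ f) : ContDiff ℝ ∞ fun x => conj (f x) :=
  Complex.conjCLE.contDiff.comp hf

omit [FiniteDimensional ℝ V] [MeasurableSpace V] [BorelSpace V] in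
lemma fderiv_conj_apply {X : Type*} [NormedAddCommGroup X] [NormedSpace ℝ X] {f : X → ℂ} {x : X}
    (hf : DifferentiableAt ℝ f x) (v : X) :
    fderiv ℝ (fun x => conj (f x)) x v = conj (fderiv ℝ f x v) := by
  have := (Complex.conjCLE.toContinuousLinearMap.hasFDerivAt.comp x hf.hasFDerivAt).fderiv
  have h : fderiv ℝ (fun x => conj (f x)) x = _ := this
  rw [h]
  simp

/-- The inner product of two members of families of sections. -/
def pair (D : Set (V × V)) (f : Fam E k Λ) (p : E) (g : Fam E' k Λ) (q : E') : ℂ :=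
  ∫ A in D, f.1 (p, A) * conj (g.1 (q, A))

variable {D : Set (V × V)}

omit [FiniteDimensional ℝ V] [MeasurableSpace V] [BorelSpace V] in
lemma continuous_mul_conj (f : Fam E k Λ) (p : E) (g : Fam E' k Λ) (q : E') :
    Continuous fun A => f.1 (p, A) * conj (g.1 (q, A)) :=
  (f.contDiff_slice p).continuous.mul
    (Complex.continuous_conj.comp (g.contDiff_slice q).continuous)

lemma pair_integrable (hD : IsCell Λ D) (f : Fam E k Λ) (p : E) (g : Fam E' k Λ) (q : E') :
    IntegrableOn (fun A => f.1 (p, A) * conj (g.1 (q, A))) D :=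
  integrableOn_of_bounded hD.bounded (continuous_mul_conj f p g q)

lemma pair_conj (f : Fam E k Λ) (p : E) (g : Fam E' k Λ) (q : E') :
    conj (pair D f p g q) = pair D g q f p := by
  rw [pair, ← integral_conj]
  refine integral_congr_ae (.of_forall fun A => ?_)
  simp [mul_comm]

lemma pair_add_left (hD : IsCell Λ D) (f f' : Fam E k Λ) (p : E) (g : Fam E' k Λ) (q : E') :
    pair D (f + f') p g q = pair D f p g q + pair D f' p g q := by
  rw [pair, pair, pair, ← integral_add (pair_integrable hD _ _ _ _) (pair_integrable hD _ _ _ _)]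
  simp only [Fam.add_val, add_mul]

lemma pair_smul_left (c : ℂ) (f : Fam E k Λ) (p : E) (g : Fam E' k Λ) (q : E') :
    pair D (c • f) p g q = c * pair D f p g q := by
  rw [pair, pair, ← integral_const_mul]
  simp only [Fam.smul_val, mul_assoc]

/-- The inner product as a linear form in the first argument. -/
def pairL (hD : IsCell Λ D) (p : E) (g : Fam E' k Λ) (q : E') : Fam E k Λ →ₗ[ℂ] ℂ where
  toFun f := pair D f p g q
  map_add' f f' := pair_add_left hD f f' p g q
  map_smul' c f := pair_smul_left c f p g q

/-- In `(∇f) conj g + f conj (∇g)` the purely imaginary connection forms cancel, leaving the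
derivative of the periodic function `f conj g`. -/
lemma pair_nab_add [Countable Λ] (hD : IsCell Λ D) (X : V × V) (f : Fam E k Λ) (p : E)
    (g : Fam E' k Λ) (q : E') :
    pair D (nab (0, X) f) p g q + pair D f p (nab (0, X) g) q = 0 := by
  have h1 := setIntegral_fderiv_eq_zero hD.fundamental hD.bounded (isPeriodic_mul_conj f p g q)
    ((f.contDiff_slice p).mul (contDiff_conj (g.contDiff_slice q))) X
  rw [pair, pair, ← integral_add (pair_integrable hD _ _ _ _) (pair_integrable hD _ _ _ _), ← h1]
  refine integral_congr_ae (.of_forall fun A => ?_)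
  have hf : DifferentiableAt ℝ (fun A => f.1 (p, A)) A :=
    ((f.contDiff_slice p).differentiable (by simp)).differentiableAt
  have hg : DifferentiableAt ℝ (fun A => g.1 (q, A)) A :=
    ((g.contDiff_slice q).differentiable (by simp)).differentiableAt
  have hg' : DifferentiableAt ℝ (fun A => conj (g.1 (q, A))) A :=
    ((contDiff_conj (g.contDiff_slice q)).differentiable (by simp)).differentiableAt
  have e1 := congrFun (covDeriv_slice X f p) A
  have e2 := congrFun (covDeriv_slice X g q) A
  have e3 := (hf.hasFDerivAt.mul hg'.hasFDerivAt).fderiv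
  have e4 : fderiv ℝ (fun A => f.1 (p, A) * conj (g.1 (q, A))) A = _ := e3
  simp only [← e1, ← e2, covDeriv, e4, add_apply, smul_apply, smul_eq_mul,
    fderiv_conj_apply hg, map_sub, map_mul, map_div₀, Complex.conj_I, Complex.conj_ofReal]
  simp only [map_ofNat]
  ring

lemma pair_nab_left [Countable Λ] (hD : IsCell Λ D) (X : V × V) (f : Fam E k Λ) (p : E)
    (g : Fam E' k Λ) (q : E') :
    pair D (nab (0, X) f) p g q = -pair D f p (nab (0, X) g) q :=
  eq_neg_of_add_eq_zero_left (pair_nab_add hD X f p g q)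

lemma pair_sum_left (hD : IsCell Λ D) {κ : Type*} (s : Finset κ) (f : κ → Fam E k Λ) (p : E)
    (g : Fam E' k Λ) (q : E') : pair D (∑ i ∈ s, f i) p g q = ∑ i ∈ s, pair D (f i) p g q :=
  map_sum (pairL hD p g q) f s

lemma pair_add_right (hD : IsCell Λ D) (f : Fam E k Λ) (p : E) (g g' : Fam E' k Λ) (q : E') :
    pair D f p (g + g') q = pair D f p g q + pair D f p g' q := by
  rw [← pair_conj, pair_add_left hD, map_add, pair_conj, pair_conj]

lemma pair_smul_right (c : ℂ) (f : Fam E k Λ) (p : E) (g : Fam E' k Λ) (q : E') :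
    pair D f p (c • g) q = conj c * pair D f p g q := by
  rw [← pair_conj, pair_smul_left, map_mul, pair_conj]

lemma pair_sum_right (hD : IsCell Λ D) {κ : Type*} (s : Finset κ) (f : Fam E k Λ) (p : E)
    (g : κ → Fam E' k Λ) (q : E') : pair D f p (∑ i ∈ s, g i) q = ∑ i ∈ s, pair D f p (g i) q := by
  rw [← pair_conj, pair_sum_left hD, map_sum]
  exact Finset.sum_congr rfl fun i _ => pair_conj _ _ _ _

lemma pair_nab_nab [Countable Λ] (hD : IsCell Λ D) (X Y : V × V) (f : Fam E k Λ) (p : E)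
    (g : Fam E' k Λ) (q : E') :
    pair D (nab (0, X) (nab (0, Y) f)) p g q = pair D f p (nab (0, Y) (nab (0, X) g)) q := by
  rw [pair_nab_left hD, pair_nab_left hD, neg_neg]

variable (e : OrthonormalBasis (Fin n) ℝ V)

lemma pair_Lu [Countable Λ] (hD : IsCell Λ D) (f : Fam E k Λ) (p : E) (g : Fam E' k Λ) (q : E') :
    pair D (Lu e f) p g q = pair D f p (Lu e g) q := by
  simp only [Lu, LinearMap.sum_apply, pair_sum_left hD, pair_sum_right hD, Module.End.mul_apply]
  exact Finset.sum_congr rfl fun i _ => pair_nab_nab hD _ _ _ _ _ _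

lemma pair_Lv [Countable Λ] (hD : IsCell Λ D) (f : Fam E k Λ) (p : E) (g : Fam E' k Λ) (q : E') :
    pair D (Lv e f) p g q = pair D f p (Lv e g) q := by
  simp only [Lv, LinearMap.sum_apply, pair_sum_left hD, pair_sum_right hD, Module.End.mul_apply]
  exact Finset.sum_congr rfl fun i _ => pair_nab_nab hD _ _ _ _ _ _

/-- Transposition reverses the order of the two derivatives, so only the symmetrized product is
symmetric. -/
lemma pair_Luv [Countable Λ] (hD : IsCell Λ D) (f : Fam E k Λ) (p : E) (g : Fam E' k Λ) (q : E') :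
    pair D (Luv e f) p g q = pair D f p (Luv e g) q := by
  simp only [Luv, LinearMap.sum_apply, pair_sum_left hD, pair_sum_right hD, Module.End.mul_apply,
    LinearMap.add_apply, pair_add_left hD, pair_add_right hD]
  refine Finset.sum_congr rfl fun i _ => ?_
  rw [add_comm]
  exact congrArg₂ _ (pair_nab_nab hD _ _ _ _ _ _) (pair_nab_nab hD _ _ _ _ _ _)

lemma hasDerivAt_pair (hD : IsCell Λ D) (f : Fam E k Λ) (p x : E) (g : Fam E' k Λ) (q y : E')
    (s : ℝ) :
    HasDerivAt (fun s : ℝ => pair D f (p + s • x) g (q + s • y))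
      (pair D (nab (x, 0) f) (p + s • x) g (q + s • y) +
        pair D f (p + s • x) (nab (y, 0) g) (q + s • y)) s := by
  have hl : ∀ {E : Type _} [NormedAddCommGroup E] [NormedSpace ℝ E] (p x : E),
      ContDiff ℝ ∞ fun z : ℝ × (V × V) => (p + z.1 • x, z.2) := fun p x =>
    (contDiff_const.add (contDiff_fst.smul contDiff_const)).prodMk contDiff_snd
  -- The same statement for `E'`, which may live in another universe than `E`.
  have hl' : ∀ {E : Type _} [NormedAddCommGroup E] [NormedSpace ℝ E] (p x : E),
      ContDiff ℝ ∞ fun z : ℝ × (V × V) => (p + z.1 • x, z.2) := fun p x =>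
    (contDiff_const.add (contDiff_fst.smul contDiff_const)).prodMk contDiff_snd
  have hF : ContDiff ℝ ∞ fun z : ℝ × (V × V) => f.1 (p + z.1 • x, z.2) := f.contDiff.comp (hl p x)
  have hG : ContDiff ℝ ∞ fun z : ℝ × (V × V) => g.1 (q + z.1 • y, z.2) := g.contDiff.comp (hl' q y)
  refine (hasDerivAt_setIntegral hD.fundamental.nullMeasurableSet hD.bounded
    (hF.mul (contDiff_conj hG)) s).congr_deriv ?_
  rw [pair, pair, ← integral_add (pair_integrable hD _ _ _ _) (pair_integrable hD _ _ _ _)]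
  refine integral_congr_ae (.of_forall fun A => ?_)
  have dF : fderiv ℝ (fun z : ℝ × (V × V) => f.1 (p + z.1 • x, z.2)) (s, A) (1, 0) =
      (nab (x, 0) f).1 (p + s • x, A) := by
    have h1 : HasFDerivAt (fun z : ℝ × (V × V) => (p + z.1 • x, z.2))
        (((ContinuousLinearMap.fst ℝ ℝ (V × V)).smulRight x).prod
          (ContinuousLinearMap.snd ℝ ℝ (V × V))) (s, A) :=
      ((hasFDerivAt_fst.smul_const x).const_add p).prodMk hasFDerivAt_snd
    have h2 : fderiv ℝ (fun z : ℝ × (V × V) => f.1 (p + z.1 • x, z.2)) (s, A) = _ :=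
      ((f.differentiableAt (p + s • x, A)).hasFDerivAt.comp (s, A) h1).fderiv
    rw [h2, nab_param_apply]
    simp
  have dG : fderiv ℝ (fun z : ℝ × (V × V) => g.1 (q + z.1 • y, z.2)) (s, A) (1, 0) =
      (nab (y, 0) g).1 (q + s • y, A) := by
    have h1 : HasFDerivAt (fun z : ℝ × (V × V) => (q + z.1 • y, z.2))
        (((ContinuousLinearMap.fst ℝ ℝ (V × V)).smulRight y).prod
          (ContinuousLinearMap.snd ℝ ℝ (V × V))) (s, A) :=
      ((hasFDerivAt_fst.smul_const y).const_add q).prodMk hasFDerivAt_snd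
    have h2 : fderiv ℝ (fun z : ℝ × (V × V) => g.1 (q + z.1 • y, z.2)) (s, A) = _ :=
      ((g.differentiableAt (q + s • y, A)).hasFDerivAt.comp (s, A) h1).fderiv
    rw [h2, nab_param_apply]
    simp
  have d1 := (hF.differentiable (by simp)).differentiableAt (x := (s, A))
  have d2 := (hG.differentiable (by simp)).differentiableAt (x := (s, A))
  have d2' := ((contDiff_conj hG).differentiable (by simp)).differentiableAt (x := (s, A))
  have e4 : fderiv ℝ (fun z : ℝ × (V × V) => f.1 (p + z.1 • x, z.2) *
      conj (g.1 (q + z.1 • y, z.2))) (s, A) = _ := (d1.hasFDerivAt.mul d2'.hasFDerivAt).fderiv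
  simp only [e4, add_apply, smul_apply, smul_eq_mul,
    fderiv_conj_apply d2, dF, dG]
  ring

lemma eq_zero_of_pair_self [Countable Λ] (hD : IsCell Λ D) (f : Fam E k Λ) (p : E)
    (h : pair D f p f p = 0) (A : V × V) : f.1 (p, A) = 0 := by
  refine congrFun (eq_zero_of_setIntegral_eq_zero hD.fundamental hD.bounded
    (f.contDiff_slice p).continuous (fun l₁ h₁ l₂ h₂ A => ?_) h) A
  rw [f.apply_add h₁ h₂, norm_mul, norm_multiplier, one_mul]

/-- Uniqueness for the Schrödinger equation along a line in the parameter space. -/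
lemma eq_zero_of_schrodinger [Countable Λ] (hD : IsCell Λ D) (R : Fam E k Λ) (p x : E)
    (S : E → Fam E k Λ) (hS : ∀ q, pair D (S q) q R q = pair D R q (S q) q)
    (h : ∀ q A, (nab (x, 0) R).1 (q, A) = Complex.I * (S q).1 (q, A))
    (h0 : ∀ A, R.1 (p, A) = 0) (s : ℝ) (A : V × V) : R.1 (p + s • x, A) = 0 := by
  refine eq_zero_of_pair_self hD R _ ?_ A
  -- Conservation of the norm: the derivative is `i⟨SR, R⟩ - i⟨R, SR⟩`, which vanishes by `hS`.
  have hd : ∀ s : ℝ, HasDerivAt (fun s : ℝ => pair D R (p + s • x) R (p + s • x)) 0 s := by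
    intro s
    refine (hasDerivAt_pair hD R p x R p x s).congr_deriv ?_
    set q := p + s • x
    have h1 : pair D (nab (x, 0) R) q R q = Complex.I * pair D (S q) q R q := by
      rw [← pair_smul_left, pair, pair]
      simp only [h, Fam.smul_val]
    have h2 : pair D R q (nab (x, 0) R) q = -Complex.I * pair D R q (S q) q := by
      rw [← pair_conj, h1, map_mul, Complex.conj_I, pair_conj]
    rw [h1, h2, hS]
    ring
  have hc : (fun s : ℝ => pair D R (p + s • x) R (p + s • x)) s =
      (fun s : ℝ => pair D R (p + s • x) R (p + s • x)) 0 :=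
    is_const_of_deriv_eq_zero (fun s => (hd s).differentiableAt) (fun s => (hd s).deriv) s 0
  simp only [zero_smul, add_zero] at hc
  rw [hc, pair]
  simp [h0]

/-- Uniqueness for the Schrödinger equation with a real quadratic Hamiltonian. -/
lemma eq_zero_of_ham [Countable Λ] (hD : IsCell Λ D) (R : Fam E k Λ) (p x : E)
    (a b c : E → ℝ) (h : ∀ q A, (nab (x, 0) R).1 (q, A) = Complex.I *
      (a q * (Lv e R).1 (q, A) + b q * (Luv e R).1 (q, A) + c q * (Lu e R).1 (q, A)))
    (h0 : ∀ A, R.1 (p, A) = 0) (s : ℝ) (A : V × V) : R.1 (p + s • x, A) = 0 := by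
  refine eq_zero_of_schrodinger hD R p x
    (fun q => (a q : ℂ) • Lv e R + (b q : ℂ) • Luv e R + (c q : ℂ) • Lu e R) (fun q => ?_)
    (fun q A => h q A) h0 s A
  simp only [pair_add_left hD, pair_add_right hD, pair_smul_left, pair_smul_right, pair_Lv e hD,
    pair_Lu e hD, pair_Luv e hD, Complex.conj_ofReal]

end Energy

/-! ### Fourier series along a lattice direction -/

section Fourier

lemma hasFDerivAt_intervalIntegral_of_contDiff {X : Type*} [NormedAddCommGroup X]
    [NormedSpace ℝ X] [FiniteDimensional ℝ X] {G : ℝ × X → ℂ} (hG : ContDiff ℝ ∞ G) (x : X) :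
    HasFDerivAt (fun x => ∫ s in (0 : ℝ)..1, G (s, x))
      (∫ s in (0 : ℝ)..1, (fderiv ℝ G (s, x)).comp (ContinuousLinearMap.inr ℝ ℝ X)) x := by
  have hK : IsCompact (Set.Icc (0 : ℝ) 1 ×ˢ Metric.closedBall x 1) :=
    isCompact_Icc.prod (isCompact_closedBall x 1)
  have hdc : Continuous fun y : ℝ × X =>
      (fderiv ℝ G y).comp (ContinuousLinearMap.inr ℝ ℝ X) :=
    (hG.continuous_fderiv (by simp)).clm_comp continuous_const
  obtain ⟨C, hC⟩ := hK.exists_bound_of_continuousOn hdc.continuousOn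
  refine intervalIntegral.hasFDerivAt_integral_of_dominated_of_fderiv_le
    (F' := fun x s => (fderiv ℝ G (s, x)).comp (ContinuousLinearMap.inr ℝ ℝ X))
    (bound := fun _ => C) (Metric.closedBall_mem_nhds x one_pos) (.of_forall fun x' => ?_) ?_ ?_
    (.of_forall fun s hs x' hx' => ?_) intervalIntegrable_const (.of_forall fun s hs x' hx' => ?_)
  · exact (hG.continuous.comp (Continuous.prodMk_left x')).aestronglyMeasurable
  · exact (hG.continuous.comp (Continuous.prodMk_left x)).intervalIntegrable _ _
  · exact (hdc.comp (Continuous.prodMk_left x)).aestronglyMeasurable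
  · rw [Set.uIoc_of_le zero_le_one] at hs
    exact hC (s, x') ⟨⟨hs.1.le, hs.2⟩, hx'⟩
  · have h1 : HasFDerivAt (fun x : X => (s, x)) (ContinuousLinearMap.inr ℝ ℝ X) x' :=
      hasFDerivAt_prodMk_right s x'
    exact ((hG.differentiable (by simp)) (s, x')).hasFDerivAt.comp x' h1

lemma fderiv_intervalIntegral_apply {X : Type*} [NormedAddCommGroup X]
    [NormedSpace ℝ X] [FiniteDimensional ℝ X] {G : ℝ × X → ℂ} (hG : ContDiff ℝ ∞ G) (x ξ : X) :
    fderiv ℝ (fun x => ∫ s in (0 : ℝ)..1, G (s, x)) x ξ =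
      ∫ s in (0 : ℝ)..1, fderiv ℝ (fun x => G (s, x)) x ξ := by
  have hdc : Continuous fun y : ℝ × X =>
      (fderiv ℝ G y).comp (ContinuousLinearMap.inr ℝ ℝ X) :=
    (hG.continuous_fderiv (by simp)).clm_comp continuous_const
  rw [(hasFDerivAt_intervalIntegral_of_contDiff hG x).fderiv,
    ContinuousLinearMap.intervalIntegral_apply (φ := fun s : ℝ =>
      (fderiv ℝ G (s, x)).comp (ContinuousLinearMap.inr ℝ ℝ X))
      ((hdc.comp (Continuous.prodMk_left x)).intervalIntegrable _ _)]
  refine intervalIntegral.integral_congr fun s _ => ?_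
  have h1 : HasFDerivAt (fun x : X => (s, x)) (ContinuousLinearMap.inr ℝ ℝ X) x :=
      hasFDerivAt_prodMk_right s x
  have h2 : fderiv ℝ (fun x => G (s, x)) x = _ :=
    (((hG.differentiable (by simp)) (s, x)).hasFDerivAt.comp x h1).fderiv
  simp only [h2]

variable {V : Type*} [NormedAddCommGroup V] [InnerProductSpace ℝ V]
  {E : Type*} [NormedAddCommGroup E] [NormedSpace ℝ E] {k : ℕ} {Λ : Submodule ℤ V}

/-- The magnetic translation by `s d` in the second factor. -/
def magTrans (k : ℕ) (d : V) (f : E × (V × V) → ℂ) (s : ℝ) (x : E × (V × V)) : ℂ :=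
  f (x + s • (0, (0, d))) * Complex.exp (Complex.I * (Real.pi * k * s * ⟪x.2.1, d⟫_ℝ : ℝ))

lemma contDiff_magTrans (d : V) (f : Fam E k Λ) :
    ContDiff ℝ ∞ fun z : ℝ × (E × (V × V)) => magTrans k d f.1 z.1 z.2 := by
  have h1 : ContDiff ℝ ∞ fun z : ℝ × (E × (V × V)) => z.2 + z.1 • ((0 : E), ((0 : V), d)) := by
    fun_prop
  have h2 : ContDiff ℝ ∞ fun z : ℝ × (E × (V × V)) =>
      (Real.pi * k * z.1 * ⟪z.2.2.1, d⟫_ℝ : ℝ) :=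
    (contDiff_const.mul contDiff_fst).mul
      ((contDiff_fst.comp (contDiff_snd.comp contDiff_snd)).inner ℝ contDiff_const)
  exact (f.contDiff.comp h1).mul (contDiff_const.mul (Complex.ofRealCLM.contDiff.comp h2)).cexp

/-- The phase in `magTrans` compensates the shift of the connection form, so magnetic translations
commute with all covariant derivatives. -/
lemma nabF_magTrans (d : V) (f : Fam E k Λ) (s : ℝ) (ξ x : E × (V × V)) :
    nabF k ξ (magTrans k d f.1 s) x = magTrans k d (nab ξ f).1 s x := by
  have h1 : HasFDerivAt (fun x : E × (V × V) => f.1 (x + s • (0, (0, d))))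
      (fderiv ℝ f.1 (x + s • (0, (0, d)))) x :=
    (hasFDerivAt_comp_add_right _).2 (f.differentiableAt _).hasFDerivAt
  have h0 : ∀ x : E × (V × V), Real.pi * k * s * ⟪x.2.1, d⟫_ℝ = s / 2 * omegaL k (0, d) x.2 := by
    intro x
    rw [omegaL_apply, omega]
    simp
    ring
  have h2 : HasFDerivAt (fun x : E × (V × V) => ((Real.pi * k * s * ⟪x.2.1, d⟫_ℝ : ℝ) : ℂ))
      (Complex.ofRealCLM.comp ((s / 2) • (omegaL k (0, d)).comp
        (ContinuousLinearMap.snd ℝ E (V × V)))) x := by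
    simp only [h0]
    exact (Complex.ofRealCLM.comp ((s / 2) • (omegaL k (0, d)).comp
        (ContinuousLinearMap.snd ℝ E (V × V)))).hasFDerivAt
  have h3 : fderiv ℝ (magTrans k d f.1 s) x = _ := (h1.mul (h2.const_mul Complex.I).cexp).fderiv
  rw [nabF, h3, magTrans, magTrans, nab_coe, nabF]
  simp only [add_apply, smul_apply, smul_eq_mul, ContinuousLinearMap.coe_comp, Function.comp_apply,
    Complex.ofRealCLM_apply, ContinuousLinearMap.coe_snd', Prod.snd_add, Prod.smul_snd,
    omega_add_left, omega_smul_left, omegaL_apply]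
  rw [omega_swap k ξ.2]
  push_cast
  ring

/-- The connection form along `d` and the derivative of the phase each contribute `iπk⟨A₁, d⟩`. -/
lemma hasDerivAt_magTrans (d : V) (f : Fam E k Λ) (s : ℝ) (x : E × (V × V)) :
    HasDerivAt (fun s => magTrans k d f.1 s x) (magTrans k d (opV d f).1 s x +
      Complex.I * (2 * Real.pi * k * ⟪x.2.1, d⟫_ℝ : ℝ) * magTrans k d f.1 s x) s := by
  have h1 : HasDerivAt (fun s : ℝ => x + s • ((0 : E), ((0 : V), d))) (0, (0, d)) s := by
    simpa using ((hasDerivAt_id s).smul_const ((0 : E), ((0 : V), d))).const_add x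
  have h2 := (f.differentiableAt (x + s • (0, (0, d)))).hasFDerivAt.comp_hasDerivAt s h1
  have h3 : HasDerivAt (fun s : ℝ => ((Real.pi * k * s * ⟪x.2.1, d⟫_ℝ : ℝ) : ℂ))
      ((Real.pi * k * ⟪x.2.1, d⟫_ℝ : ℝ) : ℂ) s := by
    have := (((hasDerivAt_id s).const_mul (Real.pi * k)).mul_const ⟪x.2.1, d⟫_ℝ).ofReal_comp
    simpa using this
  refine (h2.mul (h3.const_mul Complex.I).cexp).congr_deriv ?_
  simp only [magTrans, opV, nab_coe, nabF, Prod.snd_add, Prod.smul_snd, omega,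
    inner_zero_left, Function.comp_apply, Prod.fst_add, Prod.smul_fst, smul_zero, add_zero]
  push_cast
  ring

/-- Compared with `f` itself there is an additional character in `s`; it will shift the index of the
Fourier modes. -/
lemma magTrans_apply_add (d : V) (f : Fam E k Λ) (s : ℝ) {l₁ l₂ : V} (h₁ : l₁ ∈ Λ) (h₂ : l₂ ∈ Λ)
    (p : E) (A : V × V) : magTrans k d f.1 s (p, A + (l₁, l₂)) = multiplier k (l₁, l₂) A *
      Complex.exp (Complex.I * (2 * Real.pi * k * s * ⟪l₁, d⟫_ℝ : ℝ)) *
        magTrans k d f.1 s (p, A) := by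
  have h3 : ((p, A + (l₁, l₂)) : E × (V × V)) + s • (0, (0, d)) =
      (p, (A + s • (0, d)) + (l₁, l₂)) := by
    ext <;> simp [add_right_comm]
  have h4 : ((p, A) : E × (V × V)) + s • (0, (0, d)) = (p, A + s • (0, d)) := by simp
  have h5 : multiplier k (l₁, l₂) (A + s • (0, d)) = multiplier k (l₁, l₂) A *
      Complex.exp (Complex.I * (Real.pi * k * s * ⟪l₁, d⟫_ℝ : ℝ)) := by
    simp only [multiplier, ← Complex.exp_add]
    congr 1
    simp only [omega, Prod.snd_add, Prod.fst_add, Prod.smul_fst, Prod.smul_snd, smul_zero,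
      add_zero, inner_add_right, inner_smul_right]
    push_cast
    ring
  have h6 : Complex.exp (Complex.I * (Real.pi * k * s * ⟪(A + (l₁, l₂)).1, d⟫_ℝ : ℝ)) =
      Complex.exp (Complex.I * (Real.pi * k * s * ⟪A.1, d⟫_ℝ : ℝ)) *
      Complex.exp (Complex.I * (Real.pi * k * s * ⟪l₁, d⟫_ℝ : ℝ)) := by
    rw [← Complex.exp_add]
    congr 1
    simp only [Prod.fst_add, inner_add_left]
    push_cast
    ring
  have h7 : Complex.exp (Complex.I * (2 * Real.pi * k * s * ⟪l₁, d⟫_ℝ : ℝ)) =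
      Complex.exp (Complex.I * (Real.pi * k * s * ⟪l₁, d⟫_ℝ : ℝ)) *
      Complex.exp (Complex.I * (Real.pi * k * s * ⟪l₁, d⟫_ℝ : ℝ)) := by
    rw [← Complex.exp_add]
    congr 1
    push_cast
    ring
  rw [magTrans, magTrans, h3, h4, f.apply_add h₁ h₂, h5, h7]
  simp only [h6]
  ring

/-- For a lattice vector `d` the multiplier of the shift by `d` is undone by the phase. This
periodicity is what allows a Fourier series in `s`. -/
lemma magTrans_add_one {d : V} (hd : d ∈ Λ) (f : Fam E k Λ) (s : ℝ) (x : E × (V × V)) :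
    magTrans k d f.1 (s + 1) x = magTrans k d f.1 s x := by
  have h1 : x + (s + 1) • ((0 : E), ((0 : V), d)) =
      (x.1, (x.2 + s • (0, d)) + (0, d)) := by
    ext <;> simp [add_smul, add_assoc]
  have h2 : x + s • ((0 : E), ((0 : V), d)) = (x.1, x.2 + s • (0, d)) := by
    ext <;> simp
  rw [magTrans, h1, f.apply_add Λ.zero_mem hd, magTrans, h2, multiplier]
  simp only [omega, Prod.fst_add, Prod.smul_fst, smul_zero, add_zero, inner_zero_left, mul_zero,
    Complex.ofReal_zero, Complex.exp_zero, one_mul, sub_zero]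
  rw [mul_comm (Complex.exp _) (f.1 _), mul_assoc, ← Complex.exp_add]
  congr 2
  push_cast
  ring

/-- The Fourier coefficients of a section in the direction `d` of the second factor. -/
def fcoef (k : ℕ) (d : V) (f : E × (V × V) → ℂ) (m : ℤ) (x : E × (V × V)) : ℂ :=
  ∫ s in (0 : ℝ)..1, magTrans k d f s x * Complex.exp (-(2 * Real.pi * Complex.I * m * s))

lemma contDiff_fcoef_integrand (d : V) (f : Fam E k Λ) (m : ℤ) :
    ContDiff ℝ ∞ fun z : ℝ × (E × (V × V)) => magTrans k d f.1 z.1 z.2 *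
      Complex.exp (-(2 * Real.pi * Complex.I * m * z.1)) :=
  (contDiff_magTrans d f).mul
    (contDiff_const.mul (Complex.ofRealCLM.contDiff.comp contDiff_fst)).neg.cexp

lemma intervalIntegrable_fcoef (d : V) (f : Fam E k Λ) (m : ℤ) (x : E × (V × V)) :
    IntervalIntegrable (fun s : ℝ => magTrans k d f.1 s x *
      Complex.exp (-(2 * Real.pi * Complex.I * m * s))) volume 0 1 :=
  ((contDiff_fcoef_integrand d f m).continuous.comp
    (Continuous.prodMk_left x)).intervalIntegrable _ _

lemma differentiable_fcoef [FiniteDimensional ℝ E] [FiniteDimensional ℝ V] (d : V) (f : Fam E k Λ)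
    (m : ℤ) : Differentiable ℝ (fcoef k d f.1 m) := fun x =>
  (hasFDerivAt_intervalIntegral_of_contDiff (contDiff_fcoef_integrand d f m) x).differentiableAt

lemma nabF_fcoef [FiniteDimensional ℝ E] [FiniteDimensional ℝ V] (d : V) (f : Fam E k Λ) (m : ℤ)
    (ξ : E × (V × V)) : nabF k ξ (fcoef k d f.1 m) = fcoef k d (nab ξ f).1 m := by
  ext x
  have h1 := fderiv_intervalIntegral_apply (contDiff_fcoef_integrand d f m) x ξ
  have h2 : fderiv ℝ (fcoef k d f.1 m) x ξ = _ := h1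
  rw [nabF, h2, fcoef, fcoef, ← intervalIntegral.integral_const_mul,
    ← intervalIntegral.integral_sub]
  · refine intervalIntegral.integral_congr fun s _ => ?_
    have h3 : DifferentiableAt ℝ (magTrans k d f.1 s) x :=
      (((contDiff_magTrans d f).comp (contDiff_const.prodMk contDiff_id)).differentiable
        (by simp)).differentiableAt
    simp only [← nabF_magTrans, nabF]
    rw [fderiv_mul_const h3]
    simp only [smul_apply, smul_eq_mul]
    ring
  · have h3 : Continuous fun z : ℝ × (E × (V × V)) => fderiv ℝ (fun x => magTrans k d f.1 z.1 x *
        Complex.exp (-(2 * Real.pi * Complex.I * m * z.1))) z.2 ξ := by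
      have h4 : ∀ z : ℝ × (E × (V × V)), fderiv ℝ (fun x => magTrans k d f.1 z.1 x *
        Complex.exp (-(2 * Real.pi * Complex.I * m * z.1))) z.2 ξ =
          (magTrans k d (nab ξ f).1 z.1 z.2 + Complex.I / 2 * (omega k z.2.2 ξ.2 : ℂ) *
            magTrans k d f.1 z.1 z.2) * Complex.exp (-(2 * Real.pi * Complex.I * m * z.1)) := by
        intro z
        have h3 : DifferentiableAt ℝ (magTrans k d f.1 z.1) z.2 :=
          (((contDiff_magTrans d f).comp (contDiff_const.prodMk contDiff_id)).differentiable
            (by simp)).differentiableAt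
        rw [fderiv_mul_const h3, ← nabF_magTrans, ← fderiv_eq_nabF]
        simp [mul_comm]
      simp only [h4]
      refine Continuous.mul (Continuous.add (contDiff_magTrans d _).continuous
        (Continuous.mul (Continuous.mul continuous_const
          ((contDiff_omega (E := E) k ξ.2).continuous.comp continuous_snd))
          (contDiff_magTrans d f).continuous)) ?_
      fun_prop
    exact (h3.comp (Continuous.prodMk_left x)).intervalIntegrable _ _
  · exact (intervalIntegrable_fcoef d f m x).const_mul _

/-- The eigenvalue of `opV d` on the `m`-th Fourier mode. -/
def freq (k : ℕ) (d : V) (m : ℤ) (A : V × V) : ℝ := 2 * Real.pi * (m - k * ⟪A.1, d⟫_ℝ)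

/-- Integrate the `s`-derivative of the integrand over one period: the boundary terms agree by
periodicity. Thus `opV d` acts diagonally on the modes. -/
lemma fcoef_opV {d : V} (hd : d ∈ Λ) (f : Fam E k Λ) (m : ℤ) (x : E × (V × V)) :
    fcoef k d (opV d f).1 m x = Complex.I * freq k d m x.2 * fcoef k d f.1 m x := by
  have h1 : ∀ s : ℝ, HasDerivAt (fun s : ℝ => magTrans k d f.1 s x *
      Complex.exp (-(2 * Real.pi * Complex.I * m * s)))
      (magTrans k d (opV d f).1 s x * Complex.exp (-(2 * Real.pi * Complex.I * m * s)) -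
        Complex.I * freq k d m x.2 *
        (magTrans k d f.1 s x * Complex.exp (-(2 * Real.pi * Complex.I * m * s)))) s := by
    intro s
    have h2 : HasDerivAt (fun s : ℝ => -(2 * Real.pi * Complex.I * m * (s : ℂ)))
        (-(2 * Real.pi * Complex.I * m)) s := by
      simpa [Pi.neg_def] using ((Complex.ofRealCLM.hasDerivAt (x := s)).const_mul
        (2 * Real.pi * Complex.I * m : ℂ)).neg
    refine ((hasDerivAt_magTrans d f s x).mul h2.cexp).congr_deriv ?_
    rw [freq]
    push_cast
    ring
  have hi := (intervalIntegrable_fcoef d (opV d f) m x).sub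
    ((intervalIntegrable_fcoef d f m x).const_mul (Complex.I * freq k d m x.2))
  have h3 := intervalIntegral.integral_eq_sub_of_hasDerivAt (fun s _ => h1 s) hi
  rw [intervalIntegral.integral_sub (intervalIntegrable_fcoef d (opV d f) m x)
    ((intervalIntegrable_fcoef d f m x).const_mul (Complex.I * freq k d m x.2)),
    intervalIntegral.integral_const_mul] at h3
  have h4 : magTrans k d f.1 1 x = magTrans k d f.1 0 x := by
    simpa using magTrans_add_one hd f 0 x
  have h5 : Complex.exp (-(2 * Real.pi * Complex.I * m * ((1 : ℝ) : ℂ))) = 1 := by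
    rw [Complex.exp_eq_one_iff]
    exact ⟨-m, by push_cast; ring⟩
  rw [h4, h5] at h3
  simp only [Complex.ofReal_zero, mul_zero, neg_zero, Complex.exp_zero, sub_self] at h3
  exact sub_eq_zero.1 h3

/-- The character found in `magTrans_apply_add` is absorbed into the mode index; this uses that
`k⟨l₁, d⟩` is an integer. -/
lemma fcoef_apply_add {d : V} (f : Fam E k Λ) (m : ℤ) {l₁ l₂ : V} (h₁ : l₁ ∈ Λ)
    (h₂ : l₂ ∈ Λ) (p : E) (A : V × V) {j : ℤ} (hj : k * ⟪l₁, d⟫_ℝ = j) :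
    fcoef k d f.1 m (p, A + (l₁, l₂)) =
      multiplier k (l₁, l₂) A * fcoef k d f.1 (m - j) (p, A) := by
  rw [fcoef, fcoef, ← intervalIntegral.integral_const_mul]
  refine intervalIntegral.integral_congr fun s _ => ?_
  simp only [magTrans_apply_add d f s h₁ h₂]
  have h1 : Complex.exp (Complex.I * (2 * Real.pi * k * s * ⟪l₁, d⟫_ℝ : ℝ)) *
      Complex.exp (-(2 * Real.pi * Complex.I * m * s)) =
      Complex.exp (-(2 * Real.pi * Complex.I * (m - j : ℤ) * s)) := by
    rw [← Complex.exp_add,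
      show 2 * Real.pi * k * s * ⟪l₁, d⟫_ℝ = 2 * Real.pi * s * (k * ⟪l₁, d⟫_ℝ) by ring, hj]
    congr 1
    push_cast
    ring
  rw [← h1]
  ring

lemma freq_add (d : V) (m : ℤ) (l₁ l₂ : V) (A : V × V) {j : ℤ} (hj : k * ⟪l₁, d⟫_ℝ = j) :
    freq k d m (A + (l₁, l₂)) = freq k d (m - j) A := by
  rw [freq, freq, Prod.fst_add, inner_add_left, mul_add, hj]
  push_cast
  ring

lemma norm_magTrans (d : V) (f : E × (V × V) → ℂ) (s : ℝ) (x : E × (V × V)) :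
    ‖magTrans k d f s x‖ = ‖f (x + s • (0, (0, d)))‖ := by
  rw [magTrans, norm_mul, Complex.norm_exp]
  simp

/-- The coefficients of `f - ∇_d² f` are those of `f` times `1 + freq²`, and they are bounded on
balls. Quadratic decay in `m` is summable, and applies equally to all covariant derivatives of `f`.
-/
lemma exists_norm_fcoef_le [FiniteDimensional ℝ E] [FiniteDimensional ℝ V] {d : V} (hd : d ∈ Λ)
    (f : Fam E k Λ) (R : ℝ) :
    ∃ C : ℝ, ∀ (m : ℤ) (x : E × (V × V)), ‖x‖ < R → ‖fcoef k d f.1 m x‖ ≤ C * (1 + (m : ℝ) ^ 2)⁻¹ := by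
  set g := f - opV d (opV d f) with hg
  have hK : IsCompact (Metric.closedBall (0 : E × (V × V)) (|R| + ‖d‖)) := isCompact_closedBall _ _
  obtain ⟨C, hC⟩ := hK.exists_bound_of_continuousOn g.contDiff.continuous.continuousOn
  set q := k * (|R| * ‖d‖) with hq
  refine ⟨C * (2 * (1 + q ^ 2)), fun m x hx => ?_⟩
  have hxR : ‖x‖ < |R| := hx.trans_le (le_abs_self R)
  have h1 : ‖fcoef k d g.1 m x‖ ≤ C := by
    have : ‖fcoef k d g.1 m x‖ ≤ C * |1 - 0| := by
      refine intervalIntegral.norm_integral_le_of_norm_le_const fun s hs => ?_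
      rw [Set.uIoc_of_le zero_le_one] at hs
      rw [norm_mul, norm_magTrans, Complex.norm_exp]
      have : (-(2 * Real.pi * Complex.I * m * s) : ℂ).re = 0 := by simp
      rw [this, Real.exp_zero, mul_one]
      refine hC _ ?_
      rw [mem_closedBall_zero_iff]
      refine (norm_add_le _ _).trans (add_le_add hxR.le ?_)
      rw [norm_smul, Real.norm_eq_abs, abs_of_pos hs.1]
      have : ‖((0 : E), ((0 : V), d))‖ = ‖d‖ := by simp [Prod.norm_def]
      rw [this]
      exact mul_le_of_le_one_left (norm_nonneg _) hs.2
    simpa using this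
  have h2 : fcoef k d g.1 m x = (1 + freq k d m x.2 ^ 2 : ℝ) * fcoef k d f.1 m x := by
    have h3 : fcoef k d g.1 m x = fcoef k d f.1 m x - fcoef k d (opV d (opV d f)).1 m x := by
      rw [fcoef, fcoef, fcoef, ← intervalIntegral.integral_sub (intervalIntegrable_fcoef _ _ _ _)
        (intervalIntegrable_fcoef _ _ _ _)]
      refine intervalIntegral.integral_congr fun s _ => ?_
      simp only [magTrans, hg, Fam.sub_val]
      ring
    rw [h3, fcoef_opV hd, fcoef_opV hd]
    push_cast
    linear_combination (freq k d m x.2 : ℂ) ^ 2 * fcoef k d f.1 m x * (-Complex.I_sq)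
  rw [h2, norm_mul, Complex.norm_real, Real.norm_eq_abs, abs_of_pos (by positivity)] at h1
  have hin : |(k : ℝ) * ⟪x.2.1, d⟫_ℝ| ≤ q := by
    rw [abs_mul, Nat.abs_cast, hq]
    refine mul_le_mul_of_nonneg_left ?_ (Nat.cast_nonneg _)
    refine (abs_real_inner_le_norm _ _).trans (mul_le_mul_of_nonneg_right ?_ (norm_nonneg _))
    exact ((norm_fst_le _).trans (norm_snd_le _)).trans hxR.le
  set c := (k : ℝ) * ⟪x.2.1, d⟫_ℝ with hc
  -- With `c = k⟨A₁, d⟩`, bounded by `q` on the ball: `m² ≤ 2(m - c)² + 2c²`, and `(m - c)² ≤ freq²`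
  -- because `2π ≥ 1`.
  have h4 : (1 + (m : ℝ) ^ 2) ≤ 2 * (1 + q ^ 2) * (1 + freq k d m x.2 ^ 2) := by
    have h5 : c ^ 2 ≤ q ^ 2 := sq_le_sq.2 (hin.trans (le_abs_self _))
    have h6 : (m - c) ^ 2 ≤ freq k d m x.2 ^ 2 := by
      rw [freq, ← hc, mul_pow]
      have : (1 : ℝ) ≤ (2 * Real.pi) ^ 2 := by nlinarith [Real.pi_gt_three]
      nlinarith [sq_nonneg ((m : ℝ) - c)]
    nlinarith [sq_nonneg ((m : ℝ) - 2 * c), mul_nonneg (sq_nonneg q) (sq_nonneg (freq k d m x.2))]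
  rw [← div_eq_mul_inv, le_div_iff₀ (by positivity)]
  calc ‖fcoef k d f.1 m x‖ * (1 + (m : ℝ) ^ 2)
      ≤ ‖fcoef k d f.1 m x‖ * (2 * (1 + q ^ 2) * (1 + freq k d m x.2 ^ 2)) := by gcongr
    _ = ((1 + freq k d m x.2 ^ 2) * ‖fcoef k d f.1 m x‖) * (2 * (1 + q ^ 2)) := by ring
    _ ≤ C * (2 * (1 + q ^ 2)) := by gcongr

lemma summable_one_add_sq_inv : Summable fun m : ℤ => (1 + (m : ℝ) ^ 2)⁻¹ := by
  refine Summable.of_norm_bounded_eventually (g := fun m : ℤ => 1 / (m : ℝ) ^ 2)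
    (Real.summable_one_div_int_pow.2 one_lt_two) ?_
  refine (Set.finite_singleton (0 : ℤ)).subset fun m hm => ?_
  by_contra h0
  refine hm ?_
  have : (0 : ℝ) < (m : ℝ) ^ 2 := by
    have : (m : ℝ) ≠ 0 := by simpa using h0
    positivity
  change ‖(1 + (m : ℝ) ^ 2)⁻¹‖ ≤ 1 / (m : ℝ) ^ 2
  rw [Real.norm_eq_abs, abs_of_pos (by positivity), one_div]
  exact inv_anti₀ this (by linarith)

/-- Fourier inversion for the periodic function `s ↦ magTrans`, evaluated at `s = 0`, where it
equals `f`. -/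
lemma tsum_fcoef [FiniteDimensional ℝ E] [FiniteDimensional ℝ V] {d : V} (hd : d ∈ Λ)
    (f : Fam E k Λ) (x : E × (V × V)) : ∑' m, fcoef k d f.1 m x = f.1 x := by
  have hp : Function.Periodic (fun s => magTrans k d f.1 s x) 1 := fun s => magTrans_add_one hd f s x
  have hcont : Continuous fun s => magTrans k d f.1 s x :=
    (contDiff_magTrans d f).continuous.comp (Continuous.prodMk_left x)
  let g : C(AddCircle (1 : ℝ), ℂ) := ⟨hp.lift, continuous_coinduced_dom.2 hcont⟩
  have hco : ∀ m, fourierCoeff g m = fcoef k d f.1 m x := by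
    intro m
    rw [fourierCoeff_eq_intervalIntegral _ m 0, fcoef]
    simp only [zero_add, div_one, one_smul]
    refine intervalIntegral.integral_congr fun s _ => ?_
    have h1 : g (s : AddCircle (1 : ℝ)) = magTrans k d f.1 s x := hp.lift_coe s
    simp only [h1, fourier_coe_apply, smul_eq_mul]
    rw [mul_comm]
    congr 2
    push_cast
    ring
  obtain ⟨C, hC⟩ := exists_norm_fcoef_le hd f (‖x‖ + 1)
  have hs : Summable (fourierCoeff g) := by
    refine .of_norm_bounded (summable_one_add_sq_inv.mul_left C) fun m => ?_
    rw [hco]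
    exact hC m x (by linarith)
  have h2 := (has_pointwise_sum_fourier_series_of_summable hs (((0 : ℝ) : AddCircle (1 : ℝ)))).tsum_eq
  have h3 : g ((0 : ℝ) : AddCircle (1 : ℝ)) = magTrans k d f.1 0 x := hp.lift_coe 0
  have h4 : magTrans k d f.1 0 x = f.1 x := by simp [magTrans]
  rw [← h4, ← h3, ← h2]
  refine tsum_congr fun m => ?_
  rw [hco, fourier_coe_apply]
  simp

end Fourier

/-! ### Pullbacks and flows of families -/

section Pullback

variable {V : Type*} [NormedAddCommGroup V] [InnerProductSpace ℝ V]
  {E : Type*} [NormedAddCommGroup E] [NormedSpace ℝ E]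
  {E' : Type*} [NormedAddCommGroup E'] [NormedSpace ℝ E'] {k n : ℕ} {Λ : Submodule ℤ V}

/-- The pullback of a family along a smooth map of parameter spaces. -/
def pull (g : E' → E) (hg : ContDiff ℝ ∞ g) : Fam E k Λ →ₗ[ℂ] Fam E' k Λ where
  toFun f := ⟨fun x => f.1 (g x.1, x.2), f.contDiff.comp ((hg.comp contDiff_fst).prodMk contDiff_snd),
    fun _ h₁ _ h₂ p A => f.apply_add h₁ h₂ (g p) A⟩
  map_add' _ _ := rfl
  map_smul' _ _ := rfl

lemma pull_apply {g : E' → E} (hg : ContDiff ℝ ∞ g) (f : Fam E k Λ) (p : E') (A : V × V) :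
    (pull g hg f).1 (p, A) = f.1 (g p, A) := rfl

lemma nab_pull_apply {g : E' → E} (hg : ContDiff ℝ ∞ g) (f : Fam E k Λ) (x : E') (X : V × V)
    (p : E') (A : V × V) :
    (nab (x, X) (pull g hg f)).1 (p, A) = (nab (fderiv ℝ g p x, X) f).1 (g p, A) := by
  have h1 : HasFDerivAt (fun x : E' × (V × V) => (g x.1, x.2))
      (((fderiv ℝ g p).comp (ContinuousLinearMap.fst ℝ E' (V × V))).prod
        (ContinuousLinearMap.snd ℝ E' (V × V))) (p, A) :=
    (((hg.differentiable (by simp)) p).hasFDerivAt.comp (p, A) hasFDerivAt_fst).prodMk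
      hasFDerivAt_snd
  have h2 : fderiv ℝ (pull g hg f).1 (p, A) = _ :=
    ((f.differentiableAt (g p, A)).hasFDerivAt.comp (p, A) h1).fderiv
  rw [nab_coe, nab_coe, nabF, nabF, h2]
  simp [pull_apply]

lemma nab_zero_pull {g : E' → E} (hg : ContDiff ℝ ∞ g) (f : Fam E k Λ) (X : V × V) :
    nab (0, X) (pull g hg f) = pull g hg (nab (0, X) f) := by
  ext ⟨p, A⟩
  rw [nab_pull_apply, pull_apply, map_zero]

variable (e : OrthonormalBasis (Fin n) ℝ V)

lemma Lu_pull {g : E' → E} (hg : ContDiff ℝ ∞ g) (f : Fam E k Λ) :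
    Lu e (pull g hg f) = pull g hg (Lu e f) := by
  simp only [Lu, LinearMap.sum_apply, Module.End.mul_apply, opU, nab_zero_pull, map_sum]

lemma Lv_pull {g : E' → E} (hg : ContDiff ℝ ∞ g) (f : Fam E k Λ) :
    Lv e (pull g hg f) = pull g hg (Lv e f) := by
  simp only [Lv, LinearMap.sum_apply, Module.End.mul_apply, opV, nab_zero_pull, map_sum]

lemma Luv_pull {g : E' → E} (hg : ContDiff ℝ ∞ g) (f : Fam E k Λ) :
    Luv e (pull g hg f) = pull g hg (Luv e f) := by
  simp only [Luv, LinearMap.sum_apply, Module.End.mul_apply, opV, opU, nab_zero_pull, map_sum,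
    LinearMap.add_apply, map_add]

/-- Invariance of the multipliers under the row action of `SL(2, ℤ)`. -/
def IsRowInvariant (k : ℕ) (Λ : Submodule ℤ V) : Prop :=
  ∀ (φ : SL(2, ℤ)), ∀ l₁ ∈ Λ, ∀ l₂ ∈ Λ, ∀ A : V × V,
    multiplier k (rowAction φ (l₁, l₂)) (rowAction φ A) = multiplier k (l₁, l₂) A

/-- The row action as a continuous linear map. -/
def rowL (φ : SL(2, ℤ)) : V × V →L[ℝ] V × V :=
  ((φ 0 0 : ℝ) • ContinuousLinearMap.fst ℝ V V + (φ 1 0 : ℝ) • ContinuousLinearMap.snd ℝ V V).prod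
    ((φ 0 1 : ℝ) • ContinuousLinearMap.fst ℝ V V + (φ 1 1 : ℝ) • ContinuousLinearMap.snd ℝ V V)

lemma rowL_apply (φ : SL(2, ℤ)) (A : V × V) : rowL φ A = rowAction φ A := by
  simp [rowL, rowAction, Int.cast_smul_eq_zsmul]

/-- Substitution of the row action in a family. -/
def rho (hΛ : IsRowInvariant k Λ) (φ : SL(2, ℤ)) : Fam E k Λ →ₗ[ℂ] Fam E k Λ where
  toFun f := ⟨fun x => f.1 (x.1, rowAction φ x.2), by
      simp only [← rowL_apply]
      have h : ContDiff ℝ ∞ fun x : E × (V × V) => rowL φ x.2 :=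
        (rowL (V := V) φ).contDiff.comp (contDiff_snd (E := E))
      exact f.contDiff.comp (contDiff_fst.prodMk h),
    fun l₁ h₁ l₂ h₂ p A => by
      rw [← hΛ φ l₁ h₁ l₂ h₂ A]
      simp only [← rowL_apply, map_add]
      rw [rowL_apply φ (l₁, l₂)]
      exact f.apply_add (Λ.add_mem (Λ.smul_mem _ h₁) (Λ.smul_mem _ h₂))
        (Λ.add_mem (Λ.smul_mem _ h₁) (Λ.smul_mem _ h₂)) _ _⟩
  map_add' _ _ := rfl
  map_smul' _ _ := rfl

lemma rho_apply (hΛ : IsRowInvariant k Λ) (φ : SL(2, ℤ)) (f : Fam E k Λ) (p : E) (A : V × V) :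
    (rho hΛ φ f).1 (p, A) = f.1 (p, rowAction φ A) := rfl

/-- Holds because the row action is linear and preserves `ω`, hence also the connection form. -/
lemma nab_rho (hΛ : IsRowInvariant k Λ) (φ : SL(2, ℤ)) (f : Fam E k Λ) (x : E) (X : V × V) :
    nab (x, X) (rho hΛ φ f) = rho hΛ φ (nab (x, rowAction φ X) f) := by
  ext ⟨p, A⟩
  have h1 : HasFDerivAt (fun x : E × (V × V) => (x.1, rowAction φ x.2))
      ((ContinuousLinearMap.fst ℝ E (V × V)).prod ((rowL φ).comp
        (ContinuousLinearMap.snd ℝ E (V × V)))) (p, A) := by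
    simp only [← rowL_apply]
    exact ((ContinuousLinearMap.fst ℝ E (V × V)).prod ((rowL φ).comp
        (ContinuousLinearMap.snd ℝ E (V × V)))).hasFDerivAt
  have h2 : fderiv ℝ (rho hΛ φ f).1 (p, A) = _ :=
    ((f.differentiableAt (p, rowAction φ A)).hasFDerivAt.comp (p, A) h1).fderiv
  rw [rho_apply, nab_coe, nab_coe, nabF, nabF, h2]
  simp [rho_apply, omega_rowAction, rowL_apply]

lemma opU_rho (hΛ : IsRowInvariant k Λ) (φ : SL(2, ℤ)) (f : Fam E k Λ) (x : V) :
    opU x (rho hΛ φ f) =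
      rho hΛ φ ((φ 0 0 : ℂ) • opU x f + (φ 0 1 : ℂ) • opV x f) := by
  rw [opU, nab_rho]
  have h : ((0 : E), rowAction φ (x, (0 : V))) =
      ((φ 0 0 : ℝ) • ((0 : E), (x, (0 : V))) + (φ 0 1 : ℝ) • ((0 : E), ((0 : V), x))) := by
    simp [rowAction, Int.cast_smul_eq_zsmul]
  rw [h, nab_add, nab_smul, nab_smul]
  simp [opV]

lemma opV_rho (hΛ : IsRowInvariant k Λ) (φ : SL(2, ℤ)) (f : Fam E k Λ) (x : V) :
    opV x (rho hΛ φ f) =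
      rho hΛ φ ((φ 1 0 : ℂ) • opU x f + (φ 1 1 : ℂ) • opV x f) := by
  rw [opV, nab_rho]
  have h : ((0 : E), rowAction φ ((0 : V), x)) =
      ((φ 1 0 : ℝ) • ((0 : E), (x, (0 : V))) + (φ 1 1 : ℝ) • ((0 : E), ((0 : V), x))) := by
    simp [rowAction, Int.cast_smul_eq_zsmul]
  rw [h, nab_add, nab_smul, nab_smul]
  simp [opU]

/-- `φ` acts on the pair `(∇_u, ∇_v)` by its matrix, hence on the three quadratic operators by the
symmetric square. Likewise for `Lv_rho` and `Luv_rho`. -/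
lemma Lu_rho (hΛ : IsRowInvariant k Λ) (φ : SL(2, ℤ)) (f : Fam E k Λ) :
    Lu e (rho hΛ φ f) = rho hΛ φ ((φ 0 1 : ℂ) ^ 2 • Lv e f + ((φ 0 0 : ℂ) * φ 0 1) • Luv e f +
      (φ 0 0 : ℂ) ^ 2 • Lu e f) := by
  simp only [Lu, Lv, Luv, LinearMap.sum_apply, Module.End.mul_apply, opU_rho, ← map_sum]
  congr 1
  simp only [LinearMap.add_apply, Finset.smul_sum, ← Finset.sum_add_distrib, map_add, map_smul,
    Module.End.mul_apply]
  refine Finset.sum_congr rfl fun i _ => ?_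
  module

lemma Lv_rho (hΛ : IsRowInvariant k Λ) (φ : SL(2, ℤ)) (f : Fam E k Λ) :
    Lv e (rho hΛ φ f) = rho hΛ φ ((φ 1 1 : ℂ) ^ 2 • Lv e f + ((φ 1 0 : ℂ) * φ 1 1) • Luv e f +
      (φ 1 0 : ℂ) ^ 2 • Lu e f) := by
  simp only [Lu, Lv, Luv, LinearMap.sum_apply, Module.End.mul_apply, opV_rho, ← map_sum]
  congr 1
  simp only [LinearMap.add_apply, Finset.smul_sum, ← Finset.sum_add_distrib, map_add, map_smul,
    Module.End.mul_apply]
  refine Finset.sum_congr rfl fun i _ => ?_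
  module

lemma Luv_rho (hΛ : IsRowInvariant k Λ) (φ : SL(2, ℤ)) (f : Fam E k Λ) :
    Luv e (rho hΛ φ f) = rho hΛ φ ((2 * φ 0 1 * φ 1 1 : ℂ) • Lv e f +
      ((φ 0 0 : ℂ) * φ 1 1 + φ 0 1 * φ 1 0) • Luv e f + (2 * φ 0 0 * φ 1 0 : ℂ) • Lu e f) := by
  simp only [Lu, Lv, Luv, LinearMap.sum_apply, Module.End.mul_apply, LinearMap.add_apply, opV_rho,
    opU_rho, ← map_sum, ← map_add]
  congr 1
  simp only [Finset.smul_sum, ← Finset.sum_add_distrib, map_add, map_smul, smul_add]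
  refine Finset.sum_congr rfl fun i _ => ?_
  module

end Pullback

/-! ### The flow of the square of the covariant derivative along one lattice vector. -/

section LineFlow

variable {V : Type*} [NormedAddCommGroup V] [InnerProductSpace ℝ V]
  {E : Type*} [NormedAddCommGroup E] [NormedSpace ℝ E] {k n : ℕ} {Λ : Submodule ℤ V}

lemma fcoef_add (d : V) (f g : Fam E k Λ) (m : ℤ) (x : E × (V × V)) :
    fcoef k d (f + g).1 m x = fcoef k d f.1 m x + fcoef k d g.1 m x := by
  rw [fcoef, fcoef, fcoef, ← intervalIntegral.integral_add (intervalIntegrable_fcoef _ _ _ _)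
    (intervalIntegrable_fcoef _ _ _ _)]
  refine intervalIntegral.integral_congr fun s _ => ?_
  simp only [magTrans, Fam.add_val]
  ring

lemma fcoef_mulOp (d : V) (f : Fam E k Λ) (c : SmoothFns E) (m : ℤ) (x : E × (V × V)) :
    fcoef k d (mulOp c f).1 m x = c.1 x.1 * fcoef k d f.1 m x := by
  rw [fcoef, fcoef, ← intervalIntegral.integral_const_mul]
  refine intervalIntegral.integral_congr fun s _ => ?_
  simp only [magTrans, mulOp_apply, Prod.fst_add, Prod.smul_fst, smul_zero, add_zero]
  ring

/-- The last parameter. -/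
def lastParam (E : Type*) [NormedAddCommGroup E] [NormedSpace ℝ E] : SmoothFns (E × ℝ) :=
  ⟨fun p => (p.2 : ℂ), (Complex.ofRealCLM.contDiff.comp contDiff_snd :
    ContDiff ℝ ∞ fun p : E × ℝ => (p.2 : ℂ))⟩

lemma lastParam_val (p : E × ℝ) : (lastParam E).1 p = (p.2 : ℂ) := rfl

/-- The terms of the Fourier series of the flow generated by `(opV d)²`. -/
def flowTerm (k : ℕ) (d : V) (f : (E × ℝ) × (V × V) → ℂ) (m : ℤ) (x : (E × ℝ) × (V × V)) : ℂ :=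
  Complex.exp (-(Complex.I * (x.1.2 * freq k d m x.2 ^ 2 : ℝ))) * fcoef k d f m x

/-- The effect of covariant differentiation on `flowTerm`. -/
def flowDir (d : V) (ξ : (E × ℝ) × (V × V)) (f : Fam (E × ℝ) k Λ) : Fam (E × ℝ) k Λ :=
  nab ξ f + (mulOp (algebraMap ℂ _ (Complex.I * ξ.1.2)) (opV d (opV d f)) +
    mulOp ((4 * Real.pi * k * ⟪ξ.2.1, d⟫_ℝ : ℂ) • lastParam E) (opV d f))

lemma hasFDerivAt_flowPhase (d : V) (m : ℤ) (x : (E × ℝ) × (V × V)) :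
    ∃ L : (E × ℝ) × (V × V) →L[ℝ] ℝ, HasFDerivAt (fun x : (E × ℝ) × (V × V) =>
      x.1.2 * freq k d m x.2 ^ 2) L x ∧ ∀ ξ, L ξ = ξ.1.2 * freq k d m x.2 ^ 2 -
        4 * Real.pi * k * ⟪ξ.2.1, d⟫_ℝ * x.1.2 * freq k d m x.2 := by
  have h1 : HasFDerivAt (fun x : (E × ℝ) × (V × V) => x.1.2) ((ContinuousLinearMap.snd ℝ E ℝ).comp
      (ContinuousLinearMap.fst ℝ (E × ℝ) (V × V))) x :=
    ((ContinuousLinearMap.snd ℝ E ℝ).comp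
      (ContinuousLinearMap.fst ℝ (E × ℝ) (V × V))).hasFDerivAt
  have h0 : ∀ x : (E × ℝ) × (V × V), freq k d m x.2 = 2 * Real.pi * m - omegaL k (0, d) x.2 := by
    intro x
    rw [omegaL_apply, omega, freq]
    simp
    ring
  have h2 : HasFDerivAt (fun x : (E × ℝ) × (V × V) => freq k d m x.2)
      (-((omegaL k (0, d)).comp (ContinuousLinearMap.snd ℝ (E × ℝ) (V × V)))) x := by
    simp only [h0]
    exact ((omegaL k (0, d)).comp
      (ContinuousLinearMap.snd ℝ (E × ℝ) (V × V))).hasFDerivAt.const_sub _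
  refine ⟨_, h1.mul (h2.pow 2), fun ξ => ?_⟩
  simp [omegaL_apply, omega]
  ring

variable [FiniteDimensional ℝ E] [FiniteDimensional ℝ V]

omit [FiniteDimensional ℝ E] [FiniteDimensional ℝ V] in
lemma differentiableAt_flowPhase (d : V) (m : ℤ) (x : (E × ℝ) × (V × V)) :
    ∃ L : (E × ℝ) × (V × V) →L[ℝ] ℂ, HasFDerivAt (fun x : (E × ℝ) × (V × V) =>
      Complex.exp (-(Complex.I * (x.1.2 * freq k d m x.2 ^ 2 : ℝ)))) L x ∧
      ∀ ξ, L ξ = Complex.exp (-(Complex.I * (x.1.2 * freq k d m x.2 ^ 2 : ℝ))) *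
        (-(Complex.I * (ξ.1.2 * freq k d m x.2 ^ 2 -
        4 * Real.pi * k * ⟪ξ.2.1, d⟫_ℝ * x.1.2 * freq k d m x.2 : ℝ))) := by
  obtain ⟨L, hL, hLξ⟩ := hasFDerivAt_flowPhase (E := E) (k := k) d m x
  have h1 := ((Complex.ofRealCLM.hasFDerivAt.comp x hL).const_mul Complex.I).neg.cexp
  refine ⟨_, h1, fun ξ => ?_⟩
  simp [hLξ]

/-- Differentiating the phase brings down `freq²` and `freq`, and by `fcoef_opV` multiplication of a
mode by `i freq` is the effect of `opV d`. So the terms form a system closed under covariant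
differentiation. -/
lemma nabF_flowTerm {d : V} (hd : d ∈ Λ) (f : Fam (E × ℝ) k Λ) (m : ℤ)
    (ξ : (E × ℝ) × (V × V)) :
    nabF k ξ (flowTerm k d f.1 m) = flowTerm k d (flowDir d ξ f).1 m := by
  ext x
  obtain ⟨L, hL, hLξ⟩ := differentiableAt_flowPhase (E := E) (k := k) d m x
  have h3 : fderiv ℝ (flowTerm k d f.1 m) x = _ :=
    (hL.mul (differentiable_fcoef d f m x).hasFDerivAt).fderiv
  rw [nabF, h3, flowTerm, flowTerm, flowDir, fcoef_add, fcoef_add, fcoef_mulOp, fcoef_mulOp,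
    fcoef_opV hd, fcoef_opV hd, ← nabF_fcoef, nabF]
  simp only [add_apply, smul_apply, smul_eq_mul, hLξ, SmoothFns.algebraMap_val,
    SmoothFns.smul_val, lastParam_val]
  push_cast
  linear_combination (-Complex.exp (-(Complex.I * (x.1.2 * freq k d m x.2 ^ 2 : ℂ))) *
    fcoef k d f.1 m x * Complex.I * ξ.1.2 * freq k d m x.2 ^ 2) * Complex.I_sq

lemma differentiable_flowTerm (d : V) (f : Fam (E × ℝ) k Λ) (m : ℤ) :
    Differentiable ℝ (flowTerm k d f.1 m) := fun x => by
  obtain ⟨L, hL, -⟩ := differentiableAt_flowPhase (E := E) (k := k) d m x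
  exact hL.differentiableAt.mul (differentiable_fcoef d f m x)

omit [FiniteDimensional ℝ E] [FiniteDimensional ℝ V] in
lemma norm_flowTerm (d : V) (f : Fam (E × ℝ) k Λ) (m : ℤ) (x : (E × ℝ) × (V × V)) :
    ‖flowTerm k d f.1 m x‖ = ‖fcoef k d f.1 m x‖ := by
  rw [flowTerm, norm_mul, Complex.norm_exp]
  simp only [Complex.neg_re, Complex.I_mul_re, Complex.ofReal_im, neg_zero, Real.exp_zero, one_mul]

/-- Integrality of the lattice. -/
def IsIntegralLattice (Λ : Submodule ℤ V) : Prop :=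
  ∀ x ∈ Λ, ∀ y ∈ Λ, ∃ m : ℤ, ⟪x, y⟫_ℝ = m

/-- The phases are unimodular, so the terms obey the bounds of the Fourier coefficients and
`tsum_nabF_closed` applies. -/
lemma tsum_flowTerm_spec {d : V} (hd : d ∈ Λ) (f : Fam (E × ℝ) k Λ) :
    ContDiff ℝ ∞ (fun x => ∑' m, flowTerm k d f.1 m x) ∧
      ∀ ξ, nabF k ξ (fun x => ∑' m, flowTerm k d f.1 m x) =
        fun x => ∑' m, flowTerm k d (flowDir d ξ f).1 m x := by
  refine tsum_nabF_closed (J := Fam (E × ℝ) k Λ) (fun f m => flowTerm k d f.1 m) (flowDir d)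
    (fun f m => differentiable_flowTerm d f m) (fun ξ f m => nabF_flowTerm hd f m ξ)
    (fun f R => ?_) f
  obtain ⟨C, hC⟩ := exists_norm_fcoef_le hd f R
  exact ⟨_, summable_one_add_sq_inv.mul_left C, fun m x hx => (norm_flowTerm d f m x).trans_le
    (hC m x hx)⟩

/-- The flow generated by `(opV d)²`. -/
def lineFlow (hΛ : IsIntegralLattice Λ) {d : V} (hd : d ∈ Λ) (f : Fam (E × ℝ) k Λ) :
    Fam (E × ℝ) k Λ :=
  ⟨fun x => ∑' m, flowTerm k d f.1 m x, (tsum_flowTerm_spec hd f).1, fun l₁ h₁ l₂ h₂ p A => by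
    -- By integrality a lattice translation moves mode `m` to mode `m - kj`, together with its
    -- frequency; it only permutes the terms of the series.
    obtain ⟨j, hj⟩ := hΛ l₁ h₁ d hd
    have hj' : k * ⟪l₁, d⟫_ℝ = (k * j : ℤ) := by rw [hj]; push_cast; ring
    have : ∀ m, flowTerm k d f.1 m (p, A + (l₁, l₂)) =
        multiplier k (l₁, l₂) A * flowTerm k d f.1 (m - k * j) (p, A) := by
      intro m
      rw [flowTerm, flowTerm, fcoef_apply_add f m h₁ h₂ p A hj']
      simp only [freq_add d m l₁ l₂ A hj']
      ring
    simp only [this, tsum_mul_left]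
    congr 1
    exact (Equiv.subRight (k * j : ℤ)).tsum_eq fun m => flowTerm k d f.1 m (p, A)⟩

lemma exists_lineFlow (hΛ : IsIntegralLattice Λ) {d : V} (hd : d ∈ Λ) (f : Fam E k Λ) :
    ∃ G : Fam (E × ℝ) k Λ, (∀ p A, G.1 ((p, 0), A) = f.1 (p, A)) ∧
      nab ((0, 1), 0) G = Complex.I • opV d (opV d G) := by
  set f' : Fam (E × ℝ) k Λ := pull Prod.fst contDiff_fst f with hf'
  refine ⟨lineFlow hΛ hd f', fun p A => ?_, ?_⟩
  · have h1 := tsum_fcoef hd f' ((p, 0), A)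
    rw [hf', pull_apply] at h1
    rw [← h1]
    exact tsum_congr fun m => by simp [flowTerm, hf']
  · have key : ∀ (f : Fam (E × ℝ) k Λ) (ξ : (E × ℝ) × (V × V)),
        nab ξ (lineFlow hΛ hd f) = lineFlow hΛ hd (flowDir d ξ f) := fun f ξ =>
      Subtype.ext ((tsum_flowTerm_spec hd f).2 ξ)
    have hV : ∀ f : Fam (E × ℝ) k Λ, opV d (lineFlow hΛ hd f) = lineFlow hΛ hd (opV d f) := by
      intro f
      rw [opV, key, flowDir]
      congr 1
      simp [opV]
    rw [hV, hV, key]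
    -- `f'` is constant in time, so only the phase is differentiated.
    have h1 : flowDir d ((0, 1), 0) f' = Complex.I • opV d (opV d f') := by
      have h2 : nab (((0 : E), (1 : ℝ)), (0 : V × V)) f' = 0 := by
        ext ⟨p, A⟩
        rw [hf', nab_pull_apply, fderiv_fst]
        have : nab ((0 : E), (0 : V × V)) f = 0 := by
          have := nab_smul (k := k) (Λ := Λ) (0 : ℝ) ((0 : E), (0 : V × V))
          rw [zero_smul] at this
          simp only [Prod.mk_zero_zero]
          rw [this]
          simp
        simp only [ContinuousLinearMap.coe_fst', this]
        rfl
      rw [flowDir, h2]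
      ext x
      simp
    rw [h1]
    ext x
    rw [Fam.smul_val]
    change ∑' m, _ = Complex.I * ∑' m, _
    rw [← tsum_mul_left]
    refine tsum_congr fun m => ?_
    rw [flowTerm, flowTerm]
    have : fcoef k d (Complex.I • opV d (opV d f')).1 m x =
        Complex.I * fcoef k d (opV d (opV d f')).1 m x := by
      have := fcoef_mulOp d (opV d (opV d f')) (algebraMap ℂ _ Complex.I) m x
      rw [AlgHom.commutes] at this
      exact this
    rw [this]
    ring

end LineFlow

/-! ### The flows of `∑ ∇_{v_i}²` and `∑ ∇_{u_i}²` -/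

section QuadraticFlow

open scoped TensorProduct

variable {V : Type*} [NormedAddCommGroup V] [InnerProductSpace ℝ V]
  {E : Type*} [NormedAddCommGroup E] [NormedSpace ℝ E]
  {E' : Type*} [NormedAddCommGroup E'] [NormedSpace ℝ E'] {k n : ℕ} {Λ : Submodule ℤ V}

/-- Products of the operators `opV`, as a bilinear map. -/
def opVV : V →ₗ[ℝ] V →ₗ[ℝ] Module.End ℂ (Fam E k Λ) :=
  LinearMap.mk₂ ℝ (fun x y => opVL x * opVL y)
    (fun x x' y => by rw [map_add, add_mul])
    (fun c x y => by rw [map_smul, smul_mul_assoc])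
    (fun x y y' => by rw [map_add, mul_add])
    (fun c x y => by rw [map_smul, mul_smul_comm])

/-- The second order operator associated with a tensor. -/
def opT : V ⊗[ℝ] V →ₗ[ℝ] Module.End ℂ (Fam E k Λ) := TensorProduct.lift opVV

lemma opT_tmul (x y : V) : (opT (x ⊗ₜ y) : Module.End ℂ (Fam E k Λ)) = opV x * opV y := rfl

lemma Lv_eq_opT (e : OrthonormalBasis (Fin n) ℝ V) :
    (Lv e : Module.End ℂ (Fam E k Λ)) = opT (∑ i, e i ⊗ₜ[ℝ] e i) := by
  simp only [map_sum, opT_tmul]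
  rfl

lemma opV_pull {g : E' → E} (hg : ContDiff ℝ ∞ g) (f : Fam E k Λ) (x : V) :
    opV x (pull g hg f) = pull g hg (opV x f) := nab_zero_pull hg f _

lemma real_smul_val (c : ℝ) (f : Fam E k Λ) (x : E × (V × V)) :
    (c • f).1 x = c * f.1 x := rfl

lemma opT_pull {g : E' → E} (hg : ContDiff ℝ ∞ g) (f : Fam E k Λ) (t : V ⊗[ℝ] V) :
    opT t (pull g hg f) = pull g hg (opT t f) := by
  induction t using TensorProduct.induction_on with
  | zero => simp
  | tmul x y => simp only [opT_tmul, Module.End.mul_apply, opV_pull]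
  | add t t' h h' => simp only [map_add, LinearMap.add_apply, h, h']

lemma opT_comm (t t' : V ⊗[ℝ] V) :
    Commute (opT t) (opT t' : Module.End ℂ (Fam E k Λ)) := by
  induction t using TensorProduct.induction_on with
  | zero => simp
  | tmul x y =>
    induction t' using TensorProduct.induction_on with
    | zero => simp
    | tmul x' y' =>
      exact Commute.mul_left (Commute.mul_right (opV_mul_opV _ _) (opV_mul_opV _ _))
        (Commute.mul_right (opV_mul_opV _ _) (opV_mul_opV _ _))
    | add t t' h h' => rw [map_add]; exact h.add_right h'
  | add t t' h h' => rw [map_add]; exact h.add_left h'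

lemma nab_param_commute_opT (x : E) (t : V ⊗[ℝ] V) :
    Commute (nab (x, 0)) (opT t : Module.End ℂ (Fam E k Λ)) := by
  induction t using TensorProduct.induction_on with
  | zero => simp
  | tmul x y => exact Commute.mul_right (nab_param_commute_nab _ _) (nab_param_commute_nab _ _)
  | add t t' h h' => rw [map_add]; exact h.add_right h'

variable [FiniteDimensional ℝ V] [MeasurableSpace V] [BorelSpace V] {D : Set (V × V)}

lemma pair_opT [Countable Λ] (hD : IsCell Λ D) (t : V ⊗[ℝ] V) (f : Fam E k Λ) (p : E)
    (g : Fam E' k Λ) (q : E') : pair D (opT t f) p g q = pair D f p (opT t g) q := by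
  induction t using TensorProduct.induction_on with
  | zero => simp [pair]
  | tmul x y =>
    have : (opT (x ⊗ₜ y) g : Fam E' k Λ) = opV y (opV x g) := by
      rw [opT_tmul, opV_mul_opV]
      rfl
    rw [this]
    exact pair_nab_nab hD _ _ _ _ _ _
  | add t t' h h' =>
    rw [map_add, map_add, LinearMap.add_apply, LinearMap.add_apply, pair_add_left hD,
      pair_add_right hD, h, h']

lemma eq_zero_of_opT [Countable Λ] (hD : IsCell Λ D) (t : V ⊗[ℝ] V) (R : Fam E k Λ) (p x : E)
    (h : nab (x, 0) R = Complex.I • opT t R)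
    (h0 : ∀ A, R.1 (p, A) = 0) (s : ℝ) (A : V × V) : R.1 (p + s • x, A) = 0 :=
  eq_zero_of_schrodinger hD R p x (fun _ => opT t R) (fun _ => pair_opT hD _ _ _ _ _)
    (fun q A => by rw [h]; rfl) h0 s A

variable (k Λ) in
/-- The Schrödinger equation with Hamiltonian `opT t` is solvable in families. -/
def IsFlowable (t : V ⊗[ℝ] V) : Prop :=
  ∀ (E : Type) [NormedAddCommGroup E] [NormedSpace ℝ E] [FiniteDimensional ℝ E] (f : Fam E k Λ),
    ∃ G : Fam (E × ℝ) k Λ, (∀ p A, G.1 ((p, 0), A) = f.1 (p, A)) ∧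
      nab ((0, 1), 0) G = Complex.I • opT t G

omit [FiniteDimensional ℝ V] [MeasurableSpace V] [BorelSpace V] in
lemma nab_real_smul (c : ℝ) (ξ : E × (V × V)) (f : Fam E k Λ) :
    nab (c • ξ) f = (c : ℂ) • nab ξ f := by
  rw [nab_smul]
  rfl

omit [FiniteDimensional ℝ V] [MeasurableSpace V] [BorelSpace V] in
-- Rescale the time.
lemma IsFlowable.smul {t : V ⊗[ℝ] V} (ht : IsFlowable k Λ t) (c : ℝ) : IsFlowable k Λ (c • t) := by
  intro E _ _ _ f
  obtain ⟨G, hG0, hG⟩ := ht E f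
  let g : E × ℝ →L[ℝ] E × ℝ := (ContinuousLinearMap.fst ℝ E ℝ).prod
    (c • ContinuousLinearMap.snd ℝ E ℝ)
  have hg : ∀ p, g p = (p.1, c * p.2) := fun p => rfl
  refine ⟨pull g g.contDiff G, fun p A => ?_, ?_⟩
  · rw [pull_apply, hg, mul_zero, hG0]
  · rw [map_smul, LinearMap.smul_apply, opT_pull]
    ext ⟨p, A⟩
    rw [nab_pull_apply, g.fderiv, Fam.smul_val, real_smul_val, pull_apply, hg (0, 1)]
    have : (((0 : E), c * (1 : ℝ)), (0 : V × V)) = c • (((0 : E), (1 : ℝ)), (0 : V × V)) := by simp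
    rw [this, nab_real_smul, hG]
    simp only [Fam.smul_val]
    ring

omit [FiniteDimensional ℝ V] [MeasurableSpace V] [BorelSpace V] in
lemma isFlowable_zero : IsFlowable k Λ 0 := by
  intro E _ _ _ f
  refine ⟨pull Prod.fst contDiff_fst f, fun p A => rfl, ?_⟩
  ext ⟨p, A⟩
  rw [nab_pull_apply, fderiv_fst, map_zero, LinearMap.zero_apply, smul_zero]
  have := nab_real_smul (0 : ℝ) ((0 : E), (0 : V × V)) f
  rw [zero_smul, Complex.ofReal_zero, zero_smul] at this
  exact congrArg (fun g : Fam E k Λ => g.1 (p.1, A)) this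

/-- Run both flows with independent times, the second starting from the result of the first, and
restrict to equal times. The first equation survives the second flow because `opT t` and `opT t'`
commute: its defect `R` solves the second Schrödinger equation with zero initial value. -/
lemma IsFlowable.add [Countable Λ] (hD : IsCell Λ D) {t t' : V ⊗[ℝ] V} (ht : IsFlowable k Λ t)
    (ht' : IsFlowable k Λ t') : IsFlowable k Λ (t + t') := by
  intro E _ _ _ f
  obtain ⟨G, hG0, hG⟩ := ht E f
  obtain ⟨H, hH0, hH⟩ := ht' (E × ℝ) G
  have hR : nab (((0, 1), 0), 0) H = Complex.I • opT t H := by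
    rw [← sub_eq_zero]
    set R := nab (((0, 1), 0), 0) H - Complex.I • opT t H with hRdef
    have hRflow : nab ((0, 1), 0) R = Complex.I • opT t' R := by
      have h1 : nab ((0, 1), 0) (nab (((0, 1), 0), 0) H) =
          nab (((0, 1), 0), 0) (nab ((0, 1), 0) H) := by
        have := congrArg (fun T : Module.End ℂ (Fam ((E × ℝ) × ℝ) k Λ) => T H)
          (nab_mul_nab (k := k) (Λ := Λ) (((0 : E × ℝ), (1 : ℝ)), (0 : V × V))
            ((((0 : E), (1 : ℝ)), (0 : ℝ)), (0 : V × V)))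
        simpa [omega] using this
      rw [hRdef, map_sub, h1, hH, map_smul, map_smul]
      have h2 := congrArg (fun T : Module.End ℂ (Fam ((E × ℝ) × ℝ) k Λ) => T H)
        (nab_param_commute_opT (k := k) (Λ := Λ) (((0 : E), (1 : ℝ)), (0 : ℝ)) t').eq
      have h3 := congrArg (fun T : Module.End ℂ (Fam ((E × ℝ) × ℝ) k Λ) => T H)
        (nab_param_commute_opT (k := k) (Λ := Λ) ((0 : E × ℝ), (1 : ℝ)) t).eq
      have h4 := congrArg (fun T : Module.End ℂ (Fam ((E × ℝ) × ℝ) k Λ) => T H)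
        (opT_comm (k := k) (Λ := Λ) (E := (E × ℝ) × ℝ) t t').eq
      simp only [Module.End.mul_apply] at h2 h3 h4
      rw [h2, h3, hH, map_sub, map_smul, map_smul, h4, smul_sub]
    ext ⟨⟨q, s⟩, A⟩
    have h0 : ∀ A, R.1 ((q, 0), A) = 0 := by
      intro A
      have hpull : pull (fun q : E × ℝ => (q, (0 : ℝ))) (contDiff_id.prodMk contDiff_const) H = G := by
        ext ⟨p, A⟩
        rw [pull_apply, hH0]
      have h5 : (nab (((0, 1), 0), 0) H).1 ((q, 0), A) = (nab ((0, 1), 0) G).1 (q, A) := by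
        rw [← hpull, nab_pull_apply, (hasFDerivAt_prodMk_left q (0 : ℝ)).fderiv]
        rfl
      have h6 : (opT t H).1 ((q, 0), A) = (opT t G).1 (q, A) := by
        rw [← hpull, opT_pull, pull_apply]
      rw [hRdef, Fam.sub_val, Fam.smul_val, h5, h6, hG, Fam.smul_val, sub_self]
    have := eq_zero_of_opT hD t' R (q, 0) (0, 1) hRflow h0 s A
    simpa using this
  let g : E × ℝ →L[ℝ] (E × ℝ) × ℝ := (ContinuousLinearMap.id ℝ (E × ℝ)).prod
    (ContinuousLinearMap.snd ℝ E ℝ)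
  have hg : ∀ p, g p = (p, p.2) := fun p => rfl
  refine ⟨pull g g.contDiff H, fun p A => ?_, ?_⟩
  · rw [pull_apply, hg, hH0, hG0]
  · rw [map_add, LinearMap.add_apply, opT_pull, opT_pull]
    ext ⟨p, A⟩
    rw [nab_pull_apply, g.fderiv, hg (0, 1)]
    have : ((((0 : E), (1 : ℝ)), (1 : ℝ)), (0 : V × V)) =
      ((((0 : E), (1 : ℝ)), (0 : ℝ)), (0 : V × V)) + (((0 : E × ℝ), (1 : ℝ)), (0 : V × V)) := by
      simp
    simp only [this, nab_add, LinearMap.add_apply, hR, hH]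
    simp only [Fam.add_val, Fam.smul_val, pull_apply]
    ring

/-- Squares of lattice vectors are flowable by `exists_lineFlow`. Polarization gives symmetric
products of lattice vectors, and since the lattice spans `V`, linearity in each argument gives all
symmetric products. -/
lemma isFlowable_symm [Countable Λ] (hD : IsCell Λ D) (hΛ : IsIntegralLattice Λ)
    (hspan : Submodule.span ℝ (Λ : Set V) = ⊤) (x y : V) :
    IsFlowable k Λ (x ⊗ₜ y + y ⊗ₜ x) := by
  have hsq : ∀ d ∈ Λ, IsFlowable k Λ (d ⊗ₜ d) := fun d hd E _ _ _ f => exists_lineFlow hΛ hd f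
  have hlat : ∀ c ∈ Λ, ∀ d ∈ Λ, IsFlowable k Λ (c ⊗ₜ d + d ⊗ₜ c) := by
    intro c hc d hd
    have h : c ⊗ₜ[ℝ] d + d ⊗ₜ[ℝ] c = (c + d) ⊗ₜ[ℝ] (c + d) +
        ((-1 : ℝ) • c ⊗ₜ[ℝ] c + (-1 : ℝ) • d ⊗ₜ[ℝ] d) := by
      simp only [TensorProduct.tmul_add, TensorProduct.add_tmul]
      module
    rw [h]
    exact (hsq _ (Λ.add_mem hc hd)).add hD (((hsq c hc).smul _).add hD ((hsq d hd).smul _))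
  have hgen : ∀ (S : Set V) (T : V → V ⊗[ℝ] V), (∀ u v, T (u + v) = T u + T v) →
      (∀ (a : ℝ) u, T (a • u) = a • T u) → (∀ u ∈ S, IsFlowable k Λ (T u)) →
      ∀ u ∈ Submodule.span ℝ S, IsFlowable k Λ (T u) := by
    intro S T hadd hsmul hS u hu
    induction hu using Submodule.span_induction with
    | mem u hu => exact hS u hu
    | zero =>
      have := hsmul 0 0
      rw [zero_smul, zero_smul] at this
      rw [this]
      exact isFlowable_zero
    | add u v _ _ h h' => rw [hadd]; exact h.add hD h'
    | smul a u _ h => rw [hsmul]; exact h.smul a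
  have hx : ∀ c ∈ Λ, ∀ x : V, IsFlowable k Λ (x ⊗ₜ c + c ⊗ₜ x) := fun c hc x =>
    hgen Λ (fun x => x ⊗ₜ c + c ⊗ₜ x)
      (fun u v => by simp only [TensorProduct.tmul_add, TensorProduct.add_tmul]; abel)
      (fun a u => by
        simp only [TensorProduct.tmul_smul, smul_add, ← TensorProduct.smul_tmul'])
      (fun d hd => hlat d hd c hc) x (by rw [hspan]; trivial)
  exact hgen Λ (fun y => x ⊗ₜ y + y ⊗ₜ x)
      (fun u v => by simp only [TensorProduct.tmul_add, TensorProduct.add_tmul]; abel)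
      (fun a u => by
        simp only [TensorProduct.tmul_smul, smul_add, ← TensorProduct.smul_tmul'])
      (fun d hd => hx d hd x) y (by rw [hspan]; trivial)

variable (k) in
/-- The properties of the lattice and of its fundamental domain used for the construction of
flows. -/
structure IsBundleLattice (Λ : Submodule ℤ V) (D : Set (V × V)) : Prop where
  cell : IsCell Λ D
  integral : IsIntegralLattice Λ
  row : IsRowInvariant k Λ
  span : Submodule.span ℝ (Λ : Set V) = ⊤

variable (e : OrthonormalBasis (Fin n) ℝ V) {F : Type} [NormedAddCommGroup F] [NormedSpace ℝ F]
  [FiniteDimensional ℝ F]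

lemma exists_flow_Lv [Countable Λ] (hΛ : IsBundleLattice k Λ D) (f : Fam F k Λ) :
    ∃ G : Fam (F × ℝ) k Λ, (∀ p A, G.1 ((p, 0), A) = f.1 (p, A)) ∧
      nab ((0, 1), 0) G = Complex.I • Lv e G := by
  have h : ∀ s : Finset (Fin n), IsFlowable k Λ (∑ i ∈ s, e i ⊗ₜ[ℝ] e i) := by
    intro s
    induction s using Finset.induction_on with
    | empty => exact isFlowable_zero
    | insert i s hi ih =>
      rw [Finset.sum_insert hi]
      refine IsFlowable.add hΛ.cell ?_ ih
      have h1 := (isFlowable_symm (k := k) hΛ.cell hΛ.integral hΛ.span (e i) (e i)).smul (1 / 2)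
      have h2 : (1 / 2 : ℝ) • (e i ⊗ₜ[ℝ] e i + e i ⊗ₜ[ℝ] e i) = e i ⊗ₜ[ℝ] e i := by module
      rwa [h2] at h1
  rw [Lv_eq_opT]
  exact h Finset.univ F f

/-- Substituting the matrix `S` turns derivatives along one factor into derivatives along the other,
up to sign; the flow is that of `Lv` conjugated by it. -/
lemma exists_flow_Lu [Countable Λ] (hΛ : IsBundleLattice k Λ D) (f : Fam F k Λ) :
    ∃ G : Fam (F × ℝ) k Λ, (∀ p A, G.1 ((p, 0), A) = f.1 (p, A)) ∧
      nab ((0, 1), 0) G = Complex.I • Lu e G := by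
  obtain ⟨G, hG0, hG⟩ := exists_flow_Lv e hΛ (rho hΛ.row ModularGroup.S⁻¹ f)
  refine ⟨rho hΛ.row ModularGroup.S G, fun p A => ?_, ?_⟩
  · rw [rho_apply, hG0, rho_apply, ← rowAction_mul, mul_inv_cancel, rowAction_one]
  · have h1 : rowAction ModularGroup.S (0 : V × V) = 0 := by simp [rowAction]
    rw [nab_rho, h1, hG, map_smul, Lu_rho]
    simp [ModularGroup.S]

end QuadraticFlow

/-! ### Flat systems of Schrödinger equations -/

section Flat

variable {V : Type*} [NormedAddCommGroup V] [InnerProductSpace ℝ V]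
  {E : Type*} [NormedAddCommGroup E] [NormedSpace ℝ E]
  {E' : Type*} [NormedAddCommGroup E'] [NormedSpace ℝ E'] {k n : ℕ} {Λ : Submodule ℤ V}

/-- A smooth real function of the parameters. -/
def realFn (m : E → ℝ) (hm : ContDiff ℝ ∞ m) : SmoothFns E :=
  ⟨fun p => (m p : ℂ), (Complex.ofRealCLM.contDiff.comp hm : ContDiff ℝ ∞ fun p => (m p : ℂ))⟩

lemma realFn_val (m : E → ℝ) (hm : ContDiff ℝ ∞ m) (p : E) : (realFn m hm).1 p = (m p : ℂ) := rfl

lemma paramDeriv_realFn (m : E → ℝ) (hm : ContDiff ℝ ∞ m) (x p : E) :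
    (paramDeriv x (realFn m hm)).1 p = (fderiv ℝ m p x : ℂ) := by
  have h1 : fderiv ℝ (realFn m hm).1 p = _ :=
    (Complex.ofRealCLM.hasFDerivAt.comp p (hm.differentiable (by simp) p).hasFDerivAt).fderiv
  rw [paramDeriv]
  simp only [h1]
  rfl

/-- The coefficients of the Hamiltonians met below are at most quadratic along the lines of
interest, so their derivatives can be read off. -/
lemma fderiv_apply_of_quadratic {m : E → ℝ} (hm : ContDiff ℝ ∞ m) {p x : E} (c₀ c₁ c₂ : ℝ)
    (h : ∀ s : ℝ, m (p + s • x) = c₀ + c₁ * s + c₂ * s ^ 2) : fderiv ℝ m p x = c₁ := by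
  have h1 : HasDerivAt (fun s : ℝ => p + s • x) x 0 := by
    simpa using ((hasDerivAt_id (0 : ℝ)).smul_const x).const_add p
  have h2 : HasFDerivAt m (fderiv ℝ m p) (p + (0 : ℝ) • x) := by
    simpa using (hm.differentiable (by simp) p).hasFDerivAt
  have h3 := h2.comp_hasDerivAt (0 : ℝ) h1
  have h4 : HasDerivAt (fun s : ℝ => c₀ + c₁ * s + c₂ * s ^ 2) c₁ 0 := by
    have := (((hasDerivAt_id (0 : ℝ)).const_mul c₁).const_add c₀).add
      (((hasDerivAt_id (0 : ℝ)).pow 2).const_mul c₂)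
    exact this.congr_deriv (by simp)
  have h5 : (m ∘ fun s : ℝ => p + s • x) = fun s => c₀ + c₁ * s + c₂ * s ^ 2 := funext h
  rw [h5] at h3
  exact h3.unique h4

variable (e : OrthonormalBasis (Fin n) ℝ V)

/-- The Hamiltonian with real coefficients. -/
def hamR (a : E → ℝ) (ha : ContDiff ℝ ∞ a) (b : E → ℝ) (hb : ContDiff ℝ ∞ b) (c : E → ℝ)
    (hc : ContDiff ℝ ∞ c) : Module.End ℂ (Fam E k Λ) :=
  ham e (realFn a ha) (realFn b hb) (realFn c hc)

lemma hamR_apply {a : E → ℝ} (ha : ContDiff ℝ ∞ a) {b : E → ℝ} (hb : ContDiff ℝ ∞ b) {c : E → ℝ}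
    (hc : ContDiff ℝ ∞ c) (f : Fam E k Λ) (x : E × (V × V)) : (hamR e a ha b hb c hc f).1 x =
      a x.1 * (Lv e f).1 x + b x.1 * (Luv e f).1 x + c x.1 * (Lu e f).1 x := rfl

variable [FiniteDimensional ℝ V] [MeasurableSpace V] [BorelSpace V] {D : Set (V × V)}

lemma eq_zero_of_hamR [Countable Λ] (hD : IsCell Λ D) (R : Fam E k Λ) (p x : E)
    {a : E → ℝ} (ha : ContDiff ℝ ∞ a) {b : E → ℝ} (hb : ContDiff ℝ ∞ b) {c : E → ℝ}
    (hc : ContDiff ℝ ∞ c) (h : nab (x, 0) R = Complex.I • hamR e a ha b hb c hc R)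
    (h0 : ∀ A, R.1 (p, A) = 0) (s : ℝ) (A : V × V) : R.1 (p + s • x, A) = 0 :=
  eq_zero_of_ham e hD R p x a b c (fun q A => by rw [h]; rfl) h0 s A

omit [FiniteDimensional ℝ V] [MeasurableSpace V] [BorelSpace V] in
lemma nab_param_comm (x y : E) (f : Fam E k Λ) :
    nab (x, 0) (nab (y, 0) f) = nab (y, 0) (nab (x, 0) f) := by
  have := congrArg (fun T : Module.End ℂ (Fam E k Λ) => T f)
    (nab_mul_nab (k := k) (Λ := Λ) (x, (0 : V × V)) (y, (0 : V × V)))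
  simpa [omega] using this

omit [FiniteDimensional ℝ V] [MeasurableSpace V] [BorelSpace V] in
/-- If `∂_x G = i H G` and the pair `H`, `H'` is flat, then `∂_y G - i H' G` satisfies the same
equation as `G`. -/
lemma nab_sub_ham_of_flat (G : Fam E k Λ) (x y : E) {A B C A' B' C' : SmoothFns E}
    (h : nab (x, 0) G = Complex.I • ham e A B C G)
    (hA : paramDeriv x A' = paramDeriv y A + (Complex.I * (4 * kap k)) • (B * A' - A * B'))
    (hB : paramDeriv x B' = paramDeriv y B + (Complex.I * (2 * kap k)) • (C * A' - A * C'))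
    (hC : paramDeriv x C' = paramDeriv y C + (Complex.I * (4 * kap k)) • (C * B' - B * C')) :
    nab (x, 0) (nab (y, 0) G - Complex.I • ham e A' B' C' G) =
      Complex.I • ham e A B C (nab (y, 0) G - Complex.I • ham e A' B' C' G) := by
  have h1 := fun (z : E) (A B C : SmoothFns E) => congrArg (fun T : Module.End ℂ (Fam E k Λ) => T G)
    (nab_param_mul_ham e z A B C)
  have h2 := congrArg (fun T : Module.End ℂ (Fam E k Λ) => T G) (ham_mul_ham e A B C A' B' C')
  simp only [Module.End.mul_apply, LinearMap.add_apply] at h1 h2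
  rw [map_sub, nab_param_comm, h, map_smul, map_smul, h1, h1, h, map_sub, map_smul, map_smul, h2,
    hA, hB, hC, ← ham_add]
  simp only [← smul_smul, ← smul_ham e Complex.I]
  rw [LinearMap.add_apply, LinearMap.smul_apply]
  simp only [smul_add, smul_sub, smul_smul]
  module

/-- Zero curvature: `hA`, `hB`, `hC` say that the Hamiltonians for the time direction and for `y`
form a flat connection. The defect `∂_y G - iH'G` then obeys the same Schrödinger equation as `G`;
it vanishes at time zero by `h0`, hence always. -/
lemma flow_param_deriv [Countable Λ] (hD : IsCell Λ D) {G₀ : Fam E k Λ} {G : Fam (E × ℝ) k Λ}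
    (hG₀ : ∀ p A, G.1 ((p, 0), A) = G₀.1 (p, A))
    {a : E × ℝ → ℝ} (ha : ContDiff ℝ ∞ a) {b : E × ℝ → ℝ} (hb : ContDiff ℝ ∞ b) {c : E × ℝ → ℝ}
    (hc : ContDiff ℝ ∞ c) (hG : nab ((0, 1), 0) G = Complex.I • hamR e a ha b hb c hc G) (y : E)
    {a' : E × ℝ → ℝ} (ha' : ContDiff ℝ ∞ a') {b' : E × ℝ → ℝ} (hb' : ContDiff ℝ ∞ b')
    {c' : E × ℝ → ℝ} (hc' : ContDiff ℝ ∞ c')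
    (hA : ∀ p, fderiv ℝ a' p (0, 1) = fderiv ℝ a p (y, 0) +
      4 * (2 * Real.pi * k) * (b p * a' p - a p * b' p))
    (hB : ∀ p, fderiv ℝ b' p (0, 1) = fderiv ℝ b p (y, 0) +
      2 * (2 * Real.pi * k) * (c p * a' p - a p * c' p))
    (hC : ∀ p, fderiv ℝ c' p (0, 1) = fderiv ℝ c p (y, 0) +
      4 * (2 * Real.pi * k) * (c p * b' p - b p * c' p))
    (h0 : ∀ p A, (nab (y, 0) G₀).1 (p, A) = Complex.I * (a' (p, 0) * (Lv e G₀).1 (p, A) +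
      b' (p, 0) * (Luv e G₀).1 (p, A) + c' (p, 0) * (Lu e G₀).1 (p, A))) :
    nab ((y, 0), 0) G = Complex.I • hamR e a' ha' b' hb' c' hc' G := by
  -- `i · kap k = 2πk`, so the flatness equations have real coefficients.
  have hI : ∀ c : ℂ, Complex.I * (c * kap k) = c * (2 * Real.pi * k) := by
    intro c
    rw [kap]
    linear_combination (-(c * (2 * Real.pi * k))) * Complex.I_sq
  have hflat := nab_sub_ham_of_flat e G (0, 1) (y, 0) hG (A' := realFn a' ha') (B' := realFn b' hb')
    (C' := realFn c' hc')
    (by ext p; simp only [SmoothFns.add_val, SmoothFns.smul_val, SmoothFns.sub_val,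
          SmoothFns.mul_val, paramDeriv_realFn, hA, realFn_val, hI]; push_cast; ring)
    (by ext p; simp only [SmoothFns.add_val, SmoothFns.smul_val, SmoothFns.sub_val,
          SmoothFns.mul_val, paramDeriv_realFn, hB, realFn_val, hI]; push_cast; ring)
    (by ext p; simp only [SmoothFns.add_val, SmoothFns.smul_val, SmoothFns.sub_val,
          SmoothFns.mul_val, paramDeriv_realFn, hC, realFn_val, hI]; push_cast; ring)
  rw [← sub_eq_zero]
  ext ⟨⟨q, s⟩, A⟩
  have hpull : pull (fun q : E => (q, (0 : ℝ))) (contDiff_id.prodMk contDiff_const) G = G₀ := by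
    ext ⟨p, A⟩
    rw [pull_apply, hG₀]
  have hz : ∀ A, (nab ((y, 0), 0) G - Complex.I • hamR e a' ha' b' hb' c' hc' G).1 ((q, 0), A) =
      0 := by
    intro A
    have h5 : (nab ((y, 0), 0) G).1 ((q, 0), A) = (nab (y, 0) G₀).1 (q, A) := by
      rw [← hpull, nab_pull_apply, (hasFDerivAt_prodMk_left q (0 : ℝ)).fderiv]
      rfl
    rw [Fam.sub_val, Fam.smul_val, h5, h0, ← hpull, hamR_apply, Lu_pull, Lv_pull, Luv_pull]
    simp only [pull_apply, sub_self]
  have h1 := eq_zero_of_hamR e hD _ (q, 0) (0, 1) ha hb hc hflat hz s A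
  have h2 : (q, (0 : ℝ)) + s • ((0 : E), (1 : ℝ)) = (q, s) := by simp
  rw [h2] at h1
  exact h1

end Flat

/-! ### The flow of the Laplace operator -/

section TripleFlow

variable {V : Type*} [NormedAddCommGroup V] [InnerProductSpace ℝ V]
  {E : Type*} [NormedAddCommGroup E] [NormedSpace ℝ E] {k n : ℕ} {Λ : Submodule ℤ V}
  (e : OrthonormalBasis (Fin n) ℝ V)

lemma Lu_eq_hamR : (Lu e : Module.End ℂ (Fam E k Λ)) =
    hamR e (fun _ => 0) contDiff_const (fun _ => 0) contDiff_const (fun _ => 1) contDiff_const := by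
  ext f x
  simp [hamR_apply]

lemma Lv_eq_hamR : (Lv e : Module.End ℂ (Fam E k Λ)) =
    hamR e (fun _ => 1) contDiff_const (fun _ => 0) contDiff_const (fun _ => 0) contDiff_const := by
  ext f x
  simp [hamR_apply]

lemma Fam.apply_line_of_nab_eq_zero (f : Fam E k Λ) (p x : E)
    (h : ∀ s : ℝ, ∀ A, (nab (x, 0) f).1 (p + s • x, A) = 0) (s : ℝ) (A : V × V) :
    f.1 (p + s • x, A) = f.1 (p, A) := by
  have hd : ∀ s : ℝ, HasDerivAt (fun s : ℝ => f.1 (p + s • x, A)) 0 s := by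
    intro s
    have h1 : HasDerivAt (fun s : ℝ => (p + s • x, A)) (x, 0) s := by
      simpa using (((hasDerivAt_id s).smul_const x).const_add p).prodMk (hasDerivAt_const s A)
    have h2 := (f.differentiableAt (p + s • x, A)).hasFDerivAt.comp_hasDerivAt s h1
    rw [← nab_param_apply, h] at h2
    exact h2
  have := is_const_of_deriv_eq_zero (fun s => (hd s).differentiableAt) (fun s => (hd s).deriv) s 0
  simpa using this

variable [FiniteDimensional ℝ V] [MeasurableSpace V] [BorelSpace V] {D : Set (V × V)}
  {F : Type} [NormedAddCommGroup F] [NormedSpace ℝ F] [FiniteDimensional ℝ F]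

/-- The product of three one-parameter groups. -/
lemma exists_triple_flow [Countable Λ] (hΛ : IsBundleLattice k Λ D) (f : Fam F k Λ) :
    ∃ G : Fam (((F × ℝ) × ℝ) × ℝ) k Λ, (∀ p s A, G.1 ((((p, s), 0), -s), A) = f.1 (p, A)) ∧
      nab ((0, 1), 0) G = Complex.I • Lu e G ∧
      nab (((0, 1), 0), 0) G = Complex.I • hamR e (fun _ => 1) contDiff_const
        (fun p => 2 * (2 * Real.pi * k) * p.2) (by fun_prop)
        (fun p => 4 * (2 * Real.pi * k) ^ 2 * p.2 ^ 2) (by fun_prop) G ∧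
      nab ((((0, 1), 0), 0), 0) G = Complex.I • hamR e
        (fun p => 4 * (2 * Real.pi * k) ^ 2 * p.1.2 ^ 2) (by fun_prop)
        (fun p => -2 * (2 * Real.pi * k) * p.1.2 + 8 * (2 * Real.pi * k) ^ 3 * p.1.2 ^ 2 * p.2)
        (by fun_prop)
        (fun p => 1 - 8 * (2 * Real.pi * k) ^ 2 * p.1.2 * p.2 +
          16 * (2 * Real.pi * k) ^ 4 * p.1.2 ^ 2 * p.2 ^ 2) (by fun_prop) G := by
  obtain ⟨G₁, hf₁, hG₁⟩ := exists_flow_Lu e hΛ f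
  obtain ⟨G₂, hf₂, hG₂⟩ := exists_flow_Lv e hΛ G₁
  obtain ⟨G₃, hf₃, hG₃⟩ := exists_flow_Lu e hΛ G₂
  have hG₂' := hG₂
  have hG₃' := hG₃
  rw [Lv_eq_hamR] at hG₂'
  rw [Lu_eq_hamR] at hG₃'
  set l := 2 * Real.pi * k with hl
  -- After the second flow the first time derivative is governed by `Lu` conjugated by the flow of
  -- `Lv`. Its coefficients are polynomials in the second time, solving the linear system `hA`,
  -- `hB`, `hC` of `flow_param_deriv` with initial value `(0, 0, 1)`.
  have h21 : nab (((0, 1), 0), 0) G₂ = Complex.I • hamR e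
      (fun p => 4 * l ^ 2 * p.2 ^ 2) (by fun_prop) (fun p => -2 * l * p.2) (by fun_prop)
      (fun _ => 1) contDiff_const G₂ := by
    refine flow_param_deriv e hΛ.cell hf₂ contDiff_const contDiff_const contDiff_const hG₂' (0, 1)
      _ _ _ (fun p => ?_) (fun p => ?_) (fun p => ?_) fun p A => ?_
    · rw [fderiv_apply_of_quadratic (by fun_prop) (4 * l ^ 2 * p.2 ^ 2) (8 * l ^ 2 * p.2)
        (4 * l ^ 2) (fun s => by simp; ring)]
      simp
      ring
    · rw [fderiv_apply_of_quadratic (by fun_prop) (-2 * l * p.2) (-2 * l) 0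
        (fun s => by simp; ring)]
      simp
      ring
    · simp
    · rw [hG₁]
      simp
  have h32 : nab ((((0, 1), 0), 0), 0) G₃ = Complex.I • hamR e
        (fun p => 4 * l ^ 2 * p.1.2 ^ 2) (by fun_prop)
        (fun p => -2 * l * p.1.2 + 8 * l ^ 3 * p.1.2 ^ 2 * p.2) (by fun_prop)
        (fun p => 1 - 8 * l ^ 2 * p.1.2 * p.2 + 16 * l ^ 4 * p.1.2 ^ 2 * p.2 ^ 2)
        (by fun_prop) G₃ := by
    refine flow_param_deriv e hΛ.cell hf₃ contDiff_const contDiff_const contDiff_const hG₃'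
      ((0, 1), 0) _ _ _ (fun p => ?_) (fun p => ?_) (fun p => ?_) fun p A => ?_
    · rw [fderiv_apply_of_quadratic (by fun_prop) (4 * l ^ 2 * p.1.2 ^ 2) 0 0
        (fun s => by simp)]
      simp
    · rw [fderiv_apply_of_quadratic (by fun_prop)
        (-2 * l * p.1.2 + 8 * l ^ 3 * p.1.2 ^ 2 * p.2) (8 * l ^ 3 * p.1.2 ^ 2) 0
        (fun s => by simp; ring)]
      simp
      ring
    · rw [fderiv_apply_of_quadratic (by fun_prop)
        (1 - 8 * l ^ 2 * p.1.2 * p.2 + 16 * l ^ 4 * p.1.2 ^ 2 * p.2 ^ 2)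
        (-8 * l ^ 2 * p.1.2 + 32 * l ^ 4 * p.1.2 ^ 2 * p.2) (16 * l ^ 4 * p.1.2 ^ 2)
        (fun s => by simp; ring)]
      simp
      ring
    · rw [h21]
      simp [hamR_apply]
  have h31 : nab (((0, 1), 0), 0) G₃ = Complex.I • hamR e (fun _ => 1) contDiff_const
        (fun p => 2 * l * p.2) (by fun_prop) (fun p => 4 * l ^ 2 * p.2 ^ 2) (by fun_prop) G₃ := by
    refine flow_param_deriv e hΛ.cell hf₃ contDiff_const contDiff_const contDiff_const hG₃'
      (0, 1) _ _ _ (fun p => ?_) (fun p => ?_) (fun p => ?_) fun p A => ?_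
    · simp
    · rw [fderiv_apply_of_quadratic (by fun_prop) (2 * l * p.2) (2 * l) 0 (fun s => by simp; ring)]
      simp
      exact hl
    · rw [fderiv_apply_of_quadratic (by fun_prop) (4 * l ^ 2 * p.2 ^ 2) (8 * l ^ 2 * p.2)
        (4 * l ^ 2) (fun s => by simp; ring)]
      simp
      ring
    · rw [hG₂]
      simp
  refine ⟨G₃, fun p s A => ?_, hG₃, h31, h32⟩
  have h0 : G₃.1 ((((p, 0), 0), 0), A) = f.1 (p, A) := by rw [hf₃, hf₂, hf₁]
  rw [← h0]
  -- When the second time is zero, the first and third flows are both generated by `Lu`, so opposite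
  -- times cancel: the family is constant along `(((0, 1), 0), -1)`.
  have h1 := G₃.apply_line_of_nab_eq_zero (((p, 0), 0), 0) (((0, 1), 0), -1) (fun s A => ?_) s A
  · have h2 : ((((p, (0 : ℝ)), (0 : ℝ)), (0 : ℝ)) : ((F × ℝ) × ℝ) × ℝ) + s • (((0, 1), 0), -1) =
        (((p, s), 0), -s) := by simp
    rw [h2] at h1
    exact h1
  · have h2 : ((((((0 : F), (1 : ℝ)), (0 : ℝ)), (-1 : ℝ)), (0 : V × V)) :
        (((F × ℝ) × ℝ) × ℝ) × (V × V)) = ((((0, 1), 0), 0), 0) + (-1 : ℝ) • ((0, 1), 0) := by simp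
    rw [h2, nab_add, LinearMap.add_apply, nab_real_smul, h32, hG₃]
    simp [hamR_apply]

/-! ### The Laplace operators over the upper half plane, in logarithmic coordinates -/

/-- The factor `-1 / (2π y)` for `y = e^η`. -/
def lapFactor (q : ℝ × ℝ) : ℝ := -(Real.exp (-q.2) / (2 * Real.pi))

lemma contDiff_lapFactor : ContDiff ℝ ∞ lapFactor := by
  unfold lapFactor
  fun_prop

/-- The rate of change of `arctan(α) / k`. -/
def rate (k : ℕ) (α : ℝ) : ℝ := 1 / (k * (1 + α ^ 2))

lemma contDiff_rate (k : ℕ) : ContDiff ℝ ∞ (rate k) := by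
  have : rate k = fun α => (k : ℝ)⁻¹ * (1 + α ^ 2)⁻¹ := by
    ext α
    rw [rate, one_div, mul_inv]
  rw [this]
  refine contDiff_const.mul (ContDiff.inv (by fun_prop) fun α => ?_)
  positivity

/-- The Laplace operator at the point `x + i e^η`, for families over a space mapping to the plane. -/
def lapOp (g : E → ℝ × ℝ) (hg : ContDiff ℝ ∞ g) : Module.End ℂ (Fam E k Λ) :=
  hamR e (fun p => lapFactor (g p)) (contDiff_lapFactor.comp hg)
    (fun p => -(lapFactor (g p) * (g p).1)) ((contDiff_lapFactor.comp hg).mul hg.fst).neg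
    (fun p => lapFactor (g p) * ((g p).1 ^ 2 + Real.exp (g p).2 ^ 2))
    ((contDiff_lapFactor.comp hg).mul ((hg.fst.pow 2).add (hg.snd.exp.pow 2)))

omit [FiniteDimensional ℝ V] [MeasurableSpace V] [BorelSpace V] in
lemma lapOp_apply {g : E → ℝ × ℝ} (hg : ContDiff ℝ ∞ g) (f : Fam E k Λ) (p : E) (A : V × V) :
    (lapOp e g hg f).1 (p, A) = lapFactor (g p) * ((Lv e f).1 (p, A) - (g p).1 * (Luv e f).1 (p, A) +
      ((g p).1 ^ 2 + Real.exp (g p).2 ^ 2) * (Lu e f).1 (p, A)) := by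
  rw [lapOp, hamR_apply]
  push_cast
  ring

/-- The curve of parameters of the three one-parameter groups. -/
def tripleCurve (k : ℕ) (z : ℝ × (ℝ × ℝ)) : (((ℝ × ℝ) × ℝ) × ℝ) × ℝ :=
  -- Rotation as a product of three shears: with `α = tan φ` the outer times carry `tan φ` and the
  -- middle one `α/(1 + α²) = sin(2φ)/2`. The summands `± z.2.1` conjugate by the shear that moves
  -- `iy` to `x + iy`.
  (((z.2, (z.2.1 - Real.exp z.2.2 * z.1) / (2 * (2 * Real.pi * k))),
    -(Real.exp (-z.2.2) / (2 * Real.pi * k)) * (z.1 / (1 + z.1 ^ 2))),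
    (-z.2.1 - Real.exp z.2.2 * z.1) / (2 * (2 * Real.pi * k)))

lemma contDiff_tripleCurve (k : ℕ) : ContDiff ℝ ∞ (tripleCurve k) := by
  have h1 : ContDiff ℝ ∞ fun z : ℝ × (ℝ × ℝ) => z.1 / (1 + z.1 ^ 2) := by
    refine ContDiff.div (by fun_prop) (by fun_prop) fun z => ?_
    positivity
  unfold tripleCurve
  refine ContDiff.prodMk (ContDiff.prodMk (ContDiff.prodMk (by fun_prop) ?_) ?_) ?_
  · fun_prop
  · exact ContDiff.mul (by fun_prop) h1
  · fun_prop

lemma fderiv_tripleCurve (k : ℕ) (z : ℝ × (ℝ × ℝ)) : fderiv ℝ (tripleCurve k) z (1, 0) =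
    (((0, -Real.exp z.2.2 / (2 * (2 * Real.pi * k))),
      -(Real.exp (-z.2.2) / (2 * Real.pi * k)) * ((1 - z.1 ^ 2) / (1 + z.1 ^ 2) ^ 2)),
      -Real.exp z.2.2 / (2 * (2 * Real.pi * k))) := by
  have h1 : HasDerivAt (fun α : ℝ => (α, z.2)) (1, 0) z.1 :=
    (hasDerivAt_id _).prodMk (hasDerivAt_const _ _)
  have h2 := ((contDiff_tripleCurve k).differentiable (by simp) (z.1, z.2)).hasFDerivAt.comp_hasDerivAt
    z.1 h1
  refine h2.unique ?_
  have hid := hasDerivAt_id z.1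
  refine HasDerivAt.prodMk (HasDerivAt.prodMk (HasDerivAt.prodMk (hasDerivAt_const _ _) ?_) ?_) ?_
  · refine (((hid.const_mul (Real.exp z.2.2)).const_sub z.2.1).div_const _).congr_deriv ?_
    ring
  · have hd : HasDerivAt (fun α : ℝ => α / (1 + α ^ 2)) ((1 - z.1 ^ 2) / (1 + z.1 ^ 2) ^ 2) z.1 := by
      refine (hid.div ((hid.pow 2).const_add 1) (ne_of_gt ?_)).congr_deriv ?_
      · change 0 < 1 + z.1 ^ 2
        positivity
      simp
      ring
    exact hd.const_mul (-(Real.exp (-z.2.2) / (2 * Real.pi * k)))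
  · refine (((hid.const_mul (Real.exp z.2.2)).const_sub (-z.2.1)).div_const _).congr_deriv ?_
    ring

/-- Solvability of the Schrödinger equation of the Laplace operators, in families over the upper
half plane; the time is `arctan(α) / k`. -/
theorem exists_lap_flow [Countable Λ] (hΛ : IsBundleLattice k Λ D) (hk : 1 ≤ k)
    (f : Fam (ℝ × ℝ) k Λ) :
    ∃ w : Fam (ℝ × (ℝ × ℝ)) k Λ, (∀ q A, w.1 ((0, q), A) = f.1 (q, A)) ∧
      ∀ z A, (nab ((1, 0), 0) w).1 (z, A) =
        Complex.I * (rate k z.1 * (lapOp e Prod.snd contDiff_snd w).1 (z, A)) := by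
  obtain ⟨G, h0, hG1, hG2, hG3⟩ := exists_triple_flow e hΛ f
  refine ⟨pull (tripleCurve k) (contDiff_tripleCurve k) G, fun q A => ?_, fun z A => ?_⟩
  · have h1 : tripleCurve k (0, q) = (((q, q.1 / (2 * (2 * Real.pi * k))), 0),
        -(q.1 / (2 * (2 * Real.pi * k)))) := by
      simp [tripleCurve, neg_div]
    rw [pull_apply, ← h0 q (q.1 / (2 * (2 * Real.pi * k))), h1]
  · rw [nab_pull_apply, fderiv_tripleCurve, lapOp_apply, Lu_pull, Lv_pull, Luv_pull]
    simp only [pull_apply]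
    set l := 2 * Real.pi * k with hl
    set y := Real.exp z.2.2 with hy
    set c₁ := -y / (2 * l)
    set c₂ := -(Real.exp (-z.2.2) / l) * ((1 - z.1 ^ 2) / (1 + z.1 ^ 2) ^ 2)
    have h2 : ((((((0 : ℝ × ℝ), c₁), c₂), c₁), (0 : V × V)) :
        ((((ℝ × ℝ) × ℝ) × ℝ) × ℝ) × (V × V)) = c₁ • ((((0, 1), 0), 0), 0) +
          c₂ • (((0, 1), 0), 0) + c₁ • ((0, 1), 0) := by simp
    simp only [h2, nab_add, LinearMap.add_apply, nab_real_smul, hG1, hG2, hG3, Fam.add_val,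
      Fam.smul_val, hamR_apply]
    have hk0 : (k : ℝ) ≠ 0 := by positivity
    have hpi := Real.pi_ne_zero
    have hy0 : y ≠ 0 := (Real.exp_pos _).ne'
    have hl0 : l ≠ 0 := by positivity
    have hα : (1 + z.1 ^ 2) ≠ 0 := by positivity
    have hfac : rate k z.1 * lapFactor z.2 = -(1 / (l * y * (1 + z.1 ^ 2))) := by
      rw [rate, lapFactor, Real.exp_neg, hl, ← hy]
      field_simp
    have ha : (tripleCurve k z).2 = (-z.2.1 - y * z.1) / (2 * l) := rfl
    have hb : (tripleCurve k z).1.2 = -(y⁻¹ / l) * (z.1 / (1 + z.1 ^ 2)) := by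
      rw [hy, ← Real.exp_neg]
      rfl
    have hc₂ : c₂ = -(y⁻¹ / l) * ((1 - z.1 ^ 2) / (1 + z.1 ^ 2) ^ 2) := by
      rw [hy, ← Real.exp_neg]
    -- The velocity of the curve has components `c₁`, `c₂`, `c₁` in the three times. The identities
    -- `e1`, `e2`, `e3` match the resulting coefficients of `Lv`, `Luv`, `Lu` with those of the
    -- Laplace operator.
    have e1 : c₁ * (4 * l ^ 2 * (tripleCurve k z).1.2 ^ 2) + c₂ = rate k z.1 * lapFactor z.2 := by
      rw [hfac, hb, hc₂]
      simp only [c₁]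
      field_simp
      ring
    have e2 : c₁ * (-2 * l * (tripleCurve k z).1.2 +
        8 * l ^ 3 * (tripleCurve k z).1.2 ^ 2 * (tripleCurve k z).2) +
        c₂ * (2 * l * (tripleCurve k z).2) = -(rate k z.1 * lapFactor z.2 * z.2.1) := by
      rw [hfac, hb, ha, hc₂]
      simp only [c₁]
      field_simp
      ring
    have e3 : c₁ * (1 - 8 * l ^ 2 * (tripleCurve k z).1.2 * (tripleCurve k z).2 +
          16 * l ^ 4 * (tripleCurve k z).1.2 ^ 2 * (tripleCurve k z).2 ^ 2) +
        c₂ * (4 * l ^ 2 * (tripleCurve k z).2 ^ 2) + c₁ =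
        rate k z.1 * lapFactor z.2 * (z.2.1 ^ 2 + y ^ 2) := by
      rw [hfac, hb, ha, hc₂]
      simp only [c₁]
      field_simp
      ring
    replace e1 := congrArg (fun r : ℝ => (r : ℂ)) e1
    replace e2 := congrArg (fun r : ℝ => (r : ℂ)) e2
    replace e3 := congrArg (fun r : ℝ => (r : ℂ)) e3
    push_cast at e1 e2 e3 ⊢
    linear_combination (Complex.I * (Lv e G).1 (tripleCurve k z, A)) * e1 +
      (Complex.I * (Luv e G).1 (tripleCurve k z, A)) * e2 +
      (Complex.I * (Lu e G).1 (tripleCurve k z, A)) * e3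

end TripleFlow

/-! ### Variation of the complex structure -/

section ParamDeriv

variable {E : Type*} [NormedAddCommGroup E] [NormedSpace ℝ E]

lemma paramDeriv_val (x : E) (m : SmoothFns E) (p : E) :
    (paramDeriv x m).1 p = fderiv ℝ m.1 p x := rfl

lemma paramDeriv_add (x : E) (m m' : SmoothFns E) :
    paramDeriv x (m + m') = paramDeriv x m + paramDeriv x m' := by
  ext p
  have h : fderiv ℝ (m + m').1 p = _ := fderiv_add (m.differentiableAt p) (m'.differentiableAt p)
  simp only [paramDeriv_val, h, SmoothFns.add_val, add_apply]

lemma paramDeriv_smul (x : E) (c : ℂ) (m : SmoothFns E) :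
    paramDeriv x (c • m) = c • paramDeriv x m := by
  ext p
  have h : fderiv ℝ (c • m).1 p = _ := fderiv_const_smul (m.differentiableAt p) c
  simp only [paramDeriv_val, h, SmoothFns.smul_val, smul_apply, smul_eq_mul]

lemma paramDeriv_mul (x : E) (m m' : SmoothFns E) :
    paramDeriv x (m * m') = paramDeriv x m * m' + m * paramDeriv x m' := by
  ext p
  have h : fderiv ℝ (m * m').1 p = _ := fderiv_mul (m.differentiableAt p) (m'.differentiableAt p)
  simp only [paramDeriv_val, h, SmoothFns.mul_val, SmoothFns.add_val, add_apply, smul_apply,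
    smul_eq_mul]
  ring

lemma paramDeriv_neg (x : E) (m : SmoothFns E) : paramDeriv x (-m) = -paramDeriv x m := by
  rw [← neg_one_smul ℂ, paramDeriv_smul, neg_one_smul]

lemma paramDeriv_sub (x : E) (m m' : SmoothFns E) :
    paramDeriv x (m - m') = paramDeriv x m - paramDeriv x m' := by
  rw [sub_eq_add_neg, paramDeriv_add, paramDeriv_neg, sub_eq_add_neg]

end ParamDeriv

/-! ### The commutation relations of `∂_σ`, `Δ_σ` and `Δ_G`. -/

section Variation

variable {V : Type*} [NormedAddCommGroup V] [InnerProductSpace ℝ V]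
  {E : Type*} [NormedAddCommGroup E] [NormedSpace ℝ E] {k n : ℕ} {Λ : Submodule ℤ V}
  (e : OrthonormalBasis (Fin n) ℝ V)

/-- The coordinate `x` of the upper half plane. -/
def coordX (g : E →L[ℝ] ℝ × ℝ) : SmoothFns E := realFn (fun p => (g p).1) g.contDiff.fst

/-- The coordinate `y = e^η` of the upper half plane. -/
def coordY (g : E →L[ℝ] ℝ × ℝ) : SmoothFns E :=
  realFn (fun p => Real.exp (g p).2) g.contDiff.snd.exp

/-- The inverse of the coordinate `y = e^η` of the upper half plane. -/
def coordYInv (g : E →L[ℝ] ℝ × ℝ) : SmoothFns E :=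
  realFn (fun p => Real.exp (-(g p).2)) g.contDiff.snd.neg.exp

lemma coordY_mul_coordYInv (g : E →L[ℝ] ℝ × ℝ) : coordY g * coordYInv g = 1 := by
  ext p
  simp only [coordY, coordYInv, SmoothFns.mul_val, realFn_val, SmoothFns.one_val]
  rw [← Complex.ofReal_mul, ← Real.exp_add, add_neg_cancel, Real.exp_zero, Complex.ofReal_one]

lemma paramDeriv_coordX (g : E →L[ℝ] ℝ × ℝ) (x : E) :
    paramDeriv x (coordX g) = algebraMap ℂ _ ((g x).1 : ℂ) := by
  ext p
  have h : HasFDerivAt (fun p => (g p).1) ((ContinuousLinearMap.fst ℝ ℝ ℝ).comp g) p :=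
    ((ContinuousLinearMap.fst ℝ ℝ ℝ).comp g).hasFDerivAt
  rw [coordX, paramDeriv_realFn, h.fderiv]
  rfl

lemma paramDeriv_coordY (g : E →L[ℝ] ℝ × ℝ) (x : E) :
    paramDeriv x (coordY g) = ((g x).2 : ℂ) • coordY g := by
  ext p
  have h : HasFDerivAt (fun p => (g p).2) ((ContinuousLinearMap.snd ℝ ℝ ℝ).comp g) p :=
    ((ContinuousLinearMap.snd ℝ ℝ ℝ).comp g).hasFDerivAt
  rw [coordY, paramDeriv_realFn, h.exp.fderiv, SmoothFns.smul_val, realFn_val]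
  simp [mul_comm]

lemma paramDeriv_coordYInv (g : E →L[ℝ] ℝ × ℝ) (x : E) :
    paramDeriv x (coordYInv g) = (-(g x).2 : ℂ) • coordYInv g := by
  ext p
  have h : HasFDerivAt (fun p => -(g p).2) (-((ContinuousLinearMap.snd ℝ ℝ ℝ).comp g)) p :=
    (-((ContinuousLinearMap.snd ℝ ℝ ℝ).comp g)).hasFDerivAt
  rw [coordYInv, paramDeriv_realFn, h.exp.fderiv, SmoothFns.smul_val, realFn_val]
  simp [mul_comm]

/-- The coordinate `x - i ε y`. -/
def coordC (ε : ℂ) (g : E →L[ℝ] ℝ × ℝ) : SmoothFns E := coordX g - (Complex.I * ε) • coordY g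

/-- The operator `Δ_G` for `ε = 1`, and its conjugate for `ε = -1`. -/
def hitchinOp (ε : ℂ) (g : E →L[ℝ] ℝ × ℝ) : Module.End ℂ (Fam E k Λ) :=
  ham e ((-(Complex.I * ε) / (4 * Real.pi)) • coordYInv g ^ 2)
    (-((-(Complex.I * ε) / (4 * Real.pi)) • coordYInv g ^ 2 * coordC ε g))
    ((-(Complex.I * ε) / (4 * Real.pi)) • coordYInv g ^ 2 * coordC ε g ^ 2)

lemma lapOp_eq_ham (g : E →L[ℝ] ℝ × ℝ) : (lapOp e g g.contDiff : Module.End ℂ (Fam E k Λ)) =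
    ham e ((-1 / (2 * Real.pi) : ℂ) • coordYInv g) (-((-1 / (2 * Real.pi) : ℂ) • coordYInv g * coordX g))
      ((-1 / (2 * Real.pi) : ℂ) • coordYInv g * (coordX g ^ 2 + coordY g ^ 2)) := by
  have h1 : ∀ p, (lapFactor (g p) : ℂ) = (-1 / (2 * Real.pi) : ℂ) * Real.exp (-(g p).2) := by
    intro p
    rw [lapFactor]
    push_cast
    ring
  rw [lapOp, hamR]
  congr 1 <;> ext p <;> simp only [realFn_val, SmoothFns.smul_val, SmoothFns.neg_val,
    SmoothFns.mul_val, SmoothFns.add_val, pow_two, coordX, coordY, coordYInv] <;>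
    push_cast <;> rw [h1] <;> push_cast <;> ring

/-- The derivative `∂_σ` for `ε = 1` and its conjugate for `ε = -1`. -/
def dolbeault (ε : ℂ) (g : E →L[ℝ] ℝ × ℝ) (x y : E) : Module.End ℂ (Fam E k Λ) :=
  (1 / 2 : ℂ) • nab (x, 0) - (Complex.I * ε / 2) • (mulOp (coordYInv g) * nab (y, 0))

lemma linear_combination_mul_eq {R : Type*} [Ring R] [Algebra ℂ R] {N₁ N₂ Y L H₁ H₂ : R}
    (h₁ : N₁ * L = L * N₁ + H₁) (h₂ : N₂ * L = L * N₂ + H₂) (hY : Y * L = L * Y) (a b : ℂ) :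
    (a • N₁ - b • (Y * N₂)) * L = L * (a • N₁ - b • (Y * N₂)) + (a • H₁ - b • (Y * H₂)) := by
  simp only [sub_mul, mul_sub, smul_mul_assoc, mul_smul_comm, mul_assoc, h₁, h₂, mul_add]
  rw [← mul_assoc Y L, hY, mul_assoc]
  module

lemma ham_sub (A B C A' B' C' : SmoothFns E) : (ham e A B C - ham e A' B' C' :
    Module.End ℂ (Fam E k Λ)) = ham e (A - A') (B - B') (C - C') := by
  simp only [ham, map_sub, sub_mul]
  abel

lemma mulOp_commute (m m' : SmoothFns E) :
    Commute (mulOp m : Module.End ℂ (Fam E k Λ)) (mulOp m') := mulOp_comm m m'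

lemma mulOp_commute_ham (m A B C : SmoothFns E) :
    Commute (mulOp m) (ham e A B C : Module.End ℂ (Fam E k Λ)) := by
  rw [ham]
  refine Commute.add_right (Commute.add_right ?_ ?_) ?_
  · exact Commute.mul_right (mulOp_commute m A) (mulOp_commute_Lv e m)
  · exact Commute.mul_right (mulOp_commute m B) (mulOp_commute_Luv e m)
  · exact Commute.mul_right (mulOp_commute m C) (mulOp_commute_Lu e m)

/-- `∂_σ` differentiates only the coefficients of `Δ_σ`, and the result is `Δ_G`, or its conjugate
for `ε = -1`. In the coordinate `η = log y` one has `∂_y = e^{-η} ∂_η`, the form used in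
`dolbeault`. -/
lemma dolbeault_mul_lapOp {ε : ℂ} (hε : ε ^ 2 = 1) (g : E →L[ℝ] ℝ × ℝ) {x y : E}
    (hx : g x = (1, 0)) (hy : g y = (0, 1)) :
    (dolbeault ε g x y * lapOp e g g.contDiff : Module.End ℂ (Fam E k Λ)) =
      lapOp e g g.contDiff * dolbeault ε g x y + hitchinOp e ε g := by
  rw [lapOp_eq_ham, dolbeault, linear_combination_mul_eq (nab_param_mul_ham e x _ _ _)
    (nab_param_mul_ham e y _ _ _) (mulOp_commute_ham e _ _ _ _).eq, mulOp_mul_ham, smul_ham,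
    smul_ham, ham_sub, hitchinOp]
  have hYp : ∀ p, (coordY g).1 p * (coordYInv g).1 p = 1 := fun p =>
    congrArg (fun m : SmoothFns E => m.1 p) (coordY_mul_coordYInv g)
  congr 2 <;> ext p <;> simp only [paramDeriv_add, paramDeriv_neg, paramDeriv_mul, paramDeriv_smul,
    paramDeriv_coordX, paramDeriv_coordY, paramDeriv_coordYInv, hx, hy, pow_two, coordC,
    SmoothFns.add_val, SmoothFns.sub_val, SmoothFns.mul_val, SmoothFns.smul_val, SmoothFns.neg_val,
    SmoothFns.algebraMap_val] <;> push_cast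
  all_goals
    have hY := hYp p
    set Y := (coordY g).1 p
    set Z := (coordYInv g).1 p
    set X := (coordX g).1 p
    have hpi : (Real.pi : ℂ) ≠ 0 := by exact_mod_cast Real.pi_ne_zero
    have hI := Complex.I_sq
    have hY0 : Y ≠ 0 := left_ne_zero_of_mul_eq_one hY
    have hZ : Z = Y⁻¹ := eq_inv_of_mul_eq_one_right hY
    rw [hZ]
    field_simp
  · ring
  · linear_combination (4 * Y) * (ε ^ 2 * hI - hε)
  · linear_combination (-8 * X * Y + 4 * Complex.I * ε * Y ^ 2) * (ε ^ 2 * hI - hε)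

lemma ham_congr {A B C A' B' C' : SmoothFns E} (hA : A = A') (hB : B = B') (hC : C = C') :
    (ham e A B C : Module.End ℂ (Fam E k Λ)) = ham e A' B' C' := by rw [hA, hB, hC]

/-- For `ε = 1` the operator is a sum of products of two creation operators, each of which raises
the eigenvalue of the Laplace operator by `2k`; for `ε = -1` annihilation operators lower it. -/
lemma lapOp_mul_hitchinOp {ε : ℂ} (hε : ε ^ 2 = 1) (g : E →L[ℝ] ℝ × ℝ) :
    (lapOp e g g.contDiff * hitchinOp e ε g : Module.End ℂ (Fam E k Λ)) =
      hitchinOp e ε g * lapOp e g g.contDiff + (4 * k * ε) • hitchinOp e ε g := by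
  rw [lapOp_eq_ham, hitchinOp, ham_mul_ham, smul_ham]
  congr 1
  have hYp : ∀ p, (coordY g).1 p * (coordYInv g).1 p = 1 := fun p =>
    congrArg (fun m : SmoothFns E => m.1 p) (coordY_mul_coordYInv g)
  refine ham_congr e ?_ ?_ ?_ <;> ext p <;> simp only [pow_two, coordC, kap,
    SmoothFns.add_val, SmoothFns.sub_val, SmoothFns.mul_val, SmoothFns.smul_val, SmoothFns.neg_val]
  all_goals
    have hY := hYp p
    set Y := (coordY g).1 p
    set Z := (coordYInv g).1 p
    set X := (coordX g).1 p
    have hpi : (Real.pi : ℂ) ≠ 0 := by exact_mod_cast Real.pi_ne_zero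
    have hI := Complex.I_sq
    have hY0 : Y ≠ 0 := left_ne_zero_of_mul_eq_one hY
    have hZ : Z = Y⁻¹ := eq_inv_of_mul_eq_one_right hY
    rw [hZ]
    field_simp
  · linear_combination (k * Y * ε ^ 2) * hI
  · linear_combination (-4 * k * X * Y * ε ^ 2 + 2 * Complex.I * k * Y ^ 2 * ε ^ 3) * hI +
      (2 * Complex.I * k * ε * Y ^ 2) * hε
  · linear_combination (k * Y * ε * (X - Complex.I * Y * ε)) * (ε * X * hI - Complex.I * Y * hε)

lemma dolbeault_apply (ε : ℂ) (g : E →L[ℝ] ℝ × ℝ) (x y : E) (f : Fam E k Λ) (p : E) (A : V × V) :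
    (dolbeault ε g x y f).1 (p, A) = (1 / 2 : ℂ) * (nab (x, 0) f).1 (p, A) -
      (Complex.I * ε / 2) * (Real.exp (-(g p).2) * (nab (y, 0) f).1 (p, A)) := rfl

lemma hitchinOp_apply (ε : ℂ) (g : E →L[ℝ] ℝ × ℝ) (f : Fam E k Λ) (p : E) (A : V × V) :
    (hitchinOp e ε g f).1 (p, A) = (-(Complex.I * ε) / (4 * Real.pi)) * Real.exp (-(g p).2) ^ 2 *
      ((Lv e f).1 (p, A) - ((g p).1 - Complex.I * ε * Real.exp (g p).2) * (Luv e f).1 (p, A) +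
        ((g p).1 - Complex.I * ε * Real.exp (g p).2) ^ 2 * (Lu e f).1 (p, A)) := by
  have h : ∀ m : SmoothFns E, (m ^ 2).1 p = m.1 p ^ 2 := fun m => by
    rw [pow_two, SmoothFns.mul_val, pow_two]
  rw [hitchinOp, ham_apply]
  simp only [SmoothFns.smul_val, SmoothFns.neg_val, SmoothFns.mul_val, h, coordC,
    SmoothFns.sub_val, coordX, coordY, coordYInv, realFn_val]
  ring

lemma param_mul_dolbeault {g : E →L[ℝ] ℝ × ℝ} {z : E} (hz : g z = 0) (ε : ℂ) (x y : E) :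
    (nab (z, 0) * dolbeault ε g x y : Module.End ℂ (Fam E k Λ)) =
      dolbeault ε g x y * nab (z, 0) := by
  have h1 : ∀ y, (nab (z, 0) * nab (y, 0) : Module.End ℂ (Fam E k Λ)) =
      nab (y, 0) * nab (z, 0) := fun y => by rw [nab_mul_nab]; simp [omega]
  rw [dolbeault, mul_sub, sub_mul, mul_smul_comm, mul_smul_comm, smul_mul_assoc, smul_mul_assoc, h1,
    ← mul_assoc, nab_mul_mulOp, paramDeriv_coordYInv, hz, add_mul, mul_assoc, h1, mul_assoc]
  simp

lemma param_mul_hitchinOp {g : E →L[ℝ] ℝ × ℝ} {z : E} (hz : g z = 0) (ε : ℂ) :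
    (nab (z, 0) * hitchinOp e ε g : Module.End ℂ (Fam E k Λ)) =
      hitchinOp e ε g * nab (z, 0) := by
  rw [hitchinOp, nab_param_mul_ham]
  simp only [coordC, pow_two, paramDeriv_neg, paramDeriv_mul, paramDeriv_smul, paramDeriv_sub,
    paramDeriv_coordX, paramDeriv_coordY, paramDeriv_coordYInv, hz]
  simp [ham]

/-- The commutation relation behind the conjugation formula. -/
lemma commutator_eq_zero {R : Type*} [Ring R] [Algebra ℂ R] {N S L H T C C' : R} {κ : ℂ}
    (hNS : N * S = S * N) (hNH : N * H = H * N) (hNC : N * C = C * N + C')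
    (hSL : S * L = L * S + H) (hST : S * T = T * S) (hLH : L * H = H * L + κ • H)
    (hTC : T * C = C * T) (hCL : C * L = L * C) (hTH : T * H = H * T)
    (hC : C' = Complex.I • (T + κ • (T * C))) :
    (N - Complex.I • (T * L)) * (S - C * H) = (S - C * H) * (N - Complex.I • (T * L)) := by
  have e1 : S * (T * L) = T * L * S + T * H := by
    rw [← mul_assoc, hST, mul_assoc, hSL, mul_add, mul_assoc]
  have e2 : N * (C * H) = C * H * N + C' * H := by
    rw [← mul_assoc, hNC, add_mul, mul_assoc, hNH, mul_assoc]
  have e3 : T * L * (C * H) = C * H * (T * L) + κ • (T * C * H) := by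
    have : C * H * (T * L) = T * C * (H * L) := by
      rw [mul_assoc, ← mul_assoc H, ← hTH, hTC]
      simp only [mul_assoc]
    rw [this, mul_assoc, ← mul_assoc L, ← hCL, mul_assoc C, hLH, mul_add, mul_add, mul_smul_comm,
      mul_smul_comm, mul_assoc, mul_assoc]
  simp only [sub_mul, mul_sub, smul_mul_assoc, mul_smul_comm, hNS, e1, e2, e3, hC, add_mul]
  module

/-! ### Conjugation of `∂_σ` by the flow of the Laplace operators. -/

variable [FiniteDimensional ℝ V] [MeasurableSpace V] [BorelSpace V] {D : Set (V × V)}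

/-- The coefficient of `Δ_G` after time `arctan(α) / k`. -/
def duhamelCoef (k : ℕ) (ε γ : ℂ) (α : ℝ) : ℂ :=
  ((1 + 4 * k * ε * γ) * Complex.exp (4 * Complex.I * ε * (Real.arctan α : ℝ)) - 1) / (4 * k * ε)

lemma contDiff_duhamelCoef (k : ℕ) (ε γ : ℂ) : ContDiff ℝ ∞ (duhamelCoef k ε γ) := by
  have h1 : ContDiff ℝ ∞ fun α : ℝ => ((Real.arctan α : ℝ) : ℂ) :=
    Complex.ofRealCLM.contDiff.comp Real.contDiff_arctan
  unfold duhamelCoef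
  exact ((contDiff_const.mul (contDiff_const.mul h1).cexp).sub contDiff_const).div_const _

/-- The linear equation is exactly condition `hC` of `commutator_eq_zero`. The exponent `4iε arctan
α` appears because `k · rate k α` is the derivative of `arctan`. -/
lemma hasDerivAt_duhamelCoef (hk : 1 ≤ k) {ε : ℂ} (hε : ε ^ 2 = 1) (γ : ℂ) (α : ℝ) :
    HasDerivAt (duhamelCoef k ε γ)
      (Complex.I * (rate k α + 4 * k * ε * (rate k α * duhamelCoef k ε γ α))) α := by
  have hk0 : (k : ℂ) ≠ 0 := by
    have : k ≠ 0 := by omega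
    exact_mod_cast this
  have hε0 : ε ≠ 0 := by
    rintro rfl
    simp at hε
  have h1 : HasDerivAt (fun α : ℝ => ((Real.arctan α : ℝ) : ℂ)) ((1 / (1 + α ^ 2) : ℝ) : ℂ) α :=
    (Real.hasDerivAt_arctan α).ofReal_comp
  have h2 := ((((h1.const_mul (4 * Complex.I * ε)).cexp).const_mul (1 + 4 * k * ε * γ)).sub_const
    1).div_const (4 * k * ε)
  refine h2.congr_deriv ?_
  have h3 : (1 + (α : ℂ) ^ 2) ≠ 0 := by
    have : (1 + α ^ 2) ≠ 0 := by positivity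
    exact_mod_cast this
  rw [rate, duhamelCoef]
  push_cast
  field_simp
  ring

/-- The slice of a family at a fixed value of the first parameter. -/
def sliceAt (α : ℝ) : Fam (ℝ × (ℝ × ℝ)) k Λ →ₗ[ℂ] Fam (ℝ × ℝ) k Λ :=
  pull (fun q => (α, q)) (contDiff_const.prodMk contDiff_id)

omit [FiniteDimensional ℝ V] [MeasurableSpace V] [BorelSpace V] in
lemma sliceAt_apply (α : ℝ) (w : Fam (ℝ × (ℝ × ℝ)) k Λ) (q : ℝ × ℝ) (A : V × V) :
    (sliceAt α w).1 (q, A) = w.1 ((α, q), A) := rfl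

omit [FiniteDimensional ℝ V] [MeasurableSpace V] [BorelSpace V] in
lemma nab_sliceAt (α : ℝ) (w : Fam (ℝ × (ℝ × ℝ)) k Λ) (x q : ℝ × ℝ) (A : V × V) :
    (nab (x, 0) (sliceAt α w)).1 (q, A) = (nab ((0, x), 0) w).1 ((α, q), A) := by
  rw [sliceAt, nab_pull_apply, (hasFDerivAt_prodMk_right α q).fderiv]
  rfl

omit [FiniteDimensional ℝ V] [MeasurableSpace V] [BorelSpace V] in
lemma dolbeault_sliceAt (ε : ℂ) (α : ℝ) (w : Fam (ℝ × (ℝ × ℝ)) k Λ) (q : ℝ × ℝ) (A : V × V) :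
    (dolbeault ε (ContinuousLinearMap.id ℝ _) (1, 0) (0, 1) (sliceAt α w)).1 (q, A) =
      (dolbeault ε (ContinuousLinearMap.snd ℝ ℝ (ℝ × ℝ)) (0, (1, 0)) (0, (0, 1)) w).1
        ((α, q), A) := by
  rw [dolbeault_apply, dolbeault_apply, nab_sliceAt, nab_sliceAt]
  rfl

omit [FiniteDimensional ℝ V] [MeasurableSpace V] [BorelSpace V] in
lemma hitchinOp_sliceAt (ε : ℂ) (α : ℝ) (w : Fam (ℝ × (ℝ × ℝ)) k Λ) (q : ℝ × ℝ) (A : V × V) :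
    (hitchinOp e ε (ContinuousLinearMap.id ℝ _) (sliceAt α w)).1 (q, A) =
      (hitchinOp e ε (ContinuousLinearMap.snd ℝ ℝ (ℝ × ℝ)) w).1 ((α, q), A) := by
  rw [hitchinOp_apply, hitchinOp_apply, sliceAt, Lu_pull, Lv_pull, Luv_pull]
  rfl

/-- The flow of the Laplace operators preserves the solutions of `∂_σ f = c Δ_G f`, and changes the
coefficient `c` in a definite way. -/
theorem dolbeault_flow [Countable Λ] (hD : IsCell Λ D) (hk : 1 ≤ k) {ε : ℂ} (hε : ε ^ 2 = 1)
    {γ : ℂ} {f : Fam (ℝ × ℝ) k Λ} {w : Fam (ℝ × (ℝ × ℝ)) k Λ}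
    (h0 : ∀ q A, w.1 ((0, q), A) = f.1 (q, A))
    (hw : ∀ z A, (nab ((1, 0), 0) w).1 (z, A) =
        Complex.I * (rate k z.1 * (lapOp e Prod.snd contDiff_snd w).1 (z, A)))
    (hf : dolbeault ε (ContinuousLinearMap.id ℝ _) (1, 0) (0, 1) f =
      γ • hitchinOp e ε (ContinuousLinearMap.id ℝ _) f) (α : ℝ) :
    dolbeault ε (ContinuousLinearMap.id ℝ _) (1, 0) (0, 1) (sliceAt α w) =
      duhamelCoef k ε γ α • hitchinOp e ε (ContinuousLinearMap.id ℝ _) (sliceAt α w) := by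
  have hk0 : (k : ℂ) ≠ 0 := by
    have : k ≠ 0 := by omega
    exact_mod_cast this
  have hε0 : ε ≠ 0 := by
    rintro rfl
    simp at hε
  set g := ContinuousLinearMap.snd ℝ ℝ (ℝ × ℝ) with hg
  set T : SmoothFns (ℝ × (ℝ × ℝ)) := realFn (fun z => rate k z.1)
    ((contDiff_rate k).comp contDiff_fst) with hT
  set C : SmoothFns (ℝ × (ℝ × ℝ)) := ⟨fun z => duhamelCoef k ε γ z.1,
    ((contDiff_duhamelCoef k ε γ).comp contDiff_fst :
      ContDiff ℝ ∞ fun z : ℝ × (ℝ × ℝ) => duhamelCoef k ε γ z.1)⟩ with hC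
  set S : Module.End ℂ (Fam (ℝ × (ℝ × ℝ)) k Λ) := dolbeault ε g (0, (1, 0)) (0, (0, 1)) with hS
  set H : Module.End ℂ (Fam (ℝ × (ℝ × ℝ)) k Λ) := hitchinOp e ε g with hH
  set L : Module.End ℂ (Fam (ℝ × (ℝ × ℝ)) k Λ) := lapOp e g g.contDiff with hL
  set N : Module.End ℂ (Fam (ℝ × (ℝ × ℝ)) k Λ) := nab ((1, 0), 0) with hN
  have hTv : ∀ z, T.1 z = (rate k z.1 : ℂ) := fun _ => rfl
  have hCv : C.1 = fun z => duhamelCoef k ε γ z.1 := rfl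
  have hderivT : ∀ x : ℝ × ℝ, paramDeriv ((0 : ℝ), x) T = 0 := by
    intro x
    ext p
    rw [hT, paramDeriv_realFn]
    have := ((((contDiff_rate k).differentiable (by simp)) p.1).hasFDerivAt.comp p
      (hasFDerivAt_fst (𝕜 := ℝ) (p := p))).fderiv
    have h' : fderiv ℝ (fun z : ℝ × (ℝ × ℝ) => rate k z.1) p = _ := this
    rw [h']
    simp
  have hderivC : paramDeriv ((1 : ℝ), (0 : ℝ × ℝ)) C =
      Complex.I • (T + (4 * k * ε) • (T * C)) := by
    ext p
    have := ((hasDerivAt_duhamelCoef hk hε γ p.1).hasFDerivAt.comp p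
      (hasFDerivAt_fst (𝕜 := ℝ) (p := p))).fderiv
    have h' : fderiv ℝ (fun z : ℝ × (ℝ × ℝ) => duhamelCoef k ε γ z.1) p = _ := this
    rw [paramDeriv_val]
    simp only [hCv, h', SmoothFns.smul_val, SmoothFns.add_val, SmoothFns.mul_val, hTv]
    simp
  have hST : S * mulOp T = mulOp T * S := by
    rw [hS, dolbeault, mul_sub, sub_mul, mul_smul_comm, mul_smul_comm, smul_mul_assoc,
      smul_mul_assoc, mul_assoc, nab_mul_mulOp, nab_mul_mulOp, hderivT, hderivT, map_zero, add_zero,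
      add_zero, ← mul_assoc (mulOp (coordYInv g)), mulOp_comm, mul_assoc]
  set U : Module.End ℂ (Fam (ℝ × (ℝ × ℝ)) k Λ) := N - Complex.I • (mulOp T * L) with hU
  set W : Module.End ℂ (Fam (ℝ × (ℝ × ℝ)) k Λ) := S - mulOp C * H with hW
  -- `U` annihilates the flow `w` and commutes with `W`, so `R = W w` solves the same Schrödinger
  -- equation. It vanishes at `α = 0` by `hf`, hence everywhere, and that is the claim.
  have key : U * W = W * U := by
    refine commutator_eq_zero (C' := mulOp (paramDeriv ((1 : ℝ), (0 : ℝ × ℝ)) C))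
      (κ := 4 * k * ε) (param_mul_dolbeault rfl ε _ _) (param_mul_hitchinOp e rfl ε)
      (nab_mul_mulOp _ _) (dolbeault_mul_lapOp e hε g rfl rfl) hST (lapOp_mul_hitchinOp e hε g)
      (mulOp_comm _ _) ?_ (mulOp_commute_ham e _ _ _ _).eq ?_
    · exact (mulOp_commute_ham e _ _ _ _).eq
    · rw [hderivC]
      simp only [map_smul, map_add, map_mul]
  have hNw : U w = 0 := by
    ext ⟨z, A⟩
    have := hw z A
    rw [hU, LinearMap.sub_apply, Fam.sub_val, this, LinearMap.smul_apply, Fam.smul_val,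
      Module.End.mul_apply, mulOp_apply, hT, realFn_val]
    exact sub_self _
  set R := W w with hR
  have hRN : nab ((1, 0), 0) R = Complex.I • mulOp T (L R) := by
    have h1 : U R = 0 := by
      rw [hR, ← Module.End.mul_apply, key, Module.End.mul_apply, hNw, map_zero]
    rw [hU, LinearMap.sub_apply, sub_eq_zero] at h1
    exact h1
  have hR0 : ∀ q A, R.1 ((0, q), A) = 0 := by
    intro q A
    have hs : sliceAt 0 w = f := by
      ext ⟨q, A⟩
      rw [sliceAt_apply, h0]
    rw [hR, hW, LinearMap.sub_apply, Fam.sub_val, Module.End.mul_apply, mulOp_apply,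
      ← dolbeault_sliceAt, ← hitchinOp_sliceAt, hs, hf, Fam.smul_val, hCv]
    have : duhamelCoef k ε γ 0 = γ := by
      rw [duhamelCoef]
      simp
      field_simp
    simp only [this, sub_self]
  ext ⟨q, A⟩
  rw [Fam.smul_val, dolbeault_sliceAt, hitchinOp_sliceAt, ← sub_eq_zero]
  have h1 := eq_zero_of_ham e hD R (0, q) (1, 0) (fun z => rate k z.1 * lapFactor z.2)
    (fun z => rate k z.1 * -(lapFactor z.2 * z.2.1))
    (fun z => rate k z.1 * (lapFactor z.2 * (z.2.1 ^ 2 + Real.exp z.2.2 ^ 2))) (fun z A => ?_)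
    (hR0 q) α A
  · have h2 : ((0 : ℝ), q) + α • ((1 : ℝ), (0 : ℝ × ℝ)) = (α, q) := by simp
    rw [h2] at h1
    exact h1
  · rw [hRN, Fam.smul_val, mulOp_apply, hL, lapOp, hamR_apply, hT, realFn_val]
    simp only [hg, ContinuousLinearMap.coe_snd']
    push_cast
    ring

end Variation

/-! ### Symmetries of the flow of the Laplace operators -/

section Symmetry

variable {V : Type*} [NormedAddCommGroup V] [InnerProductSpace ℝ V]
  {E : Type*} [NormedAddCommGroup E] [NormedSpace ℝ E]
  {E' : Type*} [NormedAddCommGroup E'] [NormedSpace ℝ E'] {k n : ℕ} {Λ : Submodule ℤ V}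
  (e : OrthonormalBasis (Fin n) ℝ V)

/-- The diagonal action of an isometry. -/
def diagL (w : V ≃ₗᵢ[ℝ] V) : V × V →L[ℝ] V × V :=
  (w.toContinuousLinearEquiv : V →L[ℝ] V).prodMap (w.toContinuousLinearEquiv : V →L[ℝ] V)

lemma diagL_apply (w : V ≃ₗᵢ[ℝ] V) (A : V × V) : diagL w A = (w A.1, w A.2) := rfl

lemma omega_diagL (w : V ≃ₗᵢ[ℝ] V) (A X : V × V) : omega k (diagL w A) (diagL w X) = omega k A X := by
  simp only [omega, diagL_apply, LinearIsometryEquiv.inner_map_map]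

lemma multiplier_diagL (w : V ≃ₗᵢ[ℝ] V) (l A : V × V) :
    multiplier k (diagL w l) (diagL w A) = multiplier k l A := by
  rw [multiplier, multiplier, omega_diagL]
  simp only [diagL_apply, LinearIsometryEquiv.inner_map_map]

/-- Substitution of an isometry preserving the lattice. -/
def act (w : V ≃ₗᵢ[ℝ] V) (hw : ∀ x ∈ Λ, w x ∈ Λ) : Fam E k Λ →ₗ[ℂ] Fam E k Λ where
  toFun f := ⟨fun x => f.1 (x.1, diagL w x.2), by
      have h : ContDiff ℝ ∞ fun x : E × (V × V) => diagL w x.2 :=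
        (diagL w).contDiff.comp (contDiff_snd (E := E))
      exact f.contDiff.comp (contDiff_fst.prodMk h),
    fun l₁ h₁ l₂ h₂ p A => by
      rw [← multiplier_diagL w]
      simp only [map_add]
      exact f.apply_add (hw _ h₁) (hw _ h₂) _ _⟩
  map_add' _ _ := rfl
  map_smul' _ _ := rfl

variable {w : V ≃ₗᵢ[ℝ] V} (hw : ∀ x ∈ Λ, w x ∈ Λ)

lemma act_apply (f : Fam E k Λ) (p : E) (A : V × V) :
    (act w hw f).1 (p, A) = f.1 (p, diagL w A) := rfl

lemma nab_act (f : Fam E k Λ) (x : E) (X : V × V) :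
    nab (x, X) (act w hw f) = act w hw (nab (x, diagL w X) f) := by
  ext ⟨p, A⟩
  have h1 : HasFDerivAt (fun x : E × (V × V) => (x.1, diagL w x.2))
      ((ContinuousLinearMap.fst ℝ E (V × V)).prod ((diagL w).comp
        (ContinuousLinearMap.snd ℝ E (V × V)))) (p, A) :=
    ((ContinuousLinearMap.fst ℝ E (V × V)).prod ((diagL w).comp
        (ContinuousLinearMap.snd ℝ E (V × V)))).hasFDerivAt
  have h2 : fderiv ℝ (act w hw f).1 (p, A) = _ :=
    ((f.differentiableAt (p, diagL w A)).hasFDerivAt.comp (p, A) h1).fderiv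
  rw [act_apply, nab_coe, nab_coe, nabF, nabF, h2]
  simp [act_apply, omega_diagL]

lemma opU_act (f : Fam E k Λ) (x : V) : opU x (act w hw f) = act w hw (opU (w x) f) := by
  rw [opU, nab_act, diagL_apply]
  simp [opU]

lemma opV_act (f : Fam E k Λ) (x : V) : opV x (act w hw f) = act w hw (opV (w x) f) := by
  rw [opV, nab_act, diagL_apply]
  simp [opV]

/-- Products of `opU` and `opV`, as a bilinear map. -/
def opBil (S T : V →ₗ[ℝ] Module.End ℂ (Fam E k Λ)) : V →ₗ[ℝ] V →ₗ[ℝ] Module.End ℂ (Fam E k Λ) :=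
  LinearMap.mk₂ ℝ (fun x y => S x * T y)
    (fun x x' y => by rw [map_add, add_mul])
    (fun c x y => by rw [map_smul, smul_mul_assoc])
    (fun x y y' => by rw [map_add, mul_add])
    (fun c x y => by rw [map_smul, mul_smul_comm])

/-- The image of `e` under the isometry is another orthonormal basis, and the contraction does not
depend on the basis. -/
lemma sum_map_eq (S T : V →ₗ[ℝ] Module.End ℂ (Fam E k Λ)) (w : V ≃ₗᵢ[ℝ] V) (f : Fam E k Λ) :
    ∑ i, S (w (e i)) (T (w (e i)) f) = ∑ i, S (e i) (T (e i) f) := by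
  have h := congrArg (fun T : Module.End ℂ (Fam E k Λ) => T f)
    (sum_orthonormal_eq e (e.map w) (opBil S T))
  simpa [LinearMap.sum_apply, opBil] using h

lemma Lu_act (f : Fam E k Λ) : Lu e (act w hw f) = act w hw (Lu e f) := by
  simp only [Lu, LinearMap.sum_apply, Module.End.mul_apply, opU_act]
  rw [← map_sum]
  exact congrArg _ (sum_map_eq e opUL opUL w f)

lemma Lv_act (f : Fam E k Λ) : Lv e (act w hw f) = act w hw (Lv e f) := by
  simp only [Lv, LinearMap.sum_apply, Module.End.mul_apply, opV_act]
  rw [← map_sum]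
  exact congrArg _ (sum_map_eq e opVL opVL w f)

lemma Luv_act (f : Fam E k Λ) : Luv e (act w hw f) = act w hw (Luv e f) := by
  simp only [Luv, LinearMap.sum_apply, Module.End.mul_apply, opV_act, opU_act, LinearMap.add_apply,
    Finset.sum_add_distrib]
  rw [← map_sum, ← map_sum, ← map_add]
  exact congrArg _ (congrArg₂ _ (sum_map_eq e opUL opVL w f) (sum_map_eq e opVL opUL w f))

/-- The Laplace operator at a fixed point `x + i e^η` of the upper half plane. -/
def lapPt (q : ℝ × ℝ) : Module.End ℂ (Fam E k Λ) := lapOp e (fun _ => q) contDiff_const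

lemma lapPt_apply (q : ℝ × ℝ) (f : Fam E k Λ) (p : E) (A : V × V) :
    (lapPt e q f).1 (p, A) = lapFactor q * ((Lv e f).1 (p, A) - q.1 * (Luv e f).1 (p, A) +
      (q.1 ^ 2 + Real.exp q.2 ^ 2) * (Lu e f).1 (p, A)) :=
  lapOp_apply e _ f p A

lemma lapPt_pull (q : ℝ × ℝ) {g : E' → E} (hg : ContDiff ℝ ∞ g) (f : Fam E k Λ) :
    lapPt e q (pull g hg f) = pull g hg (lapPt e q f) := by
  ext ⟨p, A⟩
  rw [lapPt_apply, Lu_pull, Lv_pull, Luv_pull]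
  simp only [pull_apply, lapPt_apply]

lemma lapPt_act (q : ℝ × ℝ) (f : Fam E k Λ) :
    lapPt e q (act w hw f) = act w hw (lapPt e q f) := by
  ext ⟨p, A⟩
  rw [lapPt_apply, Lu_act, Lv_act, Luv_act]
  simp only [act_apply, lapPt_apply]

lemma lapOp_snd_apply (f : Fam (ℝ × (ℝ × ℝ)) k Λ) (z : ℝ × (ℝ × ℝ)) (A : V × V) :
    (lapOp e Prod.snd contDiff_snd f).1 (z, A) = (lapPt e z.2 f).1 (z, A) := by
  rw [lapPt_apply, lapOp_apply]

/-- The logarithmic coordinates of a point of the upper half plane. -/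
def logCoord (σ : UpperHalfPlane) : ℝ × ℝ := (σ.re, Real.log σ.im)

lemma exp_logCoord (σ : UpperHalfPlane) : Real.exp (logCoord σ).2 = σ.im := Real.exp_log σ.im_pos

lemma lapFactor_logCoord (σ : UpperHalfPlane) :
    lapFactor (logCoord σ) = -(1 / (2 * Real.pi * σ.im)) := by
  rw [lapFactor, Real.exp_neg, exp_logCoord]
  have := σ.im_pos.ne'
  field_simp

lemma laplacian_eq_lapPt (b : Module.Basis (Fin n) ℝ V) (σ : UpperHalfPlane) (f : Fam E k Λ)
    (p : E) : laplacian k b σ (fun A => f.1 (p, A)) =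
      fun A => (lapPt e (logCoord σ) f).1 (p, A) := by
  rw [laplacian_slice b e]
  ext A
  rw [lapPt_apply, lapFactor_logCoord, exp_logCoord]
  simp only [logCoord]
  push_cast
  ring

lemma det_eq_one (φ : SL(2, ℤ)) : (φ 0 0 : ℝ) * φ 1 1 - φ 0 1 * φ 1 0 = 1 := by
  have := φ.det_coe
  rw [Matrix.det_fin_two] at this
  exact_mod_cast this

/-- The denominator is `|a + bσ|²`, nonzero because the determinant excludes `a = b = 0`. -/
lemma re_im_pushforward (φ : SL(2, ℤ)) (σ : UpperHalfPlane) :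
    0 < ((φ 0 0 : ℝ) + φ 0 1 * σ.re) ^ 2 + (φ 0 1 * σ.im) ^ 2 ∧
    (pushforward φ σ).re = ((φ 1 0 + φ 1 1 * σ.re) * (φ 0 0 + φ 0 1 * σ.re) +
      φ 0 1 * φ 1 1 * σ.im ^ 2) / (((φ 0 0 : ℝ) + φ 0 1 * σ.re) ^ 2 + (φ 0 1 * σ.im) ^ 2) ∧
    (pushforward φ σ).im = σ.im / (((φ 0 0 : ℝ) + φ 0 1 * σ.re) ^ 2 + (φ 0 1 * σ.im) ^ 2) := by
  have hdet := det_eq_one φ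
  have hy := σ.im_pos
  have hpos : 0 < ((φ 0 0 : ℝ) + φ 0 1 * σ.re) ^ 2 + (φ 0 1 * σ.im) ^ 2 := by
    by_cases h : (φ 0 1 : ℝ) = 0
    · rw [h] at hdet ⊢
      have : (φ 0 0 : ℝ) ≠ 0 := by
        intro h0
        rw [h0] at hdet
        simp at hdet
      have := sq_pos_of_ne_zero this
      simpa using this
    · have : 0 < ((φ 0 1 : ℝ) * σ.im) ^ 2 := sq_pos_of_ne_zero (mul_ne_zero h hy.ne')
      positivity
  refine ⟨hpos, ?_, ?_⟩
  · rw [← UpperHalfPlane.coe_re, coe_pushforward, Complex.div_re, Complex.normSq_apply]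
    simp only [Complex.add_re, Complex.add_im, Complex.mul_re, Complex.mul_im, Complex.intCast_re,
      Complex.intCast_im, UpperHalfPlane.coe_re, UpperHalfPlane.coe_im, zero_mul, sub_zero, zero_add,
      add_zero]
    rw [← add_div]
    congr 1 <;> ring
  · rw [← UpperHalfPlane.coe_im, coe_pushforward, Complex.div_im, Complex.normSq_apply]
    simp only [Complex.add_re, Complex.add_im, Complex.mul_re, Complex.mul_im, Complex.intCast_re,
      Complex.intCast_im, UpperHalfPlane.coe_re, UpperHalfPlane.coe_im, zero_mul, sub_zero, zero_add,
      add_zero]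
    rw [← sub_div]
    congr 1
    · linear_combination σ.im * hdet
    · ring

/-- Equivariance of the Laplacian: its coefficients are those of the binary quadratic form attached
to `σ`, divided by `Im σ`, and they transform oppositely to the symmetric square acting on `Lv`,
`Luv`, `Lu`. -/
lemma lapPt_rho (hΛ : IsRowInvariant k Λ) (φ : SL(2, ℤ)) (σ : UpperHalfPlane) (f : Fam E k Λ) :
    lapPt e (logCoord (pushforward φ σ)) (rho hΛ φ f) = rho hΛ φ (lapPt e (logCoord σ) f) := by
  ext ⟨p, A⟩
  rw [lapPt_apply, Lu_rho, Lv_rho, Luv_rho, lapFactor_logCoord, exp_logCoord]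
  simp only [rho_apply, Fam.add_val, Fam.smul_val, lapPt_apply, lapFactor_logCoord, exp_logCoord]
  obtain ⟨hN, hre, him⟩ := re_im_pushforward φ σ
  have h1 : (logCoord (pushforward φ σ)).1 = (pushforward φ σ).re := rfl
  have h2 : (logCoord σ).1 = σ.re := rfl
  rw [h1, h2, hre, him]
  have hdet := det_eq_one φ
  have hy := σ.im_pos.ne'
  set N := ((φ 0 0 : ℝ) + φ 0 1 * σ.re) ^ 2 + (φ 0 1 * σ.im) ^ 2 with hNdef
  set y := σ.im
  set x := σ.re
  have hpi := Real.pi_ne_zero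
  have hN0 := hN.ne'
  set ρ := ((φ 1 0 + φ 1 1 * x) * (φ 0 0 + φ 0 1 * x) + φ 0 1 * φ 1 1 * y ^ 2) / N with hρ
  -- This is `|φ_*σ|² = |c + dσ|² / |a + bσ|²`.
  have hmod : ρ ^ 2 + (y / N) ^ 2 = ((φ 1 0 + φ 1 1 * x) ^ 2 + (φ 1 1 * y) ^ 2) / N := by
    rw [hρ]
    field_simp
    rw [hNdef]
    linear_combination (-y ^ 2 * (φ 0 0 * φ 1 1 - φ 0 1 * φ 1 0 + 1)) * hdet
  have e1 : -(1 / (2 * Real.pi * (y / N))) * ((φ 1 1 : ℝ) ^ 2 - ρ * (2 * φ 0 1 * φ 1 1) +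
      (ρ ^ 2 + (y / N) ^ 2) * (φ 0 1) ^ 2) = -(1 / (2 * Real.pi * y)) := by
    rw [hmod, hρ]
    field_simp
    rw [hNdef]
    linear_combination (-(φ 0 0 * φ 1 1 - φ 0 1 * φ 1 0 + 1)) * hdet
  have e2 : -(1 / (2 * Real.pi * (y / N))) * ((φ 1 0 : ℝ) * φ 1 1 -
      ρ * (φ 0 0 * φ 1 1 + φ 0 1 * φ 1 0) + (ρ ^ 2 + (y / N) ^ 2) * (φ 0 0 * φ 0 1)) =
      -(1 / (2 * Real.pi * y)) * (-x) := by
    rw [hmod, hρ]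
    field_simp
    rw [hNdef]
    linear_combination (x * (φ 0 0 * φ 1 1 - φ 0 1 * φ 1 0 + 1)) * hdet
  have e3 : -(1 / (2 * Real.pi * (y / N))) * ((φ 1 0 : ℝ) ^ 2 - ρ * (2 * φ 0 0 * φ 1 0) +
      (ρ ^ 2 + (y / N) ^ 2) * (φ 0 0) ^ 2) = -(1 / (2 * Real.pi * y)) * (x ^ 2 + y ^ 2) := by
    rw [hmod, hρ]
    field_simp
    rw [hNdef]
    linear_combination (-(x ^ 2 + y ^ 2) * (φ 0 0 * φ 1 1 - φ 0 1 * φ 1 0 + 1)) * hdet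
  replace e1 := congrArg (fun r : ℝ => (r : ℂ)) e1
  replace e2 := congrArg (fun r : ℝ => (r : ℂ)) e2
  replace e3 := congrArg (fun r : ℝ => (r : ℂ)) e3
  push_cast at e1 e2 e3 ⊢
  linear_combination ((Lv e f).1 (p, rowAction φ A)) * e1 +
    ((Luv e f).1 (p, rowAction φ A)) * e2 + ((Lu e f).1 (p, rowAction φ A)) * e3

end Symmetry

/-! ### The unitary group of the Laplace operators -/

section Evolution

variable {V : Type*} [NormedAddCommGroup V] [InnerProductSpace ℝ V]
  {E : Type*} [NormedAddCommGroup E] [NormedSpace ℝ E]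
  {E' : Type*} [NormedAddCommGroup E'] [NormedSpace ℝ E'] {k n : ℕ} {Λ : Submodule ℤ V}
  [FiniteDimensional ℝ V] [MeasurableSpace V] [BorelSpace V] {D : Set (V × V)}
  (e : OrthonormalBasis (Fin n) ℝ V)

lemma pair_lapPt [Countable Λ] (hD : IsCell Λ D) (q : ℝ × ℝ) (f : Fam E k Λ) (p : E)
    (g : Fam E' k Λ) (p' : E') :
    pair D (lapPt e q f) p g p' = pair D f p (lapPt e q g) p' := by
  have h : ∀ {E : Type _} [NormedAddCommGroup E] [NormedSpace ℝ E] (f : Fam E k Λ),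
      lapPt e q f = (lapFactor q : ℂ) • (Lv e f + ((-q.1 : ℝ) : ℂ) • Luv e f +
        ((q.1 ^ 2 + Real.exp q.2 ^ 2 : ℝ) : ℂ) • Lu e f) := by
    intro E _ _ f
    ext ⟨p, A⟩
    simp only [lapPt_apply, Fam.smul_val, Fam.add_val]
    push_cast
    ring
  have h' : ∀ {E : Type _} [NormedAddCommGroup E] [NormedSpace ℝ E] (f : Fam E k Λ),
      lapPt e q f = (lapFactor q : ℂ) • (Lv e f + ((-q.1 : ℝ) : ℂ) • Luv e f +
        ((q.1 ^ 2 + Real.exp q.2 ^ 2 : ℝ) : ℂ) • Lu e f) := by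
    intro E _ _ f
    ext ⟨p, A⟩
    simp only [lapPt_apply, Fam.smul_val, Fam.add_val]
    push_cast
    ring
  rw [h, h']
  simp only [pair_add_left hD, pair_add_right hD, pair_smul_left, pair_smul_right, pair_Lv e hD,
    pair_Lu e hD, pair_Luv e hD, Complex.conj_ofReal]

/-- `w` solves the Schrödinger equations of the Laplace operators with initial value `f`. -/
structure IsLapFlow (f : Fam (ℝ × ℝ) k Λ) (w : Fam (ℝ × (ℝ × ℝ)) k Λ) : Prop where
  initial : ∀ q A, w.1 ((0, q), A) = f.1 (q, A)
  flow : ∀ z A, (nab ((1, 0), 0) w).1 (z, A) =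
    Complex.I * (rate k z.1 * (lapOp e Prod.snd contDiff_snd w).1 (z, A))

lemma eq_zero_of_lapPt [Countable Λ] (hD : IsCell Λ D) (q : ℝ × ℝ) (u : Fam ℝ k Λ)
    (h0 : ∀ A, u.1 (0, A) = 0)
    (h : ∀ α A, (nab (1, 0) u).1 (α, A) = Complex.I * (rate k α * (lapPt e q u).1 (α, A)))
    (α : ℝ) (A : V × V) : u.1 (α, A) = 0 := by
  have h1 := eq_zero_of_ham e hD u 0 1 (fun α => rate k α * lapFactor q)
    (fun α => rate k α * -(lapFactor q * q.1))
    (fun α => rate k α * (lapFactor q * (q.1 ^ 2 + Real.exp q.2 ^ 2))) (fun α A => ?_) h0 α A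
  · simpa using h1
  · rw [h, lapPt_apply]
    push_cast
    ring

omit [FiniteDimensional ℝ V] [MeasurableSpace V] [BorelSpace V] in
lemma contDiff_curve (q : ℝ × ℝ) : ContDiff ℝ ∞ fun α : ℝ => (α, q) :=
  contDiff_id.prodMk contDiff_const

omit [FiniteDimensional ℝ V] [MeasurableSpace V] [BorelSpace V] in
lemma nab_curve {f : Fam (ℝ × ℝ) k Λ} {w : Fam (ℝ × (ℝ × ℝ)) k Λ} (hw : IsLapFlow e f w)
    (q : ℝ × ℝ) : nab (1, 0) (pull (fun α => (α, q)) (contDiff_curve q) w) =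
      Complex.I • mulOp (realFn (rate k) (contDiff_rate k))
        (lapPt e q (pull (fun α => (α, q)) (contDiff_curve q) w)) := by
  ext ⟨α, A⟩
  have h1 : fderiv ℝ (fun α : ℝ => (α, q)) α 1 = (1, 0) := by
    have := ((hasFDerivAt_id (𝕜 := ℝ) α).prodMk (hasFDerivAt_const q α)).fderiv
    have h' : fderiv ℝ (fun α : ℝ => (α, q)) α = _ := this
    rw [h']
    rfl
  rw [nab_pull_apply, h1, hw.flow, lapOp_snd_apply, Fam.smul_val, mulOp_apply, lapPt_pull]
  rfl

/-- The difference of the two curves solves the Schrödinger equation at `q'` with zero initial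
value. The abstract `S` and `T` cover the Weyl group and `SL(2, ℤ)` at once. -/
lemma IsLapFlow.eq_of_intertwine [Countable Λ] (hD : IsCell Λ D) {f f' : Fam (ℝ × ℝ) k Λ}
    {w w' : Fam (ℝ × (ℝ × ℝ)) k Λ} (hw : IsLapFlow e f w) (hw' : IsLapFlow e f' w') (q q' : ℝ × ℝ)
    (S : Module.End ℂ (Fam ℝ k Λ)) (T : V × V → V × V)
    (hS : ∀ (u : Fam ℝ k Λ) α A, (S u).1 (α, A) = u.1 (α, T A))
    (hnab : ∀ u, nab (1, 0) (S u) = S (nab (1, 0) u))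
    (hlap : ∀ u, lapPt e q' (S u) = S (lapPt e q u))
    (h0 : ∀ A, f'.1 (q', A) = f.1 (q, T A)) (α : ℝ) (A : V × V) :
    w'.1 ((α, q'), A) = w.1 ((α, q), T A) := by
  set c := pull (fun α => (α, q)) (contDiff_curve q) w with hc
  set c' := pull (fun α => (α, q')) (contDiff_curve q') w' with hc'
  have h := eq_zero_of_lapPt e hD q' (c' - S c) (fun A => ?_) (fun α A => ?_) α A
  · rw [Fam.sub_val, hS, sub_eq_zero] at h
    exact h
  · rw [Fam.sub_val, hS, hc, hc', pull_apply, pull_apply, hw.initial, hw'.initial, h0, sub_self]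
  · rw [map_sub, map_sub, hnab, nab_curve e hw, nab_curve e hw', hlap]
    simp only [Fam.sub_val, Fam.smul_val, mulOp_apply, hS, realFn_val]
    ring

/-- By symmetry of the Laplace operator, the coefficient along an eigensection obeys a scalar linear
equation in the time `arctan(α)/k`. -/
lemma IsLapFlow.pair_eq [Countable Λ] (hD : IsCell Λ D) {f : Fam (ℝ × ℝ) k Λ}
    {w : Fam (ℝ × (ℝ × ℝ)) k Λ} (hw : IsLapFlow e f w) (q : ℝ × ℝ) (v : Fam E k Λ) (p : E) (μ : ℝ)
    (hv : ∀ A, (lapPt e q v).1 (p, A) = μ * v.1 (p, A)) (α : ℝ) :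
    pair D w (α, q) v p = Complex.exp (Complex.I * μ * (Real.arctan α : ℝ) / k) *
      pair D f q v p := by
  set c := pull (fun α => (α, q)) (contDiff_curve q) w with hc
  have hcw : ∀ α, pair D w (α, q) v p = pair D c α v p := fun _ => rfl
  have hcf : pair D c 0 v p = pair D f q v p := by
    rw [pair, pair]
    simp only [hc, pull_apply, hw.initial]
  have hpv : ∀ α, pair D c α (lapPt e q v) p = μ * pair D c α v p := by
    intro α
    rw [pair, pair, ← integral_const_mul]
    refine integral_congr_ae (.of_forall fun A => ?_)
    simp only [hv, map_mul, Complex.conj_ofReal]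
    ring
  have hd : ∀ α, HasDerivAt (fun α => pair D c α v p)
      (Complex.I * μ * rate k α * pair D c α v p) α := by
    intro α
    have h := hasDerivAt_pair hD c 0 1 v p 0 α
    simp only [smul_zero, add_zero, smul_eq_mul, mul_one, zero_add] at h
    refine h.congr_deriv ?_
    have h1 : pair D c α (nab (0, 0) v) p = 0 := by
      have : nab ((0 : E), (0 : V × V)) v = 0 := by
        ext ⟨p, A⟩
        have h0 : ((0 : E), (0 : V × V)) = 0 := rfl
        rw [nab_coe, nabF, h0]
        simp [omega]
      rw [this, pair]
      simp
    have h2 : pair D (nab (1, 0) c) α v p = Complex.I * rate k α * pair D (lapPt e q c) α v p := by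
      rw [hc, nab_curve e hw, ← hc, pair, pair, ← integral_const_mul]
      refine integral_congr_ae (.of_forall fun A => ?_)
      simp only [Fam.smul_val, mulOp_apply, realFn_val]
      ring
    rw [h1, h2, pair_lapPt e hD, hpv]
    ring
  have ha : ∀ α : ℝ, HasDerivAt (fun α : ℝ => Complex.exp (-(Complex.I * μ *
      (Real.arctan α : ℝ) / k))) (Complex.exp (-(Complex.I * μ * (Real.arctan α : ℝ) / k)) *
        (-(Complex.I * μ * rate k α))) α := by
    intro α
    have h1 := (Real.hasDerivAt_arctan α).ofReal_comp
    have h2 := (((h1.const_mul (Complex.I * μ)).div_const (k : ℂ)).neg).cexp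
    refine h2.congr_deriv ?_
    rw [rate]
    push_cast
    congr 1
    rw [div_mul_eq_div_div_swap]
    ring
  have hconst : ∀ α, pair D c α v p * Complex.exp (-(Complex.I * μ * (Real.arctan α : ℝ) / k)) =
      pair D c 0 v p * Complex.exp (-(Complex.I * μ * (Real.arctan 0 : ℝ) / k)) := by
    intro α
    refine is_const_of_deriv_eq_zero (f := fun α : ℝ => pair D c α v p *
      Complex.exp (-(Complex.I * μ * (Real.arctan α : ℝ) / k)))
      (fun α => ((hd α).mul (ha α)).differentiableAt) (fun α => ?_) α 0
    have h' : deriv (fun α : ℝ => pair D c α v p *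
      Complex.exp (-(Complex.I * μ * (Real.arctan α : ℝ) / k))) α = _ := ((hd α).mul (ha α)).deriv
    rw [h']
    ring
  have h := hconst α
  rw [Real.arctan_zero, Complex.ofReal_zero, mul_zero, zero_div, neg_zero, Complex.exp_zero,
    mul_one, hcf] at h
  rw [hcw, ← h, mul_left_comm, ← Complex.exp_add, add_neg_cancel, Complex.exp_zero, mul_one]

variable [Countable Λ] (hΛ : IsBundleLattice k Λ D) (hk : 1 ≤ k)

/-- The unitary operators `e^{i (arctan(α) / k) Δ}`, at all points of the upper half plane. -/
def lapStep (α : ℝ) (f : Fam (ℝ × ℝ) k Λ) : Fam (ℝ × ℝ) k Λ :=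
  sliceAt α (exists_lap_flow e hΛ hk f).choose

omit [Countable Λ] in
lemma exists_isLapFlow [Countable Λ] (α : ℝ) (f : Fam (ℝ × ℝ) k Λ) :
    ∃ w, IsLapFlow e f w ∧ lapStep e hΛ hk α f = sliceAt α w :=
  ⟨_, ⟨(exists_lap_flow e hΛ hk f).choose_spec.1, (exists_lap_flow e hΛ hk f).choose_spec.2⟩, rfl⟩

/-- The unitary operators `e^{i (θ / k) Δ}`, at all points of the upper half plane. -/
def lapEvol (θ : ℝ) : Fam (ℝ × ℝ) k Λ → Fam (ℝ × ℝ) k Λ :=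
  -- The three-shear formula reaches only angles below `π/2`. Division by `⌈|θ|⌉₊ + 1` makes each
  -- angle strictly smaller than `1`, where `arctan` inverts `tan`, and avoids division by zero.
  (lapStep e hΛ hk (Real.tan (θ / (⌈|θ|⌉₊ + 1 : ℕ))))^[⌈|θ|⌉₊ + 1]

omit [FiniteDimensional ℝ V] [MeasurableSpace V] [BorelSpace V] [Countable Λ] in
lemma arctan_tan_div (θ : ℝ) : Real.arctan (Real.tan (θ / (⌈|θ|⌉₊ + 1 : ℕ))) =
    θ / (⌈|θ|⌉₊ + 1 : ℕ) := by
  have h1 : (0 : ℝ) < (⌈|θ|⌉₊ + 1 : ℕ) := by positivity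
  have h2 : |θ / (⌈|θ|⌉₊ + 1 : ℕ)| < 1 := by
    rw [abs_div, abs_of_pos h1, div_lt_one h1]
    push_cast
    exact (Nat.le_ceil _).trans_lt (lt_add_one _)
  have h3 := Real.pi_gt_three
  rw [abs_lt] at h2
  exact Real.arctan_tan (by linarith) (by linarith)

lemma pair_lapEvol (θ : ℝ) (f : Fam (ℝ × ℝ) k Λ) (q : ℝ × ℝ) (v : Fam E k Λ) (p : E) (μ : ℝ)
    (hv : ∀ A, (lapPt e q v).1 (p, A) = μ * v.1 (p, A)) :
    pair D (lapEvol e hΛ hk θ f) q v p =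
      Complex.exp (Complex.I * μ * θ / k) * pair D f q v p := by
  have key : ∀ N : ℕ, ∀ α : ℝ, pair D ((lapStep e hΛ hk α)^[N] f) q v p =
      Complex.exp (N * (Complex.I * μ * (Real.arctan α : ℝ) / k)) * pair D f q v p := by
    intro N α
    induction N with
    | zero => simp
    | succ N ih =>
      rw [Function.iterate_succ_apply']
      obtain ⟨w, hw, hs⟩ := exists_isLapFlow e hΛ hk α ((lapStep e hΛ hk α)^[N] f)
      have h1 : pair D (sliceAt α w) q v p = pair D w (α, q) v p := rfl
      rw [hs, h1, hw.pair_eq e hΛ.cell q v p μ hv, ih, ← mul_assoc, ← Complex.exp_add]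
      congr 2
      push_cast
      ring
  rw [lapEvol, key, arctan_tan_div]
  congr 2
  have h1 : ((⌈|θ|⌉₊ + 1 : ℕ) : ℂ) ≠ 0 := Nat.cast_ne_zero.2 (Nat.succ_ne_zero _)
  push_cast at h1 ⊢
  field_simp

lemma lapEvol_intertwine (θ : ℝ) {f f' : Fam (ℝ × ℝ) k Λ} (q q' : ℝ × ℝ)
    (S : Module.End ℂ (Fam ℝ k Λ)) (T : V × V → V × V)
    (hS : ∀ (u : Fam ℝ k Λ) α A, (S u).1 (α, A) = u.1 (α, T A))
    (hnab : ∀ u, nab (1, 0) (S u) = S (nab (1, 0) u))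
    (hlap : ∀ u, lapPt e q' (S u) = S (lapPt e q u))
    (h0 : ∀ A, f'.1 (q', A) = f.1 (q, T A)) (A : V × V) :
    (lapEvol e hΛ hk θ f').1 (q', A) = (lapEvol e hΛ hk θ f).1 (q, T A) := by
  have key : ∀ N : ℕ, ∀ α : ℝ, ∀ A, ((lapStep e hΛ hk α)^[N] f').1 (q', A) =
      ((lapStep e hΛ hk α)^[N] f).1 (q, T A) := by
    intro N α
    induction N with
    | zero => exact h0
    | succ N ih =>
      intro A
      rw [Function.iterate_succ_apply', Function.iterate_succ_apply']
      obtain ⟨w, hw, hs⟩ := exists_isLapFlow e hΛ hk α ((lapStep e hΛ hk α)^[N] f)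
      obtain ⟨w', hw', hs'⟩ := exists_isLapFlow e hΛ hk α ((lapStep e hΛ hk α)^[N] f')
      rw [hs, hs', sliceAt_apply, sliceAt_apply]
      exact IsLapFlow.eq_of_intertwine e hΛ.cell hw hw' q q' S T hS hnab hlap ih α A
  exact key _ _ A

lemma lapEvol_act (θ : ℝ) {f : Fam (ℝ × ℝ) k Λ} (q : ℝ × ℝ) (w : V ≃ₗᵢ[ℝ] V)
    (hw : ∀ x ∈ Λ, w x ∈ Λ) (h0 : ∀ A, f.1 (q, diagL w A) = f.1 (q, A)) (A : V × V) :
    (lapEvol e hΛ hk θ f).1 (q, diagL w A) = (lapEvol e hΛ hk θ f).1 (q, A) :=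
  (lapEvol_intertwine e hΛ hk θ q q (act w hw) (diagL w) (fun _ _ _ => rfl)
    (fun u => by rw [nab_act, map_zero]) (fun u => lapPt_act e hw q u) (fun A => (h0 A).symm) A).symm

lemma lapEvol_rho (θ : ℝ) {f f' : Fam (ℝ × ℝ) k Λ} (φ : SL(2, ℤ)) (σ : UpperHalfPlane)
    (h0 : ∀ A, f'.1 (logCoord (pushforward φ σ), A) = f.1 (logCoord σ, rowAction φ A))
    (A : V × V) : (lapEvol e hΛ hk θ f').1 (logCoord (pushforward φ σ), A) =
      (lapEvol e hΛ hk θ f).1 (logCoord σ, rowAction φ A) := by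
  have h : rowAction φ (0 : V × V) = 0 := by simp [rowAction]
  exact lapEvol_intertwine e hΛ hk θ _ _ (rho hΛ.row φ) (rowAction φ) (fun _ _ _ => rfl)
    (fun u => by rw [nab_rho, h]) (fun u => lapPt_rho e hΛ.row φ σ u) h0 A

/-- A step of angle `φ` multiplies `1 + 4kεc` by `e^{4iεφ}`, where `c` is the coefficient of `Δ_G`;
start from `c = 0`. -/
lemma dolbeault_lapEvol (θ : ℝ) {ε : ℂ} (hε : ε ^ 2 = 1) {f : Fam (ℝ × ℝ) k Λ}
    (hf : dolbeault ε (ContinuousLinearMap.id ℝ _) (1, 0) (0, 1) f = 0) :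
    dolbeault ε (ContinuousLinearMap.id ℝ _) (1, 0) (0, 1) (lapEvol e hΛ hk θ f) =
      ((Complex.exp (4 * Complex.I * ε * θ) - 1) / (4 * k * ε)) •
        hitchinOp e ε (ContinuousLinearMap.id ℝ _) (lapEvol e hΛ hk θ f) := by
  have hk0 : (k : ℂ) ≠ 0 := by
    have : k ≠ 0 := by omega
    exact_mod_cast this
  have hε0 : ε ≠ 0 := by
    rintro rfl
    simp at hε
  have key : ∀ N : ℕ, ∀ α : ℝ,
      dolbeault ε (ContinuousLinearMap.id ℝ _) (1, 0) (0, 1) ((lapStep e hΛ hk α)^[N] f) =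
      ((Complex.exp (N * (4 * Complex.I * ε * (Real.arctan α : ℝ))) - 1) / (4 * k * ε)) •
        hitchinOp e ε (ContinuousLinearMap.id ℝ _) ((lapStep e hΛ hk α)^[N] f) := by
    intro N α
    induction N with
    | zero => simp [hf]
    | succ N ih =>
      rw [Function.iterate_succ_apply']
      obtain ⟨w, hw, hs⟩ := exists_isLapFlow e hΛ hk α ((lapStep e hΛ hk α)^[N] f)
      rw [hs, dolbeault_flow e hΛ.cell hk hε hw.initial hw.flow ih, duhamelCoef]
      congr 1
      have : ((N + 1 : ℕ) : ℂ) * (4 * Complex.I * ε * (Real.arctan α : ℝ)) =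
        N * (4 * Complex.I * ε * (Real.arctan α : ℝ)) + 4 * Complex.I * ε * (Real.arctan α : ℝ) := by
        push_cast
        ring
      rw [this, Complex.exp_add]
      field_simp
      ring
  rw [lapEvol, key, arctan_tan_div]
  congr 4
  have h1 : ((⌈|θ|⌉₊ + 1 : ℕ) : ℂ) ≠ 0 := Nat.cast_ne_zero.2 (Nat.succ_ne_zero _)
  push_cast at h1 ⊢
  field_simp

end Evolution

/-! ### Ladder operators -/

section Ladder

variable {V : Type*} [NormedAddCommGroup V] [InnerProductSpace ℝ V]
  {E : Type*} [NormedAddCommGroup E] [NormedSpace ℝ E] {k n : ℕ} {Λ : Submodule ℤ V}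
  (e : OrthonormalBasis (Fin n) ℝ V)

lemma sum_inner_smul_map {R : Type*} [AddCommGroup R] [Module ℝ R] [Module ℂ R]
    [IsScalarTower ℝ ℂ R] (T : V →ₗ[ℝ] R) (x : V) :
    ∑ i, (⟪x, e i⟫_ℝ : ℂ) • T (e i) = T x := by
  conv_rhs => rw [← e.sum_repr' x]
  rw [map_sum]
  refine Finset.sum_congr rfl fun i _ => ?_
  rw [map_smul, real_inner_comm]
  exact algebraMap_smul ℂ ⟪e i, x⟫_ℝ (T (e i))

lemma opV_mul_opU (x y : V) : (opV x * opU y : Module.End ℂ (Fam E k Λ)) =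
    opU y * opV x - (kap k * ⟪x, y⟫_ℝ) • 1 := by
  rw [opU_mul_opV, real_inner_comm]
  abel

lemma commute_opU (x y : V) : Commute (opU x : Module.End ℂ (Fam E k Λ)) (opU y) :=
  opU_mul_opU x y

lemma commute_opV (x y : V) : Commute (opV x : Module.End ℂ (Fam E k Λ)) (opV y) :=
  opV_mul_opV x y

lemma opU_mul_Lu (x : V) : (opU x * Lu e : Module.End ℂ (Fam E k Λ)) = Lu e * opU x := by
  have h : Commute (opU x : Module.End ℂ (Fam E k Λ)) (Lu e) :=
    Commute.sum_right _ _ _ fun _ _ => Commute.mul_right (commute_opU x _) (commute_opU x _)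
  exact h.eq

lemma opV_mul_Lv (x : V) : (opV x * Lv e : Module.End ℂ (Fam E k Λ)) = Lv e * opV x := by
  have h : Commute (opV x : Module.End ℂ (Fam E k Λ)) (Lv e) :=
    Commute.sum_right _ _ _ fun _ _ => Commute.mul_right (commute_opV x _) (commute_opV x _)
  exact h.eq

/-- Each `i` contributes `2 kap ⟨x, e_i⟩ opV (e_i)`, and these terms add up to the expansion of `opV
x` in the basis `e`. -/
lemma opU_mul_Lv (x : V) : (opU x * Lv e : Module.End ℂ (Fam E k Λ)) =
    Lv e * opU x + (2 * kap k) • opV x := by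
  have h : (opV x : Module.End ℂ (Fam E k Λ)) = _ := (sum_inner_smul_map e opVL x).symm
  rw [h, Lv, Finset.mul_sum, Finset.sum_mul, Finset.smul_sum, ← Finset.sum_add_distrib]
  refine Finset.sum_congr rfl fun i _ => ?_
  have h1 : (opVL (e i) : Module.End ℂ (Fam E k Λ)) = opV (e i) := rfl
  rw [← mul_assoc, opU_mul_opV, add_mul, mul_assoc, opU_mul_opV, h1, mul_add, ← mul_assoc,
    smul_mul_assoc, one_mul, mul_smul_comm, mul_one]
  module

lemma opV_mul_Lu (x : V) : (opV x * Lu e : Module.End ℂ (Fam E k Λ)) =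
    Lu e * opV x - (2 * kap k) • opU x := by
  have h : (opU x : Module.End ℂ (Fam E k Λ)) = _ := (sum_inner_smul_map e opUL x).symm
  rw [h, Lu, Finset.mul_sum, Finset.sum_mul, Finset.smul_sum, ← Finset.sum_sub_distrib]
  refine Finset.sum_congr rfl fun i _ => ?_
  have h1 : (opUL (e i) : Module.End ℂ (Fam E k Λ)) = opU (e i) := rfl
  rw [← mul_assoc, opV_mul_opU, sub_mul, mul_assoc, opV_mul_opU, h1, mul_sub, ← mul_assoc,
    smul_mul_assoc, one_mul, mul_smul_comm, mul_one]
  module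

lemma opU_mul_Luv (x : V) : (opU x * Luv e : Module.End ℂ (Fam E k Λ)) =
    Luv e * opU x + (2 * kap k) • opU x := by
  have h : ((2 * kap k) • opU x : Module.End ℂ (Fam E k Λ)) = (2 * kap k) •
    ∑ i, (⟪x, e i⟫_ℝ : ℂ) • opUL (e i) := congrArg _ (sum_inner_smul_map e opUL x).symm
  rw [h, Luv, Finset.mul_sum, Finset.sum_mul, Finset.smul_sum, ← Finset.sum_add_distrib]
  refine Finset.sum_congr rfl fun i _ => ?_
  have h1 : (opUL (e i) : Module.End ℂ (Fam E k Λ)) = opU (e i) := rfl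
  rw [h1, mul_add, add_mul, ← mul_assoc, ← mul_assoc, opU_mul_opU x, mul_assoc, opU_mul_opV,
    add_mul, mul_add, mul_assoc (opV (e i)), opU_mul_opU x, smul_mul_assoc, one_mul,
    mul_smul_comm, mul_one, mul_assoc, mul_assoc]
  module

lemma opV_mul_Luv (x : V) : (opV x * Luv e : Module.End ℂ (Fam E k Λ)) =
    Luv e * opV x - (2 * kap k) • opV x := by
  have h : ((2 * kap k) • opV x : Module.End ℂ (Fam E k Λ)) = (2 * kap k) •
    ∑ i, (⟪x, e i⟫_ℝ : ℂ) • opVL (e i) := congrArg _ (sum_inner_smul_map e opVL x).symm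
  rw [h, Luv, Finset.mul_sum, Finset.sum_mul, Finset.smul_sum, ← Finset.sum_sub_distrib]
  refine Finset.sum_congr rfl fun i _ => ?_
  have h1 : (opVL (e i) : Module.End ℂ (Fam E k Λ)) = opV (e i) := rfl
  rw [h1, mul_add, add_mul, ← mul_assoc, ← mul_assoc, opV_mul_opV x, mul_assoc (opV (e i)),
    opV_mul_opU, sub_mul, mul_sub, mul_assoc (opU (e i)), opV_mul_opV x, smul_mul_assoc, one_mul,
    mul_smul_comm, mul_one, mul_assoc, mul_assoc]
  module

/-- The creation operators (`ε = 1`) and annihilation operators (`ε = -1`). -/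
def ladder (q : ℝ × ℝ) (ε : ℂ) (x : V) : Module.End ℂ (Fam E k Λ) :=
  opV x + (-q.1 + ε * Complex.I * Real.exp q.2 : ℂ) • opU x

lemma lapPt_eq (q : ℝ × ℝ) : (lapPt e q : Module.End ℂ (Fam E k Λ)) = (lapFactor q : ℂ) •
    (Lv e - (q.1 : ℂ) • Luv e + (q.1 ^ 2 + Real.exp q.2 ^ 2 : ℂ) • Lu e) := by
  ext f ⟨p, A⟩
  rw [lapPt_apply]
  simp only [LinearMap.smul_apply, LinearMap.add_apply, LinearMap.sub_apply, Fam.smul_val,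
    Fam.add_val, Fam.sub_val]

lemma lapFactor_mul (q : ℝ × ℝ) : (lapFactor q : ℂ) * (2 * Real.pi * Real.exp q.2) = -1 := by
  have h : lapFactor q * (2 * Real.pi * Real.exp q.2) = -1 := by
    rw [lapFactor, Real.exp_neg]
    have := Real.exp_ne_zero q.2
    have := Real.pi_ne_zero
    field_simp
  exact_mod_cast h

/-- The commutator with the Laplace operator preserves the span of `opU x` and `opV x`; there it has
the eigenvalues `± 2k`, with the ladder operators as eigenvectors. -/
lemma lapPt_mul_ladder (q : ℝ × ℝ) {ε : ℂ} (hε : ε ^ 2 = 1) (x : V) :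
    (lapPt e q * ladder q ε x : Module.End ℂ (Fam E k Λ)) =
      ladder q ε x * lapPt e q + (2 * k * ε) • ladder q ε x := by
  have hl := lapFactor_mul q
  have hI := Complex.I_sq
  rw [lapPt_eq, ladder]
  set y : ℂ := (Real.exp q.2 : ℂ) with hy
  set a : ℂ := (lapFactor q : ℂ) with ha
  simp only [smul_mul_assoc, mul_smul_comm, add_mul, mul_add, sub_mul, mul_sub, smul_add, smul_sub,
    opU_mul_Lu, opV_mul_Lv, opU_mul_Lv, opV_mul_Lu, opU_mul_Luv, opV_mul_Luv]
  rw [kap]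
  match_scalars <;> first
  | ring1
  | linear_combination (4 * a * ε * y * Real.pi * k) * hI - 2 * ε * k * hl
  | linear_combination (-4 * a * q.1 * ε * y * Real.pi * k) * hI +
      (2 * q.1 * ε * k - 2 * Complex.I * y * k) * hl - 2 * Complex.I * y * k * hε

end Ladder

/-! ### Functions of Gaussian type on `V × V` -/

section Gaussian

variable {V : Type*} [NormedAddCommGroup V] [InnerProductSpace ℝ V] {k n : ℕ}
  (e : OrthonormalBasis (Fin n) ℝ V)

/-- Multiplication by the linear function `ω(·, X)`. -/
def mulOmega (X : V × V) : Module.End ℂ (Fam Unit k (⊥ : Submodule ℤ V)) where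
  toFun f := ⟨fun x => omega k x.2 X * f.1 x, (contDiff_omega k X).mul f.contDiff,
    fun l₁ h₁ l₂ h₂ p A => by
      have h0 : A + ((0 : V), (0 : V)) = A := add_zero A
      rw [(Submodule.mem_bot ℤ).1 h₁, (Submodule.mem_bot ℤ).1 h₂, h0]
      simp [multiplier, omega]⟩
  map_add' f g := Fam.ext fun x => mul_add _ _ _
  map_smul' c f := Fam.ext fun x => mul_left_comm _ _ _

lemma mulOmega_apply (X : V × V) (f : Fam Unit k (⊥ : Submodule ℤ V)) (x : Unit × (V × V)) :
    (mulOmega X f).1 x = omega k x.2 X * f.1 x := rfl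

lemma nab_mul_mulOmega (Y X : V × V) :
    nab ((0 : Unit), Y) * mulOmega (k := k) X = mulOmega X * nab (0, Y) + (omega k Y X : ℂ) • 1 := by
  ext f x
  have h : fderiv ℝ (mulOmega X f).1 x = _ :=
    ((hasFDerivAt_omega k X x).mul (f.differentiableAt x).hasFDerivAt).fderiv
  simp only [Module.End.mul_apply, LinearMap.add_apply, LinearMap.smul_apply, Fam.add_val,
    Fam.smul_val, Module.End.one_apply, mulOmega_apply, nab_coe, nabF, h]
  simp [omegaL_apply]
  ring

/-- Multiplications by linear functions combined with covariant derivatives to operators commuting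
with all covariant derivatives. -/
def nabR (X : V × V) : Module.End ℂ (Fam Unit k (⊥ : Submodule ℤ V)) :=
  nab (0, X) + Complex.I • mulOmega X

/-- Adding `iω` reverses the sign of the connection form, so `nabR` is the covariant derivative for
the opposite curvature, the generator of magnetic translations. -/
lemma commute_nab_nabR (Y X : V × V) : Commute (nab ((0 : Unit), Y)) (nabR (k := k) X) := by
  rw [Commute, SemiconjBy, nabR, mul_add, add_mul, mul_smul_comm, smul_mul_assoc, nab_mul_nab,
    nab_mul_mulOmega]
  module

lemma mulOmega_eq (X : V × V) :
    mulOmega (k := k) X = Complex.I • (nab ((0 : Unit), X) - nabR X) := by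
  rw [nabR, sub_add_cancel_left, ← smul_neg, smul_smul, Complex.I_mul_I]
  module

lemma commute_lapPt_nabR (q : ℝ × ℝ) (X : V × V) : Commute (lapPt e q) (nabR (k := k) X) := by
  have hU : ∀ x : V, Commute (opU x) (nabR (k := k) X) := fun x => commute_nab_nabR _ _
  have hV : ∀ x : V, Commute (opV x) (nabR (k := k) X) := fun x => commute_nab_nabR _ _
  have h1 : Commute (Lu e) (nabR (k := k) X) := Commute.sum_left _ _ _ fun _ _ =>
    Commute.mul_left (hU _) (hU _)
  have h2 : Commute (Lv e) (nabR (k := k) X) := Commute.sum_left _ _ _ fun _ _ =>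
    Commute.mul_left (hV _) (hV _)
  have h3 : Commute (Luv e) (nabR (k := k) X) := Commute.sum_left _ _ _ fun _ _ =>
    Commute.add_left (Commute.mul_left (hU _) (hV _)) (Commute.mul_left (hV _) (hU _))
  rw [lapPt_eq]
  exact ((h2.sub_left (h3.smul_left _)).add_left (h1.smul_left _)).smul_left _

/-- The exponent of the Gaussian. -/
def gaussExponent (k : ℕ) (q : ℝ × ℝ) (A : V × V) : ℝ :=
  Real.pi * k / (2 * Real.exp q.2) * (‖A.1 + q.1 • A.2‖ ^ 2 + Real.exp q.2 ^ 2 * ‖A.2‖ ^ 2)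

lemma contDiff_gaussExponent (q : ℝ × ℝ) : ContDiff ℝ ∞ (gaussExponent (V := V) k q) := by
  unfold gaussExponent
  exact contDiff_const.mul (((contDiff_fst.add (contDiff_const.smul contDiff_snd)).norm_sq ℝ).add
    (contDiff_const.mul (contDiff_snd.norm_sq ℝ)))

/-- The ground state of the Laplace operator on `V × V`. -/
def gauss (q : ℝ × ℝ) : Fam Unit k (⊥ : Submodule ℤ V) :=
  ⟨fun x => (Real.exp (-gaussExponent k q x.2) : ℝ),
    Complex.ofRealCLM.contDiff.comp ((contDiff_gaussExponent q).neg.exp.comp contDiff_snd),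
    fun l₁ h₁ l₂ h₂ p A => by
      have h0 : A + ((0 : V), (0 : V)) = A := add_zero A
      rw [(Submodule.mem_bot ℤ).1 h₁, (Submodule.mem_bot ℤ).1 h₂, h0]
      simp [multiplier, omega]⟩

lemma gauss_apply (q : ℝ × ℝ) (x : Unit × (V × V)) :
    (gauss (k := k) q).1 x = (Real.exp (-gaussExponent k q x.2) : ℝ) := rfl

lemma fderiv_gaussExponent (q : ℝ × ℝ) (A X : V × V) : fderiv ℝ (gaussExponent k q) A X =
    Real.pi * k / Real.exp q.2 * (⟪A.1 + q.1 • A.2, X.1 + q.1 • X.2⟫_ℝ +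
      Real.exp q.2 ^ 2 * ⟪A.2, X.2⟫_ℝ) := by
  set L : V × V →L[ℝ] V := ContinuousLinearMap.fst ℝ V V + q.1 • ContinuousLinearMap.snd ℝ V V
  have h1 : HasFDerivAt (fun A : V × V => ‖A.1 + q.1 • A.2‖ ^ 2) _ A :=
    (L.hasFDerivAt (x := A)).norm_sq
  have h2 : HasFDerivAt (fun A : V × V => ‖A.2‖ ^ 2) _ A :=
    ((ContinuousLinearMap.snd ℝ V V).hasFDerivAt (x := A)).norm_sq
  have h3 : fderiv ℝ (gaussExponent k q) A = _ :=
    ((h1.add (h2.const_mul (Real.exp q.2 ^ 2))).const_mul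
      (Real.pi * k / (2 * Real.exp q.2))).fderiv
  rw [h3]
  have := Real.exp_ne_zero q.2
  simp [L]
  field_simp
  simp only [inner_add_left, inner_add_right, inner_smul_left, inner_smul_right,
    RCLike.conj_to_real]

lemma nab_gauss_apply (q : ℝ × ℝ) (X : V × V) (x : Unit × (V × V)) :
    (nab (0, X) (gauss (k := k) q)).1 x = -(fderiv ℝ (gaussExponent k q) x.2 X +
      Complex.I / 2 * omega k x.2 X) * (gauss (k := k) q).1 x := by
  have h1 : HasFDerivAt (fun x : Unit × (V × V) => gaussExponent k q x.2)
      ((fderiv ℝ (gaussExponent k q) x.2).comp (ContinuousLinearMap.snd ℝ Unit (V × V))) x :=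
    (((contDiff_gaussExponent q).differentiable (by simp)) x.2).hasFDerivAt.comp x hasFDerivAt_snd
  have h2 : fderiv ℝ (gauss (k := k) q).1 x = _ :=
    (Complex.ofRealCLM.hasFDerivAt.comp x h1.neg.exp).fderiv
  rw [nab_coe, nabF, h2, gauss_apply]
  simp
  ring

lemma opU_gauss (q : ℝ × ℝ) (x : V) : opU x (gauss (k := k) q) =
    (-1 / (2 * Real.exp q.2) : ℂ) • (mulOmega (0, x) (gauss q) -
      (q.1 - Complex.I * Real.exp q.2 : ℂ) • mulOmega (x, 0) (gauss q)) := by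
  ext z
  rw [opU, nab_gauss_apply, fderiv_gaussExponent]
  simp only [Fam.smul_val, Fam.sub_val, mulOmega_apply, omega, inner_zero_right, inner_zero_left,
    smul_zero, add_zero, mul_zero, sub_zero, zero_sub, inner_add_left, inner_smul_left,
    RCLike.conj_to_real, real_inner_comm]
  have h : (Real.exp q.2 : ℂ) ≠ 0 := by exact_mod_cast Real.exp_ne_zero q.2
  have hI := Complex.I_sq
  push_cast at h ⊢
  field_simp
  ring

/-- Equivalently, the annihilation operators `ladder q (-1) x` kill the Gaussian. -/
lemma opV_gauss (q : ℝ × ℝ) (x : V) : opV x (gauss (k := k) q) =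
    (q.1 + Complex.I * Real.exp q.2 : ℂ) • opU x (gauss q) := by
  ext z
  rw [Fam.smul_val, opV, opU, nab_gauss_apply, nab_gauss_apply, fderiv_gaussExponent,
    fderiv_gaussExponent]
  simp only [omega, inner_zero_right, inner_zero_left, smul_zero, add_zero, mul_zero, sub_zero,
    zero_sub, zero_add, inner_add_left, inner_smul_left, inner_smul_right, RCLike.conj_to_real,
    real_inner_comm]
  have h : (Real.exp q.2 : ℂ) ≠ 0 := by exact_mod_cast Real.exp_ne_zero q.2
  have hI := Complex.I_sq
  push_cast at h ⊢
  field_simp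
  ring_nf
  simp only [Complex.I_sq]
  ring

/-- By `opV_gauss` every second order term is a multiple of `Lu`. These cancel since `c = x + iy` is
a root of `c² - 2xc + x² + y²`; the commutators leave the zero-point energy `k` for each of the `n`
dimensions. -/
lemma lapPt_gauss (q : ℝ × ℝ) : lapPt e q (gauss (k := k) q) = ((k * n : ℝ) : ℂ) • gauss q := by
  set c : ℂ := q.1 + Complex.I * Real.exp q.2 with hc
  have hUV : ∀ i, opU (e i) (opV (e i) (gauss (k := k) q)) =
      c • opU (e i) (opU (e i) (gauss q)) := fun i => by rw [opV_gauss, map_smul]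
  have hVU : ∀ i, opV (e i) (opU (e i) (gauss (k := k) q)) =
      c • opU (e i) (opU (e i) (gauss q)) - kap k • gauss q := fun i => by
    have h := congrArg (fun T => T (gauss (k := k) q))
      (opU_mul_opV (E := Unit) (Λ := ⊥) (k := k) (e i) (e i))
    simp only [Module.End.mul_apply, LinearMap.add_apply, LinearMap.smul_apply,
      Module.End.one_apply, real_inner_self_eq_norm_sq, e.orthonormal.1, hUV] at h
    rw [h]
    simp
  have hVV : ∀ i, opV (e i) (opV (e i) (gauss (k := k) q)) =
      c ^ 2 • opU (e i) (opU (e i) (gauss q)) - (c * kap k) • gauss q := fun i => by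
    rw [opV_gauss, map_smul, hVU, ← hc]
    module
  have h1 : Lv e (gauss (k := k) q) = c ^ 2 • Lu e (gauss q) - (n * (c * kap k)) • gauss q := by
    simp only [Lv, Lu, LinearMap.sum_apply, Module.End.mul_apply, hVV, Finset.sum_sub_distrib,
      Finset.smul_sum, Finset.sum_const, Finset.card_univ, Fintype.card_fin]
    module
  have h2 : Luv e (gauss (k := k) q) = (2 * c) • Lu e (gauss q) - (n * kap k) • gauss q := by
    simp only [Luv, Lu, LinearMap.sum_apply, Module.End.mul_apply, LinearMap.add_apply, hUV, hVU,
      Finset.sum_sub_distrib, ← Finset.smul_sum, Finset.sum_const, Finset.card_univ,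
      Fintype.card_fin, Finset.sum_add_distrib]
    module
  have hl := lapFactor_mul q
  rw [lapPt_eq, LinearMap.smul_apply, LinearMap.add_apply, LinearMap.sub_apply,
    LinearMap.smul_apply, LinearMap.smul_apply, h1, h2, kap, hc]
  set a : ℂ := (lapFactor q : ℂ) with ha
  set y : ℂ := (Real.exp q.2 : ℂ)
  have hI := Complex.I_sq
  match_scalars
  · linear_combination (a * y ^ 2) * hI
  · linear_combination (-k * n : ℂ) * hl + a * 2 * Real.pi * y * k * n * hI

/-- Polynomials times the Gaussian. -/
def polyGauss (k : ℕ) (q : ℝ × ℝ) : Submodule ℂ (Fam Unit k (⊥ : Submodule ℤ V)) :=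
  Submodule.span ℂ (Set.range fun L : List (V × V) => (L.map mulOmega).prod (gauss q))

lemma gauss_mem_polyGauss (q : ℝ × ℝ) : gauss (V := V) q ∈ polyGauss k q :=
  Submodule.subset_span ⟨[], rfl⟩

lemma mulOmega_mem_polyGauss {q : ℝ × ℝ} (X : V × V) {f : Fam Unit k (⊥ : Submodule ℤ V)}
    (hf : f ∈ polyGauss k q) : mulOmega X f ∈ polyGauss k q := by
  induction hf using Submodule.span_induction with
  | mem f hf =>
    obtain ⟨L, rfl⟩ := hf
    exact Submodule.subset_span ⟨X :: L, by simp⟩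
  | zero => simp
  | add f g _ _ hf hg => rw [map_add]; exact Submodule.add_mem _ hf hg
  | smul c f _ hf => rw [map_smul]; exact Submodule.smul_mem _ _ hf

lemma nab_gauss_mem_polyGauss (q : ℝ × ℝ) (X : V × V) :
    nab (0, X) (gauss (k := k) q) ∈ polyGauss k q := by
  have hU : ∀ x : V, opU x (gauss (k := k) q) ∈ polyGauss k q := by
    intro x
    rw [opU_gauss]
    have h := gauss_mem_polyGauss (V := V) (k := k) q
    exact Submodule.smul_mem _ _ (Submodule.sub_mem _ (mulOmega_mem_polyGauss _ h)
      (Submodule.smul_mem _ _ (mulOmega_mem_polyGauss _ h)))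
  have hX : ((0 : Unit), X) = (0, (X.1, 0)) + (0, (0, X.2)) := by ext <;> simp
  rw [hX, nab_add]
  refine Submodule.add_mem _ (hU X.1) ?_
  have h := opV_gauss (k := k) q X.2
  rw [opV] at h
  rw [h]
  exact Submodule.smul_mem _ _ (hU X.2)

lemma nab_mem_polyGauss {q : ℝ × ℝ} (X : V × V) {f : Fam Unit k (⊥ : Submodule ℤ V)}
    (hf : f ∈ polyGauss k q) : nab (0, X) f ∈ polyGauss k q := by
  induction hf using Submodule.span_induction with
  | mem f hf =>
    obtain ⟨L, rfl⟩ := hf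
    dsimp only
    induction L with
    | nil => exact nab_gauss_mem_polyGauss q X
    | cons Y L ih =>
      rw [List.map_cons, List.prod_cons, Module.End.mul_apply, ← Module.End.mul_apply,
        nab_mul_mulOmega, LinearMap.add_apply]
      exact Submodule.add_mem _ (mulOmega_mem_polyGauss _ ih)
        (Submodule.smul_mem _ _ (Submodule.subset_span ⟨L, rfl⟩))
  | zero => simp
  | add f g _ _ hf hg => rw [map_add]; exact Submodule.add_mem _ hf hg
  | smul c f _ hf => rw [map_smul]; exact Submodule.smul_mem _ _ hf

/-- The span of the eigenfunctions of Gaussian type. -/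
def eigenGauss (k : ℕ) (q : ℝ × ℝ) : Submodule ℂ (Fam Unit k (⊥ : Submodule ℤ V)) :=
  Submodule.span ℂ {f | f ∈ polyGauss k q ∧ ∃ μ : ℝ, lapPt e q f = (μ : ℂ) • f}

lemma ladder_mem_eigenGauss {q : ℝ × ℝ} {ε : ℝ} (hε : ε ^ 2 = 1) (x : V)
    {f : Fam Unit k (⊥ : Submodule ℤ V)} (hf : f ∈ polyGauss k q) {μ : ℝ}
    (hμ : lapPt e q f = (μ : ℂ) • f) : ladder q ε x f ∈ eigenGauss e k q := by
  refine Submodule.subset_span ⟨?_, μ + 2 * k * ε, ?_⟩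
  · exact Submodule.add_mem _ (nab_mem_polyGauss _ hf)
      (Submodule.smul_mem _ _ (nab_mem_polyGauss _ hf))
  · rw [← Module.End.mul_apply, lapPt_mul_ladder e q (by exact_mod_cast hε), LinearMap.add_apply,
      Module.End.mul_apply, hμ, map_smul, LinearMap.smul_apply]
    push_cast
    module

/-- Since `e^η ≠ 0`, covariant derivatives are combinations of creation and annihilation operators,
which carry eigenfunctions to eigenfunctions. -/
lemma nab_mem_eigenGauss {q : ℝ × ℝ} (X : V × V) {f : Fam Unit k (⊥ : Submodule ℤ V)}
    (hf : f ∈ polyGauss k q) {μ : ℝ} (hμ : lapPt e q f = (μ : ℂ) • f) :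
    nab (0, X) f ∈ eigenGauss e k q := by
  have hy : (Real.exp q.2 : ℂ) ≠ 0 := by exact_mod_cast Real.exp_ne_zero q.2
  have h1 : ∀ x, ladder q (1 : ℝ) x f ∈ eigenGauss e k q := fun x =>
    ladder_mem_eigenGauss e (by norm_num) x hf hμ
  have h2 : ∀ x, ladder q (-1 : ℝ) x f ∈ eigenGauss e k q := fun x =>
    ladder_mem_eigenGauss e (by norm_num) x hf hμ
  have hU : ∀ x, opU x f ∈ eigenGauss e k q := by
    intro x
    have : opU x f = (2 * Complex.I * Real.exp q.2 : ℂ)⁻¹ •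
        (ladder q (1 : ℝ) x f - ladder q (-1 : ℝ) x f) := by
      rw [eq_inv_smul_iff₀ (by simp [Complex.I_ne_zero])]
      simp only [ladder, LinearMap.add_apply, LinearMap.smul_apply]
      push_cast
      module
    rw [this]
    exact Submodule.smul_mem _ _ (Submodule.sub_mem _ (h1 x) (h2 x))
  have hV : ∀ x, opV x f ∈ eigenGauss e k q := by
    intro x
    have : opV x f = ladder q (1 : ℝ) x f -
        (-q.1 + Complex.I * Real.exp q.2 : ℂ) • opU x f := by
      simp only [ladder, LinearMap.add_apply, LinearMap.smul_apply]
      push_cast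
      module
    rw [this]
    exact Submodule.sub_mem _ (h1 x) (Submodule.smul_mem _ _ (hU x))
  have hX : ((0 : Unit), X) = (0, (X.1, 0)) + (0, (0, X.2)) := by ext <;> simp
  rw [hX, nab_add]
  exact Submodule.add_mem _ (hU X.1) (hV X.2)

/-- By `mulOmega_eq` a linear function is the difference of `nab`, a combination of ladder
operators, and `nabR`, which commutes with the Laplace operator. -/
lemma mulOmega_mem_eigenGauss {q : ℝ × ℝ} (X : V × V) {f : Fam Unit k (⊥ : Submodule ℤ V)}
    (hf : f ∈ eigenGauss e k q) : mulOmega X f ∈ eigenGauss e k q := by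
  induction hf using Submodule.span_induction with
  | mem f hf =>
    obtain ⟨hf, μ, hμ⟩ := hf
    rw [mulOmega_eq, LinearMap.smul_apply, LinearMap.sub_apply]
    refine Submodule.smul_mem _ _ (Submodule.sub_mem _ (nab_mem_eigenGauss e X hf hμ)
      (Submodule.subset_span ⟨?_, μ, ?_⟩))
    · exact Submodule.add_mem _ (nab_mem_polyGauss _ hf)
        (Submodule.smul_mem _ _ (mulOmega_mem_polyGauss _ hf))
    · rw [← Module.End.mul_apply, (commute_lapPt_nabR e q X).eq, Module.End.mul_apply, hμ, map_smul]
  | zero => simp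
  | add f g _ _ hf hg => rw [map_add]; exact Submodule.add_mem _ hf hg
  | smul c f _ hf => rw [map_smul]; exact Submodule.smul_mem _ _ hf

/-- The functions of Gaussian type are spanned by eigenfunctions. -/
theorem polyGauss_le_eigenGauss (q : ℝ × ℝ) : polyGauss k q ≤ eigenGauss e k q := by
  refine Submodule.span_le.2 ?_
  rintro _ ⟨L, rfl⟩
  dsimp only
  induction L with
  | nil => exact Submodule.subset_span ⟨gauss_mem_polyGauss q, k * n, lapPt_gauss e q⟩
  | cons Y L ih =>
    rw [List.map_cons, List.prod_cons, Module.End.mul_apply]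
    exact mulOmega_mem_eigenGauss e Y ih

end Gaussian

/-! ### Injectivity of the Fourier transform -/

section Fourier

variable {X : Type*} [NormedAddCommGroup X] [NormedSpace ℝ X] [FiniteDimensional ℝ X]
  [MeasurableSpace X] [BorelSpace X] {μ : Measure X} [SigmaFinite μ] [μ.IsOpenPosMeasure]

omit [SigmaFinite μ] [μ.IsOpenPosMeasure] [FiniteDimensional ℝ X] in
lemma integrable_exp_mul [SecondCountableTopology X] (L : StrongDual ℝ X) {f : X → ℂ}
    (hf : Integrable f μ) : Integrable (fun x => Complex.exp (L x * Complex.I) * f x) μ := by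
  refine hf.bdd_mul (c := 1) (Continuous.aestronglyMeasurable (by fun_prop)) (.of_forall fun x => ?_)
  rw [Complex.norm_exp_ofReal_mul_I]

/-- The positive and negative parts of `R` are densities of finite measures with equal
characteristic functions. The measures agree, hence so do the densities almost everywhere. -/
lemma eq_zero_of_integral_exp_real {R : X → ℝ} (hc : Continuous R) (hi : Integrable R μ)
    (h : ∀ L : StrongDual ℝ X, ∫ x, Complex.exp (L x * Complex.I) * (R x : ℂ) ∂μ = 0) :
    R = 0 := by
  have : SecondCountableTopology X := secondCountable_of_proper
  have hm : ∀ R : X → ℝ, Continuous R → Measurable fun x => ENNReal.ofReal (R x) :=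
    fun R hR => (ENNReal.continuous_ofReal.comp hR).measurable
  have := isFiniteMeasure_withDensity_ofReal hi.2
  have := isFiniteMeasure_withDensity_ofReal hi.neg.2
  have key : ∀ R : X → ℝ, Continuous R → ∀ L : StrongDual ℝ X,
      charFunDual (μ.withDensity fun x => ENNReal.ofReal (R x)) L =
        ∫ x, Complex.exp (L x * Complex.I) * ((max (R x) 0 : ℝ) : ℂ) ∂μ := by
    intro R hR L
    rw [charFunDual_apply, integral_withDensity_eq_integral_toReal_smul (hm R hR)
      (.of_forall fun x => ENNReal.ofReal_lt_top)]
    refine integral_congr_ae (.of_forall fun x => ?_)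
    simp only [ENNReal.toReal_ofReal', Complex.real_smul]
    ring
  have hint : ∀ R : X → ℝ, Integrable R μ → ∀ L : StrongDual ℝ X,
      Integrable (fun x => Complex.exp (L x * Complex.I) * ((max (R x) 0 : ℝ) : ℂ)) μ :=
    fun R hR L => integrable_exp_mul L hR.pos_part.ofReal
  have heq : μ.withDensity (fun x => ENNReal.ofReal (R x)) =
      μ.withDensity fun x => ENNReal.ofReal ((-R) x) := by
    refine Measure.ext_of_charFunDual (funext fun L => ?_)
    rw [key R hc, key (-R) hc.neg, ← sub_eq_zero, ← integral_sub (hint R hi L) (hint _ hi.neg L),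
      ← h L]
    refine integral_congr_ae (.of_forall fun x => ?_)
    simp only [Pi.neg_apply, ← mul_sub, ← Complex.ofReal_sub]
    congr 2
    rcases le_total (R x) 0 with hx | hx
    · rw [max_eq_right hx, max_eq_left (by linarith)]
      ring
    · rw [max_eq_left hx, max_eq_right (by linarith)]
      ring
  have hae := (withDensity_eq_iff_of_sigmaFinite (hm R hc).aemeasurable
    (hm (-R) hc.neg).aemeasurable).1 heq
  refine (hc.ae_eq_iff_eq μ continuous_zero).1 ?_
  filter_upwards [hae] with x hx
  rcases lt_trichotomy (R x) 0 with h1 | h1 | h1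
  · rw [ENNReal.ofReal_of_nonpos h1.le, eq_comm, ENNReal.ofReal_eq_zero] at hx
    simp only [Pi.neg_apply] at hx
    linarith
  · exact h1
  · rw [Pi.neg_apply, ENNReal.ofReal_of_nonpos (by linarith : -R x ≤ 0),
      ENNReal.ofReal_eq_zero] at hx
    linarith

/-- Conjugating the hypothesis at `-L` gives it for `conj H`, so the real case applies to the real
and imaginary parts. -/
lemma eq_zero_of_integral_exp {H : X → ℂ} (hc : Continuous H) (hi : Integrable H μ)
    (h : ∀ L : StrongDual ℝ X, ∫ x, Complex.exp (L x * Complex.I) * H x ∂μ = 0) : H = 0 := by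
  have : SecondCountableTopology X := secondCountable_of_proper
  have hi' : Integrable (fun x => conj (H x)) μ := by
    refine hi.norm.mono' (Complex.continuous_conj.comp hc).aestronglyMeasurable
      (.of_forall fun x => ?_)
    simp
  have h' : ∀ L : StrongDual ℝ X, ∫ x, Complex.exp (L x * Complex.I) * conj (H x) ∂μ = 0 := by
    intro L
    have h1 := congrArg conj (h (-L))
    rw [← integral_conj, map_zero] at h1
    rw [← h1]
    refine integral_congr_ae (.of_forall fun x => ?_)
    simp [← Complex.exp_conj]
  have hre : (fun x => (H x).re) = 0 := by
    refine eq_zero_of_integral_exp_real (μ := μ) (Complex.continuous_re.comp hc) hi.re fun L => ?_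
    have h1 := integral_add (integrable_exp_mul L hi) (integrable_exp_mul L hi')
    rw [h, h', add_zero] at h1
    have h2 := congrArg (fun z : ℂ => (1 / 2) * z) h1
    simp only [mul_zero] at h2
    rw [← integral_const_mul] at h2
    rw [← h2]
    refine integral_congr_ae (.of_forall fun x => ?_)
    have := Complex.add_conj (H x)
    push_cast at this
    linear_combination (-Complex.exp (L x * Complex.I) / 2) * this
  have him : (fun x => (H x).im) = 0 := by
    refine eq_zero_of_integral_exp_real (μ := μ) (Complex.continuous_im.comp hc) hi.im fun L => ?_
    have h1 := integral_sub (integrable_exp_mul L hi) (integrable_exp_mul L hi')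
    rw [h, h', sub_zero] at h1
    have h2 := congrArg (fun z : ℂ => (-Complex.I / 2) * z) h1
    simp only [mul_zero] at h2
    rw [← integral_const_mul] at h2
    rw [← h2]
    refine integral_congr_ae (.of_forall fun x => ?_)
    have := Complex.sub_conj (H x)
    push_cast at this
    linear_combination (Complex.I * Complex.exp (L x * Complex.I) / 2) * this +
      Complex.exp (L x * Complex.I) * (H x).im * Complex.I_sq
  ext x
  exact Complex.ext (congrFun hre x) (congrFun him x)

end Fourier

/-! ### Decay of functions of Gaussian type -/

section Decay

variable {V : Type*} [NormedAddCommGroup V] [InnerProductSpace ℝ V] {k : ℕ}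

lemma exists_le_gaussExponent (hk : 1 ≤ k) (q : ℝ × ℝ) :
    ∃ δ > 0, ∀ A : V × V, δ * ‖A‖ ^ 2 ≤ gaussExponent k q A := by
  set y := Real.exp q.2 with hy
  have hy0 : 0 < y := Real.exp_pos _
  have hk0 : (0 : ℝ) < k := by exact_mod_cast hk
  have hpi := Real.pi_pos
  -- Chosen so that `‖A₁‖² + ‖A₂‖² ≤ a (s² + y²‖A₂‖²)`, from `‖A₁‖² ≤ 2s² + 2x²‖A₂‖²` with `s = ‖A₁
  -- + x A₂‖`.
  set a : ℝ := 2 + (2 * q.1 ^ 2 + 1) / y ^ 2 with ha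
  have ha0 : 0 < a := by positivity
  refine ⟨Real.pi * k / (2 * y) * a⁻¹, by positivity, fun A => ?_⟩
  rw [gaussExponent, mul_assoc]
  refine mul_le_mul_of_nonneg_left ?_ (by positivity)
  rw [inv_mul_le_iff₀ ha0]
  have h1 : ‖A.1‖ ≤ ‖A.1 + q.1 • A.2‖ + |q.1| * ‖A.2‖ := by
    have := norm_sub_le (A.1 + q.1 • A.2) (q.1 • A.2)
    rwa [add_sub_cancel_right, norm_smul, Real.norm_eq_abs] at this
  set s := ‖A.1 + q.1 • A.2‖
  have h2 : ‖A.1‖ ^ 2 ≤ 2 * s ^ 2 + 2 * q.1 ^ 2 * ‖A.2‖ ^ 2 := by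
    have h3 : ‖A.1‖ ^ 2 ≤ (s + |q.1| * ‖A.2‖) ^ 2 := pow_le_pow_left₀ (norm_nonneg _) h1 2
    have h4 := sq_abs q.1
    nlinarith [sq_nonneg (s - |q.1| * ‖A.2‖)]
  have h5 : ‖A‖ ^ 2 ≤ ‖A.1‖ ^ 2 + ‖A.2‖ ^ 2 := by
    rw [Prod.norm_def]
    rcases max_cases ‖A.1‖ ‖A.2‖ with ⟨h, _⟩ | ⟨h, _⟩ <;> rw [h] <;> nlinarith [sq_nonneg ‖A.1‖,
      sq_nonneg ‖A.2‖]
  have h6 : a * (s ^ 2 + y ^ 2 * ‖A.2‖ ^ 2) = a * s ^ 2 + (2 * y ^ 2 + (2 * q.1 ^ 2 + 1)) *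
      ‖A.2‖ ^ 2 := by
    rw [ha]
    field_simp
  have h7 : 2 ≤ a := by
    rw [ha]
    have : 0 ≤ (2 * q.1 ^ 2 + 1) / y ^ 2 := by positivity
    linarith
  rw [h6]
  nlinarith [sq_nonneg s, sq_nonneg ‖A.2‖, mul_nonneg (sq_nonneg y) (sq_nonneg ‖A.2‖)]

lemma exists_exp_mul_le {δ : ℝ} (hδ : 0 < δ) (c : ℝ) (m : ℕ) :
    ∃ C : ℝ, 0 ≤ C ∧ ∀ r : ℝ, 0 ≤ r →
      Real.exp (c * r) * Real.exp (-(δ * r ^ 2)) ≤ C * ((1 + r) ^ m)⁻¹ := by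
  -- After `(1 + r)^m ≤ e^{mr}`, this is the maximum of `e^{(c+m)r - δr²}`, by completing the
  -- square.
  refine ⟨Real.exp ((c + m) ^ 2 / (4 * δ)), (Real.exp_pos _).le, fun r hr => ?_⟩
  rw [← div_eq_mul_inv, le_div_iff₀ (by positivity)]
  have h1 : (1 + r) ^ m ≤ Real.exp (m * r) := by
    rw [Real.exp_nat_mul]
    refine pow_le_pow_left₀ (by positivity) ?_ m
    linarith [Real.add_one_le_exp r]
  refine (mul_le_mul_of_nonneg_left h1 (by positivity)).trans ?_
  rw [← Real.exp_add, ← Real.exp_add]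
  refine Real.exp_le_exp.2 ?_
  rw [le_div_iff₀ (by positivity)]
  nlinarith [sq_nonneg (c + m - 2 * δ * r)]

lemma abs_omega_le (X A : V × V) : |omega k A X| ≤ ‖omegaL k X‖ * ‖A‖ := by
  rw [← omegaL_apply, ← Real.norm_eq_abs]
  exact (omegaL k X).le_opNorm A

lemma polyGauss_le {q : ℝ × ℝ} {f : Fam Unit k (⊥ : Submodule ℤ V)} (hf : f ∈ polyGauss k q) :
    ∃ C c : ℝ, 0 ≤ C ∧ 0 ≤ c ∧ ∀ x, ‖f.1 x‖ ≤
      C * (Real.exp (c * ‖x.2‖) * Real.exp (-gaussExponent k q x.2)) := by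
  induction hf using Submodule.span_induction with
  | mem f hf =>
    obtain ⟨L, rfl⟩ := hf
    dsimp only
    induction L with
    | nil =>
      refine ⟨1, 0, zero_le_one, le_rfl, fun x => ?_⟩
      simp [gauss_apply, Complex.norm_exp]
    | cons Y L ih =>
      obtain ⟨C, c, hC, hc, h⟩ := ih
      refine ⟨‖omegaL k Y‖ * C, c + 1, by positivity, by positivity, fun x => ?_⟩
      rw [List.map_cons, List.prod_cons, Module.End.mul_apply, mulOmega_apply, norm_mul,
        Complex.norm_real, Real.norm_eq_abs]
      have h1 := abs_omega_le (k := k) Y x.2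
      have h2 : ‖x.2‖ ≤ Real.exp ‖x.2‖ := by linarith [Real.add_one_le_exp ‖x.2‖]
      have h3 : Real.exp ((c + 1) * ‖x.2‖) = Real.exp ‖x.2‖ * Real.exp (c * ‖x.2‖) := by
        rw [← Real.exp_add]
        congr 1
        ring
      calc _ ≤ (‖omegaL k Y‖ * Real.exp ‖x.2‖) *
            (C * (Real.exp (c * ‖x.2‖) * Real.exp (-gaussExponent k q x.2))) :=
            mul_le_mul (h1.trans (by gcongr)) (h x) (norm_nonneg _) (by positivity)
        _ = _ := by rw [h3]; ring
  | zero => exact ⟨0, 0, le_rfl, le_rfl, fun x => by simp⟩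
  | add f g _ _ hf hg =>
    obtain ⟨C, c, hC, hc, h⟩ := hf
    obtain ⟨C', c', hC', hc', h'⟩ := hg
    refine ⟨C + C', max c c', by positivity, le_max_of_le_left hc, fun x => ?_⟩
    rw [Fam.add_val, add_mul]
    refine (norm_add_le _ _).trans (add_le_add ((h x).trans ?_) ((h' x).trans ?_))
    · gcongr
      exact le_max_left _ _
    · gcongr
      exact le_max_right _ _
  | smul a f _ hf =>
    obtain ⟨C, c, hC, hc, h⟩ := hf
    refine ⟨‖a‖ * C, c, by positivity, hc, fun x => ?_⟩
    rw [Fam.smul_val, norm_mul, mul_assoc]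
    gcongr
    exact h x

lemma exp_mul_exp_gaussExponent_le (hk : 1 ≤ k) (q : ℝ × ℝ) (c : ℝ) (m : ℕ) :
    ∃ C : ℝ, 0 ≤ C ∧ ∀ A : V × V, Real.exp (c * ‖A‖) * Real.exp (-gaussExponent k q A) ≤
      C * ((1 + ‖A‖) ^ m)⁻¹ := by
  obtain ⟨δ, hδ, hle⟩ := exists_le_gaussExponent (V := V) hk q
  obtain ⟨C, hC, h⟩ := exists_exp_mul_le hδ c m
  refine ⟨C, hC, fun A => le_trans ?_ (h ‖A‖ (norm_nonneg _))⟩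
  gcongr
  exact hle A

lemma polyGauss_decay (hk : 1 ≤ k) {q : ℝ × ℝ} {f : Fam Unit k (⊥ : Submodule ℤ V)}
    (hf : f ∈ polyGauss k q) (m : ℕ) :
    ∃ C : ℝ, 0 ≤ C ∧ ∀ x, ‖f.1 x‖ ≤ C * ((1 + ‖x.2‖) ^ m)⁻¹ := by
  obtain ⟨C, c, hC, hc, h⟩ := polyGauss_le hf
  obtain ⟨C', hC', h'⟩ := exp_mul_exp_gaussExponent_le (V := V) hk q c m
  refine ⟨C * C', by positivity, fun x => (h x).trans ?_⟩
  rw [mul_assoc]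
  exact mul_le_mul_of_nonneg_left (h' x.2) hC

variable [FiniteDimensional ℝ V] [MeasurableSpace V] [BorelSpace V]

lemma integrable_of_decay {g : V × V → ℂ} (hc : AEStronglyMeasurable g)
    (h : ∀ m : ℕ, ∃ C : ℝ, ∀ᵐ A, ‖g A‖ ≤ C * ((1 + ‖A‖) ^ m)⁻¹) : Integrable g := by
  obtain ⟨C, hC⟩ := h (Module.finrank ℝ (V × V) + 1)
  have h1 := integrable_one_add_norm (E := V × V) (μ := volume)
    (r := (Module.finrank ℝ (V × V) + 1 : ℕ)) (by push_cast; linarith)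
  refine (h1.const_mul C).mono' hc ?_
  filter_upwards [hC] with A hA
  rw [Real.rpow_neg (by positivity), Real.rpow_natCast]
  exact hA

-- Nondegeneracy of the symplectic form; this is where `k ≠ 0` enters.
omit [FiniteDimensional ℝ V] [MeasurableSpace V] [BorelSpace V] in
lemma exists_omega_eq [FiniteDimensional ℝ V] (hk : 1 ≤ k) (L : StrongDual ℝ (V × V)) :
    ∃ X, ∀ A, L A = omega k A X := by
  have hk0 : (k : ℝ) ≠ 0 := by
    have : k ≠ 0 := by omega
    exact_mod_cast this
  set L₁ : StrongDual ℝ V := L.comp (ContinuousLinearMap.inl ℝ V V)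
  set L₂ : StrongDual ℝ V := L.comp (ContinuousLinearMap.inr ℝ V V)
  set a := (InnerProductSpace.toDual ℝ V).symm L₁
  set b := (InnerProductSpace.toDual ℝ V).symm L₂
  refine ⟨(-(2 * Real.pi * k)⁻¹ • b, (2 * Real.pi * k)⁻¹ • a), fun A => ?_⟩
  have h1 : L A = L₁ A.1 + L₂ A.2 := by
    simp [L₁, L₂, ← map_add]
  have h2 : L₁ A.1 = ⟪a, A.1⟫_ℝ := by
    rw [InnerProductSpace.toDual_symm_apply]
  have h3 : L₂ A.2 = ⟪b, A.2⟫_ℝ := by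
    rw [InnerProductSpace.toDual_symm_apply]
  rw [h1, h2, h3, omega]
  simp only [inner_smul_left, inner_smul_right, RCLike.conj_to_real]
  rw [real_inner_comm a A.1]
  have := Real.pi_ne_zero
  field_simp
  ring

/-- A bounded function orthogonal to all functions of Gaussian type vanishes. -/
theorem eq_zero_of_integral_polyGauss (hk : 1 ≤ k) (q : ℝ × ℝ) {χ : V × V → ℂ}
    (hχ : Continuous χ) {B : ℝ} (hB : ∀ᵐ A, ‖χ A‖ ≤ B)
    (h : ∀ f ∈ polyGauss k q, ∫ A, χ A * conj (f.1 ((), A)) = 0) : χ = 0 := by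
  set g : V × V → ℝ := fun A => Real.exp (-gaussExponent k q A) with hg
  have hgc : Continuous g := ((contDiff_gaussExponent q).neg.exp).continuous
  set H : V × V → ℂ := fun A => χ A * (g A : ℂ) with hH
  have hHc : Continuous H := hχ.mul (Complex.continuous_ofReal.comp hgc)
  have hB0 : ∀ᵐ A : V × V, 0 ≤ B := hB.mono fun A hA => (norm_nonneg _).trans hA
  have hHb : ∀ c : ℝ, Integrable fun A => Real.exp (c * ‖A‖) * (B * g A) := by
    intro c
    have : Integrable fun A => ((Real.exp (c * ‖A‖) * (B * g A) : ℝ) : ℂ) := by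
      refine integrable_of_decay (Continuous.aestronglyMeasurable (by fun_prop)) fun m => ?_
      obtain ⟨C, hC, hle⟩ := exp_mul_exp_gaussExponent_le (V := V) hk q c m
      refine ⟨|B| * C, .of_forall fun A => ?_⟩
      rw [Complex.norm_real, Real.norm_eq_abs, mul_left_comm, abs_mul, mul_assoc]
      gcongr
      rw [abs_of_pos (by positivity)]
      exact hle A
    exact this.re
  have hHn : ∀ᵐ A, ‖H A‖ ≤ B * g A := by
    filter_upwards [hB] with A hA
    rw [hH, norm_mul, Complex.norm_real, Real.norm_eq_abs, abs_of_pos (Real.exp_pos _)]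
    gcongr
  have hHi : Integrable H := by
    refine Integrable.mono' ?_ hHc.aestronglyMeasurable hHn
    simpa using hHb 0
  have hmom : ∀ (X : V × V) (j : ℕ), ∫ A, (omega k A X : ℂ) ^ j * H A = 0 := by
    intro X j
    rw [← h _ (Submodule.subset_span ⟨List.replicate j X, rfl⟩)]
    refine integral_congr_ae (.of_forall fun A => ?_)
    have hj : ∀ j, ((List.map mulOmega (List.replicate j X)).prod (gauss (k := k) q)).1 ((), A) =
        (omega k A X : ℂ) ^ j * g A := by
      intro j
      induction j with
      | zero => simp [gauss_apply, hg]
      | succ j ih =>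
        rw [List.replicate_succ, List.map_cons, List.prod_cons, Module.End.mul_apply,
          mulOmega_apply, ih, pow_succ]
        ring
    simp only [hj, map_mul, map_pow, Complex.conj_ofReal, hH]
    ring
  -- Each functional is some `ω(·, X)`. The exponential series may be integrated term by term,
  -- dominated by `e^{|ω|}` times a Gaussian, so the Fourier transform of `H` is a series of
  -- vanishing moments.
  have hzero : H = 0 := by
    refine eq_zero_of_integral_exp (μ := volume) hHc hHi fun L => ?_
    obtain ⟨X, hX⟩ := exists_omega_eq hk L
    have h1 := hasSum_integral_of_dominated_convergence (μ := (volume : Measure (V × V)))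
      (F := fun (j : ℕ) A => ((omega k A X : ℂ) * Complex.I) ^ j / (j.factorial : ℂ) * H A)
      (f := fun A => Complex.exp (L A * Complex.I) * H A)
      (fun j A => |omega k A X| ^ j / (j.factorial : ℝ) * (B * g A)) (fun j => ?_) (fun j => ?_)
      (.of_forall fun A => ?_) ?_ (.of_forall fun A => ?_)
    · have h2 : ∀ j : ℕ, ∫ A, ((omega k A X : ℂ) * Complex.I) ^ j / (j.factorial : ℂ) * H A = 0 := by
        intro j
        have := congrArg (fun z => Complex.I ^ j / (j.factorial : ℂ) * z) (hmom X j)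
        simp only [mul_zero] at this
        rw [← integral_const_mul] at this
        rw [← this]
        refine integral_congr_ae (.of_forall fun A => ?_)
        simp only [mul_pow]
        ring
      simp only [h2] at h1
      exact h1.unique hasSum_zero
    · have : Continuous fun A : V × V => (omega k A X : ℂ) := by
        simp only [← omegaL_apply]
        fun_prop
      exact Continuous.aestronglyMeasurable (by fun_prop)
    · filter_upwards [hHn] with A hA
      rw [norm_mul, norm_div, norm_pow, norm_mul, Complex.norm_I, mul_one, Complex.norm_real,
        Complex.norm_natCast, Real.norm_eq_abs]
      gcongr
    · exact (Real.summable_pow_div_factorial _).mul_right _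
    · have h2 : ∀ A, ∑' j : ℕ, |omega k A X| ^ j / (j.factorial : ℝ) * (B * g A) =
          Real.exp |omega k A X| * (B * g A) := by
        intro A
        rw [tsum_mul_right, Real.exp_eq_exp_ℝ, NormedSpace.exp_eq_tsum_div]
      simp only [h2]
      refine (hHb ‖omegaL k X‖).mono' ?_ ?_
      · have : Continuous fun A : V × V => omega k A X := by
          simp only [← omegaL_apply]
          fun_prop
        exact Continuous.aestronglyMeasurable (by fun_prop)
      · filter_upwards [hB0] with A hA
        rw [Real.norm_eq_abs, abs_of_nonneg (by positivity)]
        gcongr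
        exact abs_omega_le X A
    · rw [hX]
      refine HasSum.mul_right _ ?_
      rw [Complex.exp_eq_exp_ℂ]
      exact NormedSpace.expSeries_div_hasSum_exp _
  ext A
  have h1 := congrFun hzero A
  simp only [hH, Pi.zero_apply, mul_eq_zero, Complex.ofReal_eq_zero] at h1
  exact h1.resolve_right (Real.exp_ne_zero _)

end Decay

/-! ### Periodization -/

section Periodization

variable {V : Type*} [NormedAddCommGroup V] [InnerProductSpace ℝ V] {k n : ℕ}
  {Λ : Submodule ℤ V} (e : OrthonormalBasis (Fin n) ℝ V)

lemma conj_multiplier (l A : V × V) : conj (multiplier k l A) =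
    Complex.exp (-(Real.pi * Complex.I * ((k * ⟪l.1, l.2⟫_ℝ : ℝ) : ℂ))) *
      Complex.exp (Complex.I / 2 * (omega k A l : ℂ)) := by
  rw [multiplier, map_mul, ← Complex.exp_conj, ← Complex.exp_conj]
  have h2 : conj (2 : ℂ) = 2 := Complex.conj_ofNat 2
  simp [neg_div, h2]

/-- Translates of functions by lattice vectors, twisted by the multipliers of the line bundle. -/
def bundleTrans (k : ℕ) (l : V × V) (f : Unit × (V × V) → ℂ) (x : Unit × (V × V)) : ℂ :=
  conj (multiplier k l x.2) * f (x + (0, l))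

lemma hasFDerivAt_bundleTrans (l : V × V) (f : Fam Unit k (⊥ : Submodule ℤ V))
    (x : Unit × (V × V)) : HasFDerivAt (bundleTrans k l f.1)
      (conj (multiplier k l x.2) • fderiv ℝ f.1 (x + (0, l)) + f.1 (x + (0, l)) •
        (conj (multiplier k l x.2) • ((Complex.I / 2) • (Complex.ofRealCLM.comp ((omegaL k l).comp
          (ContinuousLinearMap.snd ℝ Unit (V × V))))))) x := by
  have h1 : HasFDerivAt (fun x => f.1 (x + (0, l))) (fderiv ℝ f.1 (x + (0, l))) x :=
    (hasFDerivAt_comp_add_right _).2 (f.differentiableAt _).hasFDerivAt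
  have h2 : HasFDerivAt (fun x : Unit × (V × V) => conj (multiplier k l x.2))
      (conj (multiplier k l x.2) • ((Complex.I / 2) • (Complex.ofRealCLM.comp ((omegaL k l).comp
          (ContinuousLinearMap.snd ℝ Unit (V × V)))))) x := by
    simp only [conj_multiplier]
    have := (((hasFDerivAt_omega (E := Unit) k l x).const_mul (Complex.I / 2)).cexp).const_mul
      (Complex.exp (-(Real.pi * Complex.I * ((k * ⟪l.1, l.2⟫_ℝ : ℝ) : ℂ))))
    refine this.congr_fderiv ?_
    rw [smul_smul]
  exact h2.mul h1

lemma nabF_bundleTrans (l : V × V) (f : Fam Unit k (⊥ : Submodule ℤ V)) (ξ : Unit × (V × V)) :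
    nabF k ξ (bundleTrans k l f.1) = bundleTrans k l (nab ξ f).1 := by
  ext x
  rw [nabF, (hasFDerivAt_bundleTrans l f x).fderiv, bundleTrans, bundleTrans, nab_coe, nabF]
  simp only [add_apply, smul_apply, smul_eq_mul, ContinuousLinearMap.coe_comp, Function.comp_apply,
    Complex.ofRealCLM_apply, ContinuousLinearMap.coe_snd', Prod.snd_add, omega_add_left,
    omegaL_apply]
  rw [omega_swap k l ξ.2]
  push_cast
  ring

/-- The cocycle identity: the two exponents differ by `2πik⟨l'₁, l₂⟩`, which is harmless by
integrality. -/
lemma multiplier_add (hΛ : IsIntegralLattice Λ) {l l' : V × V} (h1 : l.1 ∈ Λ) (h2 : l.2 ∈ Λ)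
    (h1' : l'.1 ∈ Λ) (h2' : l'.2 ∈ Λ) (A : V × V) :
    multiplier k (l + l') A = multiplier k l (A + l') * multiplier k l' A := by
  obtain ⟨a, ha⟩ := hΛ _ h1 _ h2'
  obtain ⟨b, hb⟩ := hΛ _ h1' _ h2
  simp only [multiplier, ← Complex.exp_add]
  rw [Complex.exp_eq_exp_iff_exists_int]
  refine ⟨k * b, ?_⟩
  simp only [omega, Prod.fst_add, Prod.snd_add, inner_add_left, inner_add_right, ha, hb]
  push_cast
  ring

/-- `F` is the periodization of `f`. -/
def IsPeriodization (f : Fam Unit k (⊥ : Submodule ℤ V)) (F : Fam Unit k Λ) : Prop :=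
  ∀ x, HasSum (fun l : Λ.prod Λ => bundleTrans k l f.1 x) (F.1 x)

lemma IsPeriodization.add {f g : Fam Unit k (⊥ : Submodule ℤ V)} {F G : Fam Unit k Λ}
    (h : IsPeriodization f F) (h' : IsPeriodization g G) : IsPeriodization (f + g) (F + G) := by
  intro x
  have h1 := (h x).add (h' x)
  simpa only [bundleTrans, Fam.add_val, mul_add] using h1

lemma IsPeriodization.smul {f : Fam Unit k (⊥ : Submodule ℤ V)} {F : Fam Unit k Λ} (c : ℂ)
    (h : IsPeriodization f F) : IsPeriodization (c • f) (c • F) := by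
  intro x
  have h1 := (h x).mul_left c
  simpa only [bundleTrans, Fam.smul_val, mul_left_comm c] using h1

lemma isPeriodization_zero : IsPeriodization (0 : Fam Unit k (⊥ : Submodule ℤ V))
    (0 : Fam Unit k Λ) := by
  intro x
  simpa only [bundleTrans, Fam.zero_val, mul_zero] using hasSum_zero

lemma IsPeriodization.sum {κ : Type*} (s : Finset κ) {f : κ → Fam Unit k (⊥ : Submodule ℤ V)}
    {F : κ → Fam Unit k Λ} (h : ∀ i, IsPeriodization (f i) (F i)) :
    IsPeriodization (∑ i ∈ s, f i) (∑ i ∈ s, F i) := by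
  induction s using Finset.cons_induction with
  | empty => exact isPeriodization_zero
  | cons i s hi ih =>
    rw [Finset.sum_cons, Finset.sum_cons]
    exact (h i).add ih

variable [FiniteDimensional ℝ V]

lemma summable_one_add_norm_inv (L : Submodule ℤ (V × V)) [DiscreteTopology L] :
    Summable fun l : L => ((1 + ‖(l : V × V)‖) ^ (Module.finrank ℤ L + 1))⁻¹ := by
  classical
  have h1 := ZLattice.summable_norm_pow_inv L (Module.finrank ℤ L + 1) (Nat.lt_succ_self _)
  -- In `h1` the term at the origin is zero, because `0⁻¹ = 0`; the value `1` needed there is added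
  -- separately.
  have h2 : Summable fun l : L => if l = 0 then (1 : ℝ) else 0 :=
    summable_of_hasFiniteSupport ((Set.finite_singleton 0).subset fun l hl => by
      by_contra h
      simp at h
      simp [h] at hl)
  refine (h1.add h2).of_nonneg_of_le (fun l => by positivity) fun l => ?_
  by_cases hl : l = 0
  · simp [hl]
  · have : 0 < ‖l‖ := norm_pos_iff.2 hl
    rw [if_neg hl, add_zero, inv_pow]
    gcongr
    have : ‖(l : V × V)‖ = ‖l‖ := rfl
    linarith

omit [FiniteDimensional ℝ V] in
lemma norm_bundleTrans (l : V × V) (f : Unit × (V × V) → ℂ) (x : Unit × (V × V)) :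
    ‖bundleTrans k l f x‖ = ‖f (x + (0, l))‖ := by
  rw [bundleTrans, norm_mul, Complex.norm_conj, norm_multiplier, one_mul]

/-- For `‖x‖ < R` one has `1 + ‖l‖ ≤ (1 + R)(1 + ‖x + l‖)`, so decay at the translated point becomes
decay in `l`. -/
lemma bundleTrans_bound (hk : 1 ≤ k) {q : ℝ × ℝ} {f : Fam Unit k (⊥ : Submodule ℤ V)}
    (hf : f ∈ polyGauss k q) (L : Submodule ℤ (V × V)) [DiscreteTopology L] (R : ℝ) :
    ∃ u : L → ℝ, Summable u ∧ ∀ (l : L) x, ‖x‖ < R → ‖bundleTrans k l f.1 x‖ ≤ u l := by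
  set m := Module.finrank ℤ L + 1 with hm
  obtain ⟨C, hC, h⟩ := polyGauss_decay hk hf m
  refine ⟨fun l => C * (1 + R) ^ m * ((1 + ‖(l : V × V)‖) ^ m)⁻¹,
    (summable_one_add_norm_inv L).mul_left _, fun l x hx => ?_⟩
  rw [norm_bundleTrans]
  refine (h _).trans ?_
  dsimp only
  rw [mul_assoc]
  gcongr
  have hx2 : ‖x.2‖ ≤ ‖x‖ := norm_snd_le x
  have h0 := norm_nonneg x.2
  have hR : 0 < 1 + R := by linarith
  rw [← div_eq_mul_inv, ← div_pow, ← inv_pow]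
  refine pow_le_pow_left₀ (by positivity) ?_ m
  rw [le_div_iff₀ (by positivity), inv_mul_le_iff₀ (by positivity)]
  have h1 : ‖(l : V × V)‖ ≤ ‖(x + (0, (l : V × V))).2‖ + ‖x.2‖ := by
    have := norm_sub_le (x.2 + (l : V × V)) x.2
    rwa [add_sub_cancel_left] at this
  have h2 := norm_nonneg (x + (0, (l : V × V))).2
  nlinarith

omit [FiniteDimensional ℝ V] in
lemma nab_mem_polyGauss_param {q : ℝ × ℝ} (ξ : Unit × (V × V))
    {f : Fam Unit k (⊥ : Submodule ℤ V)} (hf : f ∈ polyGauss k q) : nab ξ f ∈ polyGauss k q := by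
  obtain ⟨⟨⟩, X⟩ := ξ
  exact nab_mem_polyGauss X hf

lemma tsum_bundleTrans_spec (hk : 1 ≤ k) (L : Submodule ℤ (V × V)) [DiscreteTopology L] {q : ℝ × ℝ}
    {f : Fam Unit k (⊥ : Submodule ℤ V)} (hf : f ∈ polyGauss k q) :
    ContDiff ℝ ∞ (fun x => ∑' l : L, bundleTrans k l f.1 x) ∧
      ∀ ξ, nabF k ξ (fun x => ∑' l : L, bundleTrans k l f.1 x) =
        fun x => ∑' l : L, bundleTrans k l (nab ξ f).1 x :=
  tsum_nabF_closed (k := k) (J := {f : Fam Unit k (⊥ : Submodule ℤ V) // f ∈ polyGauss k q})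
    (fun f (l : L) => bundleTrans k (l : V × V) f.1.1)
    (fun ξ f => ⟨nab ξ f.1, nab_mem_polyGauss_param ξ f.2⟩)
    (fun f l x => (hasFDerivAt_bundleTrans (l : V × V) f.1 x).differentiableAt)
    (fun ξ f l => nabF_bundleTrans (l : V × V) f.1 ξ)
    (fun f R => bundleTrans_bound hk f.2 L R) ⟨f, hf⟩

lemma summable_bundleTrans (hk : 1 ≤ k) (L : Submodule ℤ (V × V)) [DiscreteTopology L] {q : ℝ × ℝ}
    {f : Fam Unit k (⊥ : Submodule ℤ V)} (hf : f ∈ polyGauss k q) (x : Unit × (V × V)) :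
    Summable fun l : L => bundleTrans k l f.1 x := by
  obtain ⟨u, hu, hle⟩ := bundleTrans_bound hk hf L (‖x‖ + 1)
  exact .of_norm_bounded hu fun l => hle l x (by linarith)

-- Reindex by the lattice vector and use the cocycle identity; the conjugate multiplier is the
-- inverse of the multiplier.
omit [FiniteDimensional ℝ V] in
lemma tsum_bundleTrans_add (hΛ : IsIntegralLattice Λ) (f : Unit × (V × V) → ℂ) {l₁ l₂ : V}
    (h₁ : l₁ ∈ Λ) (h₂ : l₂ ∈ Λ) (p : Unit) (A : V × V) :
    ∑' l : Λ.prod Λ, bundleTrans k l f (p, A + (l₁, l₂)) =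
      multiplier k (l₁, l₂) A * ∑' l : Λ.prod Λ, bundleTrans k l f (p, A) := by
  rw [← tsum_mul_left, ← (Equiv.addRight (⟨(l₁, l₂), h₁, h₂⟩ : Λ.prod Λ)).tsum_eq
    fun l => multiplier k (l₁, l₂) A * bundleTrans k l f (p, A)]
  refine tsum_congr fun l => ?_
  simp only [bundleTrans, Equiv.coe_addRight, Submodule.coe_add]
  rw [multiplier_add hΛ l.2.1 l.2.2 h₁ h₂, map_mul]
  have h3 : ((p, A) : Unit × (V × V)) + (0, (l : V × V) + (l₁, l₂)) =
      (p, A + (l₁, l₂)) + (0, (l : V × V)) :=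
    Prod.ext rfl (by simp only [Prod.snd_add]; abel)
  rw [h3]
  linear_combination (-(conj (multiplier k l (A + (l₁, l₂))) *
    f ((p, A + (l₁, l₂)) + (0, (l : V × V))))) * multiplier_mul_conj (k := k) (l₁, l₂) A

/-- The periodization of a function of Gaussian type. -/
def periodize (hk : 1 ≤ k) (hΛ : IsIntegralLattice Λ) [DiscreteTopology (Λ.prod Λ)] {q : ℝ × ℝ}
    {f : Fam Unit k (⊥ : Submodule ℤ V)} (hf : f ∈ polyGauss k q) : Fam Unit k Λ :=
  ⟨fun x => ∑' l : Λ.prod Λ, bundleTrans k (l : V × V) f.1 x, by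
      have h := (tsum_bundleTrans_spec hk (Λ.prod Λ) hf).1
      exact h,
    fun _ h₁ _ h₂ p A => tsum_bundleTrans_add hΛ f.1 h₁ h₂ p A⟩

lemma isPeriodization_periodize (hk : 1 ≤ k) (hΛ : IsIntegralLattice Λ)
    [DiscreteTopology (Λ.prod Λ)] {q : ℝ × ℝ} {f : Fam Unit k (⊥ : Submodule ℤ V)}
    (hf : f ∈ polyGauss k q) : IsPeriodization f (periodize hk hΛ hf) :=
  fun x => (summable_bundleTrans hk (Λ.prod Λ) hf x).hasSum

lemma IsPeriodization.nab (hk : 1 ≤ k) [DiscreteTopology (Λ.prod Λ)] {q : ℝ × ℝ}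
    {f : Fam Unit k (⊥ : Submodule ℤ V)} (hf : f ∈ polyGauss k q) {F : Fam Unit k Λ}
    (h : IsPeriodization f F) (X : V × V) : IsPeriodization (nab (0, X) f) (nab (0, X) F) := by
  intro x
  have h1 : F.1 = fun x => ∑' l : Λ.prod Λ, bundleTrans k l f.1 x :=
    funext fun x => (h x).tsum_eq.symm
  have h2 : (ComplexCS.nab (0, X) F).1 x = nabF k (0, X) F.1 x := rfl
  rw [h2, h1, (tsum_bundleTrans_spec hk (Λ.prod Λ) hf).2]
  exact (summable_bundleTrans hk (Λ.prod Λ) (nab_mem_polyGauss X hf) x).hasSum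

lemma IsPeriodization.lapPt (hk : 1 ≤ k) [DiscreteTopology (Λ.prod Λ)] {q : ℝ × ℝ}
    {f : Fam Unit k (⊥ : Submodule ℤ V)} (hf : f ∈ polyGauss k q) {F : Fam Unit k Λ}
    (h : IsPeriodization f F) (q' : ℝ × ℝ) :
    IsPeriodization (lapPt e q' f) (lapPt e q' F) := by
  have h2 : ∀ X Y : V × V, IsPeriodization (ComplexCS.nab (0, X) (ComplexCS.nab (0, Y) f))
      (ComplexCS.nab (0, X) (ComplexCS.nab (0, Y) F)) := fun X Y =>
    IsPeriodization.nab hk (nab_mem_polyGauss Y hf) (IsPeriodization.nab hk hf h Y) X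
  have hU : IsPeriodization (Lu e f) (Lu e F) := by
    simp only [Lu, LinearMap.sum_apply, Module.End.mul_apply]
    exact IsPeriodization.sum _ fun i => h2 _ _
  have hV : IsPeriodization (Lv e f) (Lv e F) := by
    simp only [Lv, LinearMap.sum_apply, Module.End.mul_apply]
    exact IsPeriodization.sum _ fun i => h2 _ _
  have hUV : IsPeriodization (Luv e f) (Luv e F) := by
    simp only [Luv, LinearMap.sum_apply, Module.End.mul_apply, LinearMap.add_apply]
    exact IsPeriodization.sum _ fun i => (h2 _ _).add (h2 _ _)
  simp only [lapPt_eq, LinearMap.smul_apply, LinearMap.add_apply, sub_eq_add_neg, ← neg_smul]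
  exact ((hV.add (hUV.smul _)).add (hU.smul _)).smul _

end Periodization

/-! ### Totality of the eigensections -/

section Totality

variable {V : Type*} [NormedAddCommGroup V] [InnerProductSpace ℝ V] [FiniteDimensional ℝ V]
  [MeasurableSpace V] [BorelSpace V] {E : Type*} [NormedAddCommGroup E] [NormedSpace ℝ E] {k n : ℕ}
  {Λ : Submodule ℤ V} {D : Set (V × V)} (e : OrthonormalBasis (Fin n) ℝ V)

/-- The norm of `χ` is periodic and bounded on the bounded set `D`. The bound off `D` is only almost
everywhere because the translates of `D` cover almost everything. -/
lemma exists_norm_le_of_isCell (hD : IsCell Λ D) (χ : Fam E k Λ) (p : E) :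
    ∃ B : ℝ, 0 ≤ B ∧ (∀ A ∈ D, ‖χ.1 (p, A)‖ ≤ B) ∧ ∀ᵐ A : V × V, ‖χ.1 (p, A)‖ ≤ B := by
  obtain ⟨B, hB⟩ := hD.bounded.isCompact_closure.exists_bound_of_continuousOn
    (χ.contDiff_slice p).continuous.continuousOn
  have h1 : ∀ A ∈ D, ‖χ.1 (p, A)‖ ≤ max B 0 := fun A hA =>
    (hB A (subset_closure hA)).trans (le_max_left _ _)
  refine ⟨max B 0, le_max_right _ _, h1, ?_⟩
  filter_upwards [hD.fundamental.ae_covers] with A hA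
  obtain ⟨g, hg⟩ := hA
  have h2 : g +ᵥ A = A + (g.1.1, g.1.2) := add_comm _ _
  have h3 := h1 _ hg
  rwa [h2, χ.apply_add g.2.1 g.2.2, norm_mul, norm_multiplier, one_mul] at h3

lemma integrable_mul_polyGauss (hk : 1 ≤ k) (hD : IsCell Λ D) (χ : Fam E k Λ) (p : E) {q : ℝ × ℝ}
    {f : Fam Unit k (⊥ : Submodule ℤ V)} (hf : f ∈ polyGauss k q) :
    Integrable fun A => χ.1 (p, A) * conj (f.1 ((), A)) := by
  obtain ⟨B, hB, -, hle⟩ := exists_norm_le_of_isCell hD χ p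
  refine integrable_of_decay (Continuous.aestronglyMeasurable ?_) fun m => ?_
  · exact (χ.contDiff_slice p).continuous.mul
      (Complex.continuous_conj.comp (f.contDiff_slice ()).continuous)
  · obtain ⟨C, hC, h⟩ := polyGauss_decay hk hf m
    refine ⟨B * C, ?_⟩
    filter_upwards [hle] with A hA
    rw [norm_mul, Complex.norm_conj, mul_assoc]
    exact mul_le_mul hA (h ((), A)) (norm_nonneg _) hB

/-- Unfolding: the integral over `V × V` is the sum of the integrals over the translates of `D`, and
the multiplier of `χ` moves onto `f` as the twist in `bundleTrans`. -/
lemma pair_periodization [Countable Λ] [DiscreteTopology (Λ.prod Λ)] (hk : 1 ≤ k)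
    (hD : IsCell Λ D) (χ : Fam E k Λ) (p : E) {q : ℝ × ℝ} {f : Fam Unit k (⊥ : Submodule ℤ V)}
    (hf : f ∈ polyGauss k q) {F : Fam Unit k Λ} (hF : IsPeriodization f F) :
    pair D χ p F () = ∫ A, χ.1 (p, A) * conj (f.1 ((), A)) := by
  have := countable_prod_submodule (Λ := Λ)
  obtain ⟨B, hB, hle, -⟩ := exists_norm_le_of_isCell hD χ p
  obtain ⟨R, hR⟩ := hD.bounded.exists_norm_le
  obtain ⟨u, hu, hbound⟩ := bundleTrans_bound hk hf (Λ.prod Λ) (R + 1)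
  have hfin : volume D < ⊤ := hD.bounded.measure_lt_top
  have : IsFiniteMeasure ((volume : Measure (V × V)).restrict D) := ⟨by simpa using hfin⟩
  have hmem : ∀ᵐ A ∂(volume.restrict D), A ∈ D := ae_restrict_mem₀ hD.fundamental.nullMeasurableSet
  have h1 : ∀ (g : Λ.prod Λ) (A : V × V), χ.1 (p, g +ᵥ A) * conj (f.1 ((), g +ᵥ A)) =
      χ.1 (p, A) * conj (bundleTrans k g f.1 ((), A)) := by
    intro g A
    have h2 : g +ᵥ A = A + (g.1.1, g.1.2) := add_comm _ _
    rw [h2, χ.apply_add g.2.1 g.2.2, bundleTrans, map_mul, Complex.conj_conj]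
    have h3 : (((), A) : Unit × (V × V)) + (0, (g : V × V)) = ((), A + (g.1.1, g.1.2)) := rfl
    rw [h3]
    ring
  rw [hD.fundamental.integral_eq_tsum'' _ (integrable_mul_polyGauss hk hD χ p hf)]
  simp only [h1]
  refine (HasSum.tsum_eq ?_).symm
  refine hasSum_integral_of_dominated_convergence (fun l _ => B * u l) (fun l => ?_) (fun l => ?_)
    (.of_forall fun A => hu.mul_left B) (integrable_const _) (.of_forall fun A => ?_)
  · have h2 : Continuous fun A : V × V => bundleTrans k l f.1 ((), A) :=
      (continuous_iff_continuousAt.2 fun x =>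
        (hasFDerivAt_bundleTrans (l : V × V) f x).continuousAt).comp (by fun_prop)
    exact ((χ.contDiff_slice p).continuous.mul
      (Complex.continuous_conj.comp h2)).aestronglyMeasurable
  · filter_upwards [hmem] with A hA
    rw [norm_mul, Complex.norm_conj]
    refine mul_le_mul (hle A hA) (hbound l ((), A) ?_) (norm_nonneg _) hB
    have : ‖(((), A) : Unit × (V × V))‖ = ‖A‖ := by simp [Prod.norm_def]
    rw [this]
    linarith [hR A hA]
  · exact ((Complex.conjCLE.toContinuousLinearMap.hasSum (hF ((), A))).mul_left (χ.1 (p, A)))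

/-- A section orthogonal to all eigensections of a Laplace operator vanishes. -/
theorem eq_zero_of_pair_eigen [Countable Λ] [DiscreteTopology (Λ.prod Λ)] (hk : 1 ≤ k)
    (hΛ : IsIntegralLattice Λ) (hD : IsCell Λ D) (q : ℝ × ℝ) (χ : Fam E k Λ) (p : E)
    (h : ∀ (μ : ℝ) (v : Fam Unit k Λ), lapPt e q v = (μ : ℂ) • v → pair D χ p v () = 0)
    (A : V × V) : χ.1 (p, A) = 0 := by
  obtain ⟨B, -, -, hB⟩ := exists_norm_le_of_isCell hD χ p
  refine congrFun (eq_zero_of_integral_polyGauss hk q (χ.contDiff_slice p).continuous hB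
    fun f hf => ?_) A
  -- Membership in `polyGauss` is carried through the induction on the span of eigenfunctions, since
  -- integrability of the summands rests on it.
  have key : f ∈ polyGauss k q ∧ ∫ A, χ.1 (p, A) * conj (f.1 ((), A)) = 0 := by
    have hf' := polyGauss_le_eigenGauss e q hf
    clear hf
    induction hf' using Submodule.span_induction with
    | mem f hf =>
      obtain ⟨hf, μ, hμ⟩ := hf
      refine ⟨hf, ?_⟩
      have hF := isPeriodization_periodize hk hΛ hf
      rw [← pair_periodization hk hD χ p hf hF]
      -- The periodization is an eigensection: periodization commutes with the Laplace operator, and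
      -- the sum of a series is unique.
      refine h μ _ (Fam.ext fun x => ?_)
      have h1 := hF.lapPt e hk hf q
      rw [hμ] at h1
      exact (h1 x).unique (hF.smul _ x)
    | zero => exact ⟨Submodule.zero_mem _, by simp⟩
    | add f g _ _ hf hg =>
      refine ⟨Submodule.add_mem _ hf.1 hg.1, ?_⟩
      have h1 := integral_add (integrable_mul_polyGauss hk hD χ p hf.1)
        (integrable_mul_polyGauss hk hD χ p hg.1)
      rw [hf.2, hg.2, add_zero] at h1
      rw [← h1]
      simp only [Fam.add_val, map_add, mul_add]
    | smul c f _ hf =>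
      refine ⟨Submodule.smul_mem _ _ hf.1, ?_⟩
      have h1 := integral_const_mul (μ := volume) (conj c)
        fun A => χ.1 (p, A) * conj (f.1 ((), A))
      rw [hf.2, mul_zero] at h1
      rw [← h1]
      simp only [Fam.smul_val, map_mul, mul_left_comm]
  exact key.2

/-- Invariance of the inner product under isometries preserving the lattice. -/
lemma pair_act [Countable Λ] (hD : IsCell Λ D) (w : V ≃ₗᵢ[ℝ] V) (hw : ∀ x ∈ Λ, w x ∈ Λ)
    (hw' : ∀ x ∈ Λ, w.symm x ∈ Λ) {E' : Type*} [NormedAddCommGroup E'] [NormedSpace ℝ E']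
    (f : Fam E k Λ) (p : E) (g : Fam E' k Λ) (p' : E') :
    pair D (act w hw f) p (act w hw g) p' = pair D f p g p' := by
  have hmp : MeasurePreserving (diagL w) (volume : Measure (V × V)) volume :=
    w.measurePreserving.prod w.measurePreserving
  have hemb : MeasurableEmbedding (diagL w) :=
    (w.toHomeomorph.prodCongr w.toHomeomorph).measurableEmbedding
  have hD' : IsAddFundamentalDomain (Λ.prod Λ) (diagL w ⁻¹' D) (volume : Measure (V × V)) := by
    refine hD.fundamental.preimage_of_equiv hmp.quasiMeasurePreserving
      (e := fun g : Λ.prod Λ =>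
        (⟨(w.symm g.1.1, w.symm g.1.2), hw' _ g.2.1, hw' _ g.2.2⟩ : Λ.prod Λ)) ⟨?_, ?_⟩ ?_
    · intro g g' h
      have h1 := congrArg Subtype.val h
      exact Subtype.ext (Prod.ext (w.symm.injective (congrArg Prod.fst h1))
        (w.symm.injective (congrArg Prod.snd h1)))
    · exact fun g => ⟨⟨(w g.1.1, w g.1.2), hw _ g.2.1, hw _ g.2.2⟩, by simp⟩
    · intro g A
      have h1 : ∀ (g : Λ.prod Λ) (A : V × V), g +ᵥ A = (g : V × V) + A := fun _ _ => rfl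
      simp only [h1, map_add]
      exact congrArg (· + diagL w A) (Prod.ext (w.apply_symm_apply _) (w.apply_symm_apply _))
  rw [pair, pair, ← setIntegral_eq_of_isPeriodic hD' hD.fundamental
    (isPeriodic_mul_conj (act w hw f) p (act w hw g) p')]
  exact hmp.setIntegral_preimage_emb hemb (fun A => f.1 (p, A) * conj (g.1 (p', A))) D

end Totality

/-! ### The coroot lattice and the Weyl group -/

section Coroot

lemma discreteTopology_of_gap {Z : Type*} [NormedAddCommGroup Z] (L : Submodule ℤ Z)
    (h : ∀ x ∈ L, ‖x‖ < 1 → x = 0) : DiscreteTopology L := by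
  refine discreteTopology_of_isOpen_singleton_zero ?_
  have : ({0} : Set L) = Metric.ball 0 1 := by
    ext x
    simp only [Set.mem_singleton_iff, Metric.mem_ball, dist_zero_right]
    refine ⟨fun hx => by simp [hx], fun hx => ?_⟩
    exact Subtype.ext (h _ x.2 hx)
  rw [this]
  exact Metric.isOpen_ball

variable {ι M V : Type*} [Finite ι] [AddCommGroup M] [Module ℝ M]
  [NormedAddCommGroup V] [InnerProductSpace ℝ V]
  {P : RootPairing ι ℝ M V}

section Lattice

variable [P.IsCrystallographic] [P.IsIrreducible]

/-- The lattice is even: a squared length below `1` of the form `2m` is zero. -/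
lemma IsBasicInner.eq_zero_of_norm_lt (hP : IsBasicInner P) {x : V} (hx : x ∈ P.corootSpan ℤ)
    (h : ‖x‖ < 1) : x = 0 := by
  obtain ⟨m, hm⟩ := hP.exists_even_self hx
  rw [real_inner_self_eq_norm_sq] at hm
  have h0 := norm_nonneg x
  have h1 : (m : ℝ) < 1 := by nlinarith
  have h2 : (-1 : ℝ) < m := by nlinarith
  have h3 : m = 0 := by
    have h1' : m < 1 := by exact_mod_cast h1
    have h2' : -1 < m := by exact_mod_cast h2
    omega
  rw [h3, Int.cast_zero, mul_zero] at hm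
  exact norm_eq_zero.1 (pow_eq_zero_iff two_ne_zero |>.1 hm)

lemma IsBasicInner.discreteTopology (hP : IsBasicInner P) : DiscreteTopology (P.corootSpan ℤ) :=
  discreteTopology_of_gap _ fun _ hx => hP.eq_zero_of_norm_lt hx

lemma IsBasicInner.discreteTopology_prod (hP : IsBasicInner P) :
    DiscreteTopology ((P.corootSpan ℤ).prod (P.corootSpan ℤ)) :=
  discreteTopology_of_gap _ fun x hx h => by
    rw [Prod.norm_def, max_lt_iff] at h
    exact Prod.ext (hP.eq_zero_of_norm_lt hx.1 h.1) (hP.eq_zero_of_norm_lt hx.2 h.2)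

omit [Finite ι] [P.IsCrystallographic] [P.IsIrreducible] in
lemma span_corootSpan [P.IsRootSystem] :
    Submodule.span ℝ ((P.corootSpan ℤ : Submodule ℤ V) : Set V) = ⊤ := by
  rw [eq_top_iff, ← RootPairing.IsRootSystem.span_coroot_eq_top (P := P)]
  exact Submodule.span_mono Submodule.subset_span

variable [FiniteDimensional ℝ V]

omit [FiniteDimensional ℝ V] in
lemma IsBasicInner.countable (hP : IsBasicInner P) : Countable (P.corootSpan ℤ) := by
  have := hP.discreteTopology
  infer_instance

variable [MeasurableSpace V] [BorelSpace V] [P.IsRootSystem]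

lemma IsBasicInner.exists_isBundleLattice (hP : IsBasicInner P) (k : ℕ) :
    ∃ D : Set (V × V), IsBundleLattice k (P.corootSpan ℤ) D := by
  have := hP.discreteTopology
  have : IsZLattice ℝ (P.corootSpan ℤ) := ⟨span_corootSpan⟩
  have := ZLattice.module_free ℝ (P.corootSpan ℤ)
  have := ZLattice.module_finite ℝ (P.corootSpan ℤ)
  let b := Module.Free.chooseBasis ℤ (P.corootSpan ℤ)
  refine ⟨_, ⟨isAddFundamentalDomain_prod (ZLattice.isAddFundamentalDomain b volume), ?_⟩,
    fun x hx y hy => hP.exists_int hx hy,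
    fun φ l₁ h₁ l₂ h₂ A => multiplier_rowAction hP k φ (l := (l₁, l₂)) h₁ h₂ A, span_corootSpan⟩
  exact (ZSpan.fundamentalDomain_isBounded _).prod (ZSpan.fundamentalDomain_isBounded _)

end Lattice

/-! ### The Weyl group as a finite group of isometries. -/

omit [Finite ι] in
lemma IsBasicInner.inner_weyl (hP : IsBasicInner P) {w : V ≃ₗ[ℝ] V} (hw : w ∈ weylGroup P)
    (x y : V) : ⟪w x, w y⟫_ℝ = ⟪x, y⟫_ℝ := by
  induction hw using Subgroup.closure_induction generalizing x y with
  | mem w h =>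
    obtain ⟨i, rfl⟩ := h
    exact hP.invariant i x y
  | one => rfl
  | mul u v _ _ hu hv => exact (hu _ _).trans (hv _ _)
  | inv u _ hu =>
    rw [← hu]
    exact congrArg₂ _ (u.apply_symm_apply x) (u.apply_symm_apply y)

/-- The elements of the Weyl group as isometries. -/
def IsBasicInner.weylIsometry (hP : IsBasicInner P) (w : weylGroup P) : V ≃ₗᵢ[ℝ] V :=
  LinearEquiv.isometryOfInner w.1 (hP.inner_weyl w.2)

omit [Finite ι] in
lemma exists_coroot_weyl {w : V ≃ₗ[ℝ] V} (hw : w ∈ weylGroup P) (j : ι) :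
    ∃ l, w (P.coroot j) = P.coroot l := by
  induction hw using Subgroup.closure_induction_left generalizing j with
  | one => exact ⟨j, rfl⟩
  | mul_left u h v _ hv =>
    obtain ⟨i, rfl⟩ := h
    obtain ⟨l, hl⟩ := hv j
    refine ⟨P.reflectionPerm i l, ?_⟩
    rw [P.coroot_reflectionPerm, ← hl]
    rfl
  | inv_mul_cancel u h v _ hv =>
    obtain ⟨i, rfl⟩ := h
    obtain ⟨l, hl⟩ := hv j
    refine ⟨P.reflectionPerm i l, ?_⟩
    rw [P.coroot_reflectionPerm, ← hl]
    exact (LinearEquiv.symm_apply_eq _).2 (P.coreflection_same i _).symm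

omit [Finite ι] in
lemma weyl_mem_corootSpan {w : V ≃ₗ[ℝ] V} (hw : w ∈ weylGroup P) {x : V}
    (hx : x ∈ P.corootSpan ℤ) : w x ∈ P.corootSpan ℤ := by
  induction hx using Submodule.span_induction with
  | zero => simp
  | add u v _ _ hu hv => rw [map_add]; exact add_mem hu hv
  | smul a u _ hu => rw [map_zsmul]; exact Submodule.smul_mem _ _ hu
  | mem u hu =>
    obtain ⟨i, rfl⟩ := hu
    obtain ⟨l, hl⟩ := exists_coroot_weyl hw i
    rw [hl]
    exact Submodule.subset_span ⟨l, rfl⟩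

/-- An element is determined by its effect on the finitely many coroots, which span `V`. -/
lemma finite_weylGroup [P.IsRootSystem] : Finite (weylGroup P) := by
  choose p hp using fun w : weylGroup P => exists_coroot_weyl w.2
  refine Finite.of_injective p fun w w' h => Subtype.ext (LinearEquiv.toLinearMap_injective ?_)
  refine LinearMap.ext_on_range (v := P.coroot) (by simp) fun j => ?_
  exact (hp w j).trans ((congrArg P.coroot (congrFun h j)).trans (hp w' j).symm)

end Coroot

/-! ### The exponentials of the Laplace operator on sections -/

section Exponential

variable {ι M V : Type*} [AddCommGroup M] [Module ℝ M]
  [NormedAddCommGroup V] [InnerProductSpace ℝ V] {P : RootPairing ι ℝ M V}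
  {E : Type*} [NormedAddCommGroup E] [NormedSpace ℝ E] {k n : ℕ}

/-- The constant family given by a section. -/
def constFam (E : Type*) [NormedAddCommGroup E] [NormedSpace ℝ E] (ψ : sections P k) :
    Fam E k (P.corootSpan ℤ) :=
  ⟨fun x => ψ.1 x.2, ψ.2.1.comp contDiff_snd, fun l₁ h₁ l₂ h₂ _ A => ψ.2.2.1 l₁ h₁ l₂ h₂ A⟩

/-- The slice of a family with the Weyl group symmetry. -/
def sliceSec (f : Fam E k (P.corootSpan ℤ)) (p : E)
    (h : ∀ w ∈ weylGroup P, ∀ A : V × V, f.1 (p, (w A.1, w A.2)) = f.1 (p, A)) : sections P k :=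
  ⟨fun A => f.1 (p, A), f.contDiff_slice p, fun _ h₁ _ h₂ A => f.apply_add h₁ h₂ p A, h⟩

variable [FiniteDimensional ℝ V] [MeasurableSpace V] [BorelSpace V] [Finite ι]
  [P.IsRootSystem] [P.IsCrystallographic] [P.IsIrreducible]

-- Periodic integrands have the same integral over any two fundamental domains, so `F`, which may be
-- unbounded, can be exchanged for the bounded cell `D`.
omit [P.IsRootSystem] in
lemma sectionInner_eq_pair (hP : IsBasicInner P) {F : Set V} {D : Set (V × V)}
    (hF : IsAddFundamentalDomain (P.corootSpan ℤ) F (volume : Measure V))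
    (hD : IsCell (P.corootSpan ℤ) D) {E' : Type*} [NormedAddCommGroup E'] [NormedSpace ℝ E']
    (ψ χ : sections P k) (p : E) (p' : E') :
    sectionInner F ψ.1 χ.1 = pair D (constFam E ψ) p (constFam E' χ) p' := by
  have := hP.countable
  exact setIntegral_eq_of_isPeriodic (isAddFundamentalDomain_prod hF) hD.fundamental
    (isPeriodic_mul_conj (constFam E ψ) p (constFam E' χ) p')

variable (e : OrthonormalBasis (Fin n) ℝ V) {D : Set (V × V)}

/-- A section orthogonal to all eigensections vanishes. -/
lemma eq_zero_of_pair_eigensection (hP : IsBasicInner P) (hk : 1 ≤ k)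
    (hD : IsCell (P.corootSpan ℤ) D) (q : ℝ × ℝ) (χ : sections P k)
    (h : ∀ (μ : ℝ) (v : sections P k),
      (∀ A, (lapPt e q (constFam Unit v)).1 ((), A) = μ * v.1 A) →
      pair D (constFam Unit χ) () (constFam Unit v) () = 0) : χ = 0 := by
  have := hP.countable
  have := hP.discreteTopology_prod
  have := finite_weylGroup (P := P)
  have := Fintype.ofFinite (weylGroup P)
  refine Subtype.ext (funext fun A => ?_)
  refine eq_zero_of_pair_eigen e hk (fun x hx y hy => hP.exists_int hx hy) hD q (constFam Unit χ) ()
    (fun μ v hv => ?_) A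
  have hmem : ∀ w : weylGroup P, ∀ x ∈ P.corootSpan ℤ, hP.weylIsometry w x ∈ P.corootSpan ℤ :=
    fun w _ hx => weyl_mem_corootSpan w.2 hx
  have hmem' : ∀ w : weylGroup P, ∀ x ∈ P.corootSpan ℤ,
      (hP.weylIsometry w).symm x ∈ P.corootSpan ℤ :=
    fun w _ hx => weyl_mem_corootSpan (w⁻¹).2 hx
  -- The average of an eigensection over the Weyl group is an invariant eigensection. As `χ` is
  -- invariant, its pairing with the average is `|W|` times its pairing with `v`.
  set S : Fam Unit k (P.corootSpan ℤ) := ∑ w, act (hP.weylIsometry w) (hmem w) v with hS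
  have hSval : ∀ A : V × V, S.1 ((), A) = ∑ w : weylGroup P, v.1 ((), (w.1 A.1, w.1 A.2)) := by
    intro A
    rw [hS, Fam.sum_val]
    rfl
  have hinv : ∀ w ∈ weylGroup P, ∀ A : V × V, S.1 ((), (w A.1, w A.2)) = S.1 ((), A) := by
    intro w hw A
    rw [hSval, hSval]
    exact Fintype.sum_equiv (Equiv.mulRight (⟨w, hw⟩ : weylGroup P)) _ _ fun u => rfl
  have hSc : constFam Unit (sliceSec S () hinv) = S := Fam.ext fun x => rfl
  have hlap : lapPt e q S = (μ : ℂ) • S := by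
    rw [hS, map_sum, Finset.smul_sum]
    refine Finset.sum_congr rfl fun w _ => ?_
    rw [lapPt_act, hv, map_smul]
  have h1 := h μ (sliceSec S () hinv) fun A => by
    rw [hSc, hlap]
    rfl
  rw [hSc, hS, pair_sum_right hD] at h1
  have h2 : ∀ w : weylGroup P, pair D (constFam Unit χ) () (act (hP.weylIsometry w) (hmem w) v) () =
      pair D (constFam Unit χ) () v () := by
    intro w
    rw [← pair_act hD (hP.weylIsometry w) (hmem w) (hmem' w) (constFam Unit χ) () v ()]
    congr 1
    exact Fam.ext fun x => (χ.2.2.2 w.1 w.2 x.2).symm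
  simp only [h2, Finset.sum_const, Finset.card_univ, nsmul_eq_mul, mul_eq_zero, Nat.cast_eq_zero] at h1
  exact h1.resolve_left Fintype.card_ne_zero

section Operators

variable (hP : IsBasicInner P) (hΛ : IsBundleLattice k (P.corootSpan ℤ) D) (hk : 1 ≤ k)

/-- The section `e^{i (θ / k) Δ_σ} ψ`. -/
def expSec (θ : ℝ) (σ : UpperHalfPlane) (ψ : sections P k) : sections P k :=
  haveI := hP.countable
  sliceSec (lapEvol e hΛ hk θ (constFam (ℝ × ℝ) ψ)) (logCoord σ) fun w hw A =>
    lapEvol_act e hΛ hk θ (logCoord σ) (hP.weylIsometry ⟨w, hw⟩)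
      (fun _ hx => weyl_mem_corootSpan hw hx) (fun A => ψ.2.2.2 w hw A) A

variable (b : Module.Basis (Fin n) ℝ V) {F : Set V}
  (hF : IsAddFundamentalDomain (P.corootSpan ℤ) F (volume : Measure V))

omit [P.IsRootSystem] in
include hF in
lemma isExpLaplacian_expSec (θ : ℝ) (σ : UpperHalfPlane) (ψ : sections P k) :
    IsExpLaplacian P k b F σ (Complex.I * θ / k) ψ (expSec e hP hΛ hk θ σ ψ) := by
  intro μ v hv
  have := hP.countable
  rw [sectionInner_eq_pair hP hF hΛ.cell _ _ () (), sectionInner_eq_pair hP hF hΛ.cell _ _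
    (logCoord σ) ()]
  have h := pair_lapEvol e hΛ hk θ (constFam (ℝ × ℝ) ψ) (logCoord σ) (constFam Unit v) () μ
    fun A => by
      have h1 := congrFun (laplacian_eq_lapPt e b σ (constFam Unit v) ()) A
      rw [← h1]
      exact congrFun hv A
  rw [show Complex.I * θ / k * μ = Complex.I * μ * θ / k by ring]
  exact h

-- The difference is orthogonal to all eigensections, and these are total.
include e hP hk hF hΛ in
lemma IsExpLaplacian.unique {σ : UpperHalfPlane} {c : ℂ} {ψ χ χ' : sections P k}
    (h : IsExpLaplacian P k b F σ c ψ χ) (h' : IsExpLaplacian P k b F σ c ψ χ') : χ = χ' := by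
  rw [← sub_eq_zero]
  refine eq_zero_of_pair_eigensection e hP hk hΛ.cell (logCoord σ) _ fun μ v hv => ?_
  have hv' : laplacian k b σ v.1 = (μ : ℂ) • v.1 := by
    funext A
    exact (congrFun (laplacian_eq_lapPt e b σ (constFam Unit v) ()) A).trans (hv A)
  have h1 := (h μ v hv').trans (h' μ v hv').symm
  rw [sectionInner_eq_pair hP hF hΛ.cell _ _ () (), sectionInner_eq_pair hP hF hΛ.cell _ _ () ()]
    at h1
  have h2 : constFam Unit (χ - χ') = constFam Unit χ + (-1 : ℂ) • constFam Unit χ' :=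
    Fam.ext fun x => by
      change χ.1 x.2 - χ'.1 x.2 = χ.1 x.2 + -1 * χ'.1 x.2
      ring
  rw [h2, pair_add_left hΛ.cell, pair_smul_left, h1]
  ring

include e hP hk hF hΛ in
lemma isExpLaplacian_iff (θ : ℝ) (σ : UpperHalfPlane) (ψ χ : sections P k) :
    IsExpLaplacian P k b F σ (Complex.I * θ / k) ψ χ ↔ expSec e hP hΛ hk θ σ ψ = χ :=
  ⟨fun h => (isExpLaplacian_expSec e hP hΛ hk b hF θ σ ψ).unique e hP hΛ hk b hF h, fun h =>
    h ▸ isExpLaplacian_expSec e hP hΛ hk b hF θ σ ψ⟩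

omit [P.IsRootSystem] in
include hP hF hΛ in
lemma sectionInner_add_left (ψ ψ' v : sections P k) :
    sectionInner F (ψ + ψ').1 v.1 = sectionInner F ψ.1 v.1 + sectionInner F ψ'.1 v.1 := by
  rw [sectionInner_eq_pair hP hF hΛ.cell _ _ () (), sectionInner_eq_pair hP hF hΛ.cell ψ _ () (),
    sectionInner_eq_pair hP hF hΛ.cell ψ' _ () ()]
  exact pair_add_left hΛ.cell (constFam Unit ψ) (constFam Unit ψ') _ _ _

omit [P.IsRootSystem] in
include hP hF hΛ in
lemma sectionInner_smul_left (c : ℂ) (ψ v : sections P k) :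
    sectionInner F (c • ψ).1 v.1 = c * sectionInner F ψ.1 v.1 := by
  rw [sectionInner_eq_pair hP hF hΛ.cell _ _ () (), sectionInner_eq_pair hP hF hΛ.cell ψ _ () ()]
  exact pair_smul_left c (constFam Unit ψ) _ _ _

include b hF in
/-- The operator `e^{i (θ / k) Δ_σ}` is linear. -/
lemma exists_expLinear (θ : ℝ) (σ : UpperHalfPlane) :
    ∃ L : sections P k →ₗ[ℂ] sections P k, ∀ ψ, L ψ = expSec e hP hΛ hk θ σ ψ := by
  refine ⟨{ toFun := expSec e hP hΛ hk θ σ, map_add' := fun ψ ψ' => ?_, map_smul' := fun c ψ => ?_ },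
    fun ψ => rfl⟩
  · rw [← isExpLaplacian_iff e hP hΛ hk b hF]
    intro μ v hv
    rw [sectionInner_add_left hP hΛ hF, sectionInner_add_left hP hΛ hF,
      isExpLaplacian_expSec e hP hΛ hk b hF θ σ ψ μ v hv,
      isExpLaplacian_expSec e hP hΛ hk b hF θ σ ψ' μ v hv, mul_add]
  · rw [← isExpLaplacian_iff e hP hΛ hk b hF]
    intro μ v hv
    rw [RingHom.id_apply, sectionInner_smul_left hP hΛ hF, sectionInner_smul_left hP hΛ hF,
      isExpLaplacian_expSec e hP hΛ hk b hF θ σ ψ μ v hv]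
    ring

-- Coefficients along eigensections determine a section, and there the two exponentials cancel.
include b hF in
lemma expSec_expSec_neg (θ : ℝ) (σ : UpperHalfPlane) (ψ : sections P k) :
    expSec e hP hΛ hk θ σ (expSec e hP hΛ hk (-θ) σ ψ) = ψ := by
  rw [← isExpLaplacian_iff e hP hΛ hk b hF]
  intro μ v hv
  rw [isExpLaplacian_expSec e hP hΛ hk b hF (-θ) σ ψ μ v hv, ← mul_assoc, ← Complex.exp_add]
  have : Complex.I * θ / k * μ + Complex.I * (-θ : ℝ) / k * μ = 0 := by
    push_cast
    ring
  rw [this, Complex.exp_zero, one_mul]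

end Operators

omit [P.IsRootSystem] in
/-- The exponentials of the Laplace operators intertwine the pre-quantum representation. -/
lemma expSec_preQuantum (hP : IsBasicInner P) (hΛ : IsBundleLattice k (P.corootSpan ℤ) D)
    (hk : 1 ≤ k) (θ : ℝ) (φ : SL(2, ℤ)) (σ : UpperHalfPlane) (ψ : sections P k) :
    expSec e hP hΛ hk θ (pushforward φ σ) (preQuantum P hP k φ ψ) =
      preQuantum P hP k φ (expSec e hP hΛ hk θ σ ψ) := by
  have := hP.countable
  exact Subtype.ext (funext fun A => lapEvol_rho e hΛ hk θ φ σ (fun _ => rfl) A)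

end Exponential

/-! ### Parallel transport for the Hitchin-Witten connection -/

section Parallel

open UpperHalfPlane

/-- The point `x + i e^η` of the upper half plane. -/
def expPoint (q : ℝ × ℝ) : ℍ := ⟨⟨q.1, Real.exp q.2⟩, Real.exp_pos _⟩

lemma logCoord_expPoint (q : ℝ × ℝ) : logCoord (expPoint q) = q :=
  Prod.ext rfl (Real.log_exp q.2)

lemma expPoint_logCoord (σ : ℍ) : expPoint (logCoord σ) = σ :=
  UpperHalfPlane.ext (Complex.ext rfl (Real.exp_log σ.im_pos))

variable {V : Type*} [NormedAddCommGroup V] [InnerProductSpace ℝ V] {k n : ℕ} {Λ : Submodule ℤ V}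

/-- Logarithmic coordinates make the upper half plane a vector space, so that families over it fall
under `Fam`. -/
lemma dirDeriv_logCoord (f : Fam (ℝ × ℝ) k Λ) (σ : ℍ) (ξ : ℂ) (A : V × V) :
    dirDeriv (fun τ A => f.1 (logCoord τ, A)) σ ξ A =
      (nab ((ξ.re, (σ.im)⁻¹ * ξ.im), 0) f).1 (logCoord σ, A) := by
  have h1 : (fun τ : ℂ => f.1 (logCoord (ofComplex τ), A)) =ᶠ[nhds (σ : ℂ)]
      fun τ : ℂ => f.1 ((τ.re, Real.log τ.im), A) := by
    filter_upwards [isOpen_upperHalfPlaneSet.mem_nhds σ.im_pos] with τ hτ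
    rw [ofComplex_apply_of_im_pos hτ]
    rfl
  have h2 : HasFDerivAt (fun τ : ℂ => (((τ.re, Real.log τ.im), A) : (ℝ × ℝ) × (V × V)))
      ((Complex.reCLM.prod ((σ.im)⁻¹ • Complex.imCLM)).prod 0) (σ : ℂ) :=
    (Complex.reCLM.hasFDerivAt.prodMk (Complex.imCLM.hasFDerivAt.log σ.im_ne_zero)).prodMk
      (hasFDerivAt_const A _)
  have h3 := ((f.differentiableAt (logCoord σ, A)).hasFDerivAt).comp (σ : ℂ) h2
  rw [dirDeriv, h1.fderiv_eq, nab_param_apply]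
  erw [h3.fderiv]
  rfl

/-- The real directions in the parameter plane, as operators on families. -/
lemma nab_param_pair (f : Fam (ℝ × ℝ) k Λ) (x y : ℝ) (q : (ℝ × ℝ) × (V × V)) :
    (nab ((x, y), 0) f).1 q =
      x * (nab ((1, 0), 0) f).1 q + y * (nab ((0, 1), 0) f).1 q := by
  rw [nab_param_apply, nab_param_apply, nab_param_apply]
  have h : (((x, y), 0) : (ℝ × ℝ) × (V × V)) = x • ((1, 0), 0) + y • ((0, 1), 0) := by simp
  rw [h, map_add, map_smul, map_smul]
  simp

lemma exp_neg_logCoord (σ : ℍ) : Real.exp (-(logCoord σ).2) = (σ.im)⁻¹ := by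
  rw [Real.exp_neg, exp_logCoord]

lemma dSigma_logCoord (f : Fam (ℝ × ℝ) k Λ) (σ : ℍ) (A : V × V) :
    dSigma (fun τ A => f.1 (logCoord τ, A)) σ A =
      (dolbeault 1 (ContinuousLinearMap.id ℝ _) (1, 0) (0, 1) f).1 (logCoord σ, A) := by
  rw [dSigma, dirDeriv_logCoord, dirDeriv_logCoord, dolbeault_apply, nab_param_pair f Complex.I.re,
    nab_param_pair f (1 : ℂ).re, ContinuousLinearMap.id_apply, exp_neg_logCoord]
  simp
  ring

lemma dSigmaBar_logCoord (f : Fam (ℝ × ℝ) k Λ) (σ : ℍ) (A : V × V) :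
    dSigmaBar (fun τ A => f.1 (logCoord τ, A)) σ A =
      (dolbeault (-1) (ContinuousLinearMap.id ℝ _) (1, 0) (0, 1) f).1 (logCoord σ, A) := by
  rw [dSigmaBar, dirDeriv_logCoord, dirDeriv_logCoord, dolbeault_apply,
    nab_param_pair f Complex.I.re, nab_param_pair f (1 : ℂ).re, ContinuousLinearMap.id_apply,
    exp_neg_logCoord]
  simp
  ring

variable (e : OrthonormalBasis (Fin n) ℝ V) (b : Module.Basis (Fin n) ℝ V)

lemma I_div_pi_sub_conj (σ : ℍ) : Complex.I / Real.pi * ((σ : ℂ) - conj (σ : ℂ))⁻¹ ^ 2 =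
    -Complex.I / (4 * Real.pi) * ((σ.im)⁻¹ : ℝ) ^ 2 := by
  have hπ : (Real.pi : ℂ) ≠ 0 := by exact_mod_cast Real.pi_ne_zero
  have hy : (σ.im : ℂ) ≠ 0 := by exact_mod_cast σ.im_ne_zero
  rw [sub_conj_coe]
  push_cast
  field_simp
  rw [Complex.I_sq]
  ring

lemma laplacianG_logCoord (f : Fam (ℝ × ℝ) k Λ) (σ : ℍ) (A : V × V) :
    laplacianG k b σ (fun A => f.1 (logCoord σ, A)) A =
      (hitchinOp e 1 (ContinuousLinearMap.id ℝ _) f).1 (logCoord σ, A) := by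
  rw [laplacianG_slice b e, hitchinOp_apply, I_div_pi_sub_conj, ContinuousLinearMap.id_apply,
    exp_neg_logCoord, exp_logCoord]
  have h : conj (σ : ℂ) = (logCoord σ).1 - Complex.I * 1 * σ.im := by
    apply Complex.ext <;> simp [logCoord]
  rw [h]
  ring

lemma laplacianGbar_logCoord (f : Fam (ℝ × ℝ) k Λ) (σ : ℍ) (A : V × V) :
    laplacianGbar k b σ (fun A => f.1 (logCoord σ, A)) A =
      (hitchinOp e (-1) (ContinuousLinearMap.id ℝ _) f).1 (logCoord σ, A) := by
  rw [laplacianGbar_slice b e, hitchinOp_apply, I_div_pi_sub_conj, ContinuousLinearMap.id_apply,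
    exp_neg_logCoord, exp_logCoord]
  have h : (σ : ℂ) = (logCoord σ).1 - Complex.I * -1 * σ.im := by
    apply Complex.ext <;> simp [logCoord]
  nth_rewrite 1 2 [h]
  ring

/-- A parallel family which vanishes over one point of the upper half plane vanishes. -/
lemma eq_zero_of_hitchinWitten [FiniteDimensional ℝ V] [MeasurableSpace V] [BorelSpace V]
    [Countable Λ] {D : Set (V × V)} (hD : IsCell Λ D) (t : ℂ) (R : Fam (ℝ × ℝ) k Λ)
    (h : dolbeault 1 (ContinuousLinearMap.id ℝ _) (1, 0) (0, 1) R =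
      -(1 / (2 * t)) • hitchinOp e 1 (ContinuousLinearMap.id ℝ _) R)
    (h' : dolbeault (-1) (ContinuousLinearMap.id ℝ _) (1, 0) (0, 1) R =
      (1 / (2 * conj t)) • hitchinOp e (-1) (ContinuousLinearMap.id ℝ _) R)
    (q : ℝ × ℝ) (h0 : ∀ A, R.1 (q, A) = 0) : R = 0 := by
  -- In a real direction the two equations combine to `i` times a quadratic Hamiltonian. Its
  -- coefficients are real because the contributions of `∂_σ` and of its conjugate are conjugate up
  -- to the common factor `i`.
  have key : ∀ x y : ℝ, ∀ p A, (nab ((x, y), 0) R).1 (p, A) = Complex.I *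
      (((Real.exp (-p.2) ^ 2 / (4 * Real.pi) * ((x + Complex.I * (y * Real.exp p.2)) / t).re : ℝ) :
          ℂ) * (Lv e R).1 (p, A) +
        ((-(Real.exp (-p.2) ^ 2 / (4 * Real.pi) * ((x + Complex.I * (y * Real.exp p.2)) / t *
          (p.1 - Complex.I * Real.exp p.2)).re) : ℝ) : ℂ) * (Luv e R).1 (p, A) +
        ((Real.exp (-p.2) ^ 2 / (4 * Real.pi) * ((x + Complex.I * (y * Real.exp p.2)) / t *
          (p.1 - Complex.I * Real.exp p.2) ^ 2).re : ℝ) : ℂ) * (Lu e R).1 (p, A)) := by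
    intro x y p A
    have h1 := congrArg (fun T : Fam (ℝ × ℝ) k Λ => T.1 (p, A)) h
    have h2 := congrArg (fun T : Fam (ℝ × ℝ) k Λ => T.1 (p, A)) h'
    simp only [dolbeault_apply, Fam.smul_val, hitchinOp_apply, ContinuousLinearMap.id_apply] at h1 h2
    have hre : ∀ z : ℂ, ((z.re : ℝ) : ℂ) = (z + conj z) / 2 := fun z => by
      rw [Complex.add_conj]
      push_cast
      ring
    have hE : (Real.exp p.2 : ℂ) * Real.exp (-p.2) = 1 := by
      rw [← Complex.ofReal_mul, ← Real.exp_add]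
      simp
    rw [nab_param_pair]
    simp only [Complex.ofReal_mul, Complex.ofReal_neg, Complex.ofReal_div, Complex.ofReal_pow,
      Complex.ofReal_ofNat, hre]
    simp only [map_mul, map_div₀, map_add, map_sub, map_pow, Complex.conj_I, Complex.conj_ofReal]
    set X := (nab ((1, 0), 0) R).1 (p, A)
    set Y := (nab ((0, 1), 0) R).1 (p, A)
    set a := (Lv e R).1 (p, A)
    set u := (Luv e R).1 (p, A)
    set c := (Lu e R).1 (p, A)
    have hI := Complex.I_sq
    generalize (Real.exp p.2 : ℂ) = F at *
    generalize (Real.exp (-p.2) : ℂ) = G at *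
    generalize conj t = t' at *
    linear_combination (x + Complex.I * (y * F)) * h1 + (x - Complex.I * (y * F)) * h2 -
      y * Y * hE + y * F * G * Y * hI
  refine Fam.ext fun ⟨p, A⟩ => ?_
  have h1 := eq_zero_of_ham e hD R q (p - q) _ _ _ (key (p - q).1 (p - q).2) h0 1 A
  rwa [one_smul, add_sub_cancel] at h1

variable {ι M : Type*} [AddCommGroup M] [Module ℝ M] {P : RootPairing ι ℝ M V}

/-- A smooth family of sections over the upper half plane, in logarithmic coordinates. -/
def sectionFam (Ψ : ℍ → sections P k) (h : ContDiffOn ℝ ∞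
    (fun p : ℂ × (V × V) => (Ψ (ofComplex p.1)).1 p.2) ({τ : ℂ | 0 < τ.im} ×ˢ Set.univ)) :
    Fam (ℝ × ℝ) k (P.corootSpan ℤ) :=
  ⟨fun x => (Ψ (expPoint x.1)).1 x.2, by
    have h1 : ContDiff ℝ ∞ fun x : (ℝ × ℝ) × (V × V) =>
        ((((x.1.1 : ℝ) : ℂ) + Complex.I * (Real.exp x.1.2 : ℝ), x.2) : ℂ × (V × V)) := by
      have h2 : ContDiff ℝ ∞ fun x : (ℝ × ℝ) × (V × V) => ((x.1.1 : ℝ) : ℂ) :=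
        Complex.ofRealCLM.contDiff.comp contDiff_fst.fst
      have h3 : ContDiff ℝ ∞ fun x : (ℝ × ℝ) × (V × V) => ((Real.exp x.1.2 : ℝ) : ℂ) :=
        Complex.ofRealCLM.contDiff.comp contDiff_fst.snd.exp
      exact (h2.add (contDiff_const.mul h3)).prodMk contDiff_snd
    have h4 : ∀ q : ℝ × ℝ, ((q.1 : ℂ) + Complex.I * (Real.exp q.2 : ℝ)) = expPoint q := by
      intro q
      apply Complex.ext <;> simp [expPoint, Complex.exp_ofReal_re]
    have h5 := h.comp_contDiff h1 fun x => by
      refine ⟨?_, trivial⟩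
      change 0 < Complex.im _
      rw [h4]
      exact (expPoint x.1).im_pos
    have h6 : (fun x : (ℝ × ℝ) × (V × V) => (Ψ (expPoint x.1)).1 x.2) =
        (fun p : ℂ × (V × V) => (Ψ (ofComplex p.1)).1 p.2) ∘ fun x : (ℝ × ℝ) × (V × V) =>
          ((((x.1.1 : ℝ) : ℂ) + Complex.I * (Real.exp x.1.2 : ℝ), x.2) : ℂ × (V × V)) := by
      funext x
      simp only [Function.comp_apply, h4, ofComplex_apply]
    rw [h6]
    exact h5,
  fun l₁ h₁ l₂ h₂ p A => (Ψ (expPoint p)).2.2.1 l₁ h₁ l₂ h₂ A⟩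

lemma sectionFam_logCoord {Ψ : ℍ → sections P k} (h : ContDiffOn ℝ ∞
    (fun p : ℂ × (V × V) => (Ψ (ofComplex p.1)).1 p.2) ({τ : ℂ | 0 < τ.im} ×ˢ Set.univ))
    (σ : ℍ) (A : V × V) : (sectionFam Ψ h).1 (logCoord σ, A) = (Ψ σ).1 A := by
  change (Ψ (expPoint (logCoord σ))).1 A = _
  rw [expPoint_logCoord]

lemma contDiffOn_of_logCoord {Ψ : ℍ → sections P k} (f : Fam (ℝ × ℝ) k (P.corootSpan ℤ))
    (hf : ∀ σ A, (Ψ σ).1 A = f.1 (logCoord σ, A)) : ContDiffOn ℝ ∞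
    (fun p : ℂ × (V × V) => (Ψ (ofComplex p.1)).1 p.2) ({τ : ℂ | 0 < τ.im} ×ˢ Set.univ) := by
  have h1 : ContDiffOn ℝ ∞ (fun p : ℂ × (V × V) => ((p.1.re, Real.log p.1.im), p.2))
      ({τ : ℂ | 0 < τ.im} ×ˢ Set.univ) := by
    have h2 : ContDiff ℝ ∞ fun p : ℂ × (V × V) => p.1.re := Complex.reCLM.contDiff.comp contDiff_fst
    have h3 : ContDiff ℝ ∞ fun p : ℂ × (V × V) => p.1.im := Complex.imCLM.contDiff.comp contDiff_fst
    exact (h2.contDiffOn.prodMk (h3.contDiffOn.log fun p hp => ne_of_gt hp.1)).prodMk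
      contDiff_snd.contDiffOn
  refine (f.contDiff.comp_contDiffOn h1).congr fun p hp => ?_
  rw [hf, ofComplex_apply_of_im_pos hp.1]
  rfl

/-- The Hitchin-Witten connection in logarithmic coordinates. -/
lemma isParallel_iff {t : ℂ} {Ψ : ℍ → sections P k} (f : Fam (ℝ × ℝ) k (P.corootSpan ℤ))
    (hf : ∀ σ A, (Ψ σ).1 A = f.1 (logCoord σ, A)) :
    IsParallel P k b t Ψ ↔
      dolbeault 1 (ContinuousLinearMap.id ℝ _) (1, 0) (0, 1) f =
        -(1 / (2 * t)) • hitchinOp e 1 (ContinuousLinearMap.id ℝ _) f ∧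
      dolbeault (-1) (ContinuousLinearMap.id ℝ _) (1, 0) (0, 1) f =
        (1 / (2 * conj t)) • hitchinOp e (-1) (ContinuousLinearMap.id ℝ _) f := by
  have hΨ : (fun τ => (Ψ τ).1) = fun τ A => f.1 (logCoord τ, A) :=
    funext fun τ => funext fun A => hf τ A
  have hΨ' : ∀ τ, (Ψ τ).1 = fun A => f.1 (logCoord τ, A) := fun τ => congrFun hΨ τ
  constructor
  · intro h
    constructor
    · refine Fam.ext fun ⟨p, A⟩ => ?_
      have h1 := h.holo (expPoint p) A
      rw [hΨ, hΨ', dSigma_logCoord, laplacianG_logCoord e b, logCoord_expPoint] at h1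
      rw [Fam.smul_val]
      linear_combination h1
    · refine Fam.ext fun ⟨p, A⟩ => ?_
      have h1 := h.antiholo (expPoint p) A
      rw [hΨ, hΨ', dSigmaBar_logCoord, laplacianGbar_logCoord e b, logCoord_expPoint] at h1
      rw [Fam.smul_val]
      linear_combination h1
  · rintro ⟨h1, h2⟩
    refine ⟨contDiffOn_of_logCoord f hf, fun σ A => ?_, fun σ A => ?_⟩
    · rw [hΨ, hΨ', dSigma_logCoord, laplacianG_logCoord e b, h1, Fam.smul_val]
      ring
    · rw [hΨ, hΨ', dSigmaBar_logCoord, laplacianGbar_logCoord e b, h2, Fam.smul_val]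
      ring

lemma dolbeault_constFam (ε : ℂ) (ψ : sections P k) :
    dolbeault ε (ContinuousLinearMap.id ℝ _) (1, 0) (0, 1) (constFam (ℝ × ℝ) ψ) = 0 := by
  have h : ∀ x : ℝ × ℝ, nab (x, 0) (constFam (ℝ × ℝ) ψ) = 0 := by
    intro x
    refine Fam.ext fun q => ?_
    have h1 : HasFDerivAt (constFam (ℝ × ℝ) ψ).1
        ((fderiv ℝ ψ.1 q.2).comp (ContinuousLinearMap.snd ℝ (ℝ × ℝ) (V × V))) q :=
      ((ψ.2.1.differentiable (by simp)) q.2).hasFDerivAt.comp q hasFDerivAt_snd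
    rw [nab_param_apply, h1.fderiv]
    simp
  refine Fam.ext fun ⟨p, A⟩ => ?_
  rw [dolbeault_apply, h, h]
  simp

variable [FiniteDimensional ℝ V] [MeasurableSpace V] [BorelSpace V] [Finite ι]
  [P.IsCrystallographic] [P.IsIrreducible] {D : Set (V × V)}

-- The equations are linear, so the difference of the two families falls under
-- `eq_zero_of_hitchinWitten`.
include e in
lemma IsParallel.unique (hP : IsBasicInner P) (hD : IsCell (P.corootSpan ℤ) D) {t : ℂ}
    {Ψ Ψ' : ℍ → sections P k} (h : IsParallel P k b t Ψ) (h' : IsParallel P k b t Ψ') {σ₁ : ℍ}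
    (h1 : Ψ σ₁ = Ψ' σ₁) : Ψ = Ψ' := by
  have := hP.countable
  obtain ⟨ha, hb⟩ := (isParallel_iff e b (sectionFam Ψ h.smooth)
    fun σ A => (sectionFam_logCoord h.smooth σ A).symm).1 h
  obtain ⟨ha', hb'⟩ := (isParallel_iff e b (sectionFam Ψ' h'.smooth)
    fun σ A => (sectionFam_logCoord h'.smooth σ A).symm).1 h'
  have h0 : sectionFam Ψ h.smooth - sectionFam Ψ' h'.smooth = 0 := by
    refine eq_zero_of_hitchinWitten e hD t _ ?_ ?_ (logCoord σ₁) fun A => ?_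
    · rw [map_sub, map_sub, ha, ha', smul_sub]
    · rw [map_sub, map_sub, hb, hb', smul_sub]
    · rw [Fam.sub_val, sectionFam_logCoord, sectionFam_logCoord, h1, sub_self]
  rw [sub_eq_zero] at h0
  refine funext fun σ => Subtype.ext (funext fun A => ?_)
  rw [← sectionFam_logCoord h.smooth, h0, sectionFam_logCoord]

/-- The unitary group of the Laplace operators produces parallel sections. -/
lemma isParallel_expSec (hP : IsBasicInner P) (hΛ : IsBundleLattice k (P.corootSpan ℤ) D)
    (hk : 1 ≤ k) {s θ : ℝ} {t : ℂ} (ht : t = k + Complex.I * s)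
    (hθ : Complex.exp (4 * Complex.I * θ) = -((k - Complex.I * s) / (k + Complex.I * s)))
    (ψ : sections P k) : IsParallel P k b t fun τ => expSec e hP hΛ hk θ τ ψ := by
  have := hP.countable
  have hk0 : (k : ℂ) ≠ 0 := by
    have : k ≠ 0 := by omega
    exact_mod_cast this
  have ht' : conj t = k - Complex.I * s := by
    rw [ht]
    simp
    ring
  have ht0 : t ≠ 0 := by
    intro h
    have h1 := congrArg Complex.re (ht.symm.trans h)
    simp at h1
    omega
  have ht0' : conj t ≠ 0 := by simpa using ht0
  -- Turns the coefficient `(-conj t / t - 1)/(4k)` into `-1/(2t)`, the one prescribed by the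
  -- connection; similarly for the conjugate equation.
  have hsum : t + conj t = 2 * k := by rw [ht', ht]; ring
  rw [← ht', ← ht] at hθ
  refine (isParallel_iff e b (lapEvol e hΛ hk θ (constFam (ℝ × ℝ) ψ)) fun _ _ => rfl).2 ⟨?_, ?_⟩
  · rw [dolbeault_lapEvol e hΛ hk θ (by norm_num) (dolbeault_constFam 1 ψ)]
    congr 1
    rw [mul_one, mul_one, hθ]
    field_simp
    linear_combination (-2 : ℂ) * hsum
  · rw [dolbeault_lapEvol e hΛ hk θ (by norm_num) (dolbeault_constFam (-1) ψ)]
    congr 1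
    have : 4 * Complex.I * -1 * (θ : ℂ) = -(4 * Complex.I * θ) := by ring
    rw [this, Complex.exp_neg, hθ, inv_neg, inv_div]
    field_simp
    linear_combination (2 : ℂ) * hsum
end Parallel

/-- The exponent of the conjugating operator is purely imaginary. -/
lemma re_eq_zero_of_exp {k : ℕ} (hk : 1 ≤ k) {s : ℝ} {r : ℂ}
    (hr : Complex.exp (-4 * k * r) = -((k - Complex.I * s) / (k + Complex.I * s))) : r.re = 0 := by
  have hk0 : (k : ℝ) ≠ 0 := by
    have : k ≠ 0 := by omega
    exact_mod_cast this
  have h1 : (k - Complex.I * s : ℂ) = conj (k + Complex.I * s : ℂ) := by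
    simp
    ring
  have h2 : (k + Complex.I * s : ℂ) ≠ 0 := by
    intro h
    have := congrArg Complex.re h
    simp at this
    omega
  have h3 := congrArg norm hr
  rw [norm_neg, norm_div, h1, RCLike.norm_conj, div_self (norm_ne_zero_iff.2 h2), Complex.norm_exp,
    Real.exp_eq_one_iff] at h3
  have h4 : (-4 * k * r : ℂ).re = -4 * k * r.re := by simp
  rw [h4] at h3
  simpa [hk0] using h3

/-- A representation conjugated by an invertible linear map. -/
def conjRepresentation {G X : Type*} [Monoid G] [AddCommGroup X] [Module ℂ X]
    (ρ : Representation ℂ G X) (L L' : X →ₗ[ℂ] X) (h : L' ∘ₗ L = LinearMap.id)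
    (h' : L ∘ₗ L' = LinearMap.id) : Representation ℂ G X where
  toFun g := L' ∘ₗ ρ g ∘ₗ L
  map_one' := by
    rw [map_one]
    exact h
  map_mul' g g' := by
    refine LinearMap.ext fun x => ?_
    have := LinearMap.congr_fun h' (ρ g' (L x))
    rw [map_mul]
    exact congrArg (fun y => L' (ρ g y)) this.symm

end ComplexCS

end

/-! ### The conjugation formula. -/

theorem proposition1p1 {ι M V : Type*} [Finite ι] [AddCommGroup M] [Module ℝ M]
    [NormedAddCommGroup V] [InnerProductSpace ℝ V] [FiniteDimensional ℝ V]
    [MeasurableSpace V] [BorelSpace V]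
    (P : RootPairing ι ℝ M V) [P.IsRootSystem] [P.IsCrystallographic] [P.IsReduced]
    [P.IsIrreducible] (hP : ComplexCS.IsBasicInner P)
    {n : ℕ} (b : Module.Basis (Fin n) ℝ V)
    (F : Set V) (hF : IsAddFundamentalDomain (P.corootSpan ℤ) F (volume : Measure V))
    (k : ℕ) (hk : 1 ≤ k) (s : ℝ) (t : ℂ) (ht : t = k + Complex.I * s)
    (r : ℂ) (hr : Complex.exp (-4 * k * r) = -((k - Complex.I * s) / (k + Complex.I * s)))
    (σ : UpperHalfPlane) :
    ∃ (E Einv : ComplexCS.sections P k →ₗ[ℂ] ComplexCS.sections P k)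
      (η : Representation ℂ SL(2, ℤ) (ComplexCS.sections P k)),
      -- `E` and `Einv` are the operators `e^{r Δ_σ}` and `e^{-r Δ_σ}`, defined on all of `H^(k)`
      (∀ ψ χ, ComplexCS.IsExpLaplacian P k b F σ r ψ χ ↔ E ψ = χ) ∧
      (∀ ψ χ, ComplexCS.IsExpLaplacian P k b F σ (-r) ψ χ ↔ Einv ψ = χ) ∧
      Einv ∘ₗ E = LinearMap.id ∧ E ∘ₗ Einv = LinearMap.id ∧
      -- `η` is the quantum representation `η_{t, σ}`
      (∀ φ ψ χ, ComplexCS.IsQuantum P hP k b t σ φ ψ χ ↔ η φ ψ = χ) ∧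
      ∀ φ : SL(2, ℤ), η φ = Einv ∘ₗ ComplexCS.preQuantum P hP k φ ∘ₗ E := by
  have hk0 : (k : ℂ) ≠ 0 := by
    have : k ≠ 0 := by omega
    exact_mod_cast this
  obtain ⟨D, hΛ⟩ := hP.exists_isBundleLattice k
  have hn : Module.finrank ℝ V = n := by simpa using Module.finrank_eq_card_basis b
  have e : OrthonormalBasis (Fin n) ℝ V := (stdOrthonormalBasis ℝ V).reindex (finCongr hn)
  have hre : r.re = 0 := ComplexCS.re_eq_zero_of_exp hk hr
  -- As `r` is purely imaginary, `r = iθ/k` with `θ = k Im r`, so `e^{rΔ}` is one of the operators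
  -- `expSec`.
  have hr0 : Complex.I * (k * r.im : ℝ) / k = r := by
    apply mul_left_cancel₀ hk0
    rw [mul_div_cancel₀ _ hk0]
    apply Complex.ext <;> simp [hre]
  have hr1 : Complex.I * (-(k * r.im) : ℝ) / k = -r := by
    rw [Complex.ofReal_neg, mul_neg, neg_div, hr0]
  have hθ : Complex.exp (4 * Complex.I * (-(k * r.im) : ℝ)) =
      -((k - Complex.I * s) / (k + Complex.I * s)) := by
    rw [← hr]
    congr 1
    have := (div_eq_iff hk0).1 hr1
    linear_combination 4 * this
  obtain ⟨E, hE⟩ := ComplexCS.exists_expLinear e hP hΛ hk b hF (k * r.im) σ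
  obtain ⟨Einv, hEinv⟩ := ComplexCS.exists_expLinear e hP hΛ hk b hF (-(k * r.im)) σ
  have h1 : Einv ∘ₗ E = LinearMap.id := LinearMap.ext fun ψ => by
    rw [LinearMap.comp_apply, hE, hEinv]
    have := ComplexCS.expSec_expSec_neg e hP hΛ hk b hF (-(k * r.im)) σ ψ
    rwa [neg_neg] at this
  have h2 : E ∘ₗ Einv = LinearMap.id := LinearMap.ext fun ψ => by
    rw [LinearMap.comp_apply, hE, hEinv]
    exact ComplexCS.expSec_expSec_neg e hP hΛ hk b hF (k * r.im) σ ψ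
  refine ⟨E, Einv, ComplexCS.conjRepresentation (ComplexCS.preQuantum P hP k) E Einv h1 h2,
    fun ψ χ => ?_, fun ψ χ => ?_, h1, h2, fun φ ψ χ => ?_, fun φ => rfl⟩
  · rw [hE, ← ComplexCS.isExpLaplacian_iff e hP hΛ hk b hF, hr0]
  · rw [hEinv, ← ComplexCS.isExpLaplacian_iff e hP hΛ hk b hF, hr1]
  -- The section `τ ↦ e^{-rΔ_τ} ρ_k(φ) e^{rΔ_σ} ψ` is parallel. Over `φ_*σ` it equals `ρ_k(φ) ψ` by
  -- equivariance of the exponentials, and over `σ` it is the conjugated operator applied to `ψ`;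
  -- uniqueness of parallel sections gives the converse.
  · have h3 := ComplexCS.isParallel_expSec e b hP hΛ hk ht hθ (ComplexCS.preQuantum P hP k φ (E ψ))
    have h4 : ComplexCS.expSec e hP hΛ hk (-(k * r.im)) (ComplexCS.pushforward φ σ)
        (ComplexCS.preQuantum P hP k φ (E ψ)) = ComplexCS.preQuantum P hP k φ ψ := by
      rw [ComplexCS.expSec_preQuantum, ← hEinv]
      exact congrArg _ (LinearMap.congr_fun h1 ψ)
    have h5 : ComplexCS.conjRepresentation (ComplexCS.preQuantum P hP k) E Einv h1 h2 φ ψ =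
        ComplexCS.expSec e hP hΛ hk (-(k * r.im)) σ (ComplexCS.preQuantum P hP k φ (E ψ)) :=
      hEinv _
    rw [h5]
    constructor
    · rintro ⟨Ψ, hΨ, hψ, rfl⟩
      exact congrFun (h3.unique e b hP hΛ.cell hΨ (h4.trans hψ.symm)) σ
    · rintro rfl
      exact ⟨_, h3, h4, rfl⟩
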